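/- **Setting.** All manifolds and maps are smooth. Let $(M,\Psi)$ be a Poisson manifold and $(B,\omega)$ a (connected) symplectic leaf of $\Psi$ that is an embedded submanifold, where $\omega(\Psi^\natural\alpha,\Psi^\natural\beta)=\Psi(\alpha,\beta)=\langle\beta,\Psi^\natural\alpha\rangle$. Let $\pi:E=T_BM/TB\to B$ be the normal bundle, with $B$ identified with the zero section, and let $\mathbf f:E\to M$ be an exponential map: a diffeomorphism onto an open neighborhood of $B$ with $\mathbf f|_B=\mathrm{id}_B$ such that, at each $b\in B$, $d_b\mathbf f$ followed by $T_bM\to E_b$ is the projection $T_bE=T_bB\oplus E_b\to E_b$. Put $\Pi=\mathbf f^*\Psi$. With $\mathbb V=\ker d\pi$, near $B$ the subbundle $\mathbb H=\Pi^\natural(\operatorname{Ann}\mathbb V)$ is complementary to $\mathbb V$, hence defines an Ehresmann connection $\Gamma$, and $\Pi=\Pi_H+\Pi_V$ with $\Pi_V$ vertical and $\Pi_H=-\tfrac12F^{ij}\,\mathrm{hor}_i\wedge\mathrm{hor}_j$, where $F=\tfrac12F_{ij}(\xi,x)\,d\xi^i\wedge d\xi^j$ is nondegenerate and $F^{is}F_{sj}=\delta^i_j$.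 In coordinates $(\xi,x)$ with $x$ linear on the fibres, let $$\Pi_V=\Lambda+O(x^2),\quad \Lambda=\tfrac12\lambda^{\alpha\beta}_\gamma(\xi)x^\gamma\tfrac{\partial}{\partial x^\alpha}\wedge\tfrac{\partial}{\partial x^\beta};\qquad \Gamma^\sigma_i=\theta^\sigma_{i\nu}(\xi)x^\nu+O(x^2);\qquad F_{ij}=\omega_{ij}(\xi)-\mathcal R_{ij\sigma}(\xi)x^\sigma+O(x^2).$$ Let $\nabla$ be the linear connection on $E$ with connection form $\theta$, and put $F^{(1)}_{ij}=\omega_{ij}-\mathcal R_{ij\sigma}x^\sigma$. The linearized Poisson structure is, near $B$, $$\Pi^{(1)}=-\tfrac12(F^{(1)})^{ij}\,\mathrm{hor}^\nabla_i\wedge\mathrm{hor}^\nabla_j+\Lambda,\qquad \mathrm{hor}^\nabla_i=\tfrac{\partial}{\partial\xi^i}-\theta^\sigma_{i\nu}x^\nu\tfrac{\partial}{\partial x^\sigma}.$$ The transverse Lie algebra $\mathfrak g$ is the Lie algebra $E_b^*$ for $b\in B$, with the bracket $\langle[\alpha,\beta],x\rangle=\Lambda_x(\alpha,\beta)$; so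 $(E_b,\Lambda_b)\cong\mathfrak g^*$ with its Lie–Poisson structure. A Lie–Poisson connection is a linear connection on $E$ for which $\Lambda$ is covariantly constant. For a flat Lie–Poisson connection $\nabla^\flat$ put $$\Pi^\flat=-\tfrac12\omega^{ij}\,\mathrm{hor}^{\nabla^\flat}_i\wedge\mathrm{hor}^{\nabla^\flat}_j+\Lambda .$$ Finally, $\mathfrak{Diff}^0_B(E)$ is the group of germs at $B$ of diffeomorphisms $\phi$ that are the time-one map of the flow, defined on a neighborhood of $B$ for $t\in[0,1]$, of a time-dependent vector field vanishing on $B$. **Proposition 4.9.** Suppose that $\Lambda$ admits a flat Lie–Poisson connection $\nabla^\flat$ and that $Z(\mathfrak g)=\{0\}$ and $H^1(\mathfrak g,\mathfrak g)=\{0\}$. Then the germs at $B$ of $\Pi^{(1)}$ and $\Pi^\flat$ are isomorphic: $\phi^*\Pi^\flat=\Pi^{(1)}$ near $B$ for some $\phi\in\mathfrak{Diff}^0_B(E)$. If, in addition, the holonomy group of $\nabla^\flat$ is trivial, then the vector bundle $E$ is trivial, and there is a trivialization $E\cong B\times\mathfrak g^*$ under which the germ of $\Pi^{(1)}$ at $B$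 is isomorphic, by a diffeomorphism in $\mathfrak{Diff}^0_B(E)$, to the direct product of the Poisson structure of $(B,\omega)$ and the Lie–Poisson structure of $\mathfrak g^*$. -/

import Mathlib

open Bundle Set Topology
open scoped Manifold ContDiff

noncomputable section

namespace PoissonLin

/-! ### Bivector fields and Poisson tensors on a manifold -/

section Manifolds

variable {V : Type*} [NormedAddCommGroup V] [NormedSpace ℝ V]
  {H : Type*} [TopologicalSpace H] (I : ModelWithCorners ℝ V H)
  (X : Type*) [TopologicalSpace X] [ChartedSpace H X]
  {V' : Type*} [NormedAddCommGroup V'] [NormedSpace ℝ V']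
  {H' : Type*} [TopologicalSpace H'] {I' : ModelWithCorners ℝ V' H'}
  {X' : Type*} [TopologicalSpace X'] [ChartedSpace H' X']

/-- A field of contravariant 2-tensors `P`, given by the maps `P♮ : T*X → TX`;
the tensor itself is `P(α, β) = ⟨β, P♮ α⟩`. It is a bivector field if this is antisymmetric,
which is part of `IsPoissonTensor` below. -/
abbrev TensorField₂ : Type _ :=
  ∀ p : X, (TangentSpace I p →L[ℝ] ℝ) →L[ℝ] TangentSpace I p

variable {I X}

/-- The bracket `{f, g} = P(df, dg)`. -/
def bracket (P : TensorField₂ I X) (f g : X → ℝ) (p : X) : ℝ :=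
  mvfderiv I g p (P p (mvfderiv I f p))

/-- `P` is a smooth Poisson tensor: it is antisymmetric and smooth, and its bracket
satisfies the Jacobi identity, that is `[P, P] = 0`. -/
structure IsPoissonTensor (P : TensorField₂ I X) : Prop where
  antisymm : ∀ (p : X) (α β : TangentSpace I p →L[ℝ] ℝ), β (P p α) = -α (P p β)
  smooth : ∀ f g : X → ℝ, ContMDiff I 𝓘(ℝ, ℝ) ∞ f → ContMDiff I 𝓘(ℝ, ℝ) ∞ g →
    ContMDiff I 𝓘(ℝ, ℝ) ∞ (bracket P f g)
  jacobi : ∀ f g h : X → ℝ, ContMDiff I 𝓘(ℝ, ℝ) ∞ f → ContMDiff I 𝓘(ℝ, ℝ) ∞ g →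
    ContMDiff I 𝓘(ℝ, ℝ) ∞ h → ∀ p : X,
    bracket P f (bracket P g h) p + bracket P g (bracket P h f) p
      + bracket P h (bracket P f g) p = 0

/-- The pull-back `φ^* Q` under a local diffeomorphism `φ : X → X'`:
`(φ^* Q)(α, β) = Q(α ∘ (dφ)⁻¹, β ∘ (dφ)⁻¹)`. -/
def pullback (φ : X → X') (Q : TensorField₂ I' X') : TensorField₂ I X := fun p =>
  (mfderiv I I' φ p).inverse ∘L Q (φ p) ∘L
    ContinuousLinearMap.precomp ℝ (mfderiv I I' φ p).inverse

/-- The direct product of two tensor fields, on the product manifold. -/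
def prodTensor (P : TensorField₂ I X) (Q : TensorField₂ I' X') :
    TensorField₂ (I.prod I') (X × X') := fun q =>
  (mfderiv I (I.prod I') (fun x : X => (x, q.2)) q.1) ∘L P q.1 ∘L
      ContinuousLinearMap.precomp ℝ (mfderiv I (I.prod I') (fun x : X => (x, q.2)) q.1)
    + (mfderiv I' (I.prod I') (fun y : X' => (q.1, y)) q.2) ∘L Q q.2 ∘L
      ContinuousLinearMap.precomp ℝ (mfderiv I' (I.prod I') (fun y : X' => (q.1, y)) q.2)

/-- A field of bilinear forms on the tangent spaces, `u ↦ ω(u, ·)`. -/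
abbrev FormField₂ (I : ModelWithCorners ℝ V H) (X : Type*) [TopologicalSpace X]
    [ChartedSpace H X] : Type _ :=
  ∀ b : X, TangentSpace I b →L[ℝ] TangentSpace I b →L[ℝ] ℝ

/-- The nondegenerate Poisson tensor of a symplectic form `ω`, in coordinates
`-(1/2) ω^{ij} ∂_i ∧ ∂_j` with `ω^{is} ω_{sj} = δ^i_j`; equivalently
`ω(P♮ α, P♮ β) = P(α, β)`. -/
def symplecticTensor (Ω : FormField₂ I X) : TensorField₂ I X := fun b => -(Ω b).inverse

/-- `(X, ω)`, embedded in the manifold `X'` by `ι`, is an embedded symplectic leaf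
(integral submanifold of the characteristic distribution; the connectedness of `X` is required
separately) of the Poisson tensor `Ψ`: `TX = Ψ♮(T*X')` along `X`, and
`ω(Ψ♮ α, Ψ♮ β) = Ψ(α, β)`. -/
structure IsEmbeddedSymplecticLeaf (Ψ : TensorField₂ I' X') (ι : X → X')
    (Ω : FormField₂ I X) : Prop where
  embedding : Manifold.IsSmoothEmbedding I I' ∞ ι
  tangent : ∀ b : X, Set.range (mfderiv I I' ι b) = Set.range (Ψ (ι b))
  form : ∀ (b : X) (α β : TangentSpace I' (ι b) →L[ℝ] ℝ) (u v : TangentSpace I b),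
    mfderiv I I' ι b u = Ψ (ι b) α → mfderiv I I' ι b v = Ψ (ι b) β →
      Ω b u v = β (Ψ (ι b) α)

end Manifolds

/-! ### Lie algebras -/

/-- The first cohomology `H¹(𝔤, 𝔤)`: derivations of `𝔤` modulo inner derivations. -/
abbrev FirstCohomology (𝔤 : Type*) [LieRing 𝔤] [LieAlgebra ℝ 𝔤] : Type _ :=
  LieDerivation ℝ 𝔤 𝔤 ⧸ LinearMap.range (LieDerivation.inner ℝ 𝔤 𝔤)

/-- The value at `μ` of the Lie–Poisson tensor on the dual of `𝔤`, as a map of covectors to vectors.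
The dual is realized as a normed space `G` with a linear isomorphism `κ : G ≃ 𝔤^*`, which gives it
its standard smooth structure. A covector `α` is an element `x` of `𝔤 = 𝔤^**`, and it is sent to the
functional `y ↦ ⟨μ, [x, y]⟩`. -/
def liePoissonMap {𝔤 : Type*} [LieRing 𝔤] [LieAlgebra ℝ 𝔤] [FiniteDimensional ℝ 𝔤]
    {G : Type*} [NormedAddCommGroup G] [NormedSpace ℝ G] [FiniteDimensional ℝ G]
    (κ : G ≃ₗ[ℝ] Module.Dual ℝ 𝔤) (μ : G) : (G →L[ℝ] ℝ) →L[ℝ] G :=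
  LinearMap.toContinuousLinearMap
    ((κ.symm : Module.Dual ℝ 𝔤 →ₗ[ℝ] G) ∘ₗ
      LinearMap.llcomp ℝ 𝔤 𝔤 ℝ (κ μ) ∘ₗ (LieAlgebra.ad ℝ 𝔤 : 𝔤 →ₗ[ℝ] 𝔤 →ₗ[ℝ] 𝔤) ∘ₗ
      ((Module.evalEquiv ℝ 𝔤).symm : Module.Dual ℝ (Module.Dual ℝ 𝔤) →ₗ[ℝ] 𝔤) ∘ₗ
      (κ.symm : Module.Dual ℝ 𝔤 →ₗ[ℝ] G).dualMap ∘ₗ ContinuousLinearMap.coeLM ℝ)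

/-- The Lie–Poisson tensor on the dual of `𝔤`: for `x, y ∈ 𝔤` regarded as linear functions on
`𝔤^*`, the bracket at `μ` is `⟨μ, [x, y]⟩`. -/
def liePoissonTensor {𝔤 : Type*} [LieRing 𝔤] [LieAlgebra ℝ 𝔤] [FiniteDimensional ℝ 𝔤]
    {G : Type*} [NormedAddCommGroup G] [NormedSpace ℝ G] [FiniteDimensional ℝ G]
    (κ : G ≃ₗ[ℝ] Module.Dual ℝ 𝔤) : TensorField₂ 𝓘(ℝ, G) G := fun μ =>
  (liePoissonMap κ μ : (G →L[ℝ] ℝ) →L[ℝ] G)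

/-! ### Geometry of the total space of a vector bundle -/

section VectorBundles

variable {EB : Type*} [NormedAddCommGroup EB] [NormedSpace ℝ EB]
  {B : Type*} [TopologicalSpace B] [ChartedSpace EB B]
  {F : Type*} [NormedAddCommGroup F] [NormedSpace ℝ F]
  {E : B → Type*} [∀ b, AddCommGroup (E b)] [∀ b, Module ℝ (E b)]
  [∀ b, TopologicalSpace (E b)] [∀ b, IsTopologicalAddGroup (E b)]
  [∀ b, ContinuousSMul ℝ (E b)] [TopologicalSpace (TotalSpace F E)]
  [FiberBundle F E] [VectorBundle ℝ F E]

/-- The differential at `p` of the projection `π : E → B`. -/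
def dproj (p : TotalSpace F E) :
    TangentSpace (𝓘(ℝ, EB).prod 𝓘(ℝ, F)) p →L[ℝ] TangentSpace 𝓘(ℝ, EB) p.proj :=
  mfderiv (𝓘(ℝ, EB).prod 𝓘(ℝ, F)) 𝓘(ℝ, EB) (TotalSpace.proj : TotalSpace F E → B) p

variable (EB) in
/-- The vertical lift `E_b → V_p ⊆ T_p E` at `p = (b, x)`: the image of `y` is the velocity at
`t = 0` of the curve `t ↦ (b, x + t y)`. Here `T_p E` is written in the chart of `E` at `p`, which
is built from the preferred trivialization over `b`. -/
def vertLift (p : TotalSpace F E) :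
    E p.proj →L[ℝ] TangentSpace (𝓘(ℝ, EB).prod 𝓘(ℝ, F)) p :=
  ContinuousLinearMap.inr ℝ EB F ∘L
    (trivializationAt F E p.proj).continuousLinearMapAt ℝ p.proj

variable (EB) in
/-- The fibre component `T_p E → E_b` in the chart of `E` at `p`; a left inverse of `vertLift`. -/
def vertCoord (p : TotalSpace F E) :
    TangentSpace (𝓘(ℝ, EB).prod 𝓘(ℝ, F)) p →L[ℝ] E p.proj :=
  (trivializationAt F E p.proj).symmL ℝ p.proj ∘L ContinuousLinearMap.snd ℝ EB F

/-- Horizontal lift at `p = (b, x)` of a linear connection `∇`: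
for a local section `s` with `s(b) = x`, `hor(u) = ds_b(u) - vertLift (∇_u s)`. In coordinates,
`hor(∂_i) = ∂/∂ξ^i - θ_{iν}^σ x^ν ∂/∂x^σ`. -/
def horLift (D : CovariantDerivative 𝓘(ℝ, EB) F E) (p : TotalSpace F E) :
    TangentSpace 𝓘(ℝ, EB) p.proj →L[ℝ] TangentSpace (𝓘(ℝ, EB).prod 𝓘(ℝ, F)) p :=
  (show TangentSpace 𝓘(ℝ, EB) p.proj →L[ℝ] TangentSpace (𝓘(ℝ, EB).prod 𝓘(ℝ, F)) p from
    mfderiv 𝓘(ℝ, EB) (𝓘(ℝ, EB).prod 𝓘(ℝ, F))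
      (fun b => TotalSpace.mk' F b (FiberBundle.extend F p.2 b)) p.proj)
  - vertLift EB p ∘L D (FiberBundle.extend F p.2) p.proj

/-- The horizontal tensor `-(1/2) F^{ij} hor_i ∧ hor_j` at `p`, where `F^{is} F_{sj} = δ^i_j`,
of a horizontal lift `hor` and a nondegenerate bilinear form `F` on `T_b B`. -/
def horTensor (p : TotalSpace F E)
    (hor : TangentSpace 𝓘(ℝ, EB) p.proj →L[ℝ] TangentSpace (𝓘(ℝ, EB).prod 𝓘(ℝ, F)) p)
    (Φ : TangentSpace 𝓘(ℝ, EB) p.proj →L[ℝ] TangentSpace 𝓘(ℝ, EB) p.proj →L[ℝ] ℝ) :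
    (TangentSpace (𝓘(ℝ, EB).prod 𝓘(ℝ, F)) p →L[ℝ] ℝ) →L[ℝ]
      TangentSpace (𝓘(ℝ, EB).prod 𝓘(ℝ, F)) p :=
  -(hor ∘L Φ.inverse ∘L ContinuousLinearMap.precomp ℝ hor)

/-! #### Geometric data of a horizontally nondegenerate bivector field -/

/-- The map `T_b^*B → T_b B` induced by `P` at `p`, with matrix the brackets of base coordinates. -/
def baseBlock (P : TensorField₂ (𝓘(ℝ, EB).prod 𝓘(ℝ, F)) (TotalSpace F E))
    (p : TotalSpace F E) :
    (TangentSpace 𝓘(ℝ, EB) p.proj →L[ℝ] ℝ) →L[ℝ] TangentSpace 𝓘(ℝ, EB) p.proj :=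
  dproj p ∘L P p ∘L ContinuousLinearMap.precomp ℝ (dproj p)

/-- The coupling form of `P`: the form with `P(π^*a, π^*c) = F(u, v)` where `u, v` are the
projections to `TB` of `P♮(π^*a)`, `P♮(π^*c)`. -/
def couplingForm (P : TensorField₂ (𝓘(ℝ, EB).prod 𝓘(ℝ, F)) (TotalSpace F E))
    (p : TotalSpace F E) :
    TangentSpace 𝓘(ℝ, EB) p.proj →L[ℝ] TangentSpace 𝓘(ℝ, EB) p.proj →L[ℝ] ℝ :=
  -(baseBlock P p).inverse

/-- The horizontal lift of the Ehresmann connection with horizontal bundle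
`P♮(Ann V)`, where `V = ker dπ`. -/
def couplingLift (P : TensorField₂ (𝓘(ℝ, EB).prod 𝓘(ℝ, F)) (TotalSpace F E))
    (p : TotalSpace F E) :
    TangentSpace 𝓘(ℝ, EB) p.proj →L[ℝ] TangentSpace (𝓘(ℝ, EB).prod 𝓘(ℝ, F)) p :=
  P p ∘L ContinuousLinearMap.precomp ℝ (dproj p) ∘L (baseBlock P p).inverse

/-- The vertical part `P_V = P - P_H`. -/
def vertPart (P : TensorField₂ (𝓘(ℝ, EB).prod 𝓘(ℝ, F)) (TotalSpace F E)) :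
    TensorField₂ (𝓘(ℝ, EB).prod 𝓘(ℝ, F)) (TotalSpace F E) := fun p =>
  P p - horTensor p (couplingLift P p) (couplingForm P p)

/-! #### The linearized Poisson tensor -/

variable (E) in
/-- A fibrewise linear family of vertical 2-tensors: `L b x : E_b^* → E_b` is the value at
`x ∈ E_b`. In coordinates, `(1/2) λ_γ^{αβ}(ξ) x^γ ∂_α ∧ ∂_β`. The corresponding bracket on `E_b^*`
is `⟨[α, β], x⟩ = β (L b x α)`. -/
abbrev LinearVertTensor : Type _ := ∀ b : B, E b →L[ℝ] (E b →L[ℝ] ℝ) →L[ℝ] E b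

variable (EB E) in
/-- An `E^*`-valued field of bilinear forms on `B`, as `R b x u v = ⟨R(u, v), x⟩`. -/
abbrev DualValuedForm : Type _ := ∀ b : B, E b →L[ℝ]
  TangentSpace 𝓘(ℝ, EB) b →L[ℝ] TangentSpace 𝓘(ℝ, EB) b →L[ℝ] ℝ

/-- The data `(L, D, R)` are the linearization along the zero section of the geometric data
(vertical part, connection, coupling form) of `P`. The coupling form of `P` restricts to the form
of the leaf on the zero section, so the last condition says `F(x) = ω - R x + O(x²)`. -/
structure IsLinearization (P : TensorField₂ (𝓘(ℝ, EB).prod 𝓘(ℝ, F)) (TotalSpace F E))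
    (L : LinearVertTensor E) (D : CovariantDerivative 𝓘(ℝ, EB) F E)
    (R : DualValuedForm EB E) : Prop where
  vert : ∀ (b : B) (y : E b) (α β : E b →L[ℝ] ℝ),
    HasDerivAt (fun t : ℝ => β (vertCoord EB (⟨b, t • y⟩ : TotalSpace F E)
      (vertPart P ⟨b, t • y⟩ (α ∘L vertCoord EB (⟨b, t • y⟩ : TotalSpace F E)))))
      (β (L b y α)) 0
  conn : ∀ (b : B) (y : E b) (α : E b →L[ℝ] ℝ) (u : TangentSpace 𝓘(ℝ, EB) b),
    HasDerivAt (fun t : ℝ => α (vertCoord EB (⟨b, t • y⟩ : TotalSpace F E)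
      (couplingLift P ⟨b, t • y⟩ u - horLift D ⟨b, t • y⟩ u))) 0 0
  form : ∀ (b : B) (y : E b) (u v : TangentSpace 𝓘(ℝ, EB) b),
    HasDerivAt (fun t : ℝ => couplingForm P (⟨b, t • y⟩ : TotalSpace F E) u v)
      (-(R b y u v)) 0

/-- The tensor `Π_H + L`, with horizontal part coupling the form
`F(x) = ω - R x` via the linear connection `D`. It is meaningful where this form is nondegenerate,
in particular near the zero section. -/
def linearizedTensor (Ω : FormField₂ 𝓘(ℝ, EB) B) (L : LinearVertTensor E)
    (D : CovariantDerivative 𝓘(ℝ, EB) F E) (R : DualValuedForm EB E) :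
    TensorField₂ (𝓘(ℝ, EB).prod 𝓘(ℝ, F)) (TotalSpace F E) := fun p =>
  horTensor p (horLift D p) (Ω p.proj - R p.proj p.2)
    + vertLift EB p ∘L L p.proj p.2 ∘L ContinuousLinearMap.precomp ℝ (vertLift EB p)

/-- The flat model: the tensor `Π_H + L` whose horizontal part is the lift
of the Poisson structure of `(B, ω)` via the (flat) connection `D`, so the coupling form is
`ω ⊗ 1`. -/
def flatModel (Ω : FormField₂ 𝓘(ℝ, EB) B) (L : LinearVertTensor E)
    (D : CovariantDerivative 𝓘(ℝ, EB) F E) :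
    TensorField₂ (𝓘(ℝ, EB).prod 𝓘(ℝ, F)) (TotalSpace F E) := fun p =>
  horTensor p (horLift D p) (Ω p.proj)
    + vertLift EB p ∘L L p.proj p.2 ∘L ContinuousLinearMap.precomp ℝ (vertLift EB p)

/-! #### Lie–Poisson connections, curvature, holonomy -/

/-- `a` is the value `(∇_u α)(b)` of the dual connection on the section `α` of `E^*`. -/
def HasDualDerivAt (D : CovariantDerivative 𝓘(ℝ, EB) F E) (α : ∀ b, E b →L[ℝ] ℝ)
    (b : B) (u : TangentSpace 𝓘(ℝ, EB) b) (a : E b →L[ℝ] ℝ) : Prop :=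
  ∀ s : ∀ b, E b, ContMDiff 𝓘(ℝ, EB) (𝓘(ℝ, EB).prod 𝓘(ℝ, F)) ∞
      (fun b => TotalSpace.mk' F b (s b)) →
    a (s b) = mvfderiv 𝓘(ℝ, EB) (fun b' => α b' (s b')) b u - α b (D s b u)

/-- `D` is a Lie–Poisson connection: `∇L = 0`. -/
def IsLiePoissonConnection (D : CovariantDerivative 𝓘(ℝ, EB) F E)
    (L : LinearVertTensor E) : Prop :=
  ∀ (α β : ∀ b, E b →L[ℝ] ℝ) (s : ∀ b, E b),
    ContMDiff 𝓘(ℝ, EB) (𝓘(ℝ, EB).prod 𝓘(ℝ, F →L[ℝ] ℝ)) ∞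
      (fun b => TotalSpace.mk' (F →L[ℝ] ℝ) b (α b)) →
    ContMDiff 𝓘(ℝ, EB) (𝓘(ℝ, EB).prod 𝓘(ℝ, F →L[ℝ] ℝ)) ∞
      (fun b => TotalSpace.mk' (F →L[ℝ] ℝ) b (β b)) →
    ContMDiff 𝓘(ℝ, EB) (𝓘(ℝ, EB).prod 𝓘(ℝ, F)) ∞ (fun b => TotalSpace.mk' F b (s b)) →
    ∀ (b : B) (u : TangentSpace 𝓘(ℝ, EB) b) (a c : E b →L[ℝ] ℝ),
      HasDualDerivAt D α b u a → HasDualDerivAt D β b u c →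
      mvfderiv 𝓘(ℝ, EB) (fun b' => β b' (L b' (s b') (α b'))) b u
        = β b (L b (D s b u) (α b)) + β b (L b (s b) a) + c (L b (s b) (α b))

/-- The curvature of `D` vanishes. -/
def IsFlatConnection [IsManifold 𝓘(ℝ, EB) ∞ B] (D : CovariantDerivative 𝓘(ℝ, EB) F E) : Prop :=
  ∀ (X Y : ∀ b : B, TangentSpace 𝓘(ℝ, EB) b) (s : ∀ b, E b),
    ContMDiff 𝓘(ℝ, EB) 𝓘(ℝ, EB).tangent ∞ (fun b => (⟨b, X b⟩ : TangentBundle 𝓘(ℝ, EB) B)) →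
    ContMDiff 𝓘(ℝ, EB) 𝓘(ℝ, EB).tangent ∞ (fun b => (⟨b, Y b⟩ : TangentBundle 𝓘(ℝ, EB) B)) →
    ContMDiff 𝓘(ℝ, EB) (𝓘(ℝ, EB).prod 𝓘(ℝ, F)) ∞ (fun b => TotalSpace.mk' F b (s b)) →
    ∀ b : B, D (fun b' => D s b' (Y b')) b (X b) - D (fun b' => D s b' (X b')) b (Y b)
      - D s b (VectorField.mlieBracket 𝓘(ℝ, EB) X Y b) = 0

/-- `c : [0, 1] → E` is a smooth `D`-horizontal curve, that is, a `D`-parallel section along the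
curve `π ∘ c` in the base. -/
def IsHorizontalCurve (D : CovariantDerivative 𝓘(ℝ, EB) F E) (c : ℝ → TotalSpace F E) : Prop :=
  ContMDiffOn 𝓘(ℝ, ℝ) (𝓘(ℝ, EB).prod 𝓘(ℝ, F)) ∞ c (Icc 0 1) ∧
  ∀ t ∈ Icc (0 : ℝ) 1,
    (mfderivWithin 𝓘(ℝ, ℝ) (𝓘(ℝ, EB).prod 𝓘(ℝ, F)) c (Icc 0 1) t (1 : ℝ) :
      TangentSpace (𝓘(ℝ, EB).prod 𝓘(ℝ, F)) (c t))
    = horLift D (c t) (dproj (c t)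
        (mfderivWithin 𝓘(ℝ, ℝ) (𝓘(ℝ, EB).prod 𝓘(ℝ, F)) c (Icc 0 1) t (1 : ℝ)))

/-- The holonomy group of `D` is trivial: parallel transport around every loop is the identity.
(A piecewise smooth loop can be reparametrized to be smooth on `[0, 1]`, so that smooth
paths with equal end points give the whole holonomy group.) -/
def HasTrivialHolonomy (D : CovariantDerivative 𝓘(ℝ, EB) F E) : Prop :=
  ∀ c : ℝ → TotalSpace F E, IsHorizontalCurve D c → (c 0).proj = (c 1).proj → c 0 = c 1

/-! #### Germs of diffeomorphisms along the zero section -/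

variable (EB) in
/-- `φ`, defined on the open neighbourhood `N` of the zero section, represents an element of
`Diff_B^0(E)`: it is a diffeomorphism of `N` onto an open set, and it is the time-one map of the flow
`Fl` of a time-dependent vector field `Z` (smooth on `[0, 1] × W`, `W` a neighbourhood of the
zero section) that vanishes on the zero section. -/
def IsDiffZero [IsManifold 𝓘(ℝ, EB) ∞ B] [ContMDiffVectorBundle ∞ F E 𝓘(ℝ, EB)]
    (N : Set (TotalSpace F E)) (φ : TotalSpace F E → TotalSpace F E) : Prop :=
  IsOpen N ∧ (∀ b : B, (⟨b, 0⟩ : TotalSpace F E) ∈ N) ∧ Set.InjOn φ N ∧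
  IsLocalDiffeomorphOn (𝓘(ℝ, EB).prod 𝓘(ℝ, F)) (𝓘(ℝ, EB).prod 𝓘(ℝ, F)) ∞ φ N ∧
  ∃ (W : Set (TotalSpace F E))
    (Z : ℝ → ∀ p : TotalSpace F E, TangentSpace (𝓘(ℝ, EB).prod 𝓘(ℝ, F)) p)
    (Fl : ℝ → TotalSpace F E → TotalSpace F E),
    IsOpen W ∧ (∀ b : B, (⟨b, 0⟩ : TotalSpace F E) ∈ W) ∧
    ContMDiffOn (𝓘(ℝ, ℝ).prod (𝓘(ℝ, EB).prod 𝓘(ℝ, F))) (𝓘(ℝ, EB).prod 𝓘(ℝ, F)).tangent ∞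
      (fun q : ℝ × TotalSpace F E =>
        (⟨q.2, Z q.1 q.2⟩ : TangentBundle (𝓘(ℝ, EB).prod 𝓘(ℝ, F)) (TotalSpace F E)))
      (Icc 0 1 ×ˢ W) ∧
    (∀ t ∈ Icc (0 : ℝ) 1, ∀ b : B, Z t (⟨b, 0⟩ : TotalSpace F E) = 0) ∧
    ContMDiffOn (𝓘(ℝ, ℝ).prod (𝓘(ℝ, EB).prod 𝓘(ℝ, F))) (𝓘(ℝ, EB).prod 𝓘(ℝ, F)) ∞
      (fun q : ℝ × TotalSpace F E => Fl q.1 q.2) (Icc 0 1 ×ˢ N) ∧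
    (∀ t ∈ Icc (0 : ℝ) 1, Set.MapsTo (Fl t) N W) ∧
    (∀ p ∈ N, ∀ t ∈ Icc (0 : ℝ) 1,
      HasMFDerivWithinAt 𝓘(ℝ, ℝ) (𝓘(ℝ, EB).prod 𝓘(ℝ, F)) (fun s => Fl s p) (Icc 0 1) t
        ((1 : ℝ →L[ℝ] ℝ).smulRight (Z t (Fl t p)))) ∧
    (∀ p ∈ N, Fl 0 p = p) ∧ (∀ p ∈ N, Fl 1 p = φ p)

/-- The germs of `P` and `Q` along the zero section are isomorphic by a diffeomorphism in
`Diff_B^0(E)`, `φ^* Q = P`. -/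
def GermIsomorphic [IsManifold 𝓘(ℝ, EB) ∞ B] [ContMDiffVectorBundle ∞ F E 𝓘(ℝ, EB)]
    (P Q : TensorField₂ (𝓘(ℝ, EB).prod 𝓘(ℝ, F)) (TotalSpace F E)) : Prop :=
  ∃ (N : Set (TotalSpace F E)) (φ : TotalSpace F E → TotalSpace F E),
    IsDiffZero EB N φ ∧ ∀ p ∈ N, pullback φ Q p = P p

/-! #### Normal bundle and exponential maps -/

variable {EM : Type*} [NormedAddCommGroup EM] [NormedSpace ℝ EM]
  {M : Type*} [TopologicalSpace M] [ChartedSpace EM M]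

/-- `E` is the normal bundle `T_B M / TB` of the submanifold `ι : B → M`, with quotient map
`ν : T_B M → E`. -/
structure IsNormalBundle [IsManifold 𝓘(ℝ, EM) ∞ M] (ι : B → M)
    (ν : ∀ b : B, TangentSpace 𝓘(ℝ, EM) (ι b) →L[ℝ] E b) : Prop where
  surjective : ∀ b, Function.Surjective (ν b)
  ker : ∀ (b : B) (w : TangentSpace 𝓘(ℝ, EM) (ι b)),
    ν b w = 0 ↔ w ∈ Set.range (mfderiv 𝓘(ℝ, EB) 𝓘(ℝ, EM) ι b)
  smooth : ∀ X : ∀ m : M, TangentSpace 𝓘(ℝ, EM) m,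
    ContMDiff 𝓘(ℝ, EM) 𝓘(ℝ, EM).tangent ∞ (fun m => (⟨m, X m⟩ : TangentBundle 𝓘(ℝ, EM) M)) →
    ContMDiff 𝓘(ℝ, EB) (𝓘(ℝ, EB).prod 𝓘(ℝ, F)) ∞ (fun b => TotalSpace.mk' F b (ν b (X (ι b))))

/-- An exponential map: a diffeomorphism `f` of the total space `E` onto an open neighbourhood of
`B` in `M`, equal to `ι` on the zero section, and with `ν ∘ d_b f` the projection
`T_b E = T_b B ⊕ E_b → E_b` for every `b ∈ B` (on `T_b B` this holds by the previous condition). -/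
structure IsExponentialMap (ι : B → M)
    (ν : ∀ b : B, TangentSpace 𝓘(ℝ, EM) (ι b) →L[ℝ] E b) (f : TotalSpace F E → M) : Prop where
  injective : Function.Injective f
  localDiffeo : IsLocalDiffeomorph (𝓘(ℝ, EB).prod 𝓘(ℝ, F)) 𝓘(ℝ, EM) ∞ f
  zero : ∀ b : B, f ⟨b, 0⟩ = ι b
  normal : ∀ (b : B) (y : E b),
    ν b (mfderiv (𝓘(ℝ, EB).prod 𝓘(ℝ, F)) 𝓘(ℝ, EM) f ⟨b, 0⟩ (vertLift EB ⟨b, 0⟩ y)) = y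

end VectorBundles

end PoissonLin

end

open Bundle Set Topology
open scoped Manifold ContDiff

noncomputable section

namespace PoissonLin

/-! ### Global solutions of Lipschitz differential equations. -/

section ODE

open Metric NNReal

variable {V : Type*} [NormedAddCommGroup V] [NormedSpace ℝ V]

/-! The linearized structure turns out to be a gauge transform of the flat model by an exact
two-form whose primitive vanishes along `B`; Moser's method then removes it.

Locally, take a frame parallel for `Dflat` (`exists_flat_frame`). There `Λ` is constant
(`BundleFrame.locVert_eq`), so the flat model is the product of the Poisson tensor of the base and
the linear Poisson tensor of the fibre. The Jacobi identity of the pulled back tensor,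
differentiated once in the fibre direction along the zero section (`JetData.jet_jacobi`), gives two
facts: the connection `∇` preserves `Λ` (`JetData.connection_vert`), and `R` composed with `Λ` is
the curvature of `∇` (`JetData.curvature_eq`). By the first, each value `A(u)` of the connection
form of `∇` is the transpose of a derivation of the Lie algebra. Vanishing of the first cohomology
makes it inner and triviality of the centre makes the inner element unique, so `A(u) y = Λ_y μ(u)`
for a smooth one-form `μ` with values in the Lie algebra. The second fact determines `R` on the
vectors `Λ_y γ`; these span the fibre, again because the centre is trivial, and the result is `R =
-dμ + [μ, μ]` (`IsLieIso.exists_gauge`).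

These two formulas say precisely that the linearized tensor is obtained from the flat one by the
gauge transformation with the closed form `dκ`, where `κ = ⟨μ, x⟩`
(`LocalModelData.gauge_relation`). Gauging by `t dκ` gives a path of Poisson tensors `Π_t`, and the
time derivative of `Π_{1-s}` is compensated by its Lie derivative along `-Π_{1-s} κ`
(`LocalModelData.lie_localLin`). This field vanishes on the zero section, so near it the flow exists
up to time one, and it carries the linearized tensor to the flat one (`LocalModelData.exists_flow`).

Globally, `κ` is determined by the difference of the two connections, because `μ` is unique; hence
the local fields are the restrictions of a single field `moserField` on the bundle. Uniqueness of
integral curves allows the local flows to be glued and shows that the time-one map is injective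
(`germIsomorphic_of_gaugeFrames`).

If the holonomy of `Dflat` is trivial, parallel transport from one fibre is independent of the path
and defines a global parallel frame in which `Λ` is constant (`exists_parallel_trivialization`). In
the resulting trivialization the flat model is exactly the product of the two Poisson structures
(`pullback_prodTensor`), and the second assertion follows from the first.

The analytic input is the smooth dependence of flows on initial values (`IsFlow.contDiff`), which
serves both Moser's method and the construction of parallel frames by radial transport
(`exists_parallel_frame`). -/

theorem exists_solution_Icc_of_lipschitzWith [CompleteSpace V] {v : ℝ → V → V} {T : ℝ} (hT : 0 < T)
    {K : ℝ≥0} (hc : ∀ x, Continuous fun t => v t x)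
    (hK : ∀ t ∈ Icc (-T) T, LipschitzWith K (v t)) (x₀ : V) :
    ∃ α : ℝ → V, α 0 = x₀ ∧ ∀ t ∈ Icc (-T) T, HasDerivWithinAt α (v t (α t)) (Icc (-T) T) t := by
  obtain ⟨C, hC⟩ : ∃ C : ℝ, ∀ t ∈ Icc (-T) T, ‖v t 0‖ ≤ C :=
    isCompact_Icc.exists_bound_of_continuousOn (hc 0).continuousOn
  have hC0 : 0 ≤ C := (norm_nonneg _).trans (hC 0 ⟨by linarith, hT.le⟩)
  have hgrow : ∀ t ∈ Icc (-T) T, ∀ x, ‖v t x‖ ≤ K * ‖x‖ + C := by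
    intro t ht x
    have h1 := (hK t ht).dist_le_mul x 0
    rw [dist_zero_right, dist_eq_norm, norm_sub_rev] at h1
    have h2 := norm_le_norm_add_norm_sub (v t 0) (v t x)
    linarith [hC t ht]
  -- `R` bounds a priori every curve from `x₀` whose speed is at most `K‖x‖ + C`. The cutoff `θ`
  -- below is 1 up to radius `R` and 0 beyond `R + 1`; it makes the field bounded, so that the
  -- Picard–Lindelöf theorem applies on the whole interval at once.
  set R : ℝ := gronwallBound ‖x₀‖ K C T with hR
  have hR0 : ‖x₀‖ ≤ R := by
    have := gronwallBound_mono (norm_nonneg x₀) hC0 K.2 hT.le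
    simpa [gronwallBound_x0] using this
  have hR00 : 0 ≤ R := (norm_nonneg _).trans hR0
  set θ : V → ℝ := fun x => max 0 (min 1 (R + 1 - ‖x‖)) with hθ
  have hθL : LipschitzWith 1 θ := by
    have h1 : LipschitzWith 1 (fun x : V => R + 1 - ‖x‖) := by
      refine LipschitzWith.of_dist_le_mul fun x y => ?_
      rw [Real.dist_eq, dist_eq_norm]
      have := abs_norm_sub_norm_le y x
      rw [norm_sub_rev] at this
      simpa [show R + 1 - ‖x‖ - (R + 1 - ‖y‖) = ‖y‖ - ‖x‖ by ring] using this
    exact (h1.const_min 1).const_max 0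
  have hθ0 : ∀ x, 0 ≤ θ x := fun x => le_max_left _ _
  have hθ1 : ∀ x, θ x ≤ 1 := fun x => max_le zero_le_one (min_le_left _ _)
  have hθR : ∀ x, ‖x‖ ≤ R → θ x = 1 := by
    intro x hx
    simp only [hθ]
    rw [min_eq_left (by linarith), max_eq_right zero_le_one]
  have hθout : ∀ x, R + 1 ≤ ‖x‖ → θ x = 0 := by
    intro x hx
    simp only [hθ]
    exact max_eq_left ((min_le_right _ _).trans (by linarith))
  set g : ℝ → V → V := fun t x => θ x • v t x with hg
  have hgle : ∀ t ∈ Icc (-T) T, ∀ x, ‖g t x‖ ≤ K * ‖x‖ + C := by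
    intro t ht x
    simp only [hg, norm_smul, Real.norm_of_nonneg (hθ0 x)]
    exact (mul_le_of_le_one_left (norm_nonneg _) (hθ1 x)).trans (hgrow t ht x)
  set L : ℝ := K * (R + 1) + C with hL
  have hL0 : 0 ≤ L := by positivity
  have hgL : ∀ t ∈ Icc (-T) T, ∀ x, ‖g t x‖ ≤ L := by
    intro t ht x
    rcases le_total (R + 1) ‖x‖ with h | h
    · simp only [hg, hθout x h, zero_smul, norm_zero]; exact hL0
    · refine (hgle t ht x).trans ?_
      rw [hL]; gcongr
  -- A bound for `v` on the ball of radius `L * T` about `x₀`. As `θ` is 1-Lipschitz and at most 1,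
  -- the product `θ • v` is Lipschitz there with constant `K + M`.
  set M : ℝ := K * (‖x₀‖ + L * T) + C with hM
  have hM0 : 0 ≤ M := by positivity
  have hPL : IsPicardLindelof g (tmin := -T) (tmax := T) ⟨0, by linarith, hT.le⟩ x₀
      (Real.toNNReal (L * T)) 0 (Real.toNNReal L) (K + Real.toNNReal M) := by
    constructor
    · intro t ht
      refine LipschitzOnWith.of_dist_le_mul fun x hx y hy => ?_
      have hy' : ‖v t y‖ ≤ M := by
        refine (hgrow t ht y).trans ?_
        rw [mem_closedBall, dist_eq_norm, Real.coe_toNNReal _ (by positivity)] at hy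
        have := norm_le_norm_add_norm_sub x₀ y
        rw [norm_sub_rev] at this
        rw [hM]; gcongr; linarith
      have h1 := (hK t ht).dist_le_mul x y
      have h2 := hθL.dist_le_mul x y
      rw [dist_eq_norm] at h1
      rw [Real.dist_eq, NNReal.coe_one, one_mul] at h2
      rw [dist_eq_norm, show g t x - g t y = θ x • (v t x - v t y) + (θ x - θ y) • v t y by
        simp only [hg]; module]
      refine (norm_add_le _ _).trans ?_
      rw [norm_smul, norm_smul, Real.norm_of_nonneg (hθ0 x), Real.norm_eq_abs, NNReal.coe_add,
        Real.coe_toNNReal _ hM0, add_mul]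
      refine add_le_add ((mul_le_of_le_one_left (norm_nonneg _) (hθ1 x)).trans h1) ?_
      rw [mul_comm M]
      exact mul_le_mul h2 hy' (norm_nonneg _) dist_nonneg
    · intro x _
      exact ((hc x).const_smul _).continuousOn
    · intro t ht x _
      rw [Real.coe_toNNReal _ hL0]
      exact hgL t ht x
    · rw [Real.coe_toNNReal _ hL0, Real.coe_toNNReal _ (by positivity)]
      simp
  obtain ⟨α, h0, hα⟩ := hPL.exists_eq_forall_mem_Icc_hasDerivWithinAt₀
  simp only at h0
  refine ⟨α, h0, fun t ht => ?_⟩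
  -- The truncated field obeys the same growth bound, so its solution never leaves the region where
  -- `θ = 1`, and it solves the original equation.
  suffices hb : ‖α t‖ ≤ R by
    have := hα t ht
    simpa only [hg, hθR _ hb, one_smul] using this
  have hαc : ContinuousOn α (Icc (-T) T) := fun t ht => (hα t ht).continuousWithinAt
  have hbound : ∀ s ∈ Icc 0 T, gronwallBound ‖x₀‖ K C s ≤ R := fun s hs =>
    gronwallBound_mono (norm_nonneg x₀) hC0 K.2 hs.2
  rcases le_total 0 t with h | h
  · have := norm_le_gronwallBound_of_norm_deriv_right_le (f := α) (f' := fun s => g s (α s))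
      (δ := ‖x₀‖) (K := K) (ε := C) (a := 0) (b := T)
      (hαc.mono (Icc_subset_Icc_left (by linarith)))
      (fun s hs => (hα s ⟨by linarith [hs.1], hs.2.le⟩).mono_of_mem_nhdsWithin
        (Filter.mem_of_superset (Icc_mem_nhdsGE hs.2) (Icc_subset_Icc_left (by linarith [hs.1]))))
      (by rw [h0]) (fun s hs => hgle s ⟨by linarith [hs.1], hs.2.le⟩ _) t ⟨h, ht.2⟩
    rw [sub_zero] at this
    exact this.trans (hbound t ⟨h, ht.2⟩)
  -- Grönwall's inequality runs forward in time; negative times are handled by reflection.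
  · have := norm_le_gronwallBound_of_norm_deriv_right_le (f := fun s => α (-s))
      (f' := fun s => -g (-s) (α (-s)))
      (δ := ‖x₀‖) (K := K) (ε := C) (a := 0) (b := T)
      (hαc.comp continuous_neg.continuousOn
        (fun s hs => ⟨by linarith [hs.2], by linarith [hs.1]⟩))
      (fun s hs => by
        have h1 := hα (-s) ⟨by linarith [hs.2], by linarith [hs.1]⟩
        have h2 := h1.scomp (h := fun s : ℝ => -s) (h' := -1) (t' := Icc (-T) T) s
          (hasDerivAt_neg s).hasDerivWithinAt (s := Icc (-T) T)
          (fun r hr => ⟨by linarith [hr.2], by linarith [hr.1]⟩)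
        have h3 : HasDerivWithinAt (α ∘ fun s => -s) ((-1 : ℝ) • g (-s) (α (-s))) (Ici s) s :=
          h2.mono_of_mem_nhdsWithin
          (Filter.mem_of_superset (Icc_mem_nhdsGE hs.2)
            (Icc_subset_Icc_left (by linarith [hs.1] : -T ≤ s)))
        rw [neg_one_smul] at h3
        exact h3)
      (by simp [h0])
      (fun s hs => by
        rw [norm_neg]; exact hgle (-s) ⟨by linarith [hs.2], by linarith [hs.1]⟩ _)
      (-t) ⟨by linarith, by linarith [ht.1]⟩
    rw [sub_zero, neg_neg] at this
    exact this.trans (hbound (-t) ⟨by linarith, by linarith [ht.1]⟩)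

/-- Solutions on growing intervals agree on overlaps by uniqueness. The value at `t` is read off
from the solution with index `⌈|t|⌉₊`, whose interval contains `t` in its interior. -/
theorem exists_solution_of_lipschitzWith [CompleteSpace V] {v : ℝ → V → V}
    (hc : ∀ x, Continuous fun t => v t x)
    (hK : ∀ T : ℝ, ∃ K : ℝ≥0, ∀ t ∈ Icc (-T) T, LipschitzWith K (v t)) (x₀ : V) :
    ∃ α : ℝ → V, α 0 = x₀ ∧ ∀ t, HasDerivAt α (v t (α t)) t := by
  have hn : ∀ n : ℕ, ∃ α : ℝ → V, α 0 = x₀ ∧ ∀ t ∈ Ioo (-(n + 1 : ℝ)) (n + 1),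
      HasDerivAt α (v t (α t)) t := by
    intro n
    obtain ⟨K, hK⟩ := hK (n + 1)
    obtain ⟨α, h0, hα⟩ := exists_solution_Icc_of_lipschitzWith (by positivity) hc hK x₀
    exact ⟨α, h0, fun t ht => (hα t (Ioo_subset_Icc_self ht)).hasDerivAt (Icc_mem_nhds ht.1 ht.2)⟩
  choose α h0 hα using hn
  have hcons : ∀ m n : ℕ, m ≤ n → EqOn (α m) (α n) (Ioo (-(m + 1 : ℝ)) (m + 1)) := by
    intro m n hmn
    obtain ⟨K, hK⟩ := hK (m + 1)
    have hmn' : (m : ℝ) ≤ n := by exact_mod_cast hmn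
    refine ODE_solution_unique_of_mem_Ioo (v := v) (K := K) (s := fun _ => univ) (t₀ := 0)
      (fun t ht => (hK t (Ioo_subset_Icc_self ht)).lipschitzOnWith)
      ⟨by linarith [show (0 : ℝ) ≤ m from m.cast_nonneg], by positivity⟩
      (fun t ht => ⟨hα m t ht, trivial⟩) (fun t ht => ⟨hα n t ⟨?_, ?_⟩, trivial⟩) (by rw [h0, h0])
    · linarith [ht.1]
    · linarith [ht.2]
  have hfl : ∀ t : ℝ, t ∈ Ioo (-((⌈|t|⌉₊ : ℕ) + 1 : ℝ)) ((⌈|t|⌉₊ : ℕ) + 1) := by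
    intro t
    have h1 := Nat.le_ceil |t|
    constructor
    · linarith [neg_abs_le t]
    · linarith [le_abs_self t]
  refine ⟨fun t => α ⌈|t|⌉₊ t, h0 _, fun t => ?_⟩
  set n := ⌈|t|⌉₊ with hn
  refine (hα n t (hfl t)).congr_of_eventuallyEq ?_
  filter_upwards [isOpen_Ioo.mem_nhds (hfl t)] with s hs
  rcases le_total ⌈|s|⌉₊ n with h | h
  · exact hcons _ _ h (hfl s)
  · exact (hcons _ _ h hs).symm

/-- `Fl` is the complete flow of the vector field `f`. -/
structure IsFlow (f : V → V) (Fl : ℝ → V → V) : Prop where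
  zero : ∀ x, Fl 0 x = x
  deriv : ∀ x t, HasDerivAt (fun s => Fl s x) (f (Fl t x)) t

theorem exists_isFlow_of_lipschitzWith [CompleteSpace V] {f : V → V} {K : ℝ≥0}
    (hf : LipschitzWith K f) : ∃ Fl, IsFlow f Fl := by
  choose Fl h0 hFl using fun x => exists_solution_of_lipschitzWith (v := fun _ => f)
    (fun _ => continuous_const) (fun _ => ⟨K, fun _ _ => hf⟩) x
  exact ⟨fun t x => Fl x t, h0, hFl⟩

theorem exists_linear_solution [CompleteSpace V] {A : ℝ → V →L[ℝ] V} (hA : Continuous A) (x₀ : V) :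
    ∃ α : ℝ → V, α 0 = x₀ ∧ ∀ t, HasDerivAt α (A t (α t)) t := by
  refine exists_solution_of_lipschitzWith (v := fun t => A t)
    (fun x => hA.clm_apply continuous_const) (fun T => ?_) x₀
  obtain ⟨C, hC⟩ := (isCompact_Icc (a := -T) (b := T)).exists_bound_of_continuousOn hA.continuousOn
  refine ⟨C.toNNReal, fun t ht => (A t).lipschitz.weaken ?_⟩
  rw [← NNReal.coe_le_coe, coe_nnnorm]
  exact (hC t ht).trans (Real.le_coe_toNNReal C)

/-- The uniqueness tool behind all later comparisons of transported objects: only continuity of the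
coefficients on `[0, 1]` is needed, which bounds their norms there. -/
theorem eqOn_of_linear_ode {A : ℝ → V →L[ℝ] V} {α β : ℝ → V}
    (hA : ContinuousOn A (Icc 0 1))
    (hα : ∀ t ∈ Icc (0 : ℝ) 1, HasDerivWithinAt α (A t (α t)) (Icc 0 1) t)
    (hβ : ∀ t ∈ Icc (0 : ℝ) 1, HasDerivWithinAt β (A t (β t)) (Icc 0 1) t)
    (h0 : α 0 = β 0) : EqOn α β (Icc 0 1) := by
  obtain ⟨C, hC⟩ := (isCompact_Icc (a := (0 : ℝ)) (b := 1)).exists_bound_of_continuousOn hA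
  have hd : ∀ {γ : ℝ → V}, (∀ t ∈ Icc (0 : ℝ) 1, HasDerivWithinAt γ (A t (γ t)) (Icc 0 1) t) →
      ∀ t ∈ Ico (0 : ℝ) 1, HasDerivWithinAt γ (A t (γ t)) (Ici t) t := fun hγ t ht =>
    (hγ t (Ico_subset_Icc_self ht)).mono_of_mem_nhdsWithin
      (Filter.mem_of_superset (Icc_mem_nhdsGE ht.2) (Icc_subset_Icc_left ht.1))
  refine ODE_solution_unique_of_mem_Icc_right (v := fun t => A t) (K := C.toNNReal)
    (s := fun _ => univ) (fun t ht => ((A t).lipschitz.weaken ?_).lipschitzOnWith)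
    (fun t ht => (hα t ht).continuousWithinAt) (hd hα) (fun _ _ => trivial)
    (fun t ht => (hβ t ht).continuousWithinAt) (hd hβ) (fun _ _ => trivial) h0
  rw [← NNReal.coe_le_coe, coe_nnnorm]
  exact (hC t (Ico_subset_Icc_self ht)).trans (Real.le_coe_toNNReal C)

theorem exists_lipschitzOnWith_closedBall [FiniteDimensional ℝ V] {W : Type*}
    [NormedAddCommGroup W] [NormedSpace ℝ W] {f : V → W} (hf : ContDiff ℝ 1 f) (R : ℝ) :
    ∃ K : ℝ≥0, LipschitzOnWith K f (closedBall 0 R) := by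
  have := FiniteDimensional.proper ℝ V
  obtain ⟨C, hC⟩ := (isCompact_closedBall (0 : V) R).exists_bound_of_continuousOn
    (hf.continuous_fderiv one_ne_zero).continuousOn
  refine ⟨C.toNNReal, (convex_closedBall 0 R).lipschitzOnWith_of_nnnorm_fderiv_le
    (fun x _ => hf.differentiable one_ne_zero x) fun x hx => ?_⟩
  rw [← NNReal.coe_le_coe, coe_nnnorm]
  exact (hC x hx).trans (Real.le_coe_toNNReal C)

end ODE

/-! ### Smooth dependence of complete flows on initial values. -/

section ODE

open Metric NNReal

variable {V : Type*} [NormedAddCommGroup V] [NormedSpace ℝ V]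

theorem two_le_infty : (2 : WithTop ℕ∞) ≤ ∞ := by
  exact WithTop.coe_le_coe.2 (le_top : (2 : ℕ∞) ≤ ⊤)

theorem IsFlow.continuous {f : V → V} {Fl : ℝ → V → V} (h : IsFlow f Fl) (x : V) :
    Continuous fun t => Fl t x :=
  continuous_iff_continuousAt.2 fun t => (h.deriv x t).continuousAt

/-- A `C¹` field is Lipschitz only on bounded sets, but on a compact time interval both curves stay
in a common ball. -/
theorem IsFlow.eq_of_hasDerivAt [FiniteDimensional ℝ V] {f : V → V} {Fl : ℝ → V → V}
    (h : IsFlow f Fl) (hf : ContDiff ℝ 1 f) {c : ℝ → V} (hc : ∀ t, HasDerivAt c (f (c t)) t)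
    (t : ℝ) : c t = Fl t (c 0) := by
  set T := |t| + 1 with hT
  have hT0 : 0 < T := by positivity
  obtain ⟨R₁, h₁⟩ := (isCompact_Icc (a := -T) (b := T)).exists_bound_of_continuousOn
    (f := c) (continuous_iff_continuousAt.2 fun t => (hc t).continuousAt).continuousOn
  obtain ⟨R₂, h₂⟩ := (isCompact_Icc (a := -T) (b := T)).exists_bound_of_continuousOn
    (f := fun t => Fl t (c 0)) (h.continuous _).continuousOn
  obtain ⟨K, hK⟩ := exists_lipschitzOnWith_closedBall hf (max R₁ R₂)
  refine ODE_solution_unique_of_mem_Ioo (v := fun _ => f) (K := K) (s := fun _ => closedBall 0 _)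
    (t₀ := 0) (a := -T) (b := T) (fun _ _ => hK) ⟨by linarith, hT0⟩ (fun s hs => ⟨hc s, ?_⟩)
    (fun s hs => ⟨h.deriv _ s, ?_⟩) (h.zero _).symm
    ⟨by linarith [neg_abs_le t], by linarith [le_abs_self t]⟩
  · rw [mem_closedBall_zero_iff]
    exact (h₁ s (Ioo_subset_Icc_self hs)).trans (le_max_left _ _)
  · rw [mem_closedBall_zero_iff]
    exact (h₂ s (Ioo_subset_Icc_self hs)).trans (le_max_right _ _)

theorem IsFlow.add [FiniteDimensional ℝ V] {f : V → V} {Fl : ℝ → V → V} (h : IsFlow f Fl)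
    (hf : ContDiff ℝ 1 f) (s t : ℝ) (x : V) : Fl (t + s) x = Fl t (Fl s x) := by
  have := h.eq_of_hasDerivAt hf (c := fun t => Fl (t + s) x) (fun t => by
    simpa using! (h.deriv x (t + s)).comp_add_const t s) t
  simpa using this

theorem IsFlow.smul {f : V → V} {Fl : ℝ → V → V} (h : IsFlow f Fl) (r : ℝ) :
    IsFlow (fun x => r • f x) fun t x => Fl (t * r) x := by
  refine ⟨fun x => by simp [h.zero], fun x t => ?_⟩
  have := (h.deriv x (t * r)).scomp t ((hasDerivAt_id t).mul_const r)
  simpa using! this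

/-- The field prolonged by the scaling parameter of time. -/
theorem IsFlow.param {f : V → V} {Fl : ℝ → V → V} (h : IsFlow f Fl) :
    IsFlow (fun p : ℝ × V => ((0 : ℝ), p.1 • f p.2)) fun t p => (p.1, Fl (t * p.1) p.2) := by
  refine ⟨fun x => by simp [h.zero], fun x t => ?_⟩
  exact (hasDerivAt_const t x.1).prodMk ((h.smul x.1).deriv x.2 t)

/-- The tangent prolongation of a complete vector field is complete. -/
theorem IsFlow.exists_tangent [CompleteSpace V] {f : V → V} {Fl : ℝ → V → V} (h : IsFlow f Fl)
    (hf : ContDiff ℝ 1 f) : ∃ J : ℝ → V → V → V,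
      IsFlow (fun p : V × V => (f p.1, fderiv ℝ f p.1 p.2)) fun t p => (Fl t p.1, J t p.1 p.2) := by
  have hA : ∀ x, Continuous fun t => fderiv ℝ f (Fl t x) := fun x =>
    (hf.continuous_fderiv one_ne_zero).comp (h.continuous x)
  choose J h0 hJ using fun x v => exists_linear_solution (hA x) v
  exact ⟨fun t x v => J x v t, fun p => by simp [h.zero, h0],
    fun p t => (h.deriv p.1 t).prodMk (hJ p.1 p.2 t)⟩

/-- A bootstrap: while the two trajectories are within distance 1, they stay in a ball where the
field is `K`-Lipschitz, and Grönwall gives distance at most `exp K` times the initial one. For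
initial distance less than `1 / (2 exp K)` this is less than 1/2, so the distance 1 is never
reached. -/
theorem IsFlow.exists_dist_le [FiniteDimensional ℝ V] {f : V → V} {Fl : ℝ → V → V}
    (h : IsFlow f Fl) (hf : ContDiff ℝ 1 f) (x₀ : V) :
    ∃ R δ C : ℝ, 0 < δ ∧ 0 ≤ C ∧ (∀ t ∈ Icc (0 : ℝ) 1, ‖Fl t x₀‖ ≤ R) ∧
      ∀ x ∈ ball x₀ δ, ∀ t ∈ Icc (0 : ℝ) 1, ‖Fl t x‖ ≤ R ∧
        dist (Fl t x) (Fl t x₀) ≤ C * dist x x₀ := by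
  obtain ⟨R₀, hR₀⟩ := (isCompact_Icc (a := (0 : ℝ)) (b := 1)).exists_bound_of_continuousOn
    (f := fun t => Fl t x₀) (h.continuous _).continuousOn
  obtain ⟨K, hK⟩ := exists_lipschitzOnWith_closedBall hf (R₀ + 1)
  set C : ℝ := Real.exp K with hC
  have hC0 : 0 < C := Real.exp_pos _
  have key : ∀ x ∈ ball x₀ (C⁻¹ / 2), ∀ T ∈ Icc (0 : ℝ) 1,
      (∀ s ∈ Icc 0 T, dist (Fl s x) (Fl s x₀) ≤ 1) →
      ∀ s ∈ Icc 0 T, dist (Fl s x) (Fl s x₀) ≤ C * dist x x₀ := by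
    intro x hx T hT hb s hs
    have h1 := dist_le_of_trajectories_ODE_of_mem (v := fun _ => f) (K := K)
      (s := fun _ => closedBall 0 (R₀ + 1)) (f := fun t => Fl t x) (g := fun t => Fl t x₀)
      (a := 0) (b := T) (δ := dist x x₀) (fun _ _ => hK) (h.continuous x).continuousOn
      (fun t _ => (h.deriv x t).hasDerivWithinAt) (fun t ht => ?_) (h.continuous x₀).continuousOn
      (fun t _ => (h.deriv x₀ t).hasDerivWithinAt) (fun t ht => ?_) (by simp [h.zero]) s hs
    · refine h1.trans ?_
      rw [mul_comm]
      refine mul_le_mul_of_nonneg_right ?_ dist_nonneg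
      rw [hC, Real.exp_le_exp, sub_zero]
      exact mul_le_of_le_one_right K.2 (hs.2.trans hT.2)
    · rw [mem_closedBall_zero_iff]
      have h2 := hb t (Ico_subset_Icc_self ht)
      rw [dist_eq_norm, norm_sub_rev] at h2
      have h3 := norm_le_norm_add_norm_sub (Fl t x₀) (Fl t x)
      have h4 := hR₀ t ⟨ht.1, ht.2.le.trans hT.2⟩
      linarith
    · rw [mem_closedBall_zero_iff]
      have h4 := hR₀ t ⟨ht.1, ht.2.le.trans hT.2⟩
      linarith
  have hclose : ∀ x ∈ ball x₀ (C⁻¹ / 2), ∀ t ∈ Icc (0 : ℝ) 1, dist (Fl t x) (Fl t x₀) ≤ 1 := by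
    intro x hx
    have hx' : C * dist x x₀ < 1 := by
      have : C * dist x x₀ < C * (C⁻¹ / 2) := mul_lt_mul_of_pos_left hx hC0
      have h2 : C * (C⁻¹ / 2) = 1 / 2 := by field_simp
      linarith
    have hcont : Continuous fun t => dist (Fl t x) (Fl t x₀) :=
      (h.continuous x).dist (h.continuous x₀)
    -- Continuous induction on the set of times up to which the bound 1 holds: it is closed in `[0,
    -- 1]`, and it extends to the right because the bound is then strict.
    set S : Set ℝ := {t | ∀ s ∈ Icc 0 t, dist (Fl s x) (Fl s x₀) ≤ 1} with hS
    have hclosed : IsClosed (S ∩ Icc 0 1) := by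
      rw [← isOpen_compl_iff, isOpen_iff_mem_nhds]
      intro t ht
      by_cases htI : t ∈ Icc (0 : ℝ) 1
      · have htS : t ∉ S := fun h' => ht ⟨h', htI⟩
        simp only [hS, mem_ofPred_eq, not_forall, not_le] at htS
        obtain ⟨s, hs, hs1⟩ := htS
        obtain ⟨r, hr0, hrt, hr1⟩ : ∃ r, 0 ≤ r ∧ r < t ∧ 1 < dist (Fl r x) (Fl r x₀) := by
          rcases hs.2.lt_or_eq with hlt | rfl
          · exact ⟨s, hs.1, hlt, hs1⟩
          · have hs0 : 0 < s := by
              rcases hs.1.lt_or_eq with h0 | rfl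
              · exact h0
              · rw [h.zero, h.zero] at hs1
                have : dist x x₀ ≤ C * dist x x₀ :=
                  le_mul_of_one_le_left dist_nonneg (Real.one_le_exp K.2)
                linarith
            have h1 : ∀ᶠ r in 𝓝[<] s, 1 < dist (Fl r x) (Fl r x₀) :=
              nhdsWithin_le_nhds (hcont.continuousAt.eventually (lt_mem_nhds hs1))
            have h2 : ∀ᶠ r in 𝓝[<] s, r ∈ Ioo 0 s := Ioo_mem_nhdsLT hs0
            obtain ⟨r, hr1, hr2⟩ := (h1.and h2).exists
            exact ⟨r, hr2.1.le, hr2.2, hr1⟩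
        filter_upwards [lt_mem_nhds hrt] with t' ht' h'
        exact absurd (h'.1 r ⟨hr0, ht'.le⟩) (not_le.2 hr1)
      · filter_upwards [isClosed_Icc.isOpen_compl.mem_nhds htI] with t' ht' h'
        exact ht' h'.2
    have hsub : Icc (0 : ℝ) 1 ⊆ S := by
      refine IsClosed.Icc_subset_of_forall_exists_gt hclosed ?_ ?_
      · intro s hs
        obtain rfl : s = 0 := le_antisymm hs.2 hs.1
        rw [h.zero, h.zero]
        have : dist x x₀ ≤ C * dist x x₀ :=
          le_mul_of_one_le_left dist_nonneg (Real.one_le_exp K.2)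
        linarith
      · rintro t ⟨htS, ht⟩ y hy
        have h1 : dist (Fl t x) (Fl t x₀) < 1 :=
          (key x hx t (Ico_subset_Icc_self ht) htS t ⟨ht.1, le_rfl⟩).trans_lt hx'
        obtain ⟨u, hu, hIcc⟩ := (mem_nhdsGT_iff_exists_Ioc_subset).1 (show
          {r | dist (Fl r x) (Fl r x₀) < 1} ∈ 𝓝[>] t from
          nhdsWithin_le_nhds (hcont.continuousAt.eventually (gt_mem_nhds h1)))
        refine ⟨min u y, ?_, lt_min hu hy, min_le_right _ _⟩
        intro s hs
        rcases le_or_gt s t with hst | hst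
        · exact htS s ⟨hs.1, hst⟩
        · exact (hIcc ⟨hst, hs.2.trans (min_le_left _ _)⟩).le
    exact fun t ht => hsub ht t ⟨ht.1, le_rfl⟩
  refine ⟨R₀ + 1, C⁻¹ / 2, C, by positivity, hC0.le, fun t ht => by linarith [hR₀ t ht],
    fun x hx t ht => ⟨?_, key x hx 1 ⟨zero_le_one, le_rfl⟩ (hclose x hx) t ht⟩⟩
  have h2 := hclose x hx t ht
  rw [dist_eq_norm, norm_sub_rev] at h2
  have h3 := norm_le_norm_add_norm_sub (Fl t x₀) (Fl t x)
  linarith [hR₀ t ht]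

/-- The error `Fl t x - Fl t x₀ - J t x₀ (x - x₀)` satisfies the linearized equation up to the
Taylor remainder of `f`, which is at most `M C² ‖x - x₀‖²`. By Grönwall the error at time one is
quadratic in `x - x₀`, hence negligible. -/
theorem IsFlow.hasFDerivAt_one [FiniteDimensional ℝ V] {f : V → V} {Fl : ℝ → V → V}
    (h : IsFlow f Fl) (hf : ContDiff ℝ 2 f) {J : ℝ → V → V → V}
    (hJ : IsFlow (fun p : V × V => (f p.1, fderiv ℝ f p.1 p.2))
      fun t p => (Fl t p.1, J t p.1 p.2)) (x₀ : V) :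
    ∃ A : V →L[ℝ] V, (∀ v, A v = J 1 x₀ v) ∧ HasFDerivAt (Fl 1) A x₀ := by
  have hf1 : ContDiff ℝ 1 f := hf.of_le one_le_two
  have hdf : ContDiff ℝ 1 (fderiv ℝ f) := hf.fderiv_right (by norm_num)
  obtain ⟨R, δ, C, hδ, hC0, hR0, hR⟩ := h.exists_dist_le hf1 x₀
  obtain ⟨K', hK'⟩ := (isCompact_Icc (a := (0 : ℝ)) (b := 1)).exists_bound_of_continuousOn
    (f := fun t => fderiv ℝ f (Fl t x₀)) (hdf.continuous.comp (h.continuous x₀)).continuousOn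
  obtain ⟨M, hM⟩ := exists_lipschitzOnWith_closedBall hdf R
  have hJ0 : ∀ v, J 0 x₀ v = v := fun v => congrArg Prod.snd (hJ.zero (x₀, v))
  have hJd : ∀ v t, HasDerivAt (fun s => J s x₀ v) (fderiv ℝ f (Fl t x₀) (J t x₀ v)) t :=
    fun v t => by
      simpa using! (ContinuousLinearMap.snd ℝ V V).hasFDerivAt.comp_hasDerivAt t
        (hJ.deriv (x₀, v) t)
  have hcA : ContinuousOn (fun t => fderiv ℝ f (Fl t x₀)) (Icc 0 1) :=
    (hdf.continuous.comp (h.continuous x₀)).continuousOn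
  have hlin : ∀ {c : ℝ → V} , (∀ t, HasDerivAt c (fderiv ℝ f (Fl t x₀) (c t)) t) →
      c 1 = J 1 x₀ (c 0) := by
    intro c hc
    exact eqOn_of_linear_ode hcA (fun t _ => (hc t).hasDerivWithinAt)
      (fun t _ => (hJd (c 0) t).hasDerivWithinAt) (hJ0 _).symm ⟨zero_le_one, le_rfl⟩
  let A : V →ₗ[ℝ] V :=
    { toFun := J 1 x₀
      map_add' := fun v w => by
        have := hlin (c := fun t => J t x₀ v + J t x₀ w) (fun t => by
          rw [map_add]; exact (hJd v t).add (hJd w t))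
        simpa [hJ0] using this.symm
      map_smul' := fun r v => by
        have := hlin (c := fun t => r • J t x₀ v) (fun t => by
          rw [map_smul]; exact (hJd v t).const_smul r)
        simpa [hJ0] using this.symm }
  refine ⟨LinearMap.toContinuousLinearMap A, fun v => rfl, ?_⟩
  set B : ℝ := gronwallBound 0 K' (M * C ^ 2) 1 with hB
  have hest : ∀ x ∈ ball x₀ δ, ‖Fl 1 x - Fl 1 x₀ - J 1 x₀ (x - x₀)‖ ≤ B * ‖x - x₀‖ ^ 2 := by
    intro x hx
    have hg := norm_le_gronwallBound_of_norm_deriv_right_le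
      (f := fun t => Fl t x - Fl t x₀ - J t x₀ (x - x₀))
      (f' := fun t => f (Fl t x) - f (Fl t x₀) - fderiv ℝ f (Fl t x₀) (J t x₀ (x - x₀)))
      (δ := 0) (K := K') (ε := M * C ^ 2 * ‖x - x₀‖ ^ 2) (a := 0) (b := 1)
      (fun t _ => (((h.deriv x t).sub (h.deriv x₀ t)).sub
        (hJd (x - x₀) t)).continuousAt.continuousWithinAt)
      (fun t _ => (((h.deriv x t).sub (h.deriv x₀ t)).sub (hJd (x - x₀) t)).hasDerivWithinAt)
      (by simp [h.zero, hJ0]) (fun t ht => ?_) 1 ⟨zero_le_one, le_rfl⟩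
    · refine hg.trans (le_of_eq ?_)
      rw [hB]
      by_cases hK0 : K' = 0
      · simp [hK0, gronwallBound_K0]
      · simp only [gronwallBound_of_K_ne_0 hK0]; simp only [sub_zero, mul_one]; ring
    · have ht' := Ico_subset_Icc_self ht
      set y := Fl t x
      set y₀ := Fl t x₀
      have hy : y ∈ closedBall (0 : V) R := by
        rw [mem_closedBall_zero_iff]; exact (hR x hx t ht').1
      have hy₀ : y₀ ∈ closedBall (0 : V) R := by
        rw [mem_closedBall_zero_iff]; exact hR0 t ht'
      have htay : ‖f y - f y₀ - fderiv ℝ f y₀ (y - y₀)‖ ≤ (M * ‖y - y₀‖) * ‖y - y₀‖ := by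
        refine Convex.norm_image_sub_le_of_norm_fderiv_le' (𝕜 := ℝ) (s := segment ℝ y₀ y)
          (fun z _ => hf1.differentiable one_ne_zero z) (fun z hz => ?_) (convex_segment _ _)
          (left_mem_segment _ _ _) (right_mem_segment _ _ _)
        have hz' : z ∈ closedBall (0 : V) R := (convex_closedBall 0 R).segment_subset hy₀ hy hz
        have h1 := hM.dist_le_mul z hz' y₀ hy₀
        rw [dist_eq_norm, dist_eq_norm] at h1
        refine h1.trans ?_
        gcongr
        exact norm_sub_le_of_mem_segment hz
      have hyC : ‖y - y₀‖ ≤ C * ‖x - x₀‖ := by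
        have := (hR x hx t ht').2
        rwa [dist_eq_norm, dist_eq_norm] at this
      rw [show f y - f y₀ - fderiv ℝ f y₀ (J t x₀ (x - x₀)) =
        fderiv ℝ f y₀ (y - y₀ - J t x₀ (x - x₀)) + (f y - f y₀ - fderiv ℝ f y₀ (y - y₀)) by
          rw [map_sub _ (y - y₀)]; abel]
      refine (norm_add_le _ _).trans (add_le_add ?_ ?_)
      · exact ((fderiv ℝ f y₀).le_opNorm _).trans
          (mul_le_mul_of_nonneg_right (hK' t ht') (norm_nonneg _))
      · refine htay.trans ?_
        calc M * ‖y - y₀‖ * ‖y - y₀‖ ≤ M * (C * ‖x - x₀‖) * (C * ‖x - x₀‖) := by gcongr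
          _ = _ := by ring
  rw [hasFDerivAt_iff_isLittleO]
  have hO : (fun x => Fl 1 x - Fl 1 x₀ - J 1 x₀ (x - x₀)) =O[𝓝 x₀] fun x => ‖x - x₀‖ ^ 2 := by
    refine Asymptotics.IsBigO.of_bound B ?_
    filter_upwards [ball_mem_nhds x₀ hδ] with x hx
    simpa using hest x hx
  refine hO.trans_isLittleO ?_
  have : (fun x : V => ‖x - x₀‖ ^ 2) =o[𝓝 x₀] fun x => ‖x - x₀‖ ^ 1 := by
    refine (Asymptotics.isLittleO_pow_pow one_lt_two).comp_tendsto ?_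
    have : Filter.Tendsto (fun x : V => ‖x - x₀‖) (𝓝 x₀) (𝓝 ‖x₀ - x₀‖) :=
      (continuous_id.sub continuous_const).norm.continuousAt
    simpa using this
  simpa using this

/-- Induction on the order of differentiability, over all spaces simultaneously: the derivative of
the flow is a component of the flow of the tangent prolongation on `V × V`, which is again smooth
and complete. -/
theorem IsFlow.contDiff_one [FiniteDimensional ℝ V] {f : V → V} {Fl : ℝ → V → V}
    (h : IsFlow f Fl) (hf : ContDiff ℝ ∞ f) : ContDiff ℝ ∞ (Fl 1) := by
  rw [contDiff_infty]
  intro n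
  induction n generalizing V with
  | zero =>
    have hc : Continuous (Fl 1) := by
      refine continuous_iff_continuousAt.2 fun x₀ => ?_
      obtain ⟨J, hJ⟩ := h.exists_tangent (hf.of_le (by exact_mod_cast le_top))
      obtain ⟨A, -, hA⟩ := h.hasFDerivAt_one (hf.of_le two_le_infty) hJ x₀
      exact hA.continuousAt
    exact_mod_cast contDiff_zero.2 hc
  | succ n ih =>
    have hf1 : ContDiff ℝ 1 f := hf.of_le (by exact_mod_cast le_top)
    obtain ⟨J, hJ⟩ := h.exists_tangent hf1
    have hprol : ContDiff ℝ ∞ fun p : V × V => (f p.1, fderiv ℝ f p.1 p.2) :=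
      (hf.comp contDiff_fst).prodMk
        (((hf.fderiv_right (m := ∞) (by exact_mod_cast le_top)).comp contDiff_fst).clm_apply
          contDiff_snd)
    have hJn := ih hJ hprol
    rw [show ((n + 1 : ℕ) : WithTop ℕ∞) = (n : WithTop ℕ∞) + 1 by push_cast; rfl]
    rw [contDiff_succ_iff_fderiv_apply]
    have hd : ∀ x₀, ∃ A : V →L[ℝ] V, (∀ v, A v = J 1 x₀ v) ∧ HasFDerivAt (Fl 1) A x₀ :=
      h.hasFDerivAt_one (hf.of_le two_le_infty) hJ
    refine ⟨fun x => (hd x).choose_spec.2.differentiableAt, by simp, fun v => ?_⟩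
    have : (fun x => fderiv ℝ (Fl 1) x v) = fun x => (Fl 1 x, J 1 x v).2 := by
      funext x
      rw [(hd x).choose_spec.2.fderiv, (hd x).choose_spec.1]
    rw [this]
    exact contDiff_snd.comp (hJn.comp (contDiff_id.prodMk contDiff_const))

/-- Joint smoothness in time reduces to time one: `(s, x) ↦ (s, Fl s x)` is the time-one map of the
field `(0, s f(x))`. -/
theorem IsFlow.contDiff [FiniteDimensional ℝ V] {f : V → V} {Fl : ℝ → V → V}
    (h : IsFlow f Fl) (hf : ContDiff ℝ ∞ f) : ContDiff ℝ ∞ fun p : ℝ × V => Fl p.1 p.2 := by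
  have := h.param.contDiff_one (contDiff_const.prodMk
    (contDiff_fst.smul (hf.comp contDiff_snd)))
  simpa using! contDiff_snd.comp this

end ODE

/-! ### Local time-dependent flows near an equilibrium, and the variational equation. -/

section ODE

open Metric NNReal

variable {V : Type*} [NormedAddCommGroup V] [NormedSpace ℝ V]

theorem exists_contDiff_cutoff [FiniteDimensional ℝ V] {K O : Set V} (hK : IsCompact K)
    (hO : IsOpen O) (hKO : K ⊆ O) :
    ∃ χ : V → ℝ, ContDiff ℝ ∞ χ ∧ HasCompactSupport χ ∧ tsupport χ ⊆ O ∧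
      ∃ O₁, IsOpen O₁ ∧ K ⊆ O₁ ∧ ∀ x ∈ O₁, χ x = 1 := by
  have := FiniteDimensional.proper ℝ V
  obtain ⟨δ, hδ, hδO⟩ := hK.exists_cthickening_subset_open hO hKO
  obtain ⟨χ, h1, h0, -⟩ := exists_contMDiffMap_one_nhds_of_subset_interior (n := ⊤) 𝓘(ℝ, V)
    hK.isClosed (t := cthickening δ K)
    ((self_subset_thickening hδ K).trans (isOpen_thickening.subset_interior_iff.2
      (thickening_subset_cthickening δ K)))
  have hts : tsupport χ ⊆ cthickening δ K :=
    closure_minimal (fun x hx => by_contra fun h => hx (h0 x h)) isClosed_cthickening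
  refine ⟨χ, χ.contMDiff.contDiff, ?_, hts.trans hδO, ?_⟩
  · exact HasCompactSupport.intro hK.cthickening h0
  · obtain ⟨O₁, hO₁, hKO₁⟩ := Filter.eventually_iff_exists_mem.1 h1
    obtain ⟨U, hU, hKU, hUs⟩ := mem_nhdsSet_iff_exists.1 hO₁
    exact ⟨U, hU, hKU, fun x hx => hKO₁ x (hUs hx)⟩

theorem contDiff_smul_of_tsupport_subset {W : Type*} [NormedAddCommGroup W] [NormedSpace ℝ W]
    {χ : V → ℝ} {g : V → W} {O : Set V} (hO : IsOpen O) (hχ : ContDiff ℝ ∞ χ)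
    (hs : tsupport χ ⊆ O) (hg : ContDiffOn ℝ ∞ g O) : ContDiff ℝ ∞ fun x => χ x • g x := by
  refine contDiff_iff_contDiffAt.2 fun x => ?_
  by_cases hx : x ∈ tsupport χ
  · exact hχ.contDiffAt.smul (hg.contDiffAt (hO.mem_nhds (hs hx)))
  · refine (contDiffAt_const (c := (0 : W))).congr_of_eventuallyEq ?_
    filter_upwards [(isClosed_tsupport χ).isOpen_compl.mem_nhds hx] with y hy
    rw [image_eq_zero_of_notMem_tsupport hy, zero_smul]

/-- Local flow, over the time interval `[0, 1]`, of a time-dependent vector field near a point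
where it vanishes. -/
theorem exists_local_flow [FiniteDimensional ℝ V] {O : Set (ℝ × V)} (hO : IsOpen O)
    {Z : ℝ × V → V} (hZ : ContDiffOn ℝ ∞ Z O) {q₁ : V} (hq₁ : ∀ t ∈ Icc (0 : ℝ) 1, (t, q₁) ∈ O)
    (hZ0 : ∀ t, Z (t, q₁) = 0) :
    ∃ (Φ : ℝ → V → V) (Ψ : V → V) (N : Set V), ContDiff ℝ ∞ (fun p : ℝ × V => Φ p.1 p.2) ∧
      ContDiff ℝ ∞ Ψ ∧ (∀ q, Ψ (Φ 1 q) = q) ∧ (∀ q, Φ 1 (Ψ q) = q) ∧ (∀ q, Φ 0 q = q) ∧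
      IsOpen N ∧ q₁ ∈ N ∧
      ∀ q ∈ N, ∀ t ∈ Icc (0 : ℝ) 1, (t, Φ t q) ∈ O ∧
        HasDerivAt (fun s => Φ s q) (Z (t, Φ t q)) t := by
  obtain ⟨χ, hχ, hχc, hχO, O₁, hO₁, hKO₁, hχ1⟩ := exists_contDiff_cutoff
    (K := Icc (0 : ℝ) 1 ×ˢ {q₁}) (isCompact_Icc.prod isCompact_singleton) hO
    (fun p hp => by
      obtain ⟨h1, h2⟩ := hp
      rw [mem_singleton_iff] at h2
      have := hq₁ p.1 h1
      rwa [← h2] at this)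
  have hg := contDiff_smul_of_tsupport_subset hO hχ hχO hZ
  have hgc : HasCompactSupport fun x => χ x • Z x := hχc.smul_right
  obtain ⟨K, hK⟩ := (hg.of_le (m := 1) (by exact_mod_cast le_top)).lipschitzWith_of_hasCompactSupport hgc
    one_ne_zero
  -- Adding time as a coordinate makes the field autonomous, and the compactly supported cutoff
  -- makes it globally Lipschitz. The cutoff is 1 near `[0, 1] × {q₁}`.
  set f : ℝ × V → ℝ × V := fun p => ((1 : ℝ), χ p • Z p) with hf
  have hfL : LipschitzWith (max 0 K) f := (LipschitzWith.const (1 : ℝ)).prodMk hK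
  have hfs : ContDiff ℝ ∞ f := contDiff_const.prodMk hg
  have hf1 : ContDiff ℝ 1 f := hfs.of_le (by exact_mod_cast le_top)
  obtain ⟨Fl, hFl⟩ := exists_isFlow_of_lipschitzWith hfL
  have hFls := hFl.contDiff hfs
  have hd1 : ∀ p t, HasDerivAt (fun s => (Fl s p).1) 1 t := fun p t => by
    simpa using! (ContinuousLinearMap.fst ℝ ℝ V).hasFDerivAt.comp_hasDerivAt t (hFl.deriv p t)
  have hd2 : ∀ p t, HasDerivAt (fun s => (Fl s p).2) (χ (Fl t p) • Z (Fl t p)) t := fun p t => by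
    simpa using! (ContinuousLinearMap.snd ℝ ℝ V).hasFDerivAt.comp_hasDerivAt t (hFl.deriv p t)
  have hfst : ∀ p t, (Fl t p).1 = p.1 + t := by
    intro p t
    have h1 : ∀ s, HasDerivAt (fun s => (Fl s p).1 - s) 0 s := fun s => by
      simpa using! (hd1 p s).sub (hasDerivAt_id s)
    have := is_const_of_deriv_eq_zero (fun s => (h1 s).differentiableAt) (fun s => (h1 s).deriv) t 0
    simp only [hFl.zero, sub_zero] at this
    linarith
  have hFl1 : ∀ t, Fl t (0, q₁) = (t, q₁) := fun t => by
    have := hFl.eq_of_hasDerivAt hf1 (c := fun t => (t, q₁)) (fun t => by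
      simp only [hf, hZ0, smul_zero]
      exact (hasDerivAt_id t).prodMk (hasDerivAt_const t q₁)) t
    exact this.symm
  have hpair : ∀ t q, Fl t (0, q) = (t, (Fl t (0, q)).2) := fun t q =>
    Prod.ext (by simp [hfst]) rfl
  -- The orbit of `q₁` is constant because the field vanishes there; compactness of `[0, 1]` keeps
  -- nearby orbits in the region where the cutoff is 1.
  have hnear : ∀ᶠ q in 𝓝 q₁, ∀ t ∈ Icc (0 : ℝ) 1, Fl t (0, q) ∈ O₁ ∩ O := by
    refine isCompact_Icc.eventually_forall_of_forall_eventually fun t ht => ?_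
    have hcont : Continuous fun z : V × ℝ => Fl z.2 (0, z.1) :=
      hFls.continuous.comp (continuous_snd.prodMk (continuous_const.prodMk continuous_fst))
    refine hcont.continuousAt.eventually ((hO₁.inter hO).mem_nhds ?_)
    simp only [hFl1]
    exact ⟨hKO₁ ⟨ht, rfl⟩, hq₁ t ht⟩
  obtain ⟨N, hN, hNo, hqN⟩ := _root_.eventually_nhds_iff.1 hnear
  -- The inverse of the time-one map flows backward from time 1 to time 0.
  refine ⟨fun t q => (Fl t (0, q)).2, fun q => (Fl (-1) (1, q)).2, N, ?_, ?_, ?_, ?_, ?_, hNo, hqN,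
    fun q hq t ht => ⟨?_, ?_⟩⟩
  · exact contDiff_snd.comp (hFls.comp (contDiff_fst.prodMk (contDiff_const.prodMk contDiff_snd)))
  · exact contDiff_snd.comp (hFls.comp (contDiff_const.prodMk (contDiff_const.prodMk contDiff_id)))
  · intro q
    have := hFl.add hf1 1 (-1) (0, q)
    rw [hpair 1 q, neg_add_cancel, hFl.zero] at this
    exact (congrArg Prod.snd this).symm
  · intro q
    have h2 : Fl (-1) (1, q) = (0, (Fl (-1) (1, q)).2) := Prod.ext (by simp [hfst]) rfl
    have := hFl.add hf1 (-1) 1 (1, q)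
    rw [h2, add_neg_cancel, hFl.zero] at this
    exact (congrArg Prod.snd this).symm
  · intro q; simp [hFl.zero]
  · have := (hN q hq t ht).2
    rwa [hpair] at this
  · have := hd2 (0, q) t
    rw [hχ1 _ (hN q hq t ht).1, one_smul, hpair] at this
    exact this

/-- The variational equation of a time-dependent flow. -/
theorem hasDerivAt_fderiv_flow {Φ : ℝ → V → V} (hΦ : ContDiff ℝ ∞ fun p : ℝ × V => Φ p.1 p.2)
    {Z : V → V} {N : Set V} (hN : IsOpen N) {t : ℝ} {q : V} (hq : q ∈ N)
    (hd : ∀ q ∈ N, HasDerivAt (fun s => Φ s q) (Z (Φ t q)) t)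
    (hZ : DifferentiableAt ℝ Z (Φ t q)) (v : V) :
    HasDerivAt (fun s => fderiv ℝ (Φ s) q v) (fderiv ℝ Z (Φ t q) (fderiv ℝ (Φ t) q v)) t := by
  set F : ℝ × V → V := fun p => Φ p.1 p.2 with hF
  have hF1 : Differentiable ℝ F := hΦ.differentiable (by simp)
  have hF2 : ContDiff ℝ 1 (fderiv ℝ F) := hΦ.fderiv_right (by exact two_le_infty)
  have hF2d : Differentiable ℝ (fderiv ℝ F) := hF2.differentiable one_ne_zero
  have hpart : ∀ s q v, fderiv ℝ (Φ s) q v = fderiv ℝ F (s, q) (0, v) := by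
    intro s q v
    have h1 : HasFDerivAt (fun q : V => ((s, q) : ℝ × V)) (ContinuousLinearMap.inr ℝ ℝ V) q :=
      (hasFDerivAt_const s q).prodMk (hasFDerivAt_id q)
    have h2 := (hF1 (s, q)).hasFDerivAt.comp q h1
    rw [show Φ s = F ∘ fun q => (s, q) from rfl, h2.fderiv]
    simp
  have htime : ∀ q ∈ N, fderiv ℝ F (t, q) (1, 0) = Z (Φ t q) := by
    intro q hq
    have h1 : HasDerivAt (fun s : ℝ => ((s, q) : ℝ × V)) (1, 0) t :=
      (hasDerivAt_id t).prodMk (hasDerivAt_const t q)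
    have h2 := (hF1 (t, q)).hasFDerivAt.comp_hasDerivAt t h1
    exact h2.unique (hd q hq)
  simp only [hpart]
  -- The variational equation is the symmetry of the mixed second derivative of `(t, q) ↦ Φ t q`.
  have hsymm : fderiv ℝ (fderiv ℝ F) (t, q) (1, 0) (0, v) =
      fderiv ℝ (fderiv ℝ F) (t, q) (0, v) (1, 0) :=
    second_derivative_symmetric (f := F) (fun y => (hF1 y).hasFDerivAt) (hF2d (t, q)).hasFDerivAt
      _ _
  have h1 : HasDerivAt (fun s : ℝ => ((s, q) : ℝ × V)) (1, 0) t :=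
    (hasDerivAt_id t).prodMk (hasDerivAt_const t q)
  have h2 := (hF2d (t, q)).hasFDerivAt.comp_hasDerivAt t h1
  have h3 : HasDerivAt (fun s => fderiv ℝ F (s, q) (0, v))
      (fderiv ℝ (fderiv ℝ F) (t, q) (1, 0) (0, v)) t := by
    simpa using! h2.clm_apply (hasDerivAt_const t ((0, v) : ℝ × V))
  convert! h3 using 1
  rw [hsymm]
  have h4 : HasFDerivAt (fun q : V => ((t, q) : ℝ × V)) (ContinuousLinearMap.inr ℝ ℝ V) q :=
    (hasFDerivAt_const t q).prodMk (hasFDerivAt_id q)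
  have h5 : HasFDerivAt (fun q => fderiv ℝ F (t, q) (1, 0))
      ((fderiv ℝ (fderiv ℝ F) (t, q) ∘L ContinuousLinearMap.inr ℝ ℝ V).flip (1, 0)) q := by
    simpa using! ((hF2d (t, q)).hasFDerivAt.comp q h4).clm_apply
      (hasFDerivAt_const ((1, 0) : ℝ × V) q)
  have h6 : HasFDerivAt (fun q => Z (Φ t q)) (fderiv ℝ Z (Φ t q) ∘L fderiv ℝ (Φ t) q) q := by
    have : DifferentiableAt ℝ (Φ t) q := ((hF1 (t, q)).comp q h4.differentiableAt)
    exact hZ.hasFDerivAt.comp q this.hasFDerivAt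
  have h7 := (h5.congr_of_eventuallyEq (f₁ := fun q => Z (Φ t q)) (by
    filter_upwards [hN.mem_nhds hq] with q hq using (htime q hq).symm)).unique h6
  have := congrArg (fun L => L v) h7
  simpa [hpart] using this.symm

end ODE

/-! ### Poisson tensors on a vector space: gauge transformations, Lie derivatives, invariance under
flows. -/

section LocalPoisson

set_option maxSynthPendingDepth 3

variable {V : Type*} [NormedAddCommGroup V] [NormedSpace ℝ V]

/-- The Jacobi identity at `q` of a tensor field on a vector space. -/
def JacobiAt (P : V → (V →L[ℝ] ℝ) →L[ℝ] V) (q : V) : Prop :=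
  ∀ α β γ : V →L[ℝ] ℝ, γ (fderiv ℝ P q (P q α) β) + α (fderiv ℝ P q (P q β) γ)
    + β (fderiv ℝ P q (P q γ) α) = 0

theorem fderiv_antisymm {P : V → (V →L[ℝ] ℝ) →L[ℝ] V} {q : V} (hP : DifferentiableAt ℝ P q)
    (ha : ∀ᶠ y in 𝓝 q, ∀ α β : V →L[ℝ] ℝ, β (P y α) = -α (P y β)) (w : V) (α β : V →L[ℝ] ℝ) :
    β (fderiv ℝ P q w α) = -α (fderiv ℝ P q w β) := by
  have h1 : ∀ α β : V →L[ℝ] ℝ, HasFDerivAt (fun y => β (P y α))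
      (β ∘L (fderiv ℝ P q).flip α) q := fun α β => by
    have := β.hasFDerivAt.comp q (hP.hasFDerivAt.clm_apply (hasFDerivAt_const α q))
    simpa using! this
  have h2 := (h1 α β).congr_of_eventuallyEq (f₁ := fun y => -α (P y β)) (by
    filter_upwards [ha] with y hy using (hy α β).symm)
  have := congrArg (fun L => L w) (h2.unique (h1 β α).neg)
  simpa using this

/-- The exterior derivative of a one-form. -/
def extDerivForm (κ : V → V →L[ℝ] ℝ) (q : V) : V →L[ℝ] V →L[ℝ] ℝ :=
  fderiv ℝ κ q - (fderiv ℝ κ q).flip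

@[simp] theorem extDerivForm_apply (κ : V → V →L[ℝ] ℝ) (q u v : V) :
    extDerivForm κ q u v = fderiv ℝ κ q u v - fderiv ℝ κ q v u := rfl

/-- This is `d² = 0`: in the cyclic sum the six second derivatives of `κ` cancel in pairs by
symmetry. -/
theorem extDerivForm_closed {κ : V → V →L[ℝ] ℝ} {q : V} (hκ : ContDiffAt ℝ ∞ κ q) (u v w : V) :
    fderiv ℝ (extDerivForm κ) q u v w + fderiv ℝ (extDerivForm κ) q v w u
      + fderiv ℝ (extDerivForm κ) q w u v = 0 := by
  have hd : DifferentiableAt ℝ (fderiv ℝ κ) q :=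
    (hκ.fderiv_right (m := 1) two_le_infty).differentiableAt one_ne_zero
  have hs : ∀ a b, fderiv ℝ (fderiv ℝ κ) q a b = fderiv ℝ (fderiv ℝ κ) q b a := by
    have := hκ.isSymmSndFDerivAt (by simpa using two_le_infty)
    exact fun a b => this a b
  have hE : ∀ a b c, fderiv ℝ (extDerivForm κ) q a b c =
      fderiv ℝ (fderiv ℝ κ) q a b c - fderiv ℝ (fderiv ℝ κ) q a c b := by
    intro a b c
    have hκ' : HasFDerivAt (fderiv ℝ κ) (fderiv ℝ (fderiv ℝ κ) q) q := hd.hasFDerivAt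
    have hflip : DifferentiableAt ℝ (fun y => (fderiv ℝ κ y).flip) q :=
      ((ContinuousLinearMap.flipₗᵢ ℝ V V ℝ).toContinuousLinearEquiv.differentiableAt
        (x := fderiv ℝ κ q)).comp q hd
    have hD : DifferentiableAt ℝ (extDerivForm κ) q := hd.sub hflip
    have hev : ∀ {g : V → V →L[ℝ] V →L[ℝ] ℝ}, DifferentiableAt ℝ g q → ∀ b c,
        fderiv ℝ (fun y => g y b c) q a = fderiv ℝ g q a b c := by
      intro g hg b c
      have h1 : HasFDerivAt (fun y => g y b) ((fderiv ℝ g q).flip b) q := by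
        simpa using! hg.hasFDerivAt.clm_apply (hasFDerivAt_const b q)
      have h2 : HasFDerivAt (fun y => g y b c) (((fderiv ℝ g q).flip b).flip c) q := by
        simpa using! h1.clm_apply (hasFDerivAt_const c q)
      rw [h2.fderiv]
      rfl
    have hdd : ∀ b c, DifferentiableAt ℝ (fun y => fderiv ℝ κ y b c) q := fun b c =>
      (hd.clm_apply (differentiableAt_const b)).clm_apply (differentiableAt_const c)
    rw [← hev hD, ← hev hd, ← hev hd, ← sub_apply, ← fderiv_fun_sub (hdd b c) (hdd c b)]
    rfl
  rw [hE, hE, hE, hs u v, hs v w, hs w u]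
  ring

/-- A gauge transformation by a closed form preserves the Jacobi identity. -/
theorem JacobiAt.gauge {P P' : V → (V →L[ℝ] ℝ) →L[ℝ] V} {σ : V → V →L[ℝ] V →L[ℝ] ℝ} {q : V}
    (hP : DifferentiableAt ℝ P q) (hP' : DifferentiableAt ℝ P' q) (hσ : DifferentiableAt ℝ σ q)
    (hrel : ∀ᶠ y in 𝓝 q, ∀ α, P' y (α - σ y (P y α)) = P y α)
    (hsurj : ∀ α' : V →L[ℝ] ℝ, ∃ α, α - σ q (P q α) = α')
    (hanti : ∀ α β : V →L[ℝ] ℝ, β (P' q α) = -α (P' q β))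
    (hσa : ∀ u v, σ q u v = -σ q v u)
    (hclosed : ∀ u v w, fderiv ℝ σ q u v w + fderiv ℝ σ q v w u + fderiv ℝ σ q w u v = 0)
    (hJ : JacobiAt P q) : JacobiAt P' q := by
  -- Obtained by differentiating the relation `P'(α - σ P α) = P α` at a fixed covector `α`.
  have hder : ∀ w α, fderiv ℝ P' q w (α - σ q (P q α)) =
      fderiv ℝ P q w α + P' q (σ q (fderiv ℝ P q w α) + fderiv ℝ σ q w (P q α)) := by
    intro w α
    have h1 : HasFDerivAt (fun y => P y α) ((fderiv ℝ P q).flip α) q := by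
      simpa using! hP.hasFDerivAt.clm_apply (hasFDerivAt_const α q)
    have h2 : HasFDerivAt (fun y => σ y (P y α)) _ q := hσ.hasFDerivAt.clm_apply h1
    have h3 : HasFDerivAt (fun y => P' y (α - σ y (P y α))) _ q :=
      hP'.hasFDerivAt.clm_apply (h2.const_sub α)
    have h4 := (h1.congr_of_eventuallyEq (by filter_upwards [hrel] with y hy using hy α)).unique h3
    have h5 := congrArg (fun L => L w) h4
    simp only [ContinuousLinearMap.flip_apply, add_apply,
      ContinuousLinearMap.comp_apply, neg_apply] at h5
    rw [map_neg, neg_add_eq_sub, eq_sub_iff_add_eq] at h5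
    exact h5.symm
  have hq := hrel.self_of_nhds
  intro α' β' γ'
  obtain ⟨α, rfl⟩ := hsurj α'
  obtain ⟨β, rfl⟩ := hsurj β'
  obtain ⟨γ, rfl⟩ := hsurj γ'
  -- On transformed covectors each term of the Jacobi identity of `P'` is the corresponding term for
  -- `P` minus a derivative of `σ` on Hamiltonian vectors. The cyclic sum of the latter vanishes
  -- since `σ` is closed.
  have hterm : ∀ α β γ : V →L[ℝ] ℝ, (γ - σ q (P q γ)) (fderiv ℝ P' q (P' q (α - σ q (P q α)))
      (β - σ q (P q β))) = γ (fderiv ℝ P q (P q α) β) - fderiv ℝ σ q (P q α) (P q β) (P q γ) := by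
    intro α β γ
    rw [hder, hq, map_add, hanti, hq]
    simp only [sub_apply, add_apply]
    rw [hσa (P q γ)]
    ring
  rw [hterm, hterm, hterm]
  linarith [hJ α β γ, hclosed (P q α) (P q β) (P q γ)]

/-- The Lie derivative of a Poisson tensor along the field `-P κ`. -/
theorem JacobiAt.fderiv_neg_apply {P : V → (V →L[ℝ] ℝ) →L[ℝ] V} {κ : V → V →L[ℝ] ℝ} {q : V}
    (hP : DifferentiableAt ℝ P q) (hκ : DifferentiableAt ℝ κ q)
    (ha : ∀ᶠ y in 𝓝 q, ∀ α β : V →L[ℝ] ℝ, β (P y α) = -α (P y β)) (hJ : JacobiAt P q)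
    (hsep : ∀ v w : V, (∀ β : V →L[ℝ] ℝ, β v = β w) → v = w) (α : V →L[ℝ] ℝ) :
    fderiv ℝ P q (-P q (κ q)) α = fderiv ℝ (fun y => -P y (κ y)) q (P q α)
      + P q (α ∘L fderiv ℝ (fun y => -P y (κ y)) q) + P q (extDerivForm κ q (P q α)) := by
  have hD : HasFDerivAt (fun y => -P y (κ y)) (-((P q ∘L fderiv ℝ κ q) +
      (fderiv ℝ P q).flip (κ q))) q :=
    (hP.hasFDerivAt.clm_apply hκ.hasFDerivAt).neg
  have haq := ha.self_of_nhds
  have hda := fderiv_antisymm hP ha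
  refine hsep _ _ fun β => ?_
  rw [hD.fderiv, map_add, map_add, haq (α ∘L _) β, haq (extDerivForm κ q (P q α)) β]
  simp only [map_neg, neg_apply, add_apply,
    ContinuousLinearMap.comp_apply, ContinuousLinearMap.flip_apply, map_add,
    extDerivForm_apply]
  -- With `κ` as one of the three covectors, the Jacobi identity expresses the derivative of `P`
  -- along `P κ` by the terms on the right; what remains is the exterior derivative of `κ`.
  have h1 := hJ (κ q) α β
  have h2 := hda (P q α) (κ q) β
  have h3 := hda (P q β) (κ q) α
  have h4 := haq (fderiv ℝ κ q (P q α)) β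
  have h5 := haq (fderiv ℝ κ q (P q β)) α
  have h6 := hda (P q α) β (κ q)
  linarith

/-- The equation `Y' = D Y + Y T` is linear in `Y`, in the space of operators. -/
theorem eq_of_conj_ode {X : Type*} [NormedAddCommGroup X] [NormedSpace ℝ X]
    {D : ℝ → V →L[ℝ] V} {T : ℝ → X →L[ℝ] X} (hD : ContinuousOn D (Icc 0 1))
    (hT : ContinuousOn T (Icc 0 1)) {Y₁ Y₂ : ℝ → X →L[ℝ] V}
    (h₁ : ∀ t ∈ Icc (0 : ℝ) 1, HasDerivWithinAt Y₁ (D t ∘L Y₁ t + Y₁ t ∘L T t) (Icc 0 1) t)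
    (h₂ : ∀ t ∈ Icc (0 : ℝ) 1, HasDerivWithinAt Y₂ (D t ∘L Y₂ t + Y₂ t ∘L T t) (Icc 0 1) t)
    (h0 : Y₁ 0 = Y₂ 0) : EqOn Y₁ Y₂ (Icc 0 1) := by
  refine eqOn_of_linear_ode (A := fun t => ContinuousLinearMap.compL ℝ X V V (D t) +
    (ContinuousLinearMap.compL ℝ X X V).flip (T t)) ?_ h₁ h₂ h0
  exact ((ContinuousLinearMap.continuous _).comp_continuousOn hD).add
    ((ContinuousLinearMap.continuous _).comp_continuousOn hT)

/-- A time-dependent tensor field whose Lie derivative along a time-dependent vector field is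
compensated by its time derivative is preserved by the flow. -/
theorem tensor_preserved_of_flow [FiniteDimensional ℝ V] {O : Set (ℝ × V)} (hO : IsOpen O)
    {Z : ℝ × V → V} (hZ : ContDiffOn ℝ ∞ Z O) {P : ℝ × V → (V →L[ℝ] ℝ) →L[ℝ] V}
    (hP : ContDiffOn ℝ ∞ P O)
    (hLie : ∀ p ∈ O, ∀ α, fderiv ℝ P p (1, Z p) α =
      fderiv ℝ (fun y => Z (p.1, y)) p.2 (P p α) + P p (α ∘L fderiv ℝ (fun y => Z (p.1, y)) p.2))
    {Φ : ℝ → V → V} (hΦ : ContDiff ℝ ∞ fun p : ℝ × V => Φ p.1 p.2) (h0 : ∀ q, Φ 0 q = q)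
    {N : Set V} (hN : IsOpen N)
    (hd : ∀ q ∈ N, ∀ t ∈ Icc (0 : ℝ) 1, (t, Φ t q) ∈ O ∧
      HasDerivAt (fun s => Φ s q) (Z (t, Φ t q)) t) {q : V} (hq : q ∈ N) (α : V →L[ℝ] ℝ) :
    P (1, Φ 1 q) α = fderiv ℝ (Φ 1) q (P (0, q) (α ∘L fderiv ℝ (Φ 1) q)) := by
  set D : ℝ → V →L[ℝ] V := fun t => fderiv ℝ (fun y => Z (t, y)) (Φ t q) with hD
  set T : (V →L[ℝ] V) →L[ℝ] (V →L[ℝ] ℝ) →L[ℝ] (V →L[ℝ] ℝ) :=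
    (ContinuousLinearMap.compL ℝ V V ℝ).flip with hT
  have hcurve : ∀ t ∈ Icc (0 : ℝ) 1, HasDerivAt (fun s => (s, Φ s q)) (1, Z (t, Φ t q)) t :=
    fun t ht => (hasDerivAt_id t).prodMk (hd q hq t ht).2
  have hZd : ∀ p ∈ O, DifferentiableAt ℝ Z p := fun p hp =>
    (hZ.contDiffAt (hO.mem_nhds hp)).differentiableAt (by simp)
  have hinr : ∀ (t : ℝ) (y : V), HasFDerivAt (fun y : V => ((t, y) : ℝ × V))
      (ContinuousLinearMap.inr ℝ ℝ V) y := fun t y =>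
    (hasFDerivAt_const t y).prodMk (hasFDerivAt_id y)
  have hDeq : ∀ t ∈ Icc (0 : ℝ) 1,
      D t = fderiv ℝ Z (t, Φ t q) ∘L ContinuousLinearMap.inr ℝ ℝ V := fun t ht =>
    ((hZd _ (hd q hq t ht).1).hasFDerivAt.comp (Φ t q) (hinr t _)).fderiv
  have hDc : ContinuousOn D (Icc 0 1) := by
    refine ContinuousOn.congr ?_ hDeq
    have h1 : ContinuousOn (fderiv ℝ Z) O := hZ.continuousOn_fderiv_of_isOpen hO (by simp)
    exact (h1.comp (fun t ht => (hcurve t ht).continuousAt.continuousWithinAt)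
      (fun t ht => (hd q hq t ht).1)).clm_comp continuousOn_const
  have hJ : ∀ t ∈ Icc (0 : ℝ) 1, HasDerivAt (fun s => fderiv ℝ (Φ s) q)
      (D t ∘L fderiv ℝ (Φ t) q) t := by
    intro t ht
    have hpt := fun v => hasDerivAt_fderiv_flow hΦ (Z := fun y => Z (t, y)) hN hq
      (fun q hq => (hd q hq t ht).2) ((hZd _ (hd q hq t ht).1).comp _ (hinr t _).differentiableAt) v
    have hdiff : DifferentiableAt ℝ (fun s => fderiv ℝ (Φ s) q) t := by
      have : ContDiff ℝ ∞ (fun s => fderiv ℝ (Φ s) q) :=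
        ContDiff.fderiv (n := ∞) (m := ∞) (f := Φ) (g := fun _ => q) hΦ contDiff_const (by simp)
      exact this.differentiable (by simp) t
    have : deriv (fun s => fderiv ℝ (Φ s) q) t = D t ∘L fderiv ℝ (Φ t) q := by
      ext v
      have h1 := hdiff.hasDerivAt.clm_apply (hasDerivAt_const t v)
      have h2 := h1.unique (hpt v)
      simpa using h2
    rw [← this]
    exact hdiff.hasDerivAt
  have hTc : ContinuousOn (fun t => T (D t)) (Icc 0 1) := T.continuous.comp_continuousOn hDc
  -- The hypothesis on the Lie derivative is exactly the equation for the total time derivative of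
  -- `P` along a flow line.
  have hY : ∀ t ∈ Icc (0 : ℝ) 1, HasDerivAt (fun s => P (s, Φ s q))
      (D t ∘L P (t, Φ t q) + P (t, Φ t q) ∘L T (D t)) t := by
    intro t ht
    have hp := (hd q hq t ht).1
    have hPd := (hP.contDiffAt (hO.mem_nhds hp)).differentiableAt (by simp)
    have h1 := hPd.hasFDerivAt.comp_hasDerivAt t (hcurve t ht)
    have h2 : fderiv ℝ P (t, Φ t q) (1, Z (t, Φ t q)) =
        D t ∘L P (t, Φ t q) + P (t, Φ t q) ∘L T (D t) := by
      ext1 α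
      rw [hLie _ hp]
      rfl
    rw [h2] at h1
    exact h1
  have hX : ∀ t ∈ Icc (0 : ℝ) 1, HasDerivAt
      (fun s => fderiv ℝ (Φ s) q ∘L P (0, q) ∘L T (fderiv ℝ (Φ s) q))
      (D t ∘L (fderiv ℝ (Φ t) q ∘L P (0, q) ∘L T (fderiv ℝ (Φ t) q)) +
        (fderiv ℝ (Φ t) q ∘L P (0, q) ∘L T (fderiv ℝ (Φ t) q)) ∘L T (D t)) t := by
    intro t ht
    have h0 := T.hasFDerivAt.comp_hasDerivAt t (hJ t ht)
    have h1 := (hasDerivAt_const t (P (0, q))).clm_comp h0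
    have h2 := (hJ t ht).clm_comp h1
    have h3 : (D t ∘L fderiv ℝ (Φ t) q) ∘L (P (0, q) ∘L T (fderiv ℝ (Φ t) q)) +
        fderiv ℝ (Φ t) q ∘L ((0 : (V →L[ℝ] ℝ) →L[ℝ] V) ∘L T (fderiv ℝ (Φ t) q) +
          P (0, q) ∘L T (D t ∘L fderiv ℝ (Φ t) q)) =
        (D t ∘L (fderiv ℝ (Φ t) q ∘L P (0, q) ∘L T (fderiv ℝ (Φ t) q)) +
        (fderiv ℝ (Φ t) q ∘L P (0, q) ∘L T (fderiv ℝ (Φ t) q)) ∘L T (D t)) := by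
      ext1 α
      simp [hT]
      rfl
    rw [← h3]
    exact h2
  -- The tensor along the flow line and the push-forward of its initial value solve the same linear
  -- equation, and they agree at time 0 since `Φ 0` is the identity.
  have key := eq_of_conj_ode hDc hTc (fun t ht => (hY t ht).hasDerivWithinAt)
    (fun t ht => (hX t ht).hasDerivWithinAt) (by
      have hid : fderiv ℝ (Φ 0) q = ContinuousLinearMap.id ℝ V := by
        rw [show Φ 0 = id from funext h0]; exact fderiv_id
      simp only [hid, h0]
      ext1 α
      simp [hT]) (show (1 : ℝ) ∈ Icc 0 1 from ⟨zero_le_one, le_rfl⟩)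
  have := congrArg (fun L => L α) key
  exact this

end LocalPoisson

/-! ### The flat model in a flat chart and its gauge transformation. -/

section LocalModel

set_option maxSynthPendingDepth 3

open ContinuousLinearMap

variable {EB F : Type*} [NormedAddCommGroup EB] [NormedSpace ℝ EB]
  [NormedAddCommGroup F] [NormedSpace ℝ F]

/-- The flat model in a flat chart: the product of a Poisson tensor on the base and a linear
Poisson tensor on the fibre. -/
def localFlat (S : EB → (EB →L[ℝ] ℝ) →L[ℝ] EB) (Λ : F →L[ℝ] (F →L[ℝ] ℝ) →L[ℝ] F) (q : EB × F) :
    (EB × F →L[ℝ] ℝ) →L[ℝ] EB × F :=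
  inl ℝ EB F ∘L S q.1 ∘L precomp ℝ (inl ℝ EB F) + inr ℝ EB F ∘L Λ q.2 ∘L precomp ℝ (inr ℝ EB F)

@[simp] theorem localFlat_apply (S : EB → (EB →L[ℝ] ℝ) →L[ℝ] EB)
    (Λ : F →L[ℝ] (F →L[ℝ] ℝ) →L[ℝ] F) (q : EB × F) (c : EB × F →L[ℝ] ℝ) :
    localFlat S Λ q c = (S q.1 (c ∘L inl ℝ EB F), Λ q.2 (c ∘L inr ℝ EB F)) := by
  simp [localFlat]

/-- The one-form `⟨μ, x⟩`, whose differential is the gauge transformation. -/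
def gaugeForm (μ : EB → EB →L[ℝ] F →L[ℝ] ℝ) (q : EB × F) : EB × F →L[ℝ] ℝ :=
  (μ q.1).flip q.2 ∘L fst ℝ EB F

@[simp] theorem gaugeForm_apply (μ : EB → EB →L[ℝ] F →L[ℝ] ℝ) (q v : EB × F) :
    gaugeForm μ q v = μ q.1 v.1 q.2 := rfl

/-- The form `[μ(u), μ(v)](x)`. -/
def muBracket (Λ : F →L[ℝ] (F →L[ℝ] ℝ) →L[ℝ] F) (μ : EB →L[ℝ] F →L[ℝ] ℝ) (x : F) :
    EB →L[ℝ] EB →L[ℝ] ℝ :=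
  μ.flip ∘L Λ x ∘L μ

@[simp] theorem muBracket_apply (Λ : F →L[ℝ] (F →L[ℝ] ℝ) →L[ℝ] F) (μ : EB →L[ℝ] F →L[ℝ] ℝ)
    (x : F) (u v : EB) : muBracket Λ μ x u v = μ v (Λ x (μ u)) := rfl

/-- The horizontal lift `(u, -t Λ_x μ(u))`. -/
def localHor (Λ : F →L[ℝ] (F →L[ℝ] ℝ) →L[ℝ] F) (μ : EB → EB →L[ℝ] F →L[ℝ] ℝ) (t : ℝ)
    (q : EB × F) : EB →L[ℝ] EB × F :=
  inl ℝ EB F - t • (inr ℝ EB F ∘L Λ q.2 ∘L μ q.1)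

@[simp] theorem localHor_apply (Λ : F →L[ℝ] (F →L[ℝ] ℝ) →L[ℝ] F) (μ : EB → EB →L[ℝ] F →L[ℝ] ℝ)
    (t : ℝ) (q : EB × F) (u : EB) : localHor Λ μ t q u = (u, -(t • Λ q.2 (μ q.1 u))) := by
  simp [localHor]

/-- The differential of the `F^*`-valued one-form `μ`, evaluated at `x`. -/
def muDiff (μ : EB → EB →L[ℝ] F →L[ℝ] ℝ) (q : EB × F) : EB →L[ℝ] EB →L[ℝ] ℝ :=
  compL ℝ EB (F →L[ℝ] ℝ) ℝ (apply ℝ ℝ q.2) ∘L fderiv ℝ μ q.1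
    - (compL ℝ EB (F →L[ℝ] ℝ) ℝ (apply ℝ ℝ q.2) ∘L fderiv ℝ μ q.1).flip

@[simp] theorem muDiff_apply (μ : EB → EB →L[ℝ] F →L[ℝ] ℝ) (q : EB × F) (u v : EB) :
    muDiff μ q u v = fderiv ℝ μ q.1 u v q.2 - fderiv ℝ μ q.1 v u q.2 := rfl

/-- The coupling form of the gauge transformed model. -/
def localCoupling (S : EB → (EB →L[ℝ] ℝ) →L[ℝ] EB) (Λ : F →L[ℝ] (F →L[ℝ] ℝ) →L[ℝ] F)
    (μ : EB → EB →L[ℝ] F →L[ℝ] ℝ) (t : ℝ) (q : EB × F) : EB →L[ℝ] EB →L[ℝ] ℝ :=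
  -(S q.1).inverse + t • muDiff μ q - t ^ 2 • muBracket Λ (μ q.1) q.2

/-- The gauge transformed model. -/
def localLin (S : EB → (EB →L[ℝ] ℝ) →L[ℝ] EB) (Λ : F →L[ℝ] (F →L[ℝ] ℝ) →L[ℝ] F)
    (μ : EB → EB →L[ℝ] F →L[ℝ] ℝ) (t : ℝ) (q : EB × F) : (EB × F →L[ℝ] ℝ) →L[ℝ] EB × F :=
  -(localHor Λ μ t q ∘L (localCoupling S Λ μ t q).inverse ∘L precomp ℝ (localHor Λ μ t q))
    + inr ℝ EB F ∘L Λ q.2 ∘L precomp ℝ (inr ℝ EB F)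

/-- The time-dependent field whose flow trivializes the gauge transformation. -/
def localField (S : EB → (EB →L[ℝ] ℝ) →L[ℝ] EB) (Λ : F →L[ℝ] (F →L[ℝ] ℝ) →L[ℝ] F)
    (μ : EB → EB →L[ℝ] F →L[ℝ] ℝ) (p : ℝ × EB × F) : EB × F :=
  localHor Λ μ (1 - p.1) p.2
    ((localCoupling S Λ μ (1 - p.1) p.2).inverse ((μ p.2.1).flip p.2.2))

/-- The data of a gauge transformation of a flat model over an open set of a vector space. -/
structure LocalModelData (U : Set EB) (S : EB → (EB →L[ℝ] ℝ) →L[ℝ] EB)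
    (Λ : F →L[ℝ] (F →L[ℝ] ℝ) →L[ℝ] F) (μ : EB → EB →L[ℝ] F →L[ℝ] ℝ) : Prop where
  isOpen : IsOpen U
  base_smooth : ContDiffOn ℝ ∞ S U
  base_inv : ∀ ξ ∈ U, (S ξ).IsInvertible
  base_antisymm : ∀ ξ ∈ U, ∀ a c : EB →L[ℝ] ℝ, c (S ξ a) = -a (S ξ c)
  base_jacobi : ∀ ξ ∈ U, JacobiAt S ξ
  fib_antisymm : ∀ x, ∀ α β : F →L[ℝ] ℝ, β (Λ x α) = -α (Λ x β)
  fib_jacobi : ∀ x, ∀ α β γ : F →L[ℝ] ℝ,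
    γ (Λ (Λ x α) β) + α (Λ (Λ x β) γ) + β (Λ (Λ x γ) α) = 0
  form_smooth : ContDiffOn ℝ ∞ μ U

variable {U : Set EB} {S : EB → (EB →L[ℝ] ℝ) →L[ℝ] EB} {Λ : F →L[ℝ] (F →L[ℝ] ℝ) →L[ℝ] F}
  {μ : EB → EB →L[ℝ] F →L[ℝ] ℝ}

theorem fderiv_gaugeForm {q : EB × F} (hμ : DifferentiableAt ℝ μ q.1) (w v : EB × F) :
    fderiv ℝ (gaugeForm μ) q w v = fderiv ℝ μ q.1 w.1 v.1 q.2 + μ q.1 v.1 w.2 := by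
  have h0 : HasFDerivAt (fun q : EB × F => μ q.1) (fderiv ℝ μ q.1 ∘L fst ℝ EB F) q :=
    hμ.hasFDerivAt.comp q hasFDerivAt_fst
  have hd : DifferentiableAt ℝ (gaugeForm μ) q := by
    have h1 := ((flipₗᵢ ℝ EB F ℝ).toContinuousLinearEquiv.differentiableAt (x := μ q.1)).comp q
      h0.differentiableAt
    exact (h1.clm_apply differentiableAt_snd).clm_comp (differentiableAt_const _)
  have h1 : HasFDerivAt (fun q => gaugeForm μ q v) ((fderiv ℝ (gaugeForm μ) q).flip v) q := by
    simpa using! hd.hasFDerivAt.clm_apply (hasFDerivAt_const v q)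
  have h2 : HasFDerivAt (fun q : EB × F => μ q.1 v.1) _ q :=
    h0.clm_apply (hasFDerivAt_const v.1 q)
  have h3 : HasFDerivAt (fun q : EB × F => μ q.1 v.1 q.2) _ q := h2.clm_apply hasFDerivAt_snd
  have := congrArg (fun L => L w) (h1.unique h3)
  simp only [flip_apply] at this
  rw [this]
  simp
  ring

/-- Write `u` for the base component of the image of `c` under the flat tensor. The transformed
covector restricts to the fibre as `α + t μ(u)` and to horizontal lifts as minus the coupling form
at `u`. So the horizontal part returns the lift `(u, -t Λ μ(u))`, whose vertical component cancels
against the extra `t Λ μ(u)` from the fibre. The quadratic term of `localCoupling` is what makes the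
second restriction come out. -/
theorem LocalModelData.gauge_relation (h : LocalModelData U S Λ μ) {q : EB × F} (hq : q.1 ∈ U)
    {t : ℝ} (hF : (localCoupling S Λ μ t q).IsInvertible) (c : EB × F →L[ℝ] ℝ) :
    localLin S Λ μ t q (c - t • extDerivForm (gaugeForm μ) q (localFlat S Λ q c)) =
      localFlat S Λ q c := by
  have hμ : DifferentiableAt ℝ μ q.1 :=
    (h.form_smooth.contDiffAt (h.isOpen.mem_nhds hq)).differentiableAt (by simp)
  set a := c ∘L inl ℝ EB F with ha
  set α := c ∘L inr ℝ EB F with hα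
  set u := S q.1 a with hu
  have hSu : (S q.1).inverse u = a := by
    obtain ⟨e, he⟩ := h.base_inv _ hq
    rw [hu, ← he, inverse_equiv]; simp
  set c' := c - t • extDerivForm (gaugeForm μ) q (localFlat S Λ q c) with hc'
  have hσ : ∀ v : EB × F, extDerivForm (gaugeForm μ) q (localFlat S Λ q c) v =
      fderiv ℝ μ q.1 u v.1 q.2 - fderiv ℝ μ q.1 v.1 u q.2 + μ q.1 v.1 (Λ q.2 α) - μ q.1 u v.2 := by
    intro v
    rw [extDerivForm_apply, fderiv_gaugeForm hμ, fderiv_gaugeForm hμ]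
    simp only [localFlat_apply]
    ring
  have hinr : c' ∘L inr ℝ EB F = α + t • μ q.1 u := by
    ext y
    simp only [hc', comp_apply, sub_apply, smul_apply, hσ, inr_apply, map_zero, zero_apply,
      add_apply, hα, smul_eq_mul]
    simp
  have hcv : ∀ v : EB, c (v, 0) = (S q.1).inverse u v := fun v => by rw [hSu]; rfl
  have hcy : ∀ y : F, c (0, y) = α y := fun y => rfl
  have hhor : c' ∘L localHor Λ μ t q = -localCoupling S Λ μ t q u := by
    ext v
    have e1 : c (localHor Λ μ t q v) = (S q.1).inverse u v - t * α (Λ q.2 (μ q.1 v)) := by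
      rw [localHor_apply, show ((v, -(t • Λ q.2 (μ q.1 v))) : EB × F) =
        (v, 0) - t • (0, Λ q.2 (μ q.1 v)) by ext <;> simp, map_sub, map_smul, hcv, hcy, smul_eq_mul]
    have e2 := h.fib_antisymm q.2 α (μ q.1 v)
    simp only [hc', comp_apply, sub_apply, smul_apply, hσ, e1]
    simp only [localCoupling, add_apply, sub_apply, neg_apply, smul_apply, muDiff_apply,
      muBracket_apply, localHor_apply, smul_eq_mul, map_neg, map_smul, e2]
    have e3 := h.fib_antisymm q.2 (μ q.1 v) (μ q.1 u)
    rw [e3]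
    ring
  have : localLin S Λ μ t q c' = -(localHor Λ μ t q ((localCoupling S Λ μ t q).inverse
      (c' ∘L localHor Λ μ t q))) + (0, Λ q.2 (c' ∘L inr ℝ EB F)) := by
    simp [localLin]
  rw [this, hhor, hinr]
  obtain ⟨e, he⟩ := hF
  rw [← he, inverse_equiv]
  simp [← ha, ← hα, ← hu]

theorem LocalModelData.localFlat_antisymm (h : LocalModelData U S Λ μ) {q : EB × F} (hq : q.1 ∈ U)
    (α β : EB × F →L[ℝ] ℝ) : β (localFlat S Λ q α) = -α (localFlat S Λ q β) := by
  have hsplit : ∀ (c : EB × F →L[ℝ] ℝ) (v : EB × F),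
      c v = (c ∘L inl ℝ EB F) v.1 + (c ∘L inr ℝ EB F) v.2 := fun c v => by
    simp [← map_add]
  rw [hsplit β, hsplit α, localFlat_apply, localFlat_apply, h.base_antisymm _ hq,
    h.fib_antisymm]
  ring

theorem LocalModelData.contDiffOn_localFlat (h : LocalModelData U S Λ μ) :
    ContDiffOn ℝ ∞ (localFlat S Λ) (U ×ˢ univ) := by
  have h1 : ContDiffOn ℝ ∞ (fun q : EB × F => S q.1) (U ×ˢ univ) :=
    h.base_smooth.comp contDiff_fst.contDiffOn (fun q hq => hq.1)
  have h2 : ContDiffOn ℝ ∞ (fun q : EB × F => Λ q.2) (U ×ˢ univ) :=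
    (Λ.contDiff.comp contDiff_snd).contDiffOn
  exact (contDiffOn_const.clm_comp (h1.clm_comp contDiffOn_const)).add
    (contDiffOn_const.clm_comp (h2.clm_comp contDiffOn_const))

theorem LocalModelData.jacobiAt_localFlat (h : LocalModelData U S Λ μ) {q : EB × F}
    (hq : q.1 ∈ U) : JacobiAt (localFlat S Λ) q := by
  have hS : DifferentiableAt ℝ S q.1 :=
    (h.base_smooth.contDiffAt (h.isOpen.mem_nhds hq)).differentiableAt (by simp)
  have hd : DifferentiableAt ℝ (localFlat S Λ) q :=
    (h.contDiffOn_localFlat.contDiffAt ((h.isOpen.prod isOpen_univ).mem_nhds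
      ⟨hq, trivial⟩)).differentiableAt (by simp)
  have hder : ∀ (w : EB × F) (c : EB × F →L[ℝ] ℝ), fderiv ℝ (localFlat S Λ) q w c =
      (fderiv ℝ S q.1 w.1 (c ∘L inl ℝ EB F), Λ w.2 (c ∘L inr ℝ EB F)) := by
    intro w c
    have h1 : HasFDerivAt (fun q => localFlat S Λ q c) ((fderiv ℝ (localFlat S Λ) q).flip c) q := by
      simpa using! hd.hasFDerivAt.clm_apply (hasFDerivAt_const c q)
    have h0 : HasFDerivAt (fun q : EB × F => S q.1) (fderiv ℝ S q.1 ∘L fst ℝ EB F) q :=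
      hS.hasFDerivAt.comp q hasFDerivAt_fst
    have h0' : HasFDerivAt (fun q : EB × F => Λ q.2) (Λ ∘L snd ℝ EB F) q :=
      Λ.hasFDerivAt.comp q hasFDerivAt_snd
    have h2 : HasFDerivAt (fun q : EB × F =>
        (S q.1 (c ∘L inl ℝ EB F), Λ q.2 (c ∘L inr ℝ EB F))) _ q :=
      (h0.clm_apply (hasFDerivAt_const (c ∘L inl ℝ EB F) q)).prodMk
        (h0'.clm_apply (hasFDerivAt_const (c ∘L inr ℝ EB F) q))
    have h3 := congrArg (fun L => L w) ((h1.congr_of_eventuallyEq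
      (f₁ := fun q : EB × F => (S q.1 (c ∘L inl ℝ EB F), Λ q.2 (c ∘L inr ℝ EB F)))
      (Filter.Eventually.of_forall fun y => (localFlat_apply S Λ y c).symm)).unique h2)
    simp only [flip_apply] at h3
    rw [h3]
    simp
  intro α β γ
  have hsplit : ∀ (c : EB × F →L[ℝ] ℝ) (v : EB × F),
      c v = (c ∘L inl ℝ EB F) v.1 + (c ∘L inr ℝ EB F) v.2 := fun c v => by
    simp [← map_add]
  rw [hder, hder, hder, hsplit γ, hsplit α, hsplit β]
  simp only [localFlat_apply]
  have h1 := h.base_jacobi _ hq (α ∘L inl ℝ EB F) (β ∘L inl ℝ EB F) (γ ∘L inl ℝ EB F)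
  have h2 := h.fib_jacobi q.2 (α ∘L inr ℝ EB F) (β ∘L inr ℝ EB F) (γ ∘L inr ℝ EB F)
  linarith

end LocalModel

/-! ### Moser's method for the path of gauge transformed models. -/

section LocalModel

set_option maxSynthPendingDepth 3

open ContinuousLinearMap

variable {EB F : Type*} [NormedAddCommGroup EB] [NormedSpace ℝ EB]
  [NormedAddCommGroup F] [NormedSpace ℝ F]
  {U : Set EB} {S : EB → (EB →L[ℝ] ℝ) →L[ℝ] EB} {Λ : F →L[ℝ] (F →L[ℝ] ℝ) →L[ℝ] F}
  {μ : EB → EB →L[ℝ] F →L[ℝ] ℝ}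

theorem contDiffAt_inverse {X Y Z : Type*} [NormedAddCommGroup X] [NormedSpace ℝ X]
    [NormedAddCommGroup Y] [NormedSpace ℝ Y] [CompleteSpace Y] [NormedAddCommGroup Z]
    [NormedSpace ℝ Z] {f : X → Y →L[ℝ] Z} {x : X} (hf : ContDiffAt ℝ ∞ f x)
    (hx : (f x).IsInvertible) : ContDiffAt ℝ ∞ (fun y => (f y).inverse) x := by
  obtain ⟨e, he⟩ := hx
  have h1 := contDiffAt_map_inverse (n := ∞) e
  rw [he] at h1
  exact h1.comp x hf

theorem contDiffAt_flip {X Y Z W : Type*} [NormedAddCommGroup X] [NormedSpace ℝ X]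
    [NormedAddCommGroup Y] [NormedSpace ℝ Y] [NormedAddCommGroup Z]
    [NormedSpace ℝ Z] [NormedAddCommGroup W] [NormedSpace ℝ W] {f : X → Y →L[ℝ] Z →L[ℝ] W} {x : X}
    (hf : ContDiffAt ℝ ∞ f x) : ContDiffAt ℝ ∞ (fun y => (f y).flip) x := by
  have h1 := ((flipₗᵢ ℝ Y Z W).toContinuousLinearEquiv.contDiff (n := ∞)).contDiffAt.comp x hf
  exact h1

theorem isOpen_setOf_isInvertible {Y Z : Type*} [NormedAddCommGroup Y] [NormedSpace ℝ Y]
    [CompleteSpace Y] [NormedAddCommGroup Z] [NormedSpace ℝ Z] :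
    IsOpen {L : Y →L[ℝ] Z | L.IsInvertible} := by
  convert! ContinuousLinearEquiv.isOpen (𝕜 := ℝ) (E := Y) (F := Z) using 1

theorem LocalModelData.contDiffAt_gaugeForm (h : LocalModelData U S Λ μ) {q : EB × F}
    (hq : q.1 ∈ U) : ContDiffAt ℝ ∞ (gaugeForm μ) q := by
  have h0 : ContDiffAt ℝ ∞ (fun q : EB × F => μ q.1) q :=
    (h.form_smooth.contDiffAt (h.isOpen.mem_nhds hq)).comp q contDiffAt_fst
  exact ((contDiffAt_flip h0).clm_apply contDiffAt_snd).clm_comp contDiffAt_const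

theorem LocalModelData.contDiffAt_localHor (h : LocalModelData U S Λ μ) {p : ℝ × EB × F}
    (hq : p.2.1 ∈ U) : ContDiffAt ℝ ∞ (fun p : ℝ × EB × F => localHor Λ μ (1 - p.1) p.2) p := by
  have h0 : ContDiffAt ℝ ∞ (fun p : ℝ × EB × F => μ p.2.1) p :=
    (h.form_smooth.contDiffAt (h.isOpen.mem_nhds hq)).comp p
      (contDiffAt_fst.comp p contDiffAt_snd)
  have h1 : ContDiffAt ℝ ∞ (fun p : ℝ × EB × F => Λ p.2.2) p :=
    Λ.contDiff.contDiffAt.comp p (contDiffAt_snd.comp p contDiffAt_snd)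
  exact contDiffAt_const.sub ((contDiffAt_const.sub contDiffAt_fst).smul
    (contDiffAt_const.clm_comp (h1.clm_comp h0)))

theorem LocalModelData.contDiffAt_localCoupling [CompleteSpace EB] (h : LocalModelData U S Λ μ)
    {p : ℝ × EB × F} (hq : p.2.1 ∈ U) :
    ContDiffAt ℝ ∞ (fun p : ℝ × EB × F => localCoupling S Λ μ (1 - p.1) p.2) p := by
  have hc : ContDiffAt ℝ ∞ (fun p : ℝ × EB × F => p.2.1) p := contDiffAt_fst.comp p contDiffAt_snd
  have hx : ContDiffAt ℝ ∞ (fun p : ℝ × EB × F => p.2.2) p := contDiffAt_snd.comp p contDiffAt_snd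
  have ht : ContDiffAt ℝ ∞ (fun p : ℝ × EB × F => 1 - p.1) p := contDiffAt_const.sub contDiffAt_fst
  have hμ := h.form_smooth.contDiffAt (h.isOpen.mem_nhds hq)
  have h0 : ContDiffAt ℝ ∞ (fun p : ℝ × EB × F => μ p.2.1) p := hμ.comp p hc
  have hdμ : ContDiffAt ℝ ∞ (fun p : ℝ × EB × F => fderiv ℝ μ p.2.1) p :=
    (hμ.fderiv_right (m := ∞) (by simp)).comp p hc
  have h1 : ContDiffAt ℝ ∞ (fun p : ℝ × EB × F => Λ p.2.2) p := Λ.contDiff.contDiffAt.comp p hx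
  have hS : ContDiffAt ℝ ∞ (fun p : ℝ × EB × F => (S p.2.1).inverse) p := by
    refine contDiffAt_inverse ?_ (h.base_inv _ hq)
    exact (h.base_smooth.contDiffAt (h.isOpen.mem_nhds hq)).comp p hc
  have hD : ContDiffAt ℝ ∞ (fun p : ℝ × EB × F =>
      compL ℝ EB (F →L[ℝ] ℝ) ℝ (apply ℝ ℝ p.2.2) ∘L fderiv ℝ μ p.2.1) p := by
    refine ContDiffAt.clm_comp ?_ hdμ
    exact (compL ℝ EB (F →L[ℝ] ℝ) ℝ).contDiff.contDiffAt.comp p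
      ((apply ℝ ℝ : F →L[ℝ] (F →L[ℝ] ℝ) →L[ℝ] ℝ).contDiff.contDiffAt.comp p hx)
  exact (hS.neg.add (ht.smul (hD.sub (contDiffAt_flip hD)))).sub
    ((ht.pow 2).smul ((contDiffAt_flip h0).clm_comp (h1.clm_comp h0)))

/-- The domain in which the coupling form is nondegenerate. -/
def localDomain (U : Set EB) (S : EB → (EB →L[ℝ] ℝ) →L[ℝ] EB) (Λ : F →L[ℝ] (F →L[ℝ] ℝ) →L[ℝ] F)
    (μ : EB → EB →L[ℝ] F →L[ℝ] ℝ) : Set (ℝ × EB × F) :=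
  {p | p.2.1 ∈ U ∧ (localCoupling S Λ μ (1 - p.1) p.2).IsInvertible}

theorem LocalModelData.isOpen_localDomain [CompleteSpace EB] (h : LocalModelData U S Λ μ) :
    IsOpen (localDomain U S Λ μ) := by
  have hU : IsOpen {p : ℝ × EB × F | p.2.1 ∈ U} :=
    h.isOpen.preimage (continuous_fst.comp continuous_snd)
  have hc : ContinuousOn (fun p : ℝ × EB × F => localCoupling S Λ μ (1 - p.1) p.2)
      {p : ℝ × EB × F | p.2.1 ∈ U} := fun p hp =>
    (h.contDiffAt_localCoupling hp).continuousAt.continuousWithinAt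
  exact hc.isOpen_inter_preimage hU isOpen_setOf_isInvertible

theorem LocalModelData.contDiffOn_localField [CompleteSpace EB] (h : LocalModelData U S Λ μ) :
    ContDiffOn ℝ ∞ (localField S Λ μ) (localDomain U S Λ μ) := by
  intro p hp
  refine ContDiffAt.contDiffWithinAt ?_
  have hx : ContDiffAt ℝ ∞ (fun p : ℝ × EB × F => p.2.2) p := contDiffAt_snd.comp p contDiffAt_snd
  have h0 : ContDiffAt ℝ ∞ (fun p : ℝ × EB × F => μ p.2.1) p :=
    (h.form_smooth.contDiffAt (h.isOpen.mem_nhds hp.1)).comp p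
      (contDiffAt_fst.comp p contDiffAt_snd)
  exact (h.contDiffAt_localHor hp.1).clm_apply
    ((contDiffAt_inverse (h.contDiffAt_localCoupling hp.1) hp.2).clm_apply
      ((contDiffAt_flip h0).clm_apply hx))

/-- The gauge operator `1 - t σ P♭` on covectors. -/
def gaugeOp (S : EB → (EB →L[ℝ] ℝ) →L[ℝ] EB) (Λ : F →L[ℝ] (F →L[ℝ] ℝ) →L[ℝ] F)
    (μ : EB → EB →L[ℝ] F →L[ℝ] ℝ) (t : ℝ) (q : EB × F) :
    (EB × F →L[ℝ] ℝ) →L[ℝ] (EB × F →L[ℝ] ℝ) :=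
  ContinuousLinearMap.id ℝ _ - t • (extDerivForm (gaugeForm μ) q ∘L localFlat S Λ q)

/-- If the gauge operator kills `c`, then by the gauge relation the flat tensor kills `c` as well,
and the operator reduces to the identity on `c`. Injectivity suffices in finite dimension. -/
theorem LocalModelData.isInvertible_gaugeOp [FiniteDimensional ℝ EB] [FiniteDimensional ℝ F]
    (h : LocalModelData U S Λ μ) {q : EB × F} (hq : q.1 ∈ U)
    {t : ℝ} (hF : (localCoupling S Λ μ t q).IsInvertible) :
    (gaugeOp S Λ μ t q).IsInvertible := by
  have hinj : Function.Injective (gaugeOp S Λ μ t q) := by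
    rw [injective_iff_map_eq_zero]
    intro c hc
    have h1 := h.gauge_relation hq hF c
    have h2 : c - t • extDerivForm (gaugeForm μ) q (localFlat S Λ q c) = 0 := hc
    rw [h2, map_zero] at h1
    rw [← h1, map_zero, smul_zero, sub_zero] at h2
    exact h2
  refine ⟨(LinearEquiv.ofInjectiveEndo (gaugeOp S Λ μ t q).toLinearMap
    hinj).toContinuousLinearEquiv, ?_⟩
  ext1 c
  rfl

theorem LocalModelData.localLin_gaugeOp (h : LocalModelData U S Λ μ) {q : EB × F} (hq : q.1 ∈ U)
    {t : ℝ} (hF : (localCoupling S Λ μ t q).IsInvertible) (c : EB × F →L[ℝ] ℝ) :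
    localLin S Λ μ t q (gaugeOp S Λ μ t q c) = localFlat S Λ q c :=
  h.gauge_relation hq hF c

theorem LocalModelData.contDiffAt_localLin [FiniteDimensional ℝ EB] (h : LocalModelData U S Λ μ)
    {p : ℝ × EB × F} (hp : p ∈ localDomain U S Λ μ) :
    ContDiffAt ℝ ∞ (fun p : ℝ × EB × F => localLin S Λ μ (1 - p.1) p.2) p := by
  have hx : ContDiffAt ℝ ∞ (fun p : ℝ × EB × F => p.2.2) p := contDiffAt_snd.comp p contDiffAt_snd
  have h1 : ContDiffAt ℝ ∞ (fun p : ℝ × EB × F => Λ p.2.2) p := Λ.contDiff.contDiffAt.comp p hx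
  have hH := h.contDiffAt_localHor hp.1
  have hI := contDiffAt_inverse (h.contDiffAt_localCoupling hp.1) hp.2
  have hpre : ContDiffAt ℝ ∞ (fun p : ℝ × EB × F =>
      precomp ℝ (localHor Λ μ (1 - p.1) p.2)) p :=
    (compL ℝ EB (EB × F) ℝ).flip.contDiff.contDiffAt.comp p hH
  exact (hH.clm_comp (hI.clm_comp hpre)).neg.add
    (contDiffAt_const.clm_comp (h1.clm_comp contDiffAt_const))

/-- Every covector lies in the image of the gauge operator, where antisymmetry follows from that of
the flat tensor and of `dκ`. -/
theorem LocalModelData.localLin_antisymm [FiniteDimensional ℝ EB] [FiniteDimensional ℝ F]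
    (h : LocalModelData U S Λ μ) {q : EB × F} (hq : q.1 ∈ U)
    {t : ℝ} (hF : (localCoupling S Λ μ t q).IsInvertible) (α β : EB × F →L[ℝ] ℝ) :
    β (localLin S Λ μ t q α) = -α (localLin S Λ μ t q β) := by
  have hs : Function.Surjective (gaugeOp S Λ μ t q) := by
    obtain ⟨e, he⟩ := h.isInvertible_gaugeOp hq hF
    rw [← he]; exact e.surjective
  obtain ⟨α, rfl⟩ := hs α
  obtain ⟨β, rfl⟩ := hs β
  rw [h.localLin_gaugeOp hq hF, h.localLin_gaugeOp hq hF]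
  have h1 := h.localFlat_antisymm hq α β
  simp only [gaugeOp, sub_apply, smul_apply, comp_apply, id_apply, smul_eq_mul,
    extDerivForm_apply]
  rw [h1]
  ring

/-- Wherever the coupling form is nondegenerate, the model is the gauge transform of the flat
Poisson tensor by a multiple of the exact form `dκ`. -/
theorem LocalModelData.jacobiAt_localLin [FiniteDimensional ℝ EB] [FiniteDimensional ℝ F]
    (h : LocalModelData U S Λ μ) {p : ℝ × EB × F} (hp : p ∈ localDomain U S Λ μ) :
    JacobiAt (localLin S Λ μ (1 - p.1)) p.2 := by
  have hsec : Continuous fun q : EB × F => ((p.1, q) : ℝ × EB × F) :=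
    continuous_const.prodMk continuous_id
  have hnear : ∀ᶠ q in 𝓝 p.2, (p.1, q) ∈ localDomain U S Λ μ :=
    hsec.continuousAt.eventually (h.isOpen_localDomain.mem_nhds hp)
  have hd : DifferentiableAt ℝ (localLin S Λ μ (1 - p.1)) p.2 := by
    have h1 := ((h.contDiffAt_localLin hp).differentiableAt (by simp))
    exact DifferentiableAt.comp (g := fun p : ℝ × EB × F => localLin S Λ μ (1 - p.1) p.2)
      (f := fun q : EB × F => ((p.1, q) : ℝ × EB × F)) p.2 h1
      ((differentiableAt_const _).prodMk differentiableAt_id)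
  have hκ := h.contDiffAt_gaugeForm hp.1
  have hE : DifferentiableAt ℝ (extDerivForm (gaugeForm μ)) p.2 := by
    have h1 := hκ.fderiv_right (m := ∞) (by simp)
    exact (h1.sub (contDiffAt_flip h1)).differentiableAt (by simp)
  have hsE : ∀ a b c, fderiv ℝ (fun q => (1 - p.1) • extDerivForm (gaugeForm μ) q) p.2 a b c =
      (1 - p.1) * fderiv ℝ (extDerivForm (gaugeForm μ)) p.2 a b c := by
    intro a b c
    rw [fderiv_fun_const_smul hE]
    rfl
  refine JacobiAt.gauge (P := localFlat S Λ)
    (σ := fun q => (1 - p.1) • extDerivForm (gaugeForm μ) q) ?_ hd (hE.fun_const_smul _) ?_ ?_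
    (h.localLin_antisymm hp.1 hp.2) ?_ ?_ (h.jacobiAt_localFlat hp.1)
  · exact (h.contDiffOn_localFlat.contDiffAt ((h.isOpen.prod isOpen_univ).mem_nhds
      ⟨hp.1, trivial⟩)).differentiableAt (by simp)
  · filter_upwards [hnear] with q hq c
    exact h.gauge_relation hq.1 hq.2 c
  · intro α'
    obtain ⟨e, he⟩ := h.isInvertible_gaugeOp hp.1 hp.2
    refine ⟨e.symm α', ?_⟩
    have h1 : gaugeOp S Λ μ (1 - p.1) p.2 (e.symm α') = α' := by rw [← he]; simp
    exact h1
  · intro u v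
    simp only [smul_apply, extDerivForm_apply, smul_eq_mul]
    ring
  · intro u v w
    rw [hsE, hsE, hsE, ← mul_add, ← mul_add, extDerivForm_closed hκ, mul_zero]

/-- The form `κ` vanishes on vertical vectors, so only the horizontal part of the tensor contributes
to `-P κ`. The horizontal description is the one that globalizes. -/
theorem localField_eq (p : ℝ × EB × F) :
    localField S Λ μ p = -localLin S Λ μ (1 - p.1) p.2 (gaugeForm μ p.2) := by
  have h1 : gaugeForm μ p.2 ∘L inr ℝ EB F = 0 := by ext y; simp
  have h2 : gaugeForm μ p.2 ∘L localHor Λ μ (1 - p.1) p.2 = (μ p.2.1).flip p.2.2 := by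
    ext u; simp
  have : localLin S Λ μ (1 - p.1) p.2 (gaugeForm μ p.2) = -(localHor Λ μ (1 - p.1) p.2
      ((localCoupling S Λ μ (1 - p.1) p.2).inverse (gaugeForm μ p.2 ∘L
        localHor Λ μ (1 - p.1) p.2))) + (0, Λ p.2.2 (gaugeForm μ p.2 ∘L inr ℝ EB F)) := by
    simp [localLin]
  rw [this, h1, h2, map_zero, localField]
  ext <;> simp

/-- Moser's equation. Along `-P κ` the derivative of `P` is the Lie transport term plus `P dκ P`, by
the Jacobi identity; the derivative in the time parameter is `-P dκ P`, and the two cancel. Time `s`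
corresponds to the gauge parameter `1 - s`, so the path goes from the linearized to the flat tensor.
-/
theorem LocalModelData.lie_localLin [FiniteDimensional ℝ EB] [FiniteDimensional ℝ F]
    (h : LocalModelData U S Λ μ) {p : ℝ × EB × F} (hp : p ∈ localDomain U S Λ μ)
    (α : EB × F →L[ℝ] ℝ) :
    fderiv ℝ (fun p : ℝ × EB × F => localLin S Λ μ (1 - p.1) p.2) p (1, localField S Λ μ p) α =
      fderiv ℝ (fun y => localField S Λ μ (p.1, y)) p.2 (localLin S Λ μ (1 - p.1) p.2 α)
      + localLin S Λ μ (1 - p.1) p.2 (α ∘L fderiv ℝ (fun y => localField S Λ μ (p.1, y)) p.2) := by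
  set P : ℝ × EB × F → (EB × F →L[ℝ] ℝ) →L[ℝ] EB × F :=
    fun p => localLin S Λ μ (1 - p.1) p.2 with hP
  have hsec : Continuous fun q : EB × F => ((p.1, q) : ℝ × EB × F) :=
    continuous_const.prodMk continuous_id
  have hnear : ∀ᶠ q in 𝓝 p.2, (p.1, q) ∈ localDomain U S Λ μ :=
    hsec.continuousAt.eventually (h.isOpen_localDomain.mem_nhds hp)
  have hPd : DifferentiableAt ℝ P p := (h.contDiffAt_localLin hp).differentiableAt (by simp)
  have hq : HasFDerivAt (fun q : EB × F => ((p.1, q) : ℝ × EB × F))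
      (inr ℝ ℝ (EB × F)) p.2 := (hasFDerivAt_const _ _).prodMk (hasFDerivAt_id _)
  have hPq := hPd.hasFDerivAt.comp p.2 hq
  have hPq' : HasFDerivAt (localLin S Λ μ (1 - p.1)) (fderiv ℝ P p ∘L inr ℝ ℝ (EB × F)) p.2 := hPq
  have hκ := h.contDiffAt_gaugeForm hp.1
  have hfield : (fun y => localField S Λ μ (p.1, y)) =ᶠ[𝓝 p.2]
      fun y => -localLin S Λ μ (1 - p.1) y (gaugeForm μ y) := by
    exact Filter.Eventually.of_forall fun y => localField_eq (p.1, y)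
  have hlie := (h.jacobiAt_localLin hp).fderiv_neg_apply hPq'.differentiableAt
    (hκ.differentiableAt (by simp))
    (by filter_upwards [hnear] with y hy using h.localLin_antisymm hy.1 hy.2)
    (fun v w hvw => (SeparatingDual.eq_iff_forall_dual_eq (R := ℝ)).2 hvw) α
  rw [← localField_eq p, hPq'.fderiv, ← hfield.fderiv_eq] at hlie
  -- Differentiate in `s` the relation `P_s(β - (1 - s) ε) = localFlat β` with `β` fixed, where `β`
  -- is the preimage of `α` under the gauge operator: its right side does not depend on `s`.
  have htime : fderiv ℝ P p (1, 0) α = -P p (extDerivForm (gaugeForm μ) p.2 (P p α)) := by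
    obtain ⟨e, he⟩ := h.isInvertible_gaugeOp hp.1 hp.2
    obtain ⟨β, hβ⟩ : ∃ β, gaugeOp S Λ μ (1 - p.1) p.2 β = α := ⟨e.symm α, by rw [← he]; simp⟩
    have hPα : P p α = localFlat S Λ p.2 β := by
      rw [← hβ]; exact h.localLin_gaugeOp hp.1 hp.2 β
    have ht : HasDerivAt (fun s : ℝ => ((s, p.2) : ℝ × EB × F)) (1, 0) p.1 :=
      (hasDerivAt_id _).prodMk (hasDerivAt_const _ _)
    have h1 := hPd.hasFDerivAt.comp_hasDerivAt p.1 ht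
    set ε := extDerivForm (gaugeForm μ) p.2 (localFlat S Λ p.2 β) with hε
    have h2 : HasDerivAt (fun s : ℝ => β - (1 - s) • ε) ε p.1 := by
      have := (((hasDerivAt_id p.1).const_sub 1).smul_const ε).const_sub β
      simpa using! this
    have h3 := h1.clm_apply h2
    have hev : ∀ᶠ s in 𝓝 p.1, localFlat S Λ p.2 β = (P ∘ fun s => (s, p.2)) s (β - (1 - s) • ε) := by
      have hsec' : Continuous fun s : ℝ => ((s, p.2) : ℝ × EB × F) :=
        continuous_id.prodMk continuous_const
      filter_upwards [hsec'.continuousAt.eventually (h.isOpen_localDomain.mem_nhds hp)] with s hs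
      exact (h.gauge_relation hs.1 hs.2 β).symm
    have h4 := (h3.congr_of_eventuallyEq (f₁ := fun _ => localFlat S Λ p.2 β) hev).unique
      (hasDerivAt_const _ _)
    have h5 : β - (1 - p.1) • ε = α := hβ
    rw [h5] at h4
    rw [hPα]
    exact eq_neg_of_add_eq_zero_left h4
  have hsplit : ((1, localField S Λ μ p) : ℝ × EB × F) = (1, 0) + (0, localField S Λ μ p) := by
    simp
  rw [hsplit, map_add, add_apply, htime]
  have h6 : fderiv ℝ P p (0, localField S Λ μ p) α =
    (fderiv ℝ P p ∘L inr ℝ ℝ (EB × F)) (localField S Λ μ p) α := rfl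
  rw [h6, hlie]
  abel

theorem localCoupling_zero_time (q : EB × F) : localCoupling S Λ μ 0 q = -(S q.1).inverse := by
  simp [localCoupling]

theorem localCoupling_zero_fibre (t : ℝ) (ξ : EB) :
    localCoupling S Λ μ t (ξ, 0) = -(S ξ).inverse := by
  ext u v
  simp [localCoupling]

/-- The form `κ` is linear in the fibre variable. This fixes the leaf pointwise and provides the
equilibrium near which the flow lasts until time one. -/
theorem localField_zero_fibre (t : ℝ) (ξ : EB) : localField S Λ μ (t, ξ, 0) = 0 := by
  simp [localField]

theorem LocalModelData.isInvertible_base (h : LocalModelData U S Λ μ) {ξ : EB} (hξ : ξ ∈ U) :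
    (-(S ξ).inverse).IsInvertible := by
  obtain ⟨e, he⟩ := h.base_inv _ hξ
  rw [← he, inverse_equiv]
  exact ⟨e.symm.trans (ContinuousLinearEquiv.neg ℝ), by ext; simp⟩

theorem LocalModelData.localLin_zero_time (h : LocalModelData U S Λ μ) {q : EB × F}
    (hq : q.1 ∈ U) : localLin S Λ μ 0 q = localFlat S Λ q := by
  have hF : (localCoupling S Λ μ 0 q).IsInvertible := by
    rw [localCoupling_zero_time]; exact h.isInvertible_base hq
  ext1 c
  simpa using h.gauge_relation hq hF c

theorem LocalModelData.mem_localDomain_zero (h : LocalModelData U S Λ μ) (t : ℝ) {ξ : EB}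
    (hξ : ξ ∈ U) : (t, ξ, 0) ∈ localDomain U S Λ μ :=
  ⟨hξ, by rw [localCoupling_zero_fibre]; exact h.isInvertible_base hξ⟩

/-- Moser's method in a flat chart. -/
theorem LocalModelData.exists_flow [FiniteDimensional ℝ EB] [FiniteDimensional ℝ F]
    (h : LocalModelData U S Λ μ) {ξ₁ : EB} (hξ₁ : ξ₁ ∈ U) {W : Set (EB × F)} (hW : IsOpen W)
    (hW1 : (ξ₁, 0) ∈ W) :
    ∃ (Φ : ℝ → EB × F → EB × F) (Ψ : EB × F → EB × F) (N : Set (EB × F)),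
      ContDiff ℝ ∞ (fun p : ℝ × EB × F => Φ p.1 p.2) ∧
      ContDiff ℝ ∞ Ψ ∧ (∀ q, Ψ (Φ 1 q) = q) ∧ (∀ q, Φ 1 (Ψ q) = q) ∧ (∀ q, Φ 0 q = q) ∧
      IsOpen N ∧ (ξ₁, 0) ∈ N ∧
      (∀ q ∈ N, ∀ t ∈ Icc (0 : ℝ) 1, (t, Φ t q) ∈ localDomain U S Λ μ ∧ Φ t q ∈ W ∧
        HasDerivAt (fun s => Φ s q) (localField S Λ μ (t, Φ t q)) t) ∧
      ∀ q ∈ N, ∀ α, localFlat S Λ (Φ 1 q) α =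
        fderiv ℝ (Φ 1) q (localLin S Λ μ 1 q (α ∘L fderiv ℝ (Φ 1) q)) := by
  -- The extra open set `W` confines the flow, so that it can be transported to the bundle.
  have hO : IsOpen (localDomain U S Λ μ ∩ Prod.snd ⁻¹' W) :=
    h.isOpen_localDomain.inter (hW.preimage continuous_snd)
  have hZ := h.contDiffOn_localField.mono
    (inter_subset_left : localDomain U S Λ μ ∩ Prod.snd ⁻¹' W ⊆ _)
  obtain ⟨Φ, Ψ, N, hΦ, hΨ, h1, h2, h3, hN, hN1, hd⟩ := exists_local_flow hO hZ (q₁ := (ξ₁, 0))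
    (fun t _ => ⟨h.mem_localDomain_zero t hξ₁, hW1⟩) (fun t => localField_zero_fibre t ξ₁)
  refine ⟨Φ, Ψ, N, hΦ, hΨ, h1, h2, h3, hN, hN1,
    fun q hq t ht => ⟨(hd q hq t ht).1.1, (hd q hq t ht).1.2, (hd q hq t ht).2⟩,
    fun q hq α => ?_⟩
  have := tensor_preserved_of_flow hO hZ
    (P := fun p : ℝ × EB × F => localLin S Λ μ (1 - p.1) p.2)
    (fun p hp => (h.contDiffAt_localLin hp.1).contDiffWithinAt)
    (fun p hp α => h.lie_localLin hp.1 α) hΦ h3 hN hd hq α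
  simp only [sub_self, sub_zero] at this
  rw [← this, h.localLin_zero_time (hd q hq 1 (by simp)).1.1.1]

end LocalModel

/-! ### The first fibre jet of the Jacobi identity along the zero section. -/

section Linearization

set_option maxSynthPendingDepth 3

open ContinuousLinearMap

variable {EB F : Type*} [NormedAddCommGroup EB] [NormedSpace ℝ EB]
  [NormedAddCommGroup F] [NormedSpace ℝ F]

/-- A Poisson tensor near `U × {0}`, which is tangent to `U × {0}` with symplectic restriction,
together with its first order jet along `U × {0}`. -/
structure JetData (U : Set EB) (O : Set (EB × F)) (Q : EB × F → (EB × F →L[ℝ] ℝ) →L[ℝ] EB × F)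
    (S : EB → (EB →L[ℝ] ℝ) →L[ℝ] EB) (Λ : EB → F →L[ℝ] (F →L[ℝ] ℝ) →L[ℝ] F)
    (A : EB → EB →L[ℝ] F →L[ℝ] F) (R : EB → F →L[ℝ] EB →L[ℝ] EB →L[ℝ] ℝ) : Prop where
  isOpen : IsOpen U
  isOpen_dom : IsOpen O
  mem : ∀ ξ ∈ U, (ξ, 0) ∈ O
  smooth : ContDiffOn ℝ ∞ Q O
  antisymm : ∀ q ∈ O, ∀ α β : EB × F →L[ℝ] ℝ, β (Q q α) = -α (Q q β)
  jacobi : ∀ q ∈ O, JacobiAt Q q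
  zero : ∀ ξ ∈ U, ∀ c, Q (ξ, 0) c = (S ξ (c ∘L inl ℝ EB F), 0)
  inv : ∀ ξ ∈ U, (S ξ).IsInvertible
  vert : ∀ ξ ∈ U, ∀ (y : F) (β : F →L[ℝ] ℝ),
    (fderiv ℝ Q (ξ, 0) (0, y) (β ∘L snd ℝ EB F)).2 = Λ ξ y β
  conn : ∀ ξ ∈ U, ∀ (y : F) (a : EB →L[ℝ] ℝ),
    (fderiv ℝ Q (ξ, 0) (0, y) (a ∘L fst ℝ EB F)).2 = -A ξ (S ξ a) y
  form : ∀ ξ ∈ U, ∀ (y : F) (a c : EB →L[ℝ] ℝ),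
    R ξ y (S ξ a) (S ξ c) = c (fderiv ℝ Q (ξ, 0) (0, y) (a ∘L fst ℝ EB F)).1

variable {U : Set EB} {O : Set (EB × F)} {Q : EB × F → (EB × F →L[ℝ] ℝ) →L[ℝ] EB × F}
  {S : EB → (EB →L[ℝ] ℝ) →L[ℝ] EB} {Λ : EB → F →L[ℝ] (F →L[ℝ] ℝ) →L[ℝ] F}
  {A : EB → EB →L[ℝ] F →L[ℝ] F} {R : EB → F →L[ℝ] EB →L[ℝ] EB →L[ℝ] ℝ}

/-- The fibre derivative of `Q` along the zero section. -/
def fibreJet (Q : EB × F → (EB × F →L[ℝ] ℝ) →L[ℝ] EB × F) (ξ : EB) (y : F) :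
    (EB × F →L[ℝ] ℝ) →L[ℝ] EB × F :=
  fderiv ℝ Q (ξ, 0) (0, y)

namespace JetData

variable (h : JetData U O Q S Λ A R)
include h

theorem contDiffAt {ξ : EB} (hξ : ξ ∈ U) : ContDiffAt ℝ ∞ Q (ξ, 0) :=
  h.smooth.contDiffAt (h.isOpen_dom.mem_nhds (h.mem ξ hξ))

theorem contDiffAt_base {ξ : EB} (hξ : ξ ∈ U) : ContDiffAt ℝ ∞ S ξ := by
  have h1 : ContDiffAt ℝ ∞ (fun ξ : EB => Q (ξ, 0)) ξ :=
    (h.contDiffAt hξ).comp ξ (contDiffAt_id.prodMk contDiffAt_const)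
  have h2 : ContDiffAt ℝ ∞ (fun ξ : EB => fst ℝ EB F ∘L Q (ξ, 0) ∘L
      precomp ℝ (fst ℝ EB F)) ξ := contDiffAt_const.clm_comp (h1.clm_comp contDiffAt_const)
  refine h2.congr_of_eventuallyEq ?_
  filter_upwards [h.isOpen.mem_nhds hξ] with η hη
  ext1 a
  simp only [comp_apply, h.zero η hη]
  rfl

theorem contDiffAt_fibreJet {ξ : EB} (hξ : ξ ∈ U) (y : F) :
    ContDiffAt ℝ ∞ (fun ξ => fibreJet Q ξ y) ξ := by
  have h1 : ContDiffAt ℝ ∞ (fun ξ : EB => fderiv ℝ Q (ξ, 0)) ξ :=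
    ((h.contDiffAt hξ).fderiv_right (m := ∞) (by simp)).comp ξ
      (contDiffAt_id.prodMk contDiffAt_const)
  exact h1.clm_apply contDiffAt_const

theorem base_antisymm {ξ : EB} (hξ : ξ ∈ U) (a c : EB →L[ℝ] ℝ) : c (S ξ a) = -a (S ξ c) := by
  have := h.antisymm _ (h.mem ξ hξ) (a ∘L fst ℝ EB F) (c ∘L fst ℝ EB F)
  rw [h.zero ξ hξ, h.zero ξ hξ] at this
  simpa using! this

theorem jet_antisymm {ξ : EB} (hξ : ξ ∈ U) (y : F) (α β : EB × F →L[ℝ] ℝ) :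
    β (fibreJet Q ξ y α) = -α (fibreJet Q ξ y β) :=
  fderiv_antisymm ((h.contDiffAt hξ).differentiableAt (by simp))
    (by filter_upwards [h.isOpen_dom.mem_nhds (h.mem ξ hξ)] with q hq using h.antisymm q hq) _ _ _

theorem fderiv_base {ξ : EB} (hξ : ξ ∈ U) (u : EB) (c : EB × F →L[ℝ] ℝ) :
    fderiv ℝ Q (ξ, 0) (u, 0) c = (fderiv ℝ S ξ u (c ∘L inl ℝ EB F), 0) := by
  have h0 : HasFDerivAt (fun η : EB => ((η, 0) : EB × F)) (inl ℝ EB F) ξ :=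
    (hasFDerivAt_id ξ).prodMk (hasFDerivAt_const _ _)
  have h1 := ((h.contDiffAt hξ).differentiableAt (by simp)).hasFDerivAt.comp ξ h0
  have h2 : HasFDerivAt (fun η : EB => Q (η, 0) c) _ ξ := h1.clm_apply (hasFDerivAt_const c ξ)
  have h3 := (((h.contDiffAt_base hξ).differentiableAt (by simp)).hasFDerivAt.clm_apply
    (hasFDerivAt_const (c ∘L inl ℝ EB F) ξ)).prodMk (hasFDerivAt_const (0 : F) ξ)
  have h4 := h2.unique (h3.congr_of_eventuallyEq (by
    filter_upwards [h.isOpen.mem_nhds hξ] with η hη using h.zero η hη c))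
  have h5 := congrArg (fun L => L u) h4
  simpa using! h5

theorem base_jacobi {ξ : EB} (hξ : ξ ∈ U) : JacobiAt S ξ := by
  intro a b c
  have := h.jacobi _ (h.mem ξ hξ) (a ∘L fst ℝ EB F) (b ∘L fst ℝ EB F) (c ∘L fst ℝ EB F)
  rw [h.zero ξ hξ, h.zero ξ hξ, h.zero ξ hξ, h.fderiv_base hξ, h.fderiv_base hξ,
    h.fderiv_base hξ] at this
  simpa using! this

/-- The fibre derivative of the Jacobi identity along the zero section. -/
theorem jet_jacobi {ξ : EB} (hξ : ξ ∈ U) (y : F) (α β γ : EB × F →L[ℝ] ℝ) :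
    let T := fun α β γ : EB × F →L[ℝ] ℝ =>
      γ (fderiv ℝ (fun η => fibreJet Q η y) ξ (S ξ (α ∘L inl ℝ EB F)) β) +
      γ ((fderiv ℝ S ξ (fibreJet Q ξ y α).1 (β ∘L inl ℝ EB F), 0) +
        fibreJet Q ξ (fibreJet Q ξ y α).2 β)
    T α β γ + T β γ α + T γ α β = 0 := by
  intro T
  have hQ := h.contDiffAt hξ
  have hDQ : DifferentiableAt ℝ (fderiv ℝ Q) (ξ, 0) :=
    (hQ.fderiv_right (m := ∞) (by simp)).differentiableAt (by simp)
  have hline : HasDerivAt (fun t : ℝ => ((ξ, t • y) : EB × F)) (0, y) 0 := by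
    have := (hasDerivAt_const (0 : ℝ) ξ).prodMk ((hasDerivAt_id (0 : ℝ)).smul_const y)
    simpa using! this
  have hl0 : ((ξ, (0 : ℝ) • y) : EB × F) = (ξ, 0) := by simp
  have hQd : HasDerivAt (fun t : ℝ => Q (ξ, t • y)) (fibreJet Q ξ y) 0 := by
    have h1 := (hQ.differentiableAt (by simp)).hasFDerivAt
    rw [← hl0] at h1
    have h2 := h1.comp_hasDerivAt (0 : ℝ) hline
    rw [hl0] at h2
    exact h2
  have hDQd : HasDerivAt (fun t : ℝ => fderiv ℝ Q (ξ, t • y))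
      (fderiv ℝ (fderiv ℝ Q) (ξ, 0) (0, y)) 0 := by
    have h1 := hDQ.hasFDerivAt
    rw [← hl0] at h1
    have h2 := h1.comp_hasDerivAt (0 : ℝ) hline
    rw [hl0] at h2
    exact h2
  -- On the zero section `Q` takes values in base directions, so second derivatives of `Q` enter
  -- only as base derivatives of the fibre jet; no second fibre derivative appears.
  have hsymm : ∀ u : EB, fderiv ℝ (fderiv ℝ Q) (ξ, 0) (0, y) (u, 0) =
      fderiv ℝ (fun η => fibreJet Q η y) ξ u := by
    intro u
    have h1 : fderiv ℝ (fderiv ℝ Q) (ξ, 0) (0, y) (u, 0) =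
        fderiv ℝ (fderiv ℝ Q) (ξ, 0) (u, 0) (0, y) :=
      (hQ.isSymmSndFDerivAt (by simpa using two_le_infty)) _ _
    rw [h1]
    have h0 : HasFDerivAt (fun η : EB => ((η, 0) : EB × F)) (inl ℝ EB F) ξ :=
      (hasFDerivAt_id ξ).prodMk (hasFDerivAt_const _ _)
    have h2 : HasFDerivAt (fun η => fibreJet Q η y) _ ξ :=
      (hDQ.hasFDerivAt.comp ξ h0).clm_apply (hasFDerivAt_const ((0, y) : EB × F) ξ)
    rw [h2.fderiv]
    simp
  have hT : ∀ α β γ : EB × F →L[ℝ] ℝ, HasDerivAt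
      (fun t : ℝ => γ (fderiv ℝ Q (ξ, t • y) (Q (ξ, t • y) α) β)) (T α β γ) 0 := by
    intro α β γ
    have h1 := (hDQd.clm_apply (hQd.clm_apply (hasDerivAt_const (0 : ℝ) α))).clm_apply
      (hasDerivAt_const (0 : ℝ) β)
    have h2 := γ.hasFDerivAt.comp_hasDerivAt (0 : ℝ) h1
    have h3 : fderiv ℝ Q (ξ, 0) (fibreJet Q ξ y α) β =
        (fderiv ℝ S ξ (fibreJet Q ξ y α).1 (β ∘L inl ℝ EB F), 0) +
        fibreJet Q ξ (fibreJet Q ξ y α).2 β := by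
      have h4 : fibreJet Q ξ y α = ((fibreJet Q ξ y α).1, 0) + (0, (fibreJet Q ξ y α).2) := by simp
      conv_lhs => rw [h4, map_add, add_apply, h.fderiv_base hξ]
      rfl
    convert! h2 using 1
    simp only [map_zero, add_zero, add_apply, hl0, h.zero ξ hξ, hsymm, h3, map_add,
      zero_comp, Prod.mk_zero_zero, zero_apply, T]
  have hsum := ((hT α β γ).add (hT β γ α)).add (hT γ α β)
  refine hsum.unique ((hasDerivAt_const (0 : ℝ) (0 : ℝ)).congr_of_eventuallyEq ?_)
  have hcont : ContinuousAt (fun t : ℝ => ((ξ, t • y) : EB × F)) 0 := hline.continuousAt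
  have hO : O ∈ 𝓝 ((ξ, (0 : ℝ) • y) : EB × F) := by
    rw [hl0]; exact h.isOpen_dom.mem_nhds (h.mem ξ hξ)
  filter_upwards [hcont.eventually hO] with t ht
  exact h.jacobi _ ht α β γ

/-- Antisymmetry of the jet carries the connection form from one mixed block to the other. -/
theorem jet_fst_snd {ξ : EB} (hξ : ξ ∈ U) (y : F) (γ : F →L[ℝ] ℝ) (c : EB →L[ℝ] ℝ) :
    c (fibreJet Q ξ y (γ ∘L snd ℝ EB F)).1 = γ (A ξ (S ξ c) y) := by
  have h1 := h.jet_antisymm hξ y (γ ∘L snd ℝ EB F) (c ∘L fst ℝ EB F)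
  have h2 := h.conn ξ hξ y c
  simp only [comp_apply, coe_fst', coe_snd'] at h1
  rw [h1]
  have h3 : (fibreJet Q ξ y (c ∘L fst ℝ EB F)).2 = -A ξ (S ξ c) y := h2
  rw [h3]; simp

theorem vert_antisymm {ξ : EB} (hξ : ξ ∈ U) (y : F) (β γ : F →L[ℝ] ℝ) :
    γ (Λ ξ y β) = -β (Λ ξ y γ) := by
  have h1 := h.jet_antisymm hξ y (β ∘L snd ℝ EB F) (γ ∘L snd ℝ EB F)
  have h2 : (fibreJet Q ξ y (β ∘L snd ℝ EB F)).2 = Λ ξ y β := h.vert ξ hξ y β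
  have h3 : (fibreJet Q ξ y (γ ∘L snd ℝ EB F)).2 = Λ ξ y γ := h.vert ξ hξ y γ
  rw [← h2, ← h3]
  exact h1

/-- The linear vertical tensor is a block of the fibre derivative of `Q`, so its smoothness is a
consequence and not an assumption. -/
theorem contDiffAt_vert {ξ : EB} (hξ : ξ ∈ U) : ContDiffAt ℝ ∞ Λ ξ := by
  have h1 : ContDiffAt ℝ ∞ (fun ξ : EB => fderiv ℝ Q (ξ, 0) ∘L inr ℝ EB F) ξ :=
    (((h.contDiffAt hξ).fderiv_right (m := ∞) (by simp)).comp ξ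
      (contDiffAt_id.prodMk contDiffAt_const)).clm_comp contDiffAt_const
  let T : ((EB × F →L[ℝ] ℝ) →L[ℝ] EB × F) →L[ℝ] (F →L[ℝ] ℝ) →L[ℝ] F :=
    (compL ℝ (F →L[ℝ] ℝ) (EB × F →L[ℝ] ℝ) F).flip (precomp ℝ (snd ℝ EB F)) ∘L
      compL ℝ (EB × F →L[ℝ] ℝ) (EB × F) F (snd ℝ EB F)
  have h2 : ContDiffAt ℝ ∞ (fun ξ : EB => T ∘L (fderiv ℝ Q (ξ, 0) ∘L inr ℝ EB F)) ξ :=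
    contDiffAt_const.clm_comp h1
  refine h2.congr_of_eventuallyEq ?_
  filter_upwards [h.isOpen.mem_nhds hξ] with η hη
  ext y β
  exact (h.vert η hη y β).symm

theorem fderiv_jet_apply {ξ : EB} (hξ : ξ ∈ U) (y : F) (α : EB × F →L[ℝ] ℝ) :
    HasFDerivAt (fun η => fibreJet Q η y α)
      ((fderiv ℝ (fun η => fibreJet Q η y) ξ).flip α) ξ := by
  have h1 := ((h.contDiffAt_fibreJet hξ y).differentiableAt (by simp)).hasFDerivAt.clm_apply
    (hasFDerivAt_const α ξ)
  simpa using! h1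

theorem fderiv_jet_vert {ξ : EB} (hξ : ξ ∈ U) (y : F) (u : EB) (β : F →L[ℝ] ℝ) :
    (fderiv ℝ (fun η => fibreJet Q η y) ξ u (β ∘L snd ℝ EB F)).2 = fderiv ℝ Λ ξ u y β := by
  have h1 := (h.fderiv_jet_apply hξ y (β ∘L snd ℝ EB F)).snd
  have h2 : HasFDerivAt (fun η => Λ η y β) _ ξ :=
    ((((h.contDiffAt_vert hξ).differentiableAt (by simp)).hasFDerivAt).clm_apply
      (hasFDerivAt_const y ξ)).clm_apply (hasFDerivAt_const β ξ)
  have h3 := h1.unique (h2.congr_of_eventuallyEq (by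
    filter_upwards [h.isOpen.mem_nhds hξ] with η hη using h.vert η hη y β))
  have h4 := congrArg (fun L => L u) h3
  simpa using! h4

theorem fderiv_jet_conn {ξ : EB} (hξ : ξ ∈ U) (hA : DifferentiableAt ℝ A ξ) (y : F) (u : EB)
    (a : EB →L[ℝ] ℝ) :
    (fderiv ℝ (fun η => fibreJet Q η y) ξ u (a ∘L fst ℝ EB F)).2 =
      -(fderiv ℝ A ξ u (S ξ a) y + A ξ (fderiv ℝ S ξ u a) y) := by
  have h1 := (h.fderiv_jet_apply hξ y (a ∘L fst ℝ EB F)).snd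
  have h2 : HasFDerivAt (fun η => S η a) _ ξ :=
    (((h.contDiffAt_base hξ).differentiableAt (by simp)).hasFDerivAt).clm_apply
      (hasFDerivAt_const a ξ)
  have h2' : HasFDerivAt (fun η => -A η (S η a) y) _ ξ :=
    ((hA.hasFDerivAt.clm_apply h2).clm_apply (hasFDerivAt_const y ξ)).neg
  have h3 := h1.unique (h2'.congr_of_eventuallyEq (by
    filter_upwards [h.isOpen.mem_nhds hξ] with η hη using h.conn η hη y a))
  have h4 := congrArg (fun L => L u) h3
  have h5 : (fderiv ℝ (fun η => fibreJet Q η y) ξ u (a ∘L fst ℝ EB F)).2 =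
    -(A ξ (fderiv ℝ S ξ u a) y + fderiv ℝ A ξ u (S ξ a) y) := by simpa using! h4
  rw [h5, add_comm]

theorem fderiv_jet_antisymm {ξ : EB} (hξ : ξ ∈ U) (y : F) (u : EB) (α β : EB × F →L[ℝ] ℝ) :
    β (fderiv ℝ (fun η => fibreJet Q η y) ξ u α) =
      -α (fderiv ℝ (fun η => fibreJet Q η y) ξ u β) := by
  have h1 := fun α β : EB × F →L[ℝ] ℝ =>
    β.hasFDerivAt.comp ξ (h.fderiv_jet_apply hξ y α)
  have h2 := (h1 α β).unique (((h1 β α).neg).congr_of_eventuallyEq (by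
    filter_upwards [h.isOpen.mem_nhds hξ] with η hη using h.jet_antisymm hη y α β))
  have h4 := congrArg (fun L => L u) h2
  simpa using! h4

/-- The connection preserves the linear vertical tensor. -/
theorem connection_vert {ξ : EB} (hξ : ξ ∈ U) (u : EB) (y : F)
    (β γ : F →L[ℝ] ℝ) :
    γ (fderiv ℝ Λ ξ u y β) = γ (Λ ξ (A ξ u y) β) - γ (A ξ u (Λ ξ y β)) -
      γ (Λ ξ y (β ∘L A ξ u)) := by
  obtain ⟨a, rfl⟩ : ∃ a, S ξ a = u := by
    obtain ⟨e, he⟩ := h.inv ξ hξ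
    exact ⟨e.symm u, by rw [← he]; simp⟩
  -- One base covector and two fibre covectors: the base covector supplies the direction `u = S a`
  -- of the covariant derivative.
  have hJ := h.jet_jacobi hξ y (a ∘L fst ℝ EB F) (β ∘L snd ℝ EB F) (γ ∘L snd ℝ EB F)
  have hin : ∀ β : F →L[ℝ] ℝ, (β ∘L snd ℝ EB F) ∘L inl ℝ EB F = 0 := fun β => by ext; simp
  have hin' : (a ∘L fst ℝ EB F) ∘L inl ℝ EB F = a := by ext; simp
  have hN : ∀ z, (fibreJet Q ξ z (a ∘L fst ℝ EB F)).2 = -A ξ (S ξ a) z :=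
    fun z => h.conn ξ hξ z a
  have hV : ∀ z (β : F →L[ℝ] ℝ), (fibreJet Q ξ z (β ∘L snd ℝ EB F)).2 = Λ ξ z β :=
    fun z β => h.vert ξ hξ z β
  simp only [hin, hin', map_zero, zero_apply, comp_apply, coe_fst', coe_snd', hN, hV,
    h.fderiv_jet_vert hξ, h.jet_fst_snd hξ, Prod.fst_add, Prod.snd_add, map_neg, neg_apply,
    Prod.fst_neg, Prod.snd_neg] at hJ
  have h1 := h.vert_antisymm hξ y (β ∘L A ξ (S ξ a)) γ
  simp only [comp_apply] at h1
  simp [h.jet_fst_snd hξ] at hJ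
  linarith

/-- The curvature of the connection is given by the linear part of the coupling form. -/
theorem curvature_eq {ξ : EB} (hξ : ξ ∈ U) (hA : DifferentiableAt ℝ A ξ) (u v : EB) (y : F)
    (γ : F →L[ℝ] ℝ) :
    R ξ (Λ ξ y γ) u v = γ (fderiv ℝ A ξ u v y - fderiv ℝ A ξ v u y +
      (A ξ u (A ξ v y) - A ξ v (A ξ u y))) := by
  have hs : ∀ u, ∃ a, S ξ a = u := by
    obtain ⟨e, he⟩ := h.inv ξ hξ
    exact fun u => ⟨e.symm u, by rw [← he]; simp⟩
  obtain ⟨a, rfl⟩ := hs u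
  obtain ⟨c, rfl⟩ := hs v
  -- Two base covectors and one fibre covector yield the curvature in the directions `S a` and `S
  -- c`.
  have hJ := h.jet_jacobi hξ y (a ∘L fst ℝ EB F) (c ∘L fst ℝ EB F) (γ ∘L snd ℝ EB F)
  have hin : ∀ β : F →L[ℝ] ℝ, (β ∘L snd ℝ EB F) ∘L inl ℝ EB F = 0 := fun β => by ext; simp
  have hin' : ∀ a : EB →L[ℝ] ℝ, (a ∘L fst ℝ EB F) ∘L inl ℝ EB F = a := fun a => by ext; simp
  have hN : ∀ z (a : EB →L[ℝ] ℝ), (fibreJet Q ξ z (a ∘L fst ℝ EB F)).2 = -A ξ (S ξ a) z :=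
    fun z a => h.conn ξ hξ z a
  have hV : ∀ z (β : F →L[ℝ] ℝ), (fibreJet Q ξ z (β ∘L snd ℝ EB F)).2 = Λ ξ z β :=
    fun z β => h.vert ξ hξ z β
  have hM : a (fderiv ℝ (fun η => fibreJet Q η y) ξ (S ξ c) (γ ∘L snd ℝ EB F)).1 =
      γ (fderiv ℝ A ξ (S ξ c) (S ξ a) y + A ξ (fderiv ℝ S ξ (S ξ c) a) y) := by
    have := h.fderiv_jet_antisymm hξ y (S ξ c) (γ ∘L snd ℝ EB F) (a ∘L fst ℝ EB F)
    simp only [comp_apply, coe_fst', coe_snd', h.fderiv_jet_conn hξ hA] at this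
    rw [this]; simp
  have hR : ∀ z, c (fibreJet Q ξ z (a ∘L fst ℝ EB F)).1 = R ξ z (S ξ a) (S ξ c) :=
    fun z => (h.form ξ hξ z a c).symm
  -- The base component of the jet is written as `S m`, so that the Jacobi identity of `S` on `m`,
  -- `a`, `c` eliminates the derivatives of `S` from the equation.
  obtain ⟨m, hm⟩ := hs (fibreJet Q ξ y (γ ∘L snd ℝ EB F)).1
  have hm' : ∀ b, b (S ξ m) = γ (A ξ (S ξ b) y) := fun b => by rw [hm, h.jet_fst_snd hξ]
  have hJ0 := h.base_jacobi hξ m a c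
  have hSa := fderiv_antisymm ((h.contDiffAt_base hξ).differentiableAt (by simp))
    (by filter_upwards [h.isOpen.mem_nhds hξ] with q hq using h.base_antisymm hq)
    (S ξ c) m a
  obtain ⟨b₁, hb₁⟩ := hs (fderiv ℝ S ξ (S ξ a) c)
  obtain ⟨b₂, hb₂⟩ := hs (fderiv ℝ S ξ (S ξ c) a)
  have e1 := h.base_antisymm hξ m b₁
  have e2 := h.base_antisymm hξ m b₂
  rw [hm', hb₁] at e1
  rw [hm', hb₂] at e2
  rw [← hb₁] at hJ0
  rw [← hb₂] at hSa
  simp only [hin, hin', map_zero, zero_apply, comp_apply, coe_fst', coe_snd', hN, hV,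
    h.fderiv_jet_conn hξ hA, hM, h.jet_fst_snd hξ, Prod.fst_add, Prod.snd_add, map_neg, neg_apply,
    Prod.fst_neg, Prod.snd_neg, ← hm, map_add, hR] at hJ
  simp [h.jet_fst_snd hξ] at hJ
  simp only [map_add, map_sub]
  rw [← hb₁] at e1
  rw [← hb₂] at e2
  simp only [hb₁, hb₂] at *
  linarith

end JetData

end Linearization

/-! ### Consequences of trivial centre and vanishing first cohomology. -/

section LieAlgebra

set_option maxSynthPendingDepth 3
set_option synthInstance.maxHeartbeats 100000

open ContinuousLinearMap

variable {F : Type*} [NormedAddCommGroup F] [NormedSpace ℝ F]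
  {𝔤 : Type*} [LieRing 𝔤] [LieAlgebra ℝ 𝔤]

/-- The linear isomorphism `e : 𝔤 ≃ F^*` identifies the bracket with that of the linear
bivector `Λ`. -/
def IsLieIso (e : 𝔤 ≃ₗ[ℝ] (F →L[ℝ] ℝ)) (Λ : F →L[ℝ] (F →L[ℝ] ℝ) →L[ℝ] F) : Prop :=
  ∀ (x y : 𝔤) (v : F), e ⁅x, y⁆ v = e y (Λ v (e x))

variable {e : 𝔤 ≃ₗ[ℝ] (F →L[ℝ] ℝ)} {Λ : F →L[ℝ] (F →L[ℝ] ℝ) →L[ℝ] F}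

namespace IsLieIso

variable (he : IsLieIso e Λ)
include he

theorem antisymm (x : F) (α β : F →L[ℝ] ℝ) : β (Λ x α) = -α (Λ x β) := by
  obtain ⟨a, rfl⟩ := e.surjective α
  obtain ⟨b, rfl⟩ := e.surjective β
  rw [← he, ← he, ← lie_skew, map_neg, neg_apply]

theorem jacobi (x : F) (α β γ : F →L[ℝ] ℝ) :
    γ (Λ (Λ x α) β) + α (Λ (Λ x β) γ) + β (Λ (Λ x γ) α) = 0 := by
  obtain ⟨a, rfl⟩ := e.surjective α
  obtain ⟨b, rfl⟩ := e.surjective β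
  obtain ⟨c, rfl⟩ := e.surjective γ
  rw [← he, ← he, ← he, ← he, ← he, ← he, ← add_apply, ← add_apply, ← map_add, ← map_add,
    lie_jacobi, map_zero, zero_apply]

/-- A linear function on the fibre whose Hamiltonian field vanishes corresponds to a central
element. -/
theorem eq_zero_of_forall (hcenter : LieAlgebra.center ℝ 𝔤 = ⊥) {β : F →L[ℝ] ℝ}
    (hβ : ∀ y (γ : F →L[ℝ] ℝ), γ (Λ y β) = 0) : β = 0 := by
  obtain ⟨b, rfl⟩ := e.surjective β
  have hb : b ∈ LieAlgebra.center ℝ 𝔤 := by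
    rw [LieModule.mem_maxTrivSubmodule]
    intro x
    apply e.injective
    ext v
    rw [← lie_skew, map_neg, neg_apply, he, hβ, map_zero]; simp
  rw [hcenter, LieSubmodule.mem_bot] at hb
  rw [hb, map_zero]

/-- The hypothesis says that the transpose of `B`, moved to the Lie algebra, is a derivation. It is
inner because the cohomology vanishes, and `B` is then a coadjoint operator. -/
theorem exists_inner (hH1 : Subsingleton (FirstCohomology 𝔤)) {B : F →L[ℝ] F}
    (hB : ∀ (y : F) (β γ : F →L[ℝ] ℝ),
      γ (Λ (B y) β) = γ (B (Λ y β)) + γ (Λ y (β ∘L B))) :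
    ∃ m : F →L[ℝ] ℝ, ∀ y, B y = Λ y m := by
  let δ : 𝔤 →ₗ[ℝ] 𝔤 := (e.symm : (F →L[ℝ] ℝ) →ₗ[ℝ] 𝔤) ∘ₗ
    ((precomp ℝ B : (F →L[ℝ] ℝ) →L[ℝ] (F →L[ℝ] ℝ)) : (F →L[ℝ] ℝ) →ₗ[ℝ] (F →L[ℝ] ℝ)) ∘ₗ (e : 𝔤 →ₗ[ℝ] (F →L[ℝ] ℝ))
  have hδ : ∀ z, e (δ z) = (e z) ∘L B := fun z => by simp [δ]
  let D : LieDerivation ℝ 𝔤 𝔤 :=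
    { toLinearMap := δ
      leibniz' := fun a b => by
        apply e.injective
        ext y
        rw [map_sub, ← lie_skew b, map_neg, sub_neg_eq_add, add_apply, hδ, he, hδ, he, hδ,
          comp_apply, he, comp_apply]
        exact hB y (e a) (e b) }
  have hD : D ∈ LinearMap.range (LieDerivation.inner ℝ 𝔤 𝔤) := by
    rw [← Submodule.Quotient.mk_eq_zero]
    exact Subsingleton.elim _ _
  obtain ⟨m, hm⟩ := hD
  -- The inner derivation of `m` is `b ↦ ⁅b, m⁆`, whereas `Λ y (e m)` pairs with `e b` to give `⁅m,
  -- b⁆`; hence the sign.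
  refine ⟨-e m, fun y => (SeparatingDual.eq_iff_forall_dual_eq (R := ℝ)).2 fun β => ?_⟩
  obtain ⟨b, rfl⟩ := e.surjective β
  have h1 : (e b) ∘L B = e ⁅b, m⁆ := by
    rw [← hδ]
    have : D b = ⁅b, m⁆ := by rw [← hm]; rfl
    exact congrArg e this
  have h2 : e b (B y) = e ⁅b, m⁆ y := by rw [← h1]; rfl
  rw [h2, he, map_neg, map_neg, he.antisymm y (e b)]

/-- Triviality of the centre makes the coadjoint representation injective. One fixed linear left
inverse recovers the inner element from the operator at all base points simultaneously, so
smoothness in the base point is inherited. -/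
theorem exists_leftInverse [FiniteDimensional ℝ F] (hcenter : LieAlgebra.center ℝ 𝔤 = ⊥) :
    ∃ T : (F →L[ℝ] F) →L[ℝ] (F →L[ℝ] ℝ), ∀ m, T (Λ.flip m) = m := by
  have hinj : LinearMap.ker (Λ.flip : (F →L[ℝ] ℝ) →ₗ[ℝ] (F →L[ℝ] F)) = ⊥ := by
    rw [LinearMap.ker_eq_bot']
    intro m hm
    refine he.eq_zero_of_forall hcenter fun y γ => ?_
    have : Λ.flip m y = 0 := by
      have h1 : Λ.flip m = 0 := hm
      rw [h1, zero_apply]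
    rw [flip_apply] at this
    rw [this, map_zero]
  obtain ⟨g, hg⟩ := LinearMap.exists_leftInverse_of_injective _ hinj
  exact ⟨LinearMap.toContinuousLinearMap g, fun m => by simpa using LinearMap.congr_fun hg m⟩

/-- The Hamiltonian vectors `Λ y γ` span the fibre: a functional vanishing on all of them is
central, hence zero. -/
theorem forall_eq_of_range [FiniteDimensional ℝ F] (hcenter : LieAlgebra.center ℝ 𝔤 = ⊥)
    {Y : Type*} [AddCommGroup Y] [Module ℝ Y]
    {f g : F →ₗ[ℝ] Y} (hfg : ∀ y γ, f (Λ y γ) = g (Λ y γ)) : f = g := by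
  have hspan : Submodule.span ℝ {z | ∃ y γ, z = Λ y γ} = ⊤ := by
    by_contra hne
    obtain ⟨φ, hφ0, hφ⟩ := Submodule.exists_le_ker_of_lt_top _ (lt_top_iff_ne_top.2 hne)
    apply hφ0
    have h1 : LinearMap.toContinuousLinearMap φ = 0 := by
      refine he.eq_zero_of_forall hcenter fun y γ => ?_
      rw [he.antisymm]
      have : φ (Λ y γ) = 0 := hφ (Submodule.subset_span ⟨y, γ, rfl⟩)
      simp [this]
    simpa using h1
  refine LinearMap.ext_on hspan ?_
  rintro _ ⟨y, γ, rfl⟩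
  exact hfg y γ

variable {EB : Type*} [NormedAddCommGroup EB] [NormedSpace ℝ EB]
  {U : Set EB} {O : Set (EB × F)} {Q : EB × F → (EB × F →L[ℝ] ℝ) →L[ℝ] EB × F}
  {S : EB → (EB →L[ℝ] ℝ) →L[ℝ] EB}
  {A : EB → EB →L[ℝ] F →L[ℝ] F} {R : EB → F →L[ℝ] EB →L[ℝ] EB →L[ℝ] ℝ}

/-- For a flat model with centreless fibre whose derivations are inner, the linearization of a
Poisson tensor is a gauge transformation of the flat model. -/
theorem exists_gauge [FiniteDimensional ℝ F] (hcenter : LieAlgebra.center ℝ 𝔤 = ⊥)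
    (hH1 : Subsingleton (FirstCohomology 𝔤)) (h : JetData U O Q S (fun _ => Λ) A R)
    (hA : ContDiffOn ℝ ∞ A U) :
    ∃ μ : EB → EB →L[ℝ] F →L[ℝ] ℝ, LocalModelData U S Λ μ ∧
      (∀ ξ ∈ U, ∀ u y, A ξ u y = Λ y (μ ξ u)) ∧
      ∀ ξ ∈ U, ∀ x, R ξ x = -muDiff μ (ξ, x) + muBracket Λ (μ ξ) x := by
  obtain ⟨T, hT⟩ := he.exists_leftInverse hcenter
  have hAm : ∀ ξ ∈ U, ∀ u, ∃ m : F →L[ℝ] ℝ, ∀ y, A ξ u y = Λ y m := by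
    intro ξ hξ u
    refine he.exists_inner hH1 fun y β γ => ?_
    have := h.connection_vert hξ u y β γ
    simp at this
    linarith
  have hAμ : ∀ ξ ∈ U, ∀ u y, A ξ u y = Λ y (T (A ξ u)) := by
    intro ξ hξ u y
    obtain ⟨m, hm⟩ := hAm ξ hξ u
    have : A ξ u = Λ.flip m := by ext1 y; exact hm y
    rw [this, hT]; rfl
  have hAt : ∀ ξ ∈ U, ContDiffAt ℝ ∞ A ξ := fun ξ hξ => hA.contDiffAt (h.isOpen.mem_nhds hξ)
  -- The one-form `μ` is the image of the connection form under the fixed left inverse `T`.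
  refine ⟨fun ξ => T ∘L A ξ, ?_, hAμ, ?_⟩
  · exact
    { isOpen := h.isOpen
      base_smooth := fun ξ hξ => (h.contDiffAt_base hξ).contDiffWithinAt
      base_inv := h.inv
      base_antisymm := fun ξ hξ => h.base_antisymm hξ
      base_jacobi := fun ξ hξ => h.base_jacobi hξ
      fib_antisymm := he.antisymm
      fib_jacobi := he.jacobi
      form_smooth := contDiffOn_const.clm_comp hA }
  · intro ξ hξ x
    set μ : EB → EB →L[ℝ] F →L[ℝ] ℝ := fun ξ => T ∘L A ξ with hμ
    have hAd := (hAt ξ hξ).differentiableAt (by simp)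
    have hμd : ∀ u v, fderiv ℝ μ ξ u v = T (fderiv ℝ A ξ u v) := by
      intro u v
      have h1 : HasFDerivAt μ _ ξ := (hasFDerivAt_const T ξ).clm_comp hAd.hasFDerivAt
      rw [h1.fderiv]
      simp
    have hdA : ∀ u v y, fderiv ℝ A ξ u v y = Λ y (fderiv ℝ μ ξ u v) := by
      intro u v y
      have h1 : HasFDerivAt (fun η => A η v y) _ ξ :=
        (hAd.hasFDerivAt.clm_apply (hasFDerivAt_const v ξ)).clm_apply (hasFDerivAt_const y ξ)
      have hμ' : DifferentiableAt ℝ μ ξ := ((hasFDerivAt_const T ξ).clm_comp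
        hAd.hasFDerivAt).differentiableAt
      have h2 : HasFDerivAt (fun η => Λ y (μ η v)) _ ξ :=
        (Λ y).hasFDerivAt.comp ξ (hμ'.hasFDerivAt.clm_apply (hasFDerivAt_const v ξ))
      have h3 := h1.unique (h2.congr_of_eventuallyEq (by
        filter_upwards [h.isOpen.mem_nhds hξ] with η hη using hAμ η hη v y))
      simpa using! congrArg (fun L => L u) h3
    -- For fixed `u` and `v` both sides are linear in the fibre point, so it is enough to compare
    -- them at the points `Λ y γ`, where the curvature identity evaluates `R`.
    suffices hlin : ∀ u v, ((R ξ).flip u).flip v =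
        (fderiv ℝ μ ξ v u - fderiv ℝ μ ξ u v) + μ ξ v ∘L Λ.flip (μ ξ u) by
      ext u v
      have := congrArg (fun L => L x) (hlin u v)
      simpa using! this
    intro u v
    apply ContinuousLinearMap.coe_injective
    refine he.forall_eq_of_range hcenter fun y γ => ?_
    have h1 := h.curvature_eq hξ hAd u v y γ
    have hAμ' : ∀ u y, A ξ u y = Λ y (μ ξ u) := hAμ ξ hξ
    rw [hdA, hdA, hAμ' u, hAμ' v, hAμ' u, hAμ' v] at h1
    -- The commutator of two coadjoint operators is rewritten by the Jacobi identity as the bracket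
    -- term at `Λ y γ`.
    have h2 := he.jacobi y γ (μ ξ u) (μ ξ v)
    have h3 := he.antisymm y γ (fderiv ℝ μ ξ v u)
    have h4 := he.antisymm y γ (fderiv ℝ μ ξ u v)
    have h5 := he.antisymm (Λ y (μ ξ v)) γ (μ ξ u)
    simp only [map_add, map_sub] at h1
    simp
    linarith

end IsLieIso

variable {EB : Type*} [NormedAddCommGroup EB] [NormedSpace ℝ EB]
  {S : EB → (EB →L[ℝ] ℝ) →L[ℝ] EB} {μ : EB → EB →L[ℝ] F →L[ℝ] ℝ}

/-- Eliminates `dμ` in favour of `R`. In this form the path of coupling forms involves only objects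
defined on the whole bundle; at `t = 1` the bracket term disappears and the linearized coupling form
remains. -/
theorem localCoupling_eq {R₀ : EB →L[ℝ] EB →L[ℝ] ℝ} {q : EB × F}
    (hR : R₀ = -muDiff μ q + muBracket Λ (μ q.1) q.2) (t : ℝ) :
    localCoupling S Λ μ t q =
      -(S q.1).inverse - t • R₀ + (t - t ^ 2) • muBracket Λ (μ q.1) q.2 := by
  rw [localCoupling, hR]
  module

end LieAlgebra

/-! ### Tangent vectors of the total space in the preferred charts. -/

section TotalSpaceGeometry

set_option maxSynthPendingDepth 3

variable {EB : Type*} [NormedAddCommGroup EB] [NormedSpace ℝ EB]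
  {B : Type*} [TopologicalSpace B] [ChartedSpace EB B]
  {F : Type*} [NormedAddCommGroup F] [NormedSpace ℝ F]
  {E : B → Type*} [∀ b, AddCommGroup (E b)] [∀ b, Module ℝ (E b)]
  [∀ b, TopologicalSpace (E b)]
  [TopologicalSpace (TotalSpace F E)]
  [FiberBundle F E] [VectorBundle ℝ F E]

theorem extChartAt_totalSpace_snd (p p' : TotalSpace F E) :
    (extChartAt (𝓘(ℝ, EB).prod 𝓘(ℝ, F)) p p').2 = (trivializationAt F E p.proj p').2 := by
  rw [FiberBundle.extChartAt]
  rfl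

theorem extChartAt_totalSpace_fst (p : TotalSpace F E) {p' : TotalSpace F E}
    (hp' : p'.proj ∈ (trivializationAt F E p.proj).baseSet) :
    (extChartAt (𝓘(ℝ, EB).prod 𝓘(ℝ, F)) p p').1 = extChartAt 𝓘(ℝ, EB) p.proj p'.proj := by
  rw [FiberBundle.extChartAt]
  exact congrArg _ (Trivialization.coe_fst' _ hp')

theorem dproj_apply (p : TotalSpace F E)
    (v : TangentSpace (𝓘(ℝ, EB).prod 𝓘(ℝ, F)) p) :
    dproj p v = (show EB × F from v).1 := by
  have h1 : HasMFDerivAt (𝓘(ℝ, EB).prod 𝓘(ℝ, F)) 𝓘(ℝ, EB)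
      (TotalSpace.proj : TotalSpace F E → B) p (ContinuousLinearMap.fst ℝ EB F) := by
    refine ⟨(FiberBundle.continuous_proj F E).continuousAt, ?_⟩
    refine (hasFDerivAt_fst (𝕜 := ℝ) (E := EB) (F := F)).hasFDerivWithinAt.congr_of_eventuallyEq ?_ ?_
    · filter_upwards [self_mem_nhdsWithin, nhdsWithin_le_nhds (extChartAt_target_mem_nhds p)]
        with y hy1 hy2
      have h3 := (extChartAt (𝓘(ℝ, EB).prod 𝓘(ℝ, F)) p).right_inv hy2
      have h4 := (extChartAt (𝓘(ℝ, EB).prod 𝓘(ℝ, F)) p).map_target hy2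
      rw [FiberBundle.extChartAt, PartialEquiv.trans_source] at h4
      have h5 := (trivializationAt F E p.proj).mem_source.1 h4.1
      rw [← FiberBundle.extChartAt] at h5
      exact (extChartAt_totalSpace_fst p h5).symm.trans (congrArg Prod.fst h3)
    · have h3 : (extChartAt (𝓘(ℝ, EB).prod 𝓘(ℝ, F)) p).symm (extChartAt (𝓘(ℝ, EB).prod 𝓘(ℝ, F)) p p)
          = p := (extChartAt (𝓘(ℝ, EB).prod 𝓘(ℝ, F)) p).left_inv (mem_extChartAt_source p)
      simp only [writtenInExtChartAt, Function.comp_apply, h3]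
      exact (extChartAt_totalSpace_fst p (FiberBundle.mem_baseSet_trivializationAt' _)).symm
  exact congrArg (fun L => L v) h1.mfderiv

theorem vertLift_apply (p : TotalSpace F E) (y : E p.proj) :
    vertLift EB p y = ((0, (trivializationAt F E p.proj).continuousLinearMapAt ℝ p.proj y) : EB × F) :=
  rfl

theorem vertCoord_apply (p : TotalSpace F E) (v : TangentSpace (𝓘(ℝ, EB).prod 𝓘(ℝ, F)) p) :
    vertCoord EB p v = (trivializationAt F E p.proj).symmL ℝ p.proj (show EB × F from v).2 :=
  rfl

theorem vertCoord_vertLift (p : TotalSpace F E) (y : E p.proj) :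
    vertCoord EB p (vertLift EB p y) = y := by
  rw [vertCoord_apply, vertLift_apply]
  exact Trivialization.symmL_continuousLinearMapAt _ (FiberBundle.mem_baseSet_trivializationAt' _) y

/-- The fibre inclusion composed with a linear map into the fibre. -/
theorem hasMFDerivAt_fibre {F' : Type*} [NormedAddCommGroup F'] [NormedSpace ℝ F'] (b : B)
    (L : F' →L[ℝ] E b) (x : F') :
    HasMFDerivAt 𝓘(ℝ, F') (𝓘(ℝ, EB).prod 𝓘(ℝ, F)) (fun x => (⟨b, L x⟩ : TotalSpace F E)) x
      (vertLift EB (⟨b, L x⟩ : TotalSpace F E) ∘L L) := by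
  refine ⟨((FiberBundle.totalSpaceMk_isInducing F E b).continuous.comp L.continuous).continuousAt, ?_⟩
  set T := (trivializationAt F E b).continuousLinearMapAt ℝ b ∘L L with hT
  have h1 : HasFDerivAt (fun x : F' => ((extChartAt 𝓘(ℝ, EB) b b, T x) : EB × F))
      ((0 : F' →L[ℝ] EB).prod T) x := (hasFDerivAt_const _ _).prodMk T.hasFDerivAt
  have h2 : writtenInExtChartAt 𝓘(ℝ, F') (𝓘(ℝ, EB).prod 𝓘(ℝ, F)) x
      (fun x => (⟨b, L x⟩ : TotalSpace F E)) =
      fun x : F' => ((extChartAt 𝓘(ℝ, EB) b b, T x) : EB × F) := by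
    ext1 y
    refine Prod.ext
      (extChartAt_totalSpace_fst ⟨b, L x⟩ (FiberBundle.mem_baseSet_trivializationAt' b)) ?_
    refine (extChartAt_totalSpace_snd ⟨b, L x⟩ _).trans ?_
    simp only [hT, ContinuousLinearMap.comp_apply, Trivialization.continuousLinearMapAt_apply]
    rw [Trivialization.coe_linearMapAt_of_mem _ (FiberBundle.mem_baseSet_trivializationAt' b)]
    rfl
  rw [h2]
  exact h1.hasFDerivWithinAt

/-- The fibre component of the derivative of a map into the total space. -/
theorem hasMFDerivAt_snd_trivializationAt {V : Type*} [NormedAddCommGroup V] [NormedSpace ℝ V]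
    {H : Type*} [TopologicalSpace H] {I : ModelWithCorners ℝ V H}
    {X : Type*} [TopologicalSpace X] [ChartedSpace H X] {g : X → TotalSpace F E} {x : X}
    (hg : MDifferentiableAt I (𝓘(ℝ, EB).prod 𝓘(ℝ, F)) g x) :
    HasMFDerivAt I 𝓘(ℝ, F) (fun x' => (trivializationAt F E (g x).proj (g x')).2) x
      (ContinuousLinearMap.snd ℝ EB F ∘L
        (mfderiv I (𝓘(ℝ, EB).prod 𝓘(ℝ, F)) g x : V →L[ℝ] EB × F)) := by
  have hg' := hg.hasMFDerivAt
  refine ⟨?_, ?_⟩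
  · have := (mdifferentiableAt_totalSpace 𝓘(ℝ, EB) g).1 hg
    exact this.2.continuousAt
  · have h1 := hg'.2.snd
    refine h1.congr_of_eventuallyEq ?_ ?_
    · exact Filter.Eventually.of_forall fun y => (extChartAt_totalSpace_snd (g x) _).symm
    · exact (extChartAt_totalSpace_snd (g x) _).symm

end TotalSpaceGeometry

/-! ### Independence of the horizontal lift from the section that computes it. -/

section Connections

set_option maxSynthPendingDepth 3

variable {EB : Type*} [NormedAddCommGroup EB] [NormedSpace ℝ EB]
  {B : Type*} [TopologicalSpace B] [ChartedSpace EB B]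
  {F : Type*} [NormedAddCommGroup F] [NormedSpace ℝ F]
  {E : B → Type*} [∀ b, AddCommGroup (E b)] [∀ b, Module ℝ (E b)]
  [∀ b, TopologicalSpace (E b)] [∀ b, IsTopologicalAddGroup (E b)]
  [∀ b, ContinuousSMul ℝ (E b)] [TopologicalSpace (TotalSpace F E)]
  [FiberBundle F E] [VectorBundle ℝ F E]

/-- The derivative of a section, as a vector of the total space. -/
def sectionDeriv (s : ∀ b, E b) (b : B) :
    TangentSpace 𝓘(ℝ, EB) b →L[ℝ]
      TangentSpace (𝓘(ℝ, EB).prod 𝓘(ℝ, F)) (⟨b, s b⟩ : TotalSpace F E) :=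
  mfderiv 𝓘(ℝ, EB) (𝓘(ℝ, EB).prod 𝓘(ℝ, F)) (fun b => TotalSpace.mk' F b (s b)) b

theorem dproj_sectionDeriv {s : ∀ b, E b} {b : B}
    (hs : MDifferentiableAt 𝓘(ℝ, EB) (𝓘(ℝ, EB).prod 𝓘(ℝ, F))
      (fun b => TotalSpace.mk' F b (s b)) b) (w : TangentSpace 𝓘(ℝ, EB) b) :
    dproj (⟨b, s b⟩ : TotalSpace F E) (sectionDeriv s b w) = w := by
  have h1 : MDifferentiableAt (𝓘(ℝ, EB).prod 𝓘(ℝ, F)) 𝓘(ℝ, EB)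
      (TotalSpace.proj : TotalSpace F E → B) (⟨b, s b⟩ : TotalSpace F E) :=
    Bundle.mdifferentiableAt_proj E
  have h2 := mfderiv_comp b h1 hs
  have h3 : (TotalSpace.proj : TotalSpace F E → B) ∘ (fun b => TotalSpace.mk' F b (s b)) = id := rfl
  rw [h3, mfderiv_id] at h2
  exact (congrArg (fun L => L w) h2).symm

theorem vertCoord_sectionDeriv {s : ∀ b, E b} {b : B}
    (hs : MDifferentiableAt 𝓘(ℝ, EB) (𝓘(ℝ, EB).prod 𝓘(ℝ, F))
      (fun b => TotalSpace.mk' F b (s b)) b) (w : TangentSpace 𝓘(ℝ, EB) b) :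
    vertCoord EB (⟨b, s b⟩ : TotalSpace F E) (sectionDeriv s b w) =
      (trivializationAt F E b).symmL ℝ b
        (mvfderiv 𝓘(ℝ, EB) (fun b' => (trivializationAt F E b ⟨b', s b'⟩).2) b w) := by
  have h1 := (hasMFDerivAt_snd_trivializationAt hs).mfderiv
  rw [vertCoord_apply]
  congr 1
  exact (congrArg (fun L => L w) h1).symm

omit [∀ b, IsTopologicalAddGroup (E b)] [∀ b, ContinuousSMul ℝ (E b)] [VectorBundle ℝ F E]
  [∀ b, AddCommGroup (E b)] [∀ b, Module ℝ (E b)] [∀ b, TopologicalSpace (E b)]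
  [TopologicalSpace (TotalSpace F E)] [FiberBundle F E] in
theorem mvfderiv_congr_of_eventuallyEq {f g : B → F} {b : B} (h : f =ᶠ[𝓝 b] g) :
    mvfderiv 𝓘(ℝ, EB) f b = mvfderiv 𝓘(ℝ, EB) g b := by
  have h1 : mfderiv 𝓘(ℝ, EB) 𝓘(ℝ, F) f b = mfderiv 𝓘(ℝ, EB) 𝓘(ℝ, F) g b := h.mfderiv_eq
  ext w
  exact congrArg (fun L => L w) h1

/-- Differentiating the fibre component in the trivialization preferred at each point is additive
and satisfies the Leibniz rule. No smoothness in the point is claimed; the operator serves only as a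
reference for differences of covariant derivatives. -/
theorem isCovariantDerivativeOn_vertCoord :
    IsCovariantDerivativeOn F (fun (s : ∀ b, E b) (b : B) =>
      vertCoord EB (⟨b, s b⟩ : TotalSpace F E) ∘L sectionDeriv s b) Set.univ where
  add {σ σ' x} hσ hσ' _ := by
    ext1 w
    have hadd : MDifferentiableAt 𝓘(ℝ, EB) (𝓘(ℝ, EB).prod 𝓘(ℝ, F))
      (fun b => TotalSpace.mk' F b ((σ + σ') b)) x := mdifferentiableAt_add_section hσ hσ'
    rw [ContinuousLinearMap.comp_apply, vertCoord_sectionDeriv hadd, add_apply,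
      ContinuousLinearMap.comp_apply, ContinuousLinearMap.comp_apply,
      vertCoord_sectionDeriv hσ, vertCoord_sectionDeriv hσ', ← map_add]
    congr 1
    have h1 := (mdifferentiableAt_section 𝓘(ℝ, EB) σ).1 hσ
    have h2 := (mdifferentiableAt_section 𝓘(ℝ, EB) σ').1 hσ'
    rw [← add_apply, ← mvfderiv_fun_add h1 h2]
    congr 1
    refine mvfderiv_congr_of_eventuallyEq ?_
    filter_upwards [(trivializationAt F E x).open_baseSet.mem_nhds
      (FiberBundle.mem_baseSet_trivializationAt' x)] with b hb
    exact ((trivializationAt F E x).linear ℝ hb).map_add _ _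
  leibniz {σ g x} hσ hg _ := by
    ext1 w
    have hsm : MDifferentiableAt 𝓘(ℝ, EB) (𝓘(ℝ, EB).prod 𝓘(ℝ, F))
      (fun b => TotalSpace.mk' F b ((g • σ) b)) x := MDifferentiableAt.smul_section hg hσ
    rw [ContinuousLinearMap.comp_apply, vertCoord_sectionDeriv hsm, add_apply,
      smul_apply, ContinuousLinearMap.comp_apply,
      vertCoord_sectionDeriv hσ]
    have h1 := (mdifferentiableAt_section 𝓘(ℝ, EB) σ).1 hσ
    have hx := FiberBundle.mem_baseSet_trivializationAt' (F := F) (E := E) x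
    have h2 : mvfderiv 𝓘(ℝ, EB) (fun b' => (trivializationAt F E x ⟨b', (g • σ) b'⟩).2) x =
        mvfderiv 𝓘(ℝ, EB) (fun b' => g b' • (trivializationAt F E x ⟨b', σ b'⟩).2) x := by
      refine mvfderiv_congr_of_eventuallyEq ?_
      filter_upwards [(trivializationAt F E x).open_baseSet.mem_nhds hx] with b hb
      exact ((trivializationAt F E x).linear ℝ hb).map_smul _ _
    rw [h2, mvfderiv_fun_smul hg h1, add_apply, smul_apply, map_add, map_smul,
      ContinuousLinearMap.smulRight_apply, ContinuousLinearMap.smulRight_apply, map_smul]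
    congr 2
    have h3 := Trivialization.symmL_continuousLinearMapAt (R := ℝ) (trivializationAt F E x) hx (σ x)
    rwa [Trivialization.continuousLinearMapAt_apply,
      Trivialization.coe_linearMapAt_of_mem _ hx] at h3

variable [FiniteDimensional ℝ F] [IsManifold 𝓘(ℝ, EB) 1 B] [ContMDiffVectorBundle 1 F E 𝓘(ℝ, EB)]

/-- The horizontal lift is computed by any differentiable section. -/
theorem horLift_eq_of_section (D : CovariantDerivative 𝓘(ℝ, EB) F E) {s : ∀ b, E b} {b : B}
    (hs : MDifferentiableAt 𝓘(ℝ, EB) (𝓘(ℝ, EB).prod 𝓘(ℝ, F))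
      (fun b => TotalSpace.mk' F b (s b)) b) (w : TangentSpace 𝓘(ℝ, EB) b) :
    horLift D (⟨b, s b⟩ : TotalSpace F E) w =
      sectionDeriv s b w - vertLift EB (⟨b, s b⟩ : TotalSpace F E) (D s b w) := by
  set x := FiberBundle.extend F (s b) with hx
  have hxb : x b = s b := FiberBundle.extend_apply_self F (s b)
  have hxd := FiberBundle.mdifferentiableAt_extend 𝓘(ℝ, EB) F (s b)
  -- The difference of two covariant derivatives is tensorial: it depends only on the value of the
  -- section at the point, which `s` shares with the extension chosen in `horLift`.
  have key := (IsCovariantDerivativeOn.difference_apply D.isCovariantDerivativeOnUniv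
    isCovariantDerivativeOn_vertCoord (by trivial) hxd).symm.trans ((congrArg _ hxb).trans
    (IsCovariantDerivativeOn.difference_apply D.isCovariantDerivativeOnUniv
    isCovariantDerivativeOn_vertCoord (by trivial) hs))
  have hb := FiberBundle.mem_baseSet_trivializationAt' (F := F) (E := E) b
  have key' := congrArg (fun L => (trivializationAt F E b).continuousLinearMapAt ℝ b (L w)) key
  simp only [sub_apply, ContinuousLinearMap.comp_apply, map_sub, vertCoord_apply,
    Trivialization.continuousLinearMapAt_symmL _ hb] at key'
  have e1 := dproj_sectionDeriv hs w
  have e2 := dproj_sectionDeriv hxd w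
  rw [dproj_apply] at e1 e2
  set v₁ : EB × F := sectionDeriv x b w with hv₁
  set v₂ : EB × F := sectionDeriv s b w with hv₂
  refine Prod.ext (x := v₁ - ((0, _) : EB × F)) (y := v₂ - ((0, _) : EB × F)) ?_ ?_
  · simp only [Prod.fst_sub]
    exact congrArg (fun z : EB => z - 0) (e2.trans e1.symm)
  · simp only [Prod.snd_sub]
    have h := congrArg Neg.neg key'
    rw [neg_sub, neg_sub] at h
    exact h

end Connections

/-! ### Local frames of the bundle over charts of the base. -/

section Frames

set_option maxSynthPendingDepth 3

variable (EB : Type*) [NormedAddCommGroup EB] [NormedSpace ℝ EB]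
  {B : Type*} [TopologicalSpace B] [ChartedSpace EB B]
  (F : Type*) [NormedAddCommGroup F] [NormedSpace ℝ F]
  (E : B → Type*) [∀ b, AddCommGroup (E b)] [∀ b, Module ℝ (E b)]
  [∀ b, TopologicalSpace (E b)] [TopologicalSpace (TotalSpace F E)]
  [FiberBundle F E] [VectorBundle ℝ F E]

/-- A local chart of the base together with a smooth frame of the bundle over its domain. -/
structure BundleFrame where
  /-- the domain of the parametrization of the base -/
  dom : Set EB
  /-- the image of the parametrization of the base -/
  img : Set B
  /-- the parametrization of the base -/
  base : EB → B
  /-- its inverse -/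
  chart : B → EB
  /-- the frame -/
  fib : ∀ b, F →L[ℝ] E b
  /-- its inverse -/
  coord : ∀ b, E b →L[ℝ] F
  isOpen_dom : IsOpen dom
  isOpen_img : IsOpen img
  base_mem : ∀ ξ ∈ dom, base ξ ∈ img
  chart_mem : ∀ b ∈ img, chart b ∈ dom
  chart_base : ∀ ξ ∈ dom, chart (base ξ) = ξ
  base_chart : ∀ b ∈ img, base (chart b) = b
  coord_fib : ∀ b ∈ img, ∀ x, coord b (fib b x) = x
  fib_coord : ∀ b ∈ img, ∀ y, fib b (coord b y) = y
  contMDiffOn_tot : ContMDiffOn 𝓘(ℝ, EB × F) (𝓘(ℝ, EB).prod 𝓘(ℝ, F)) ∞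
    (fun q : EB × F => (⟨base q.1, fib (base q.1) q.2⟩ : TotalSpace F E)) (dom ×ˢ univ)
  contMDiffOn_inv : ContMDiffOn (𝓘(ℝ, EB).prod 𝓘(ℝ, F)) 𝓘(ℝ, EB × F) ∞
    (fun p : TotalSpace F E => ((chart p.proj, coord p.proj p.2) : EB × F))
    (TotalSpace.proj ⁻¹' img)

variable {EB F E}

namespace BundleFrame

variable (φ : BundleFrame EB F E)

/-- The parametrization of the total space. -/
def tot (q : EB × F) : TotalSpace F E := ⟨φ.base q.1, φ.fib (φ.base q.1) q.2⟩

/-- The inverse of the parametrization of the total space. -/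
def inv (p : TotalSpace F E) : EB × F := (φ.chart p.proj, φ.coord p.proj p.2)

/-- The domain of the parametrization of the total space. -/
def source : Set (EB × F) := φ.dom ×ˢ univ

/-- The image of the parametrization of the total space. -/
def target : Set (TotalSpace F E) := TotalSpace.proj ⁻¹' φ.img

variable {φ}

theorem isOpen_source : IsOpen φ.source := φ.isOpen_dom.prod isOpen_univ

theorem isOpen_target : IsOpen φ.target :=
  φ.isOpen_img.preimage (FiberBundle.continuous_proj F E)

theorem mem_source {q : EB × F} : q ∈ φ.source ↔ q.1 ∈ φ.dom := by simp [source]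

theorem tot_mem {q : EB × F} (hq : q ∈ φ.source) : φ.tot q ∈ φ.target := φ.base_mem _ hq.1

theorem inv_mem {p : TotalSpace F E} (hp : p ∈ φ.target) : φ.inv p ∈ φ.source :=
  ⟨φ.chart_mem _ hp, trivial⟩

theorem inv_tot {q : EB × F} (hq : q ∈ φ.source) : φ.inv (φ.tot q) = q :=
  Prod.ext (φ.chart_base _ hq.1) (φ.coord_fib _ (φ.base_mem _ hq.1) _)

theorem tot_inv {p : TotalSpace F E} (hp : p ∈ φ.target) : φ.tot (φ.inv p) = p := by
  obtain ⟨b, y⟩ := p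
  have h1 : φ.base (φ.chart b) = b := φ.base_chart b hp
  have h2 : φ.fib b (φ.coord b y) = y := φ.fib_coord b hp y
  have h3 : ∀ b', b' = b → (⟨b', φ.fib b' (φ.coord b y)⟩ : TotalSpace F E) =
      ⟨b, φ.fib b (φ.coord b y)⟩ := by
    rintro _ rfl; rfl
  exact (h3 _ h1).trans (by rw [h2])

theorem tot_zero (ξ : EB) : φ.tot (ξ, 0) = ⟨φ.base ξ, 0⟩ := by simp [tot]

theorem contMDiffAt_tot {q : EB × F} (hq : q ∈ φ.source) :
    ContMDiffAt 𝓘(ℝ, EB × F) (𝓘(ℝ, EB).prod 𝓘(ℝ, F)) ∞ φ.tot q :=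
  φ.contMDiffOn_tot.contMDiffAt (φ.isOpen_source.mem_nhds hq)

theorem contMDiffAt_inv {p : TotalSpace F E} (hp : p ∈ φ.target) :
    ContMDiffAt (𝓘(ℝ, EB).prod 𝓘(ℝ, F)) 𝓘(ℝ, EB × F) ∞ φ.inv p :=
  φ.contMDiffOn_inv.contMDiffAt (φ.isOpen_target.mem_nhds hp)

variable (φ) in
/-- The derivative of the parametrization of the total space. -/
def dtot (q : EB × F) : EB × F →L[ℝ] TangentSpace (𝓘(ℝ, EB).prod 𝓘(ℝ, F)) (φ.tot q) :=
  mfderiv 𝓘(ℝ, EB × F) (𝓘(ℝ, EB).prod 𝓘(ℝ, F)) φ.tot q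

variable (φ) in
/-- The derivative of the parametrization of the base. -/
def dbase (ξ : EB) : EB →L[ℝ] TangentSpace 𝓘(ℝ, EB) (φ.base ξ) :=
  mfderiv 𝓘(ℝ, EB) 𝓘(ℝ, EB) φ.base ξ

theorem hasMFDerivAt_tot {q : EB × F} (hq : q ∈ φ.source) :
    HasMFDerivAt 𝓘(ℝ, EB × F) (𝓘(ℝ, EB).prod 𝓘(ℝ, F)) φ.tot q (φ.dtot q) :=
  ((contMDiffAt_tot hq).mdifferentiableAt (by simp)).hasMFDerivAt

/-- The derivative of the parametrization of the total space is invertible. -/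
theorem isInvertible_dtot {q : EB × F} (hq : q ∈ φ.source) : (φ.dtot q).IsInvertible := by
  have h1 := hasMFDerivAt_tot hq
  have h2 := ((contMDiffAt_inv (tot_mem hq)).mdifferentiableAt (by simp)).hasMFDerivAt
  have h2' : HasMFDerivAt (𝓘(ℝ, EB).prod 𝓘(ℝ, F)) 𝓘(ℝ, EB × F) φ.inv (φ.tot q) _ := h2
  have h12 := (h2'.comp q h1).mfderiv
  have h3 : φ.inv ∘ φ.tot =ᶠ[𝓝 q] id := by
    filter_upwards [φ.isOpen_source.mem_nhds hq] with x hx using inv_tot hx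
  rw [h3.mfderiv_eq, mfderiv_id] at h12
  have h1' : HasMFDerivAt 𝓘(ℝ, EB × F) (𝓘(ℝ, EB).prod 𝓘(ℝ, F)) φ.tot (φ.inv (φ.tot q))
    (φ.dtot q) := by rw [inv_tot hq]; exact h1
  have h21 := (h1'.comp (φ.tot q) h2').mfderiv
  have h4 : φ.tot ∘ φ.inv =ᶠ[𝓝 (φ.tot q)] id := by
    filter_upwards [φ.isOpen_target.mem_nhds (tot_mem hq)] with x hx using tot_inv hx
  rw [h4.mfderiv_eq, mfderiv_id] at h21
  exact ⟨ContinuousLinearEquiv.equivOfInverse (φ.dtot q) _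
    (fun v => (congrArg (fun L => L v) h12).symm) (fun v => (congrArg (fun L => L v) h21).symm), rfl⟩

theorem contMDiffAt_base {ξ : EB} (hξ : ξ ∈ φ.dom) :
    ContMDiffAt 𝓘(ℝ, EB) 𝓘(ℝ, EB) ∞ φ.base ξ := by
  have h1 : ContMDiffAt 𝓘(ℝ, EB) 𝓘(ℝ, EB × F) ∞ (fun η : EB => ((η, 0) : EB × F)) ξ :=
    (contDiffAt_id.prodMk contDiffAt_const).contMDiffAt
  have h2 := (contMDiffAt_tot (φ := φ) (q := (ξ, 0)) ⟨hξ, trivial⟩).comp ξ h1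
  exact (Bundle.contMDiff_proj E).contMDiffAt.comp ξ h2

theorem contMDiffAt_chart {b : B} (hb : b ∈ φ.img) :
    ContMDiffAt 𝓘(ℝ, EB) 𝓘(ℝ, EB) ∞ φ.chart b := by
  have h1 : ContMDiffAt 𝓘(ℝ, EB) (𝓘(ℝ, EB).prod 𝓘(ℝ, F)) ∞ (zeroSection F E) b :=
    (contMDiff_zeroSection ℝ E).contMDiffAt
  have h2 := (contMDiffAt_inv (φ := φ) (p := zeroSection F E b) hb).comp b h1
  exact contDiff_fst.contMDiff.contMDiffAt.comp b h2

theorem hasMFDerivAt_base {ξ : EB} (hξ : ξ ∈ φ.dom) :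
    HasMFDerivAt 𝓘(ℝ, EB) 𝓘(ℝ, EB) φ.base ξ (φ.dbase ξ) :=
  ((contMDiffAt_base hξ).mdifferentiableAt (by simp)).hasMFDerivAt

theorem isInvertible_dbase {ξ : EB} (hξ : ξ ∈ φ.dom) : (φ.dbase ξ).IsInvertible := by
  have h1 := hasMFDerivAt_base hξ
  have h2 := ((contMDiffAt_chart (φ.base_mem _ hξ)).mdifferentiableAt (by simp)).hasMFDerivAt
  have h12 := (h2.comp ξ h1).mfderiv
  have h3 : φ.chart ∘ φ.base =ᶠ[𝓝 ξ] id := by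
    filter_upwards [φ.isOpen_dom.mem_nhds hξ] with x hx using φ.chart_base x hx
  rw [h3.mfderiv_eq, mfderiv_id] at h12
  have h1' : HasMFDerivAt 𝓘(ℝ, EB) 𝓘(ℝ, EB) φ.base (φ.chart (φ.base ξ))
    (φ.dbase ξ) := by rw [φ.chart_base ξ hξ]; exact h1
  have h21 := (h1'.comp (φ.base ξ) h2).mfderiv
  have h4 : φ.base ∘ φ.chart =ᶠ[𝓝 (φ.base ξ)] id := by
    filter_upwards [φ.isOpen_img.mem_nhds (φ.base_mem _ hξ)] with x hx using φ.base_chart x hx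
  rw [h4.mfderiv_eq, mfderiv_id] at h21
  exact ⟨ContinuousLinearEquiv.equivOfInverse (φ.dbase ξ) _
    (fun v => (congrArg (fun L => L v) h12).symm) (fun v => (congrArg (fun L => L v) h21).symm), rfl⟩

theorem dproj_dtot {q : EB × F} (hq : q ∈ φ.source) (v : EB × F) :
    dproj (φ.tot q) (φ.dtot q v) = φ.dbase q.1 v.1 := by
  have h1 : HasMFDerivAt (𝓘(ℝ, EB).prod 𝓘(ℝ, F)) 𝓘(ℝ, EB)
      (TotalSpace.proj : TotalSpace F E → B) (φ.tot q) (dproj (φ.tot q)) := by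
    have : MDifferentiableAt (𝓘(ℝ, EB).prod 𝓘(ℝ, F)) 𝓘(ℝ, EB)
      (TotalSpace.proj : TotalSpace F E → B) (φ.tot q) := Bundle.mdifferentiableAt_proj E
    exact this.hasMFDerivAt
  have h2 := (h1.comp q (hasMFDerivAt_tot (φ := φ) hq)).mfderiv
  have h3 : HasMFDerivAt 𝓘(ℝ, EB × F) 𝓘(ℝ, EB) (Prod.fst : EB × F → EB) q
    (ContinuousLinearMap.fst ℝ EB F) := hasFDerivAt_fst.hasMFDerivAt
  have h4 := ((hasMFDerivAt_base (φ := φ) hq.1).comp q h3).mfderiv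
  exact congrArg (fun L => L v) (h2.symm.trans h4)

theorem dtot_inr {q : EB × F} (hq : q ∈ φ.source) (y : F) :
    φ.dtot q (0, y) = vertLift EB (φ.tot q) (φ.fib (φ.base q.1) y) := by
  have h1 : HasMFDerivAt 𝓘(ℝ, F) 𝓘(ℝ, EB × F) (fun x : F => ((q.1, x) : EB × F)) q.2
    (ContinuousLinearMap.inr ℝ EB F) :=
    ((hasFDerivAt_const q.1 q.2).prodMk (hasFDerivAt_id q.2)).hasMFDerivAt
  have h2 : HasMFDerivAt 𝓘(ℝ, EB × F) (𝓘(ℝ, EB).prod 𝓘(ℝ, F)) φ.tot (q.1, q.2) (φ.dtot q) :=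
    hasMFDerivAt_tot hq
  have h3 := (h2.comp q.2 h1).mfderiv
  have h4 := (hasMFDerivAt_fibre (EB := EB) (F := F) (φ.base q.1) (φ.fib (φ.base q.1)) q.2).mfderiv
  exact congrArg (fun L => L y) (h3.symm.trans h4)

end BundleFrame

end Frames

/-! ### Expressions of forms and tensors in a frame. -/

section LocalTensors

set_option maxSynthPendingDepth 3

open ContinuousLinearMap

variable {EB : Type*} [NormedAddCommGroup EB] [NormedSpace ℝ EB]
  {B : Type*} [TopologicalSpace B] [ChartedSpace EB B]
  {F : Type*} [NormedAddCommGroup F] [NormedSpace ℝ F]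
  {E : B → Type*} [∀ b, AddCommGroup (E b)] [∀ b, Module ℝ (E b)]
  [∀ b, TopologicalSpace (E b)] [∀ b, IsTopologicalAddGroup (E b)]
  [∀ b, ContinuousSMul ℝ (E b)] [TopologicalSpace (TotalSpace F E)]
  [FiberBundle F E] [VectorBundle ℝ F E]

namespace BundleFrame

variable (φ : BundleFrame EB F E)

/-- The expression of a form on the base in a frame. -/
def locForm (ξ : EB) (Φ : TangentSpace 𝓘(ℝ, EB) (φ.base ξ) →L[ℝ]
    TangentSpace 𝓘(ℝ, EB) (φ.base ξ) →L[ℝ] ℝ) : EB →L[ℝ] EB →L[ℝ] ℝ :=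
  precomp ℝ (φ.dbase ξ) ∘L Φ ∘L φ.dbase ξ

@[simp] theorem locForm_apply (ξ : EB) (Φ : TangentSpace 𝓘(ℝ, EB) (φ.base ξ) →L[ℝ]
    TangentSpace 𝓘(ℝ, EB) (φ.base ξ) →L[ℝ] ℝ) (u v : EB) :
    φ.locForm ξ Φ u v = Φ (φ.dbase ξ u) (φ.dbase ξ v) := rfl

/-- The expression of a linear vertical tensor in a frame. -/
def locVert (L : LinearVertTensor E) (ξ : EB) : F →L[ℝ] (F →L[ℝ] ℝ) →L[ℝ] F :=
  postcomp (F →L[ℝ] ℝ) (φ.coord (φ.base ξ)) ∘L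
    precomp (E (φ.base ξ)) (precomp ℝ (φ.coord (φ.base ξ))) ∘L L (φ.base ξ) ∘L φ.fib (φ.base ξ)

@[simp] theorem locVert_apply (L : LinearVertTensor E) (ξ : EB) (x : F) (α : F →L[ℝ] ℝ) :
    φ.locVert L ξ x α = φ.coord (φ.base ξ) (L (φ.base ξ) (φ.fib (φ.base ξ) x)
      (α ∘L φ.coord (φ.base ξ))) := rfl

/-- The expression of a form with values in the dual bundle in a frame. -/
def locDual (R : DualValuedForm EB E) (ξ : EB) : F →L[ℝ] EB →L[ℝ] EB →L[ℝ] ℝ :=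
  (precomp (EB →L[ℝ] ℝ) (φ.dbase ξ) ∘L postcomp (TangentSpace 𝓘(ℝ, EB) (φ.base ξ))
    (precomp ℝ (φ.dbase ξ))) ∘L R (φ.base ξ) ∘L φ.fib (φ.base ξ)

@[simp] theorem locDual_apply (R : DualValuedForm EB E) (ξ : EB) (x : F) (u v : EB) :
    φ.locDual R ξ x u v = R (φ.base ξ) (φ.fib (φ.base ξ) x) (φ.dbase ξ u) (φ.dbase ξ v) := rfl

/-- `T` is the expression in the frame, at the point `q`, of the tensor field `P`. -/
def IsLocal (P : TensorField₂ (𝓘(ℝ, EB).prod 𝓘(ℝ, F)) (TotalSpace F E)) (q : EB × F)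
    (T : (EB × F →L[ℝ] ℝ) →L[ℝ] EB × F) : Prop :=
  ∀ α, P (φ.tot q) α = φ.dtot q (T (α ∘L φ.dtot q))

/-- `A` is the connection form in the frame, at the point `ξ`, of the connection `D`. -/
def IsConnForm (D : CovariantDerivative 𝓘(ℝ, EB) F E) (ξ : EB) (A : EB →L[ℝ] F →L[ℝ] F) : Prop :=
  ∀ (x : F) (u : EB), horLift D (φ.tot (ξ, x)) (φ.dbase ξ u) = φ.dtot (ξ, x) (u, -A u x)

variable {φ}

theorem isInvertible_precomp {X Y : Type*} [NormedAddCommGroup X] [NormedSpace ℝ X]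
    [NormedAddCommGroup Y] [NormedSpace ℝ Y] {L : X →L[ℝ] Y} (hL : L.IsInvertible) :
    (precomp ℝ L : (Y →L[ℝ] ℝ) →L[ℝ] (X →L[ℝ] ℝ)).IsInvertible :=
  IsInvertible.of_inverse (g := (precomp ℝ L.inverse : (X →L[ℝ] ℝ) →L[ℝ] (Y →L[ℝ] ℝ)))
    (by ext a x; exact congrArg a (hL.inverse_apply_self x))
    (by ext a x; exact congrArg a (hL.self_apply_inverse x))

theorem inverse_locForm {ξ : EB} (hξ : ξ ∈ φ.dom) (Φ : TangentSpace 𝓘(ℝ, EB) (φ.base ξ) →L[ℝ]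
    TangentSpace 𝓘(ℝ, EB) (φ.base ξ) →L[ℝ] ℝ) (a : TangentSpace 𝓘(ℝ, EB) (φ.base ξ) →L[ℝ] ℝ) :
    Φ.inverse a = φ.dbase ξ ((φ.locForm ξ Φ).inverse (a ∘L φ.dbase ξ)) := by
  have h1 := isInvertible_dbase hξ
  have h2 : (precomp ℝ (φ.dbase ξ) : (TangentSpace 𝓘(ℝ, EB) (φ.base ξ) →L[ℝ] ℝ) →L[ℝ]
      (EB →L[ℝ] ℝ)).IsInvertible :=
    isInvertible_precomp (X := EB) (Y := EB) h1
  have h3 : (precomp ℝ (φ.dbase ξ) : (TangentSpace 𝓘(ℝ, EB) (φ.base ξ) →L[ℝ] ℝ) →L[ℝ]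
      (EB →L[ℝ] ℝ)).inverse (a ∘L φ.dbase ξ) = a := h2.inverse_apply_self a
  rw [locForm, h2.inverse_comp_apply_of_left, h1.inverse_comp_apply_of_right, h3,
    h1.self_apply_inverse]

theorem isInvertible_locForm {ξ : EB} (hξ : ξ ∈ φ.dom) (Φ : TangentSpace 𝓘(ℝ, EB) (φ.base ξ) →L[ℝ]
    TangentSpace 𝓘(ℝ, EB) (φ.base ξ) →L[ℝ] ℝ) :
    (φ.locForm ξ Φ).IsInvertible ↔ Φ.IsInvertible := by
  have h1 := isInvertible_dbase hξ
  have h2 : (precomp ℝ (φ.dbase ξ) : (TangentSpace 𝓘(ℝ, EB) (φ.base ξ) →L[ℝ] ℝ) →L[ℝ]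
      (EB →L[ℝ] ℝ)).IsInvertible :=
    isInvertible_precomp (X := EB) (Y := EB) h1
  obtain ⟨e, he⟩ := h1
  obtain ⟨e', he'⟩ := h2
  have h3 : φ.locForm ξ Φ = (e' : (TangentSpace 𝓘(ℝ, EB) (φ.base ξ) →L[ℝ] ℝ) →L[ℝ]
      (EB →L[ℝ] ℝ)) ∘L Φ ∘L (e : EB →L[ℝ] TangentSpace 𝓘(ℝ, EB) (φ.base ξ)) := by
    rw [he, he']; rfl
  rw [h3, isInvertible_equiv_comp, isInvertible_comp_equiv]

theorem fib_locVert {ξ : EB} (hξ : ξ ∈ φ.dom) (L : LinearVertTensor E) (x : F)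
    (γ : E (φ.base ξ) →L[ℝ] ℝ) :
    L (φ.base ξ) (φ.fib (φ.base ξ) x) γ =
      φ.fib (φ.base ξ) (φ.locVert L ξ x (γ ∘L φ.fib (φ.base ξ))) := by
  rw [locVert_apply, φ.fib_coord _ (φ.base_mem _ hξ)]
  congr 1
  ext y
  simp [φ.fib_coord _ (φ.base_mem _ hξ)]

/-- A common formula for the linearized tensor and the flat model: both are built from a horizontal
lift, a form on the base and the vertical tensor, and each ingredient is transported separately by
the derivative of the frame. -/
theorem isLocal_coupling {q : EB × F} (hq : q ∈ φ.source)
    {hor : TangentSpace 𝓘(ℝ, EB) (φ.base q.1) →L[ℝ]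
      TangentSpace (𝓘(ℝ, EB).prod 𝓘(ℝ, F)) (φ.tot q)}
    {hor' : EB →L[ℝ] EB × F} (hhor : ∀ u, hor (φ.dbase q.1 u) = φ.dtot q (hor' u))
    (Φ : TangentSpace 𝓘(ℝ, EB) (φ.base q.1) →L[ℝ] TangentSpace 𝓘(ℝ, EB) (φ.base q.1) →L[ℝ] ℝ)
    (L : LinearVertTensor E)
    (α : TangentSpace (𝓘(ℝ, EB).prod 𝓘(ℝ, F)) (φ.tot q) →L[ℝ] ℝ) :
    (horTensor (φ.tot q) hor Φ + vertLift EB (φ.tot q) ∘L L (φ.tot q).proj (φ.tot q).2 ∘L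
      precomp ℝ (vertLift EB (φ.tot q))) α =
    φ.dtot q ((-(hor' ∘L (φ.locForm q.1 Φ).inverse ∘L precomp ℝ hor') +
      inr ℝ EB F ∘L φ.locVert L q.1 q.2 ∘L precomp ℝ (inr ℝ EB F)) (α ∘L φ.dtot q)) := by
  have h1 : (α ∘L hor) ∘L φ.dbase q.1 = (α ∘L φ.dtot q) ∘L hor' := by
    ext u; exact congrArg α (hhor u)
  have h2 : (α ∘L vertLift EB (φ.tot q)) ∘L φ.fib (φ.base q.1) =
      (α ∘L φ.dtot q) ∘L inr ℝ EB F := by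
    ext y; exact congrArg α (dtot_inr hq y).symm
  have h3 : hor (Φ.inverse (α ∘L hor)) =
      φ.dtot q (hor' ((φ.locForm q.1 Φ).inverse ((α ∘L φ.dtot q) ∘L hor'))) := by
    rw [inverse_locForm (mem_source.1 hq), hhor, h1]
  have h4 : vertLift EB (φ.tot q) (L (φ.base q.1) (φ.fib (φ.base q.1) q.2)
      (α ∘L vertLift EB (φ.tot q))) =
      φ.dtot q (0, φ.locVert L q.1 q.2 ((α ∘L φ.dtot q) ∘L inr ℝ EB F)) := by
    rw [fib_locVert (mem_source.1 hq), dtot_inr hq, ← h2]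
    rfl
  have h5 : (-(hor' ∘L (φ.locForm q.1 Φ).inverse ∘L precomp ℝ hor') +
      inr ℝ EB F ∘L φ.locVert L q.1 q.2 ∘L precomp ℝ (inr ℝ EB F)) (α ∘L φ.dtot q) =
      -hor' ((φ.locForm q.1 Φ).inverse ((α ∘L φ.dtot q) ∘L hor')) +
      (0, φ.locVert L q.1 q.2 ((α ∘L φ.dtot q) ∘L inr ℝ EB F)) := rfl
  rw [h5, map_add, map_neg, ← h3, ← h4]
  rfl

end BundleFrame

end LocalTensors

/-! ### The standard frame at a point, and change of frame. -/

section FrameConstructions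

set_option maxSynthPendingDepth 3

open ContinuousLinearMap

variable {EB : Type*} [NormedAddCommGroup EB] [NormedSpace ℝ EB]
  {B : Type*} [TopologicalSpace B] [ChartedSpace EB B] [IsManifold 𝓘(ℝ, EB) ∞ B]
  {F : Type*} [NormedAddCommGroup F] [NormedSpace ℝ F]
  {E : B → Type*} [∀ b, AddCommGroup (E b)] [∀ b, Module ℝ (E b)]
  [∀ b, TopologicalSpace (E b)] [TopologicalSpace (TotalSpace F E)]
  [FiberBundle F E] [VectorBundle ℝ F E] [ContMDiffVectorBundle ∞ F E 𝓘(ℝ, EB)]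

namespace BundleFrame

variable (EB F E) in
/-- The frame given by the preferred charts at a point of the base. -/
def standard (b : B) : BundleFrame EB F E where
  dom := (extChartAt 𝓘(ℝ, EB) b).target ∩
    (extChartAt 𝓘(ℝ, EB) b).symm ⁻¹' (trivializationAt F E b).baseSet
  img := (extChartAt 𝓘(ℝ, EB) b).source ∩ (trivializationAt F E b).baseSet
  base := (extChartAt 𝓘(ℝ, EB) b).symm
  chart := extChartAt 𝓘(ℝ, EB) b
  fib := fun b' => (trivializationAt F E b).symmL ℝ b'
  coord := fun b' => (trivializationAt F E b).continuousLinearMapAt ℝ b'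
  isOpen_dom := (continuousOn_extChartAt_symm b).isOpen_inter_preimage
    (isOpen_extChartAt_target b) (trivializationAt F E b).open_baseSet
  isOpen_img := (isOpen_extChartAt_source b).inter (trivializationAt F E b).open_baseSet
  base_mem := fun ξ hξ => ⟨(extChartAt 𝓘(ℝ, EB) b).map_target hξ.1, hξ.2⟩
  chart_mem := fun b' hb' => ⟨(extChartAt 𝓘(ℝ, EB) b).map_source hb'.1, by
    rw [mem_preimage, (extChartAt 𝓘(ℝ, EB) b).left_inv hb'.1]; exact hb'.2⟩
  chart_base := fun ξ hξ => (extChartAt 𝓘(ℝ, EB) b).right_inv hξ.1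
  base_chart := fun b' hb' => (extChartAt 𝓘(ℝ, EB) b).left_inv hb'.1
  coord_fib := fun b' hb' x => Trivialization.continuousLinearMapAt_symmL _ hb'.2 x
  fib_coord := fun b' hb' y => Trivialization.symmL_continuousLinearMapAt _ hb'.2 y
  contMDiffOn_tot := by
    set t := trivializationAt F E b with ht
    have h1 : ContMDiffOn 𝓘(ℝ, EB × F) (𝓘(ℝ, EB).prod 𝓘(ℝ, F)) ∞
        (fun q : EB × F => (((extChartAt 𝓘(ℝ, EB) b).symm q.1, q.2) : B × F))
        (((extChartAt 𝓘(ℝ, EB) b).target ∩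
          (extChartAt 𝓘(ℝ, EB) b).symm ⁻¹' t.baseSet) ×ˢ univ) := by
      refine ContMDiffOn.prodMk ?_ contDiff_snd.contMDiff.contMDiffOn
      exact (contMDiffOn_extChartAt_symm b).comp contDiff_fst.contMDiff.contMDiffOn
        (fun q hq => hq.1.1)
    have h2 := (Trivialization.contMDiffOn_symm (n := ∞) (IB := 𝓘(ℝ, EB)) t).comp h1 (fun q hq => t.mem_target.2 hq.1.2)
    refine h2.congr fun q hq => ?_
    refine Eq.trans ?_ (Trivialization.mk_symm t hq.1.2 q.2)
    rw [Trivialization.symmL_apply]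
    exact hq.1.2
  contMDiffOn_inv := by
    set t := trivializationAt F E b with ht
    have h1 : ContMDiffOn (𝓘(ℝ, EB).prod 𝓘(ℝ, F)) (𝓘(ℝ, EB).prod 𝓘(ℝ, F)) ∞ t
        (TotalSpace.proj ⁻¹' ((extChartAt 𝓘(ℝ, EB) b).source ∩ t.baseSet)) :=
      (Trivialization.contMDiffOn (n := ∞) (IB := 𝓘(ℝ, EB)) t).mono
        (fun p hp => t.mem_source.2 hp.2)
    have h2 : ContMDiffOn (𝓘(ℝ, EB).prod 𝓘(ℝ, F)) 𝓘(ℝ, EB) ∞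
        (fun p : TotalSpace F E => extChartAt 𝓘(ℝ, EB) b p.proj)
        (TotalSpace.proj ⁻¹' ((extChartAt 𝓘(ℝ, EB) b).source ∩ t.baseSet)) :=
      contMDiffOn_extChartAt.comp (Bundle.contMDiff_proj E).contMDiffOn (fun p hp => by
        rw [← extChartAt_source 𝓘(ℝ, EB)]; exact hp.1)
    refine (h2.prodMk_space (contMDiff_snd.comp_contMDiffOn h1)).congr fun p hp => ?_
    refine Prod.ext rfl ?_
    simp only [Trivialization.continuousLinearMapAt_apply]
    rw [Trivialization.coe_linearMapAt_of_mem _ hp.2]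
    rfl

theorem mem_img_standard (b : B) : b ∈ (standard EB F E b).img :=
  ⟨mem_extChartAt_source b, FiberBundle.mem_baseSet_trivializationAt' b⟩

variable (φ : BundleFrame EB F E)

/-- Restriction of a frame to a smaller domain and change of the frame by a smooth map to the
linear group. -/
def twist {U : Set EB} (hU : IsOpen U) (hUφ : U ⊆ φ.dom) (g : EB → F ≃L[ℝ] F)
    (hg : ContDiffOn ℝ ∞ (fun ξ => (g ξ : F →L[ℝ] F)) U) [CompleteSpace F] :
    BundleFrame EB F E where
  dom := U
  img := φ.img ∩ φ.chart ⁻¹' U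
  base := φ.base
  chart := φ.chart
  fib := fun b => φ.fib b ∘L (g (φ.chart b) : F →L[ℝ] F)
  coord := fun b => ((g (φ.chart b)).symm : F →L[ℝ] F) ∘L φ.coord b
  isOpen_dom := hU
  isOpen_img := ContinuousOn.isOpen_inter_preimage
    (fun b hb => (contMDiffAt_chart hb).continuousAt.continuousWithinAt) φ.isOpen_img hU
  base_mem := fun ξ hξ => ⟨φ.base_mem ξ (hUφ hξ), by
    rw [mem_preimage, φ.chart_base ξ (hUφ hξ)]; exact hξ⟩
  chart_mem := fun b hb => hb.2
  chart_base := fun ξ hξ => φ.chart_base ξ (hUφ hξ)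
  base_chart := fun b hb => φ.base_chart b hb.1
  coord_fib := fun b hb x => by simp [φ.coord_fib b hb.1]
  fib_coord := fun b hb y => by simp [φ.fib_coord b hb.1]
  contMDiffOn_tot := by
    have h1 : ContDiffOn ℝ ∞ (fun q : EB × F => ((q.1, g q.1 q.2) : EB × F)) (U ×ˢ univ) :=
      contDiff_fst.contDiffOn.prodMk
        ((hg.comp contDiff_fst.contDiffOn (fun q hq => hq.1)).clm_apply contDiff_snd.contDiffOn)
    have h2 := φ.contMDiffOn_tot.comp h1.contMDiffOn (fun q hq => ⟨hUφ hq.1, trivial⟩)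
    refine h2.congr fun q hq => ?_
    simp only [Function.comp_apply, ContinuousLinearMap.comp_apply, φ.chart_base q.1 (hUφ hq.1)]
    rfl
  contMDiffOn_inv := by
    have hgi : ContDiffOn ℝ ∞ (fun ξ => ((g ξ).symm : F →L[ℝ] F)) U := by
      intro ξ hξ
      have h1 := contDiffAt_inverse (hg.contDiffAt (hU.mem_nhds hξ)) ⟨g ξ, rfl⟩
      simp only [inverse_equiv] at h1
      exact h1.contDiffWithinAt
    have h1 : ContDiffOn ℝ ∞ (fun q : EB × F => ((q.1, (g q.1).symm q.2) : EB × F)) (U ×ˢ univ) :=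
      contDiff_fst.contDiffOn.prodMk
        ((hgi.comp contDiff_fst.contDiffOn (fun q hq => hq.1)).clm_apply contDiff_snd.contDiffOn)
    exact h1.contMDiffOn.comp (φ.contMDiffOn_inv.mono (fun p hp => hp.1))
      (fun p hp => ⟨hp.2, trivial⟩)

end BundleFrame

end FrameConstructions

/-! ### The connection form of a covariant derivative in a frame. -/

section ConnectionForms

set_option maxSynthPendingDepth 3

open ContinuousLinearMap

variable {EB : Type*} [NormedAddCommGroup EB] [NormedSpace ℝ EB]
  {B : Type*} [TopologicalSpace B] [ChartedSpace EB B]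
  {F : Type*} [NormedAddCommGroup F] [NormedSpace ℝ F]
  {E : B → Type*} [∀ b, AddCommGroup (E b)] [∀ b, Module ℝ (E b)]
  [∀ b, TopologicalSpace (E b)] [∀ b, IsTopologicalAddGroup (E b)]
  [∀ b, ContinuousSMul ℝ (E b)] [TopologicalSpace (TotalSpace F E)]
  [FiberBundle F E] [VectorBundle ℝ F E]

namespace BundleFrame

variable (φ : BundleFrame EB F E)

/-- The section with the given coordinates in a frame. -/
def sec (c : EB → F) (b : B) : E b := φ.fib b (c (φ.chart b))

variable {φ}

theorem sec_base {c : EB → F} {ξ : EB} (hξ : ξ ∈ φ.dom) :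
    φ.sec c (φ.base ξ) = φ.fib (φ.base ξ) (c ξ) := by
  rw [sec, φ.chart_base ξ hξ]

theorem mk_sec_eq {c : EB → F} {b : B} (hb : b ∈ φ.img) :
    TotalSpace.mk' F b (φ.sec c b) = φ.tot (φ.chart b, c (φ.chart b)) := by
  have h3 : ∀ b', b' = b → (⟨b', φ.fib b' (c (φ.chart b))⟩ : TotalSpace F E) =
      ⟨b, φ.fib b (c (φ.chart b))⟩ := by
    rintro _ rfl; rfl
  exact (h3 _ (φ.base_chart b hb)).symm

theorem mk_sec_eventuallyEq {c : EB → F} {b : B} (hb : b ∈ φ.img) :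
    (fun b => TotalSpace.mk' F b (φ.sec c b)) =ᶠ[𝓝 b]
      fun b => φ.tot (φ.chart b, c (φ.chart b)) := by
  filter_upwards [φ.isOpen_img.mem_nhds hb] with b' hb' using mk_sec_eq hb'

theorem hasMFDerivAt_chart {ξ : EB} (hξ : ξ ∈ φ.dom) :
    HasMFDerivAt 𝓘(ℝ, EB) 𝓘(ℝ, EB) φ.chart (φ.base ξ) (φ.dbase ξ).inverse := by
  have h2 := ((contMDiffAt_chart (φ.base_mem _ hξ)).mdifferentiableAt (by simp)).hasMFDerivAt
  have h12 := (h2.comp ξ (hasMFDerivAt_base hξ)).mfderiv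
  have h3 : φ.chart ∘ φ.base =ᶠ[𝓝 ξ] id := by
    filter_upwards [φ.isOpen_dom.mem_nhds hξ] with x hx using φ.chart_base x hx
  rw [h3.mfderiv_eq, mfderiv_id] at h12
  suffices h : (φ.dbase ξ).inverse = mfderiv 𝓘(ℝ, EB) 𝓘(ℝ, EB) φ.chart (φ.base ξ) by
    rw [h]; exact h2
  refine ContinuousLinearMap.ext fun w => ?_
  obtain ⟨u, rfl⟩ : ∃ u, φ.dbase ξ u = w :=
    ⟨(φ.dbase ξ).inverse w, (isInvertible_dbase hξ).self_apply_inverse w⟩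
  rw [(isInvertible_dbase hξ).inverse_apply_self]
  exact congrArg (fun L => L u) h12

theorem hasMFDerivAt_comp_chart {V : Type*} [NormedAddCommGroup V] [NormedSpace ℝ V]
    {c : EB → V} {ξ : EB} (hξ : ξ ∈ φ.dom) (hc : DifferentiableAt ℝ c ξ) :
    HasMFDerivAt 𝓘(ℝ, EB) 𝓘(ℝ, V) (fun b => c (φ.chart b)) (φ.base ξ)
      (fderiv ℝ c ξ ∘L (φ.dbase ξ).inverse) := by
  have h1 : HasMFDerivAt 𝓘(ℝ, EB) 𝓘(ℝ, V) c (φ.chart (φ.base ξ)) (fderiv ℝ c ξ) := by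
    rw [φ.chart_base ξ hξ]; exact hc.hasFDerivAt.hasMFDerivAt
  exact h1.comp _ (hasMFDerivAt_chart hξ)

theorem mdifferentiableAt_sec {c : EB → F} {ξ : EB} (hξ : ξ ∈ φ.dom)
    (hc : DifferentiableAt ℝ c ξ) :
    MDifferentiableAt 𝓘(ℝ, EB) (𝓘(ℝ, EB).prod 𝓘(ℝ, F))
      (fun b => TotalSpace.mk' F b (φ.sec c b)) (φ.base ξ) := by
  have hb := φ.base_mem ξ hξ
  have h1 : MDifferentiableAt 𝓘(ℝ, EB × F) (𝓘(ℝ, EB).prod 𝓘(ℝ, F)) φ.tot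
      (φ.chart (φ.base ξ), c (φ.chart (φ.base ξ))) := by
    rw [φ.chart_base ξ hξ]
    exact (hasMFDerivAt_tot (φ := φ) (q := (ξ, c ξ)) (mem_source.2 hξ)).mdifferentiableAt
  have h2 : MDifferentiableAt 𝓘(ℝ, EB) 𝓘(ℝ, EB × F)
      (fun b => ((φ.chart b, c (φ.chart b)) : EB × F)) (φ.base ξ) :=
    ((hasMFDerivAt_comp_chart hξ (c := fun η => ((η, c η) : EB × F))
      (differentiableAt_id.prodMk hc))).mdifferentiableAt
  exact (h1.comp (φ.base ξ) h2).congr_of_eventuallyEq (mk_sec_eventuallyEq hb)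

theorem sectionDeriv_sec {c : EB → F} {ξ : EB} (hξ : ξ ∈ φ.dom)
    (hc : DifferentiableAt ℝ c ξ) (u : EB) (v : EB × F)
    (hv : v = φ.dtot (ξ, c ξ) (u, fderiv ℝ c ξ u)) :
    (show EB × F from (sectionDeriv (F := F) (φ.sec c) (φ.base ξ) (φ.dbase ξ u))) = v := by
  have h1 := (hasMFDerivAt_base hξ)
  have h2 := (mdifferentiableAt_sec hξ hc).hasMFDerivAt
  have h3 := (h2.comp ξ h1).mfderiv
  have h4 : (fun b => TotalSpace.mk' F b (φ.sec c b)) ∘ φ.base =ᶠ[𝓝 ξ]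
      φ.tot ∘ fun η => ((η, c η) : EB × F) := by
    filter_upwards [φ.isOpen_dom.mem_nhds hξ] with η hη
    simp only [Function.comp_apply]
    rw [mk_sec_eq (φ.base_mem _ hη), φ.chart_base η hη]
  have h5 : HasMFDerivAt 𝓘(ℝ, EB) 𝓘(ℝ, EB × F) (fun η => ((η, c η) : EB × F)) ξ
      ((ContinuousLinearMap.id ℝ EB).prod (fderiv ℝ c ξ)) :=
    ((hasFDerivAt_id ξ).prodMk hc.hasFDerivAt).hasMFDerivAt
  have h6 := ((hasMFDerivAt_tot (φ := φ) (q := (ξ, c ξ)) (mem_source.2 hξ)).comp ξ h5).mfderiv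
  rw [h4.mfderiv_eq] at h3
  have h7 := h3.symm.trans h6
  rw [hv]
  exact congrArg (fun L => L u) h7

/-- The coordinates of the covariant derivatives of a constant section. -/
def connDir (φ : BundleFrame EB F E) (D : CovariantDerivative 𝓘(ℝ, EB) F E) (ξ : EB) (x : F) :
    EB →L[ℝ] F :=
  φ.coord (φ.base ξ) ∘L D (φ.sec fun _ => x) (φ.base ξ) ∘L φ.dbase ξ

/-- The connection form in a frame. -/
def connForm [FiniteDimensional ℝ F] (φ : BundleFrame EB F E)
    (D : CovariantDerivative 𝓘(ℝ, EB) F E) (ξ : EB) : EB →L[ℝ] F →L[ℝ] F :=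
  ∑ i, smulRightL ℝ F F ((Module.finBasis ℝ F).coord i).toContinuousLinearMap ∘L
    φ.connDir D ξ (Module.finBasis ℝ F i)

theorem covariantDerivative_sec_add (D : CovariantDerivative 𝓘(ℝ, EB) F E) {c c' : EB → F}
    {ξ : EB} (hξ : ξ ∈ φ.dom) (hc : DifferentiableAt ℝ c ξ) (hc' : DifferentiableAt ℝ c' ξ) :
    D (φ.sec fun η => c η + c' η) (φ.base ξ) =
      D (φ.sec c) (φ.base ξ) + D (φ.sec c') (φ.base ξ) := by
  have h := D.isCovariantDerivativeOnUniv.add (mdifferentiableAt_sec hξ hc)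
    (mdifferentiableAt_sec hξ hc') (mem_univ _)
  rw [← h]
  congr 1
  ext b
  simp [sec]

theorem covariantDerivative_sec_smul (D : CovariantDerivative 𝓘(ℝ, EB) F E) {r : EB → ℝ}
    {c : EB → F} {ξ : EB} (hξ : ξ ∈ φ.dom) (hr : DifferentiableAt ℝ r ξ)
    (hc : DifferentiableAt ℝ c ξ) (u : EB) :
    D (φ.sec fun η => r η • c η) (φ.base ξ) (φ.dbase ξ u) =
      r ξ • D (φ.sec c) (φ.base ξ) (φ.dbase ξ u) +
        fderiv ℝ r ξ u • φ.fib (φ.base ξ) (c ξ) := by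
  have hr' := hasMFDerivAt_comp_chart (φ := φ) hξ hr
  have h := D.isCovariantDerivativeOnUniv.leibniz (mdifferentiableAt_sec hξ hc)
    hr'.mdifferentiableAt (mem_univ _)
  have h1 : (fun b => r (φ.chart b)) • φ.sec c = φ.sec fun η => r η • c η := by
    ext b
    simp [sec]
  rw [h1, φ.chart_base ξ hξ] at h
  have h2 : mvfderiv 𝓘(ℝ, EB) (fun b => r (φ.chart b)) (φ.base ξ) (φ.dbase ξ u) =
      fderiv ℝ r ξ u := by
    have h3 := congrArg (fun L => L (φ.dbase ξ u)) hr'.mfderiv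
    refine h3.trans ?_
    exact congrArg (fderiv ℝ r ξ) ((isInvertible_dbase hξ).inverse_apply_self u)
  rw [← h2, ← sec_base hξ]
  exact congrArg (fun L => L (φ.dbase ξ u)) h

variable [FiniteDimensional ℝ F]

/-- The formula `∇ = d + A`: expand the components in a basis of the model fibre and apply the
Leibniz rule to each term. -/
theorem covariantDerivative_sec (D : CovariantDerivative 𝓘(ℝ, EB) F E) {c : EB → F}
    {ξ : EB} (hξ : ξ ∈ φ.dom) (hc : DifferentiableAt ℝ c ξ) (u : EB) :
    D (φ.sec c) (φ.base ξ) (φ.dbase ξ u) =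
      φ.fib (φ.base ξ) (fderiv ℝ c ξ u + φ.connForm D ξ u (c ξ)) := by
  set β := Module.finBasis ℝ F with hβ
  set κ : ∀ i, F →L[ℝ] ℝ := fun i => (β.coord i).toContinuousLinearMap with hκ
  have hsum : ∀ x : F, ∑ i, κ i x • β i = x := fun x => β.sum_repr x
  have hd : ∀ i, DifferentiableAt ℝ (fun η => κ i (c η)) ξ := fun i =>
    (κ i).differentiableAt.comp ξ hc
  have hdt : ∀ i, DifferentiableAt ℝ (fun η => κ i (c η) • β i) ξ := fun i =>
    (hd i).smul_const _
  have key : ∀ s : Finset (Fin (Module.finrank ℝ F)),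
      D (φ.sec fun η => ∑ i ∈ s, κ i (c η) • β i) (φ.base ξ) (φ.dbase ξ u) =
      ∑ i ∈ s, (κ i (c ξ) • D (φ.sec fun _ => β i) (φ.base ξ) (φ.dbase ξ u) +
        fderiv ℝ (fun η => κ i (c η)) ξ u • φ.fib (φ.base ξ) (β i)) := by
    intro s
    induction s using Finset.induction_on with
    | empty =>
      have h0 : φ.sec (fun _ => (0 : F)) = 0 := by ext b; simp [sec]
      simp only [Finset.sum_empty, h0]
      rw [D.zero]; rfl
    | insert i s hi ih =>
      simp only [Finset.sum_insert hi]
      rw [covariantDerivative_sec_add D hξ (hdt i) (DifferentiableAt.fun_sum fun j _ => hdt j),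
        add_apply, ih, covariantDerivative_sec_smul D hξ (hd i) (differentiableAt_const _)]
  have h1 := key Finset.univ
  simp only [hsum] at h1
  rw [h1, Finset.sum_add_distrib, map_add, add_comm]
  congr 1
  · rw [← hsum (fderiv ℝ c ξ u), map_sum]
    refine Finset.sum_congr rfl fun i _ => ?_
    rw [map_smul]
    congr 1
    have := ((κ i).hasFDerivAt.comp ξ hc.hasFDerivAt).fderiv
    exact congrArg (fun L => L u) this
  · rw [connForm]
    simp only [FunLike.coe_sum, Finset.sum_apply, map_sum, ContinuousLinearMap.comp_apply]
    refine Finset.sum_congr rfl fun i _ => ?_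
    have h2 : smulRightL ℝ F F (κ i) (φ.connDir D ξ (β i) u) (c ξ) =
      κ i (c ξ) • φ.connDir D ξ (β i) u := rfl
    refine Eq.trans ?_ (congrArg (φ.fib (φ.base ξ)) h2).symm
    rw [map_smul, connDir]
    simp only [ContinuousLinearMap.comp_apply]
    rw [φ.fib_coord _ (φ.base_mem _ hξ)]

section

variable [IsManifold 𝓘(ℝ, EB) 1 B] [ContMDiffVectorBundle 1 F E 𝓘(ℝ, EB)]

theorem isConnForm_connForm (D : CovariantDerivative 𝓘(ℝ, EB) F E) {ξ : EB} (hξ : ξ ∈ φ.dom) :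
    φ.IsConnForm D ξ (φ.connForm D ξ) := by
  intro x u
  set c : EB → F := fun _ => x with hc
  have hcd : DifferentiableAt ℝ c ξ := differentiableAt_const x
  have h1 := horLift_eq_of_section D (mdifferentiableAt_sec hξ hcd) (φ.dbase ξ u)
  have hq : ((ξ, x) : EB × F) ∈ φ.source := mem_source.2 hξ
  rw [covariantDerivative_sec D hξ hcd] at h1
  have h0 : fderiv ℝ c ξ u = 0 := by simp [hc]
  rw [h0, zero_add] at h1
  have h2 : φ.dtot (ξ, x) (u, -φ.connForm D ξ u x) =
      φ.dtot (ξ, x) (u, 0) - vertLift EB (φ.tot (ξ, x)) (φ.fib (φ.base ξ) (φ.connForm D ξ u x)) := by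
    rw [← dtot_inr hq, ← map_sub]
    simp
  rw [h2]
  -- The type of a tangent vector depends on its base point, so the equality of the two base points
  -- is used only after the fibre point has been generalized.
  have h3 : ∀ y : E (φ.base ξ), y = φ.fib (φ.base ξ) x → ∀ a : E (φ.base ξ), ∀ w : EB × F,
      w = φ.dtot (ξ, x) (u, 0) →
      (horLift D (⟨φ.base ξ, y⟩ : TotalSpace F E) (φ.dbase ξ u) =
        (show TangentSpace (𝓘(ℝ, EB).prod 𝓘(ℝ, F)) (⟨φ.base ξ, y⟩ : TotalSpace F E) from w)
          - vertLift EB (⟨φ.base ξ, y⟩ : TotalSpace F E) a) →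
      horLift D (φ.tot (ξ, x)) (φ.dbase ξ u) =
        φ.dtot (ξ, x) (u, 0) - vertLift EB (φ.tot (ξ, x)) a := by
    rintro _ rfl a w rfl h
    exact h
  refine h3 _ (sec_base hξ) _ _ (sectionDeriv_sec hξ hcd u _ ?_) h1
  rw [h0]

end

end BundleFrame

end ConnectionForms

/-! ### Smoothness of the connection form and the structure equation of a flat connection. -/

section ConnectionForms

set_option maxSynthPendingDepth 3

open ContinuousLinearMap

variable {EB : Type*} [NormedAddCommGroup EB] [NormedSpace ℝ EB] [FiniteDimensional ℝ EB]
  {B : Type*} [TopologicalSpace B] [ChartedSpace EB B] [IsManifold 𝓘(ℝ, EB) ∞ B]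

/-- There are cutoff functions near each point. -/
theorem exists_contMDiff_cutoff [T2Space B] {U : Set B} (hU : IsOpen U) {b : B} (hb : b ∈ U) :
    ∃ ρ : B → ℝ, ContMDiff 𝓘(ℝ, EB) 𝓘(ℝ, ℝ) ∞ ρ ∧ tsupport ρ ⊆ U ∧ ρ =ᶠ[𝓝 b] 1 := by
  obtain ⟨ρ, -, hρ⟩ :=
    (SmoothBumpFunction.nhds_basis_tsupport (I := 𝓘(ℝ, EB)) b).mem_iff.1 (hU.mem_nhds hb)
  exact ⟨ρ, ρ.contMDiff, hρ, ρ.eventuallyEq_one⟩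

variable
  {F : Type*} [NormedAddCommGroup F] [NormedSpace ℝ F]
  {E : B → Type*} [∀ b, AddCommGroup (E b)] [∀ b, Module ℝ (E b)]
  [∀ b, TopologicalSpace (E b)] [∀ b, IsTopologicalAddGroup (E b)]
  [∀ b, ContinuousSMul ℝ (E b)] [TopologicalSpace (TotalSpace F E)]
  [FiberBundle F E] [VectorBundle ℝ F E]

namespace BundleFrame

variable {φ : BundleFrame EB F E}

/-- The coordinate vector fields on the base. -/
def baseField (φ : BundleFrame EB F E) (u : EB) (b : B) : TangentSpace 𝓘(ℝ, EB) b :=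
  (φ.dbase (φ.chart b) u : EB)

theorem baseField_base {u : EB} {ξ : EB} (hξ : ξ ∈ φ.dom) :
    φ.baseField u (φ.base ξ) = φ.dbase ξ u := by
  rw [baseField, φ.chart_base ξ hξ]

theorem contMDiffOn_dbase (u : EB) :
    ContMDiffOn 𝓘(ℝ, EB) 𝓘(ℝ, EB).tangent ∞
      (fun ξ => (⟨φ.base ξ, φ.dbase ξ u⟩ : TangentBundle 𝓘(ℝ, EB) B)) φ.dom := by
  have h1 : ContMDiffOn 𝓘(ℝ, EB) 𝓘(ℝ, EB) ∞ φ.base φ.dom := fun ξ hξ =>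
    (contMDiffAt_base hξ).contMDiffWithinAt
  have h2 := h1.contMDiffOn_tangentMapWithin (m := ∞) (by simp) φ.isOpen_dom.uniqueMDiffOn
  have h3 : ContMDiff 𝓘(ℝ, EB) 𝓘(ℝ, EB).tangent ∞
      (fun ξ => (⟨ξ, u⟩ : TangentBundle 𝓘(ℝ, EB) EB)) :=
    contMDiff_vectorSpace_iff_contDiff.2 contDiff_const
  refine (h2.comp h3.contMDiffOn (fun ξ hξ => hξ)).congr fun ξ hξ => ?_
  rw [Function.comp_apply, tangentMapWithin, mfderivWithin_of_isOpen φ.isOpen_dom hξ]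
  rfl

theorem contMDiffOn_baseField (u : EB) :
    ContMDiffOn 𝓘(ℝ, EB) 𝓘(ℝ, EB).tangent ∞
      (fun b => (⟨b, φ.baseField u b⟩ : TangentBundle 𝓘(ℝ, EB) B)) φ.img := by
  have h1 : ContMDiffOn 𝓘(ℝ, EB) 𝓘(ℝ, EB) ∞ φ.chart φ.img := fun b hb =>
    (contMDiffAt_chart hb).contMDiffWithinAt
  refine ((contMDiffOn_dbase u).comp h1 (fun b hb => φ.chart_mem b hb)).congr fun b hb => ?_
  have h3 : ∀ b' (w : EB), b' = b → (⟨b', w⟩ : TangentBundle 𝓘(ℝ, EB) B) = ⟨b, w⟩ := by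
    rintro _ w rfl; rfl
  exact (h3 _ _ (φ.base_chart b hb)).symm

theorem contMDiffOn_sec {c : EB → F} (hc : ContDiffOn ℝ ∞ c φ.dom) :
    ContMDiffOn 𝓘(ℝ, EB) (𝓘(ℝ, EB).prod 𝓘(ℝ, F)) ∞
      (fun b => TotalSpace.mk' F b (φ.sec c b)) φ.img := by
  have h1 : ContMDiffOn 𝓘(ℝ, EB) 𝓘(ℝ, EB) ∞ φ.chart φ.img := fun b hb =>
    (contMDiffAt_chart hb).contMDiffWithinAt
  have h2 : ContMDiffOn 𝓘(ℝ, EB) 𝓘(ℝ, EB × F) ∞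
      (fun b => ((φ.chart b, c (φ.chart b)) : EB × F)) φ.img :=
    h1.prodMk_space (hc.contMDiffOn.comp h1 (fun b hb => φ.chart_mem b hb))
  refine (φ.contMDiffOn_tot.comp h2 (fun b hb => ⟨φ.chart_mem b hb, trivial⟩)).congr fun b hb => ?_
  exact mk_sec_eq hb

theorem contMDiff_cutoff_sec {c : EB → F} (hc : ContDiffOn ℝ ∞ c φ.dom) {ρ : B → ℝ}
    (hρ : ContMDiff 𝓘(ℝ, EB) 𝓘(ℝ, ℝ) ∞ ρ) (hs : tsupport ρ ⊆ φ.img) :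
    ContMDiff 𝓘(ℝ, EB) (𝓘(ℝ, EB).prod 𝓘(ℝ, F)) ∞
      (fun b => TotalSpace.mk' F b ((ρ • φ.sec c) b)) :=
  ContMDiffOn.smul_section_of_tsupport hρ.contMDiffOn φ.isOpen_img hs (contMDiffOn_sec hc)

theorem contMDiff_cutoff_baseField (u : EB) {ρ : B → ℝ}
    (hρ : ContMDiff 𝓘(ℝ, EB) 𝓘(ℝ, ℝ) ∞ ρ) (hs : tsupport ρ ⊆ φ.img) :
    ContMDiff 𝓘(ℝ, EB) 𝓘(ℝ, EB).tangent ∞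
      (fun b => (⟨b, (ρ • φ.baseField u) b⟩ : TangentBundle 𝓘(ℝ, EB) B)) :=
  ContMDiffOn.smul_section_of_tsupport hρ.contMDiffOn φ.isOpen_img hs (contMDiffOn_baseField u)

variable [FiniteDimensional ℝ F]

theorem covariantDerivative_of_eventuallyEq (D : CovariantDerivative 𝓘(ℝ, EB) F E) {c : EB → F}
    {s : ∀ b, E b} {ξ : EB} (hξ : ξ ∈ φ.dom) (hs : ∀ᶠ b in 𝓝 (φ.base ξ), s b = φ.sec c b)
    (hc : DifferentiableAt ℝ c ξ) (u : EB) :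
    D s (φ.base ξ) (φ.dbase ξ u) =
      φ.fib (φ.base ξ) (fderiv ℝ c ξ u + φ.connForm D ξ u (c ξ)) := by
  have h1 := mdifferentiableAt_sec hξ hc
  have h2 : MDifferentiableAt 𝓘(ℝ, EB) (𝓘(ℝ, EB).prod 𝓘(ℝ, F))
      (fun b => TotalSpace.mk' F b (s b)) (φ.base ξ) := by
    refine h1.congr_of_eventuallyEq ?_
    filter_upwards [hs] with b hb
    rw [hb]
  rw [D.isCovariantDerivativeOnUniv.congr_of_eventuallyEq h2 h1 Filter.univ_mem hs,
    covariantDerivative_sec D hξ hc]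

theorem cutoff_sec_eventuallyEq {ρ : B → ℝ} {b : B} (h : ρ =ᶠ[𝓝 b] 1) (c : EB → F) :
    ∀ᶠ b' in 𝓝 b, (ρ • φ.sec c) b' = φ.sec c b' := by
  filter_upwards [h] with b' hb'
  simp [hb']

variable [ContMDiffVectorBundle ∞ F E 𝓘(ℝ, EB)] [T2Space B]
  (D : CovariantDerivative 𝓘(ℝ, EB) F E)

/-- The connection form of a smooth connection is smooth. -/
theorem contDiffOn_connForm [CovariantDerivative.ContMDiffCovariantDerivative D ∞] :
    ContDiffOn ℝ ∞ (φ.connForm D) φ.dom := by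
  have key : ∀ x : F, ContDiffOn ℝ ∞ (fun ξ => φ.connDir D ξ x) φ.dom := by
    intro x
    rw [contDiffOn_clm_apply]
    intro u ξ₀ hξ₀
    -- Smoothness of a connection is tested on global sections, so the constant section of the frame
    -- is cut off without changing it near the point.
    obtain ⟨ρ, hρ, hρs, hρ1⟩ := exists_contMDiff_cutoff (EB := EB) φ.isOpen_img (φ.base_mem ξ₀ hξ₀)
    have hσ := contMDiff_cutoff_sec (φ := φ) (c := fun _ => x) contDiffOn_const hρ hρs
    have h1 := (CovariantDerivative.ContMDiffCovariantDerivative.contMDiff (cov := D)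
      (k := ∞)).contMDiff (σ := ρ • φ.sec fun _ => x) (by simpa using! hσ.contMDiffOn)
    have h2 := (h1.contMDiffAt (Filter.univ_mem : univ ∈ 𝓝 (φ.base ξ₀))).comp ξ₀ (contMDiffAt_base hξ₀)
    have h3 := h2.clm_bundle_apply ((contMDiffOn_dbase u).contMDiffAt (φ.isOpen_dom.mem_nhds hξ₀))
    have h4 := (contMDiffAt_inv (φ := φ) (p := ⟨φ.base ξ₀, _⟩) (φ.base_mem ξ₀ hξ₀)).comp ξ₀ h3
    have h5 := (contMDiffAt_iff_contDiffAt.1 h4).snd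
    refine (h5.congr_of_eventuallyEq ?_).contDiffWithinAt
    have h6 := ((contMDiffAt_base hξ₀).continuousAt.eventually
      (eventually_eventually_nhds.2 hρ1))
    filter_upwards [h6, φ.isOpen_dom.mem_nhds hξ₀] with ξ hξ hξd
    have h7 := covariantDerivative_of_eventuallyEq D hξd
      (cutoff_sec_eventuallyEq (φ := φ) hξ (fun _ => x)) (differentiableAt_const _) u
    have h8 := covariantDerivative_sec D hξd (differentiableAt_const x) u
    exact congrArg (φ.coord (φ.base ξ)) (h8.trans h7.symm)
  have h : φ.connForm D = fun ξ => ∑ i,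
      smulRightL ℝ F F ((Module.finBasis ℝ F).coord i).toContinuousLinearMap ∘L
        φ.connDir D ξ (Module.finBasis ℝ F i) := rfl
  rw [h]
  exact ContDiffOn.sum fun i _ => contDiffOn_const.clm_comp (key _)

omit [FiniteDimensional ℝ F] [ContMDiffVectorBundle ∞ F E 𝓘(ℝ, EB)] [T2Space B] in
-- Near the point the fields are coordinate fields: pulled back by the parametrization of the base
-- they become constant, and brackets commute with this pull-back.
theorem mlieBracket_baseField [CompleteSpace EB] {ρ : B → ℝ} (u v : EB) {ξ : EB} (hξ : ξ ∈ φ.dom)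
    (hρ : ContMDiff 𝓘(ℝ, EB) 𝓘(ℝ, ℝ) ∞ ρ) (hρs : tsupport ρ ⊆ φ.img)
    (hρ1 : ρ =ᶠ[𝓝 (φ.base ξ)] 1) :
    VectorField.mlieBracket 𝓘(ℝ, EB) (ρ • φ.baseField u) (ρ • φ.baseField v) (φ.base ξ) = 0 := by
  have : IsManifold 𝓘(ℝ, EB) (minSmoothness ℝ 2) B := by
    rw [minSmoothness_of_isRCLikeNormedField]
    exact IsManifold.of_le (n := ∞) two_le_infty
  have hu := ((contMDiff_cutoff_baseField (φ := φ) u hρ hρs).mdifferentiable (by simp)) (φ.base ξ)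
  have hv := ((contMDiff_cutoff_baseField (φ := φ) v hρ hρs).mdifferentiable (by simp)) (φ.base ξ)
  have h := VectorField.mpullback_mlieBracket hu hv (contMDiffAt_base hξ) (by simp; exact two_le_infty)
  have hc : ∀ w : EB, VectorField.mpullback 𝓘(ℝ, EB) 𝓘(ℝ, EB) φ.base (ρ • φ.baseField w) =ᶠ[𝓝 ξ]
      fun _ => w := by
    intro w
    filter_upwards [(contMDiffAt_base hξ).continuousAt.eventually hρ1, φ.isOpen_dom.mem_nhds hξ]
      with η hη hηd
    rw [VectorField.mpullback_apply]
    have : (ρ • φ.baseField w) (φ.base η) = φ.dbase η w := by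
      rw [Pi.smul_apply', hη, baseField_base hηd]; exact one_smul _ _
    rw [this]
    exact (isInvertible_dbase hηd).inverse_apply_self w
  rw [(hc u).mlieBracket_vectorField_eq (hc v)] at h
  have h0 : VectorField.mlieBracket 𝓘(ℝ, EB) (fun _ : EB => u) (fun _ : EB => v) ξ = (0 : EB) := by
    have h2 := congrFun (VectorField.mlieBracketWithin_eq_lieBracketWithin (𝕜 := ℝ)
      (V := fun _ : EB => u) (W := fun _ : EB => v) (s := univ)) ξ
    refine h2.trans ?_
    rw [VectorField.lieBracketWithin_univ, VectorField.lieBracket_eq]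
    have h3 : ∀ w : EB, fderiv ℝ (fun _ : EB => w) ξ = 0 := fun w => fderiv_const_apply w
    exact (congrArg₂ (fun (L L' : EB →L[ℝ] EB) => L u - L' v) (h3 v) (h3 u)).trans (sub_zero (0 : EB))
  have h' := h.trans h0
  have h1 := congrArg (φ.dbase ξ) h'
  rw [map_zero] at h1
  exact ((isInvertible_dbase hξ).self_apply_inverse _).symm.trans h1

/-- The structure equation of a flat connection. -/
theorem connForm_of_isFlatConnection [CovariantDerivative.ContMDiffCovariantDerivative D ∞]
    (hD : IsFlatConnection D) {ξ : EB} (hξ : ξ ∈ φ.dom) (u v : EB) :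
    fderiv ℝ (φ.connForm D) ξ u v - fderiv ℝ (φ.connForm D) ξ v u +
      (φ.connForm D ξ u ∘L φ.connForm D ξ v - φ.connForm D ξ v ∘L φ.connForm D ξ u) = 0 := by
  have := FiniteDimensional.complete ℝ EB
  ext x
  obtain ⟨ρ, hρ, hρs, hρ1⟩ := exists_contMDiff_cutoff (EB := EB) φ.isOpen_img (φ.base_mem ξ hξ)
  have h1 := hD (ρ • φ.baseField u) (ρ • φ.baseField v) (ρ • φ.sec fun _ => x)
    (contMDiff_cutoff_baseField u hρ hρs) (contMDiff_cutoff_baseField v hρ hρs)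
    (contMDiff_cutoff_sec contDiffOn_const hρ hρs) (φ.base ξ)
  rw [mlieBracket_baseField u v hξ hρ hρs hρ1, map_zero, sub_zero] at h1
  have hA := ((contDiffOn_connForm (φ := φ) D).contDiffAt (φ.isOpen_dom.mem_nhds hξ)).differentiableAt
    (by simp)
  have hfield : ∀ w : EB, (ρ • φ.baseField w) (φ.base ξ) = φ.dbase ξ w := by
    intro w
    rw [Pi.smul_apply', hρ1.self_of_nhds, baseField_base hξ]; exact one_smul _ _
  have hAw : ∀ w, DifferentiableAt ℝ (fun η => φ.connForm D η w x) ξ := fun w =>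
    (hA.clm_apply (differentiableAt_const w)).clm_apply (differentiableAt_const x)
  -- The first covariant derivative must be known on a whole neighbourhood before it can be
  -- differentiated again.
  have hsec : ∀ w : EB, ∀ᶠ b in 𝓝 (φ.base ξ),
      D (ρ • φ.sec fun _ => x) b ((ρ • φ.baseField w) b) = φ.sec (fun η => φ.connForm D η w x) b := by
    intro w
    filter_upwards [eventually_eventually_nhds.2 hρ1, φ.isOpen_img.mem_nhds (φ.base_mem ξ hξ)]
      with b hb hbi
    obtain ⟨η, hη, rfl⟩ : ∃ η ∈ φ.dom, φ.base η = b :=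
      ⟨φ.chart b, φ.chart_mem b hbi, φ.base_chart b hbi⟩
    have e1 : (ρ • φ.baseField w) (φ.base η) = φ.dbase η w := by
      rw [Pi.smul_apply', hb.self_of_nhds, baseField_base hη]; exact one_smul _ _
    rw [e1, covariantDerivative_of_eventuallyEq D hη
      (cutoff_sec_eventuallyEq (φ := φ) hb (fun _ => x)) (differentiableAt_const _) w, sec_base hη]
    simp
  rw [hfield, hfield, covariantDerivative_of_eventuallyEq D hξ (hsec v) (hAw v),
    covariantDerivative_of_eventuallyEq D hξ (hsec u) (hAw u), ← map_sub] at h1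
  have h2 := congrArg (φ.coord (φ.base ξ)) h1
  rw [φ.coord_fib _ (φ.base_mem ξ hξ), map_zero] at h2
  have hder : ∀ w z : EB, fderiv ℝ (fun η => φ.connForm D η w x) ξ z =
      fderiv ℝ (φ.connForm D) ξ z w x := by
    intro w z
    have := ((hA.hasFDerivAt.clm_apply (hasFDerivAt_const w ξ)).clm_apply
      (hasFDerivAt_const x ξ)).fderiv
    rw [this]
    simp
  rw [hder, hder] at h2
  simp only [add_apply, sub_apply, ContinuousLinearMap.comp_apply, zero_apply]
  rw [← h2]
  abel

end BundleFrame

end ConnectionForms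

/-! ### Parallel frames of a flat connection form by radial transport. -/

section ParallelFrames

set_option maxSynthPendingDepth 3

open ContinuousLinearMap Metric

variable {V : Type*} [NormedAddCommGroup V] [NormedSpace ℝ V] [FiniteDimensional ℝ V]
  {F : Type*} [NormedAddCommGroup F] [NormedSpace ℝ F] [FiniteDimensional ℝ F]

/-- The radial parallel transport of a connection form on a vector space. -/
theorem exists_radial_transport {A : V → V →L[ℝ] F →L[ℝ] F} (hA : ContDiff ℝ ∞ A) :
    ∃ Φ : ℝ → V × (F →L[ℝ] F) → V × (F →L[ℝ] F),
      ContDiff ℝ ∞ (fun p : ℝ × (V × (F →L[ℝ] F)) => Φ p.1 p.2) ∧ (∀ q, Φ 0 q = q) ∧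
      (∀ t q, (Φ t q).1 = q.1) ∧
      ∀ t q, HasDerivAt (fun s => Φ s q) (0, -(A (t • q.1) q.1 ∘L (Φ t q).2)) t := by
  have := FiniteDimensional.complete ℝ F
  have := FiniteDimensional.complete ℝ V
  have hc : ∀ (s₀ : ℝ) (v : V), Continuous fun t : ℝ =>
      -(compL ℝ F F F (A ((s₀ + t) • v) v)) := by
    intro s₀ v
    refine (ContinuousLinearMap.continuous _).comp ?_ |>.neg
    exact (hA.continuous.comp (by fun_prop)).clm_apply continuous_const
  choose α h0 hα using fun (s₀ : ℝ) (v : V) (g : F →L[ℝ] F) => exists_linear_solution (hc s₀ v) g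
  -- Time is a coordinate of this autonomous field, which is why the solutions were chosen for every
  -- starting time `s₀`. Completeness comes from linearity in the last variable.
  set f : ℝ × (V × (F →L[ℝ] F)) → ℝ × (V × (F →L[ℝ] F)) := fun p =>
    (1, (0, -(A (p.1 • p.2.1) p.2.1 ∘L p.2.2))) with hf
  set Fl : ℝ → ℝ × (V × (F →L[ℝ] F)) → ℝ × (V × (F →L[ℝ] F)) := fun t p =>
    (p.1 + t, (p.2.1, α p.1 p.2.1 p.2.2 t)) with hFl
  have hfs : ContDiff ℝ ∞ f := by
    refine contDiff_const.prodMk (contDiff_const.prodMk ?_)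
    exact (((hA.comp (contDiff_fst.smul contDiff_snd.fst)).clm_apply contDiff_snd.fst).clm_comp
      contDiff_snd.snd).neg
  have hflow : IsFlow f Fl := by
    refine ⟨fun p => by simp [hFl, h0], fun p t => ?_⟩
    exact ((hasDerivAt_id t).const_add p.1).prodMk
      ((hasDerivAt_const t p.2.1).prodMk (hα p.1 p.2.1 p.2.2 t))
  have hs := hflow.contDiff hfs
  refine ⟨fun t q => (Fl t (0, q)).2, ?_, ?_, fun t q => rfl, fun t q => ?_⟩
  · exact (hs.comp (contDiff_fst.prodMk (contDiff_const.prodMk contDiff_snd))).snd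
  · intro q
    exact congrArg Prod.snd (hflow.zero (0, q))
  · have := (hasDerivAt_const t q.1).prodMk (hα 0 q.1 q.2 t)
    rw [zero_add] at this
    exact this

/-- A left inverse endomorphism in finite dimension gives an equivalence. -/
theorem exists_equiv_of_comp_eq_id {g h : F →L[ℝ] F} (hgh : h ∘L g = ContinuousLinearMap.id ℝ F) :
    ∃ e : F ≃L[ℝ] F, (e : F →L[ℝ] F) = g := by
  have hinj : Function.Injective (g : F →ₗ[ℝ] F) := fun x y hxy => by
    have := congrArg h hxy
    exact (congrArg (fun L => L x) hgh).symm.trans (this.trans (congrArg (fun L => L y) hgh))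
  refine ⟨(LinearEquiv.ofInjectiveEndo (g : F →ₗ[ℝ] F) hinj).toContinuousLinearEquiv, ?_⟩
  ext x
  rfl

/-- The variational equation of the radial parallel transport. -/
theorem hasDerivAt_fderiv_radial_transport {A : V → V →L[ℝ] F →L[ℝ] F} (hA : ContDiff ℝ ∞ A)
    {Φ : ℝ → V × (F →L[ℝ] F) → V × (F →L[ℝ] F)}
    (hΦ : ContDiff ℝ ∞ (fun p : ℝ × (V × (F →L[ℝ] F)) => Φ p.1 p.2))
    (hΦ1 : ∀ t q, (Φ t q).1 = q.1)
    (hΦd : ∀ t q, HasDerivAt (fun s => Φ s q) (0, -(A (t • q.1) q.1 ∘L (Φ t q).2)) t)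
    (v u : V) (ι : F →L[ℝ] F) (t : ℝ) :
    HasDerivAt (fun t => (fderiv ℝ (Φ t) (v, ι) (u, 0)).2)
      (-(A (t • v) v ∘L (fderiv ℝ (Φ t) (v, ι) (u, 0)).2 + (A (t • v) u +
      t • fderiv ℝ A (t • v) u v) ∘L (Φ t (v, ι)).2)) t := by
  have hAd : Differentiable ℝ A := hA.differentiable (by simp)
  set Z : ℝ → V × (F →L[ℝ] F) → V × (F →L[ℝ] F) := fun t q =>
    (0, -(A (t • q.1) q.1 ∘L q.2)) with hZ
  have hZd : ∀ t (q : V × (F →L[ℝ] F)), HasFDerivAt (Z t)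
      ((0 : V × (F →L[ℝ] F) →L[ℝ] V).prod
        (-((compL ℝ F F F (A (t • q.1) q.1)) ∘L ContinuousLinearMap.snd ℝ V (F →L[ℝ] F) +
          (compL ℝ F F F).flip q.2 ∘L (A (t • q.1) ∘L ContinuousLinearMap.fst ℝ V (F →L[ℝ] F) +
            ((fderiv ℝ A (t • q.1)) ∘L (t • ContinuousLinearMap.fst ℝ V (F →L[ℝ] F))).flip q.1)))) q := by
    intro t q
    refine (hasFDerivAt_const _ _).prodMk (HasFDerivAt.neg ?_)
    have h1 : HasFDerivAt (fun q : V × (F →L[ℝ] F) => t • q.1)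
      (t • ContinuousLinearMap.fst ℝ V (F →L[ℝ] F)) q := hasFDerivAt_fst.const_smul t
    have h2 := ((hAd (t • q.1)).hasFDerivAt.comp q h1).clm_apply
      (hasFDerivAt_fst (𝕜 := ℝ) (E := V) (F := F →L[ℝ] F) (p := q))
    exact h2.clm_comp hasFDerivAt_snd
  have hΦt : ∀ t, DifferentiableAt ℝ (Φ t) (v, ι) := fun t =>
    ((hΦ.comp (contDiff_const.prodMk contDiff_id)).differentiable (by simp)) _
  have hfst : ∀ t, (fderiv ℝ (Φ t) (v, ι) (u, 0)).1 = u := by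
    intro t
    have h1 := (hΦt t).hasFDerivAt.fst
    have h2 : (fun q => (Φ t q).1) = Prod.fst := funext (hΦ1 t)
    rw [h2] at h1
    exact congrArg (fun L => L (u, 0)) (h1.unique hasFDerivAt_fst)
  have h1 := (hasDerivAt_fderiv_flow hΦ isOpen_univ (Z := Z t) (t := t) (q := (v, ι)) (mem_univ _)
    (fun q _ => by simpa only [hZ, hΦ1] using hΦd t q) (hZd t _).differentiableAt (u, 0)).snd
  rw [(hZd t _).fderiv] at h1
  convert! h1 using 1
  simp only [ContinuousLinearMap.prod_apply, neg_apply, add_apply, ContinuousLinearMap.comp_apply,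
    compL_apply, flip_apply, coe_snd', coe_fst', hfst, hΦ1, smul_apply, map_smul]
  rfl

/-- Here `w` is the derivative of the radial transport `G` in the direction `u`, and `w + t A(u) G`
measures the failure of `G` to be parallel in that direction. The structure equation makes this
defect satisfy the same homogeneous linear equation as `G`. -/
theorem hasDerivAt_radial_defect {A : V → V →L[ℝ] F →L[ℝ] F} (hAd : Differentiable ℝ A)
    {v u : V} {t : ℝ} (hflat : fderiv ℝ A (t • v) u v - fderiv ℝ A (t • v) v u +
      (A (t • v) u ∘L A (t • v) v - A (t • v) v ∘L A (t • v) u) = 0)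
    {w G : ℝ → F →L[ℝ] F} (hGd : HasDerivAt G (-(A (t • v) v ∘L G t)) t)
    (hwd : HasDerivAt w (-(A (t • v) v ∘L w t + (A (t • v) u +
      t • fderiv ℝ A (t • v) u v) ∘L G t)) t) :
    HasDerivAt (fun t => w t + t • (A (t • v) u ∘L G t))
      (-(A (t • v) v ∘L (w t + t • (A (t • v) u ∘L G t)))) t := by
  have h1 : HasDerivAt (fun t : ℝ => A (t • v) u) (fderiv ℝ A (t • v) v u) t := by
    have h0 : HasDerivAt (fun t : ℝ => t • v) v t := by
      simpa using (hasDerivAt_id' t).smul_const v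
    have h2 : HasDerivAt (fun t : ℝ => A (t • v)) (fderiv ℝ A (t • v) v) t :=
      (hAd (t • v)).hasFDerivAt.comp_hasDerivAt t h0
    exact ((apply ℝ (F →L[ℝ] F) u).hasFDerivAt).comp_hasDerivAt t h2
  have h2 : HasDerivAt (fun t => A (t • v) u ∘L G t)
      (fderiv ℝ A (t • v) v u ∘L G t + A (t • v) u ∘L (-(A (t • v) v ∘L G t))) t := by
    have := h1.clm_comp hGd
    exact this
  have h3 : HasDerivAt (fun t => t • (A (t • v) u ∘L G t))
      (t • (fderiv ℝ A (t • v) v u ∘L G t + A (t • v) u ∘L (-(A (t • v) v ∘L G t))) +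
        (1 : ℝ) • (A (t • v) u ∘L G t)) t := (hasDerivAt_id' t).smul h2
  refine (hwd.add h3).congr_deriv ?_
  have h5 : fderiv ℝ A (t • v) u v = fderiv ℝ A (t • v) v u -
      (A (t • v) u ∘L A (t • v) v - A (t • v) v ∘L A (t • v) u) := by
    rw [eq_sub_iff_add_eq, ← sub_eq_zero, ← hflat]
    abel
  rw [h5]
  ext x
  simp only [neg_apply, ContinuousLinearMap.comp_apply, add_apply, smul_apply, sub_apply, map_add,
    map_smul, id_eq, one_smul, smul_sub, smul_add, map_neg, smul_neg]
  abel

/-- A connection form satisfying the structure equation has a parallel frame near a point. -/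
theorem exists_parallel_frame_zero {A : V → V →L[ℝ] F →L[ℝ] F} (hA : ContDiff ℝ ∞ A) {r : ℝ}
    (hflat : ∀ ξ ∈ ball (0 : V) r, ∀ u v, fderiv ℝ A ξ u v - fderiv ℝ A ξ v u +
      (A ξ u ∘L A ξ v - A ξ v ∘L A ξ u) = 0) :
    ∃ g : V → F ≃L[ℝ] F, ContDiff ℝ ∞ (fun ξ => (g ξ : F →L[ℝ] F)) ∧
      ∀ ξ ∈ ball (0 : V) r, ∀ u, fderiv ℝ (fun ξ => (g ξ : F →L[ℝ] F)) ξ u =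
        -(A ξ u ∘L (g ξ : F →L[ℝ] F)) := by
  have := FiniteDimensional.complete ℝ F
  have := FiniteDimensional.complete ℝ V
  obtain ⟨Φ, hΦ, hΦ0, hΦ1, hΦd⟩ := exists_radial_transport hA
  set ι : F →L[ℝ] F := ContinuousLinearMap.id ℝ F with hι
  set G : ℝ → V → F →L[ℝ] F := fun t v => (Φ t (v, ι)).2 with hG
  have hGd : ∀ t v, HasDerivAt (fun s => G s v) (-(A (t • v) v ∘L G t v)) t := fun t v =>
    (hΦd t (v, ι)).snd
  have hG0 : ∀ v, G 0 v = ι := fun v => by simp only [hG, hΦ0]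
  -- The solution of the adjoint equation `h' = h A` with initial value the identity is a left
  -- inverse of `G`, because the product `h G` is constant.
  have hinv : ∀ v, ∃ e : F ≃L[ℝ] F, (e : F →L[ℝ] F) = G 1 v := by
    intro v
    have hc : Continuous fun t : ℝ => (compL ℝ F F F).flip (A (t • v) v) := by
      refine (ContinuousLinearMap.continuous _).comp ?_
      exact (hA.continuous.comp (by fun_prop)).clm_apply continuous_const
    obtain ⟨h, hh0, hh⟩ := exists_linear_solution hc ι
    have hh' : ∀ t, HasDerivAt h (h t ∘L A (t • v) v) t := hh
    have hconst : ∀ t, HasDerivAt (fun t => h t ∘L G t v) 0 t := by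
      intro t
      have := (hh' t).clm_comp (hGd t v)
      convert! this using 1
      rw [ContinuousLinearMap.comp_neg, ← ContinuousLinearMap.comp_assoc]
      abel
    have h1 := is_const_of_deriv_eq_zero (fun t => (hconst t).differentiableAt)
      (fun t => (hconst t).deriv) 1 0
    refine exists_equiv_of_comp_eq_id (h := h 1) (h1.trans ?_)
    rw [hh0, hG0]
    rfl
  choose g hg using hinv
  have hGs : ContDiff ℝ ∞ fun p : ℝ × V => G p.1 p.2 :=
    (hΦ.comp (contDiff_fst.prodMk (contDiff_snd.prodMk contDiff_const))).snd
  refine ⟨g, ?_, ?_⟩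
  · simp only [hg]
    exact hGs.comp (contDiff_const.prodMk contDiff_id)
  intro v hv u
  simp only [hg]
  have hw := hasDerivAt_fderiv_radial_transport hA hΦ hΦ1 hΦd v u ι
  have hy : ∀ t ∈ Icc (0 : ℝ) 1, HasDerivAt (fun t => (fderiv ℝ (Φ t) (v, ι) (u, 0)).2 +
      t • (A (t • v) u ∘L G t v)) (-(A (t • v) v ∘L ((fderiv ℝ (Φ t) (v, ι) (u, 0)).2 +
        t • (A (t • v) u ∘L G t v)))) t := by
    intro t ht
    refine hasDerivAt_radial_defect (w := fun t => (fderiv ℝ (Φ t) (v, ι) (u, 0)).2)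
      (G := fun t => G t v) (hA.differentiable (by simp)) ?_ (hGd t v) (hw t)
    refine hflat (t • v) ?_ u v
    rw [mem_ball_zero_iff] at hv ⊢
    rw [norm_smul, Real.norm_of_nonneg ht.1]
    exact (mul_le_of_le_one_left (norm_nonneg v) ht.2).trans_lt hv
  have hΦt : DifferentiableAt ℝ (Φ 1) (v, ι) :=
    ((hΦ.comp (contDiff_const.prodMk contDiff_id)).differentiable (by simp)) _
  have hcont : ContinuousOn (fun t : ℝ => -(compL ℝ F F F (A (t • v) v))) (Icc 0 1) := by
    refine Continuous.continuousOn ?_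
    refine (ContinuousLinearMap.continuous _).comp ?_ |>.neg
    exact (hA.continuous.comp (by fun_prop)).clm_apply continuous_const
  have hw0 : (fderiv ℝ (Φ 0) (v, ι) (u, 0)).2 = 0 := by
    have : Φ 0 = id := funext hΦ0
    rw [this, fderiv_id]
    rfl
  -- The defect starts at 0, hence vanishes identically; at time one this is the equation of a
  -- parallel frame. The segment from 0 to `v` stays in the ball where the structure equation holds.
  have hzero := eqOn_of_linear_ode hcont (fun t ht => (hy t ht).hasDerivWithinAt)
    (β := fun _ => 0) (fun t ht => by simpa using! hasDerivWithinAt_const t _ (0 : F →L[ℝ] F))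
    (by simp [hw0]) (right_mem_Icc.2 zero_le_one)
  simp only [one_smul] at hzero
  rw [add_eq_zero_iff_eq_neg] at hzero
  rw [← hzero]
  have h6 : HasFDerivAt (fun v : V => ((v, ι) : V × (F →L[ℝ] F)))
    (ContinuousLinearMap.inl ℝ V (F →L[ℝ] F)) v :=
    (hasFDerivAt_id v).prodMk (hasFDerivAt_const ι v)
  have h7 := (hΦt.hasFDerivAt.comp v h6).snd.fderiv
  exact congrArg (fun L => L u) h7

/-- Translation to the origin and a cutoff reduce to a form defined everywhere. The structure
equation survives on a ball where the cutoff is 1, and only there is it needed. -/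
theorem exists_parallel_frame {A : V → V →L[ℝ] F →L[ℝ] F} {O : Set V} (hO : IsOpen O)
    (hA : ContDiffOn ℝ ∞ A O)
    (hflat : ∀ ξ ∈ O, ∀ u v, fderiv ℝ A ξ u v - fderiv ℝ A ξ v u +
      (A ξ u ∘L A ξ v - A ξ v ∘L A ξ u) = 0) {ξ₀ : V} (hξ₀ : ξ₀ ∈ O) :
    ∃ r > 0, ball ξ₀ r ⊆ O ∧ ∃ g : V → F ≃L[ℝ] F, ContDiff ℝ ∞ (fun ξ => (g ξ : F →L[ℝ] F)) ∧
      ∀ ξ ∈ ball ξ₀ r, ∀ u, fderiv ℝ (fun ξ => (g ξ : F →L[ℝ] F)) ξ u =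
        -(A ξ u ∘L (g ξ : F →L[ℝ] F)) := by
  obtain ⟨χ, hχ, -, hχO, O₁, hO₁, hKO₁, hχ1⟩ :=
    exists_contDiff_cutoff (isCompact_singleton (x := ξ₀)) hO (singleton_subset_iff.2 hξ₀)
  have hA' := contDiff_smul_of_tsupport_subset hO hχ hχO hA
  obtain ⟨r, hr, hrO⟩ := Metric.isOpen_iff.1 (hO₁.inter hO) ξ₀ ⟨hKO₁ rfl, hξ₀⟩
  set A' : V → V →L[ℝ] F →L[ℝ] F := fun η => χ (ξ₀ + η) • A (ξ₀ + η) with hA'def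
  have hsm : ContDiff ℝ ∞ A' := hA'.comp (contDiff_const.add contDiff_id)
  have hmem : ∀ η ∈ ball (0 : V) r, ξ₀ + η ∈ ball ξ₀ r := by
    intro η hη
    simpa [mem_ball, dist_eq_norm] using hη
  have heq : ∀ η ∈ ball (0 : V) r, A' =ᶠ[𝓝 η] fun η => A (ξ₀ + η) := by
    intro η hη
    filter_upwards [isOpen_ball.mem_nhds hη] with η' hη'
    simp only [hA'def]
    rw [hχ1 _ (hrO (hmem η' hη')).1, one_smul]
  obtain ⟨g, hg, hgd⟩ := exists_parallel_frame_zero hsm (r := r) (fun η hη u v => by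
    rw [(heq η hη).fderiv_eq, (heq η hη).self_of_nhds, fderiv_comp_add_left]
    exact hflat _ (hrO (hmem η hη)).2 u v)
  refine ⟨r, hr, fun ξ hξ => (hrO hξ).2, fun ξ => g (ξ - ξ₀), hg.comp (contDiff_id.sub contDiff_const),
    fun ξ hξ u => ?_⟩
  have hη : ξ - ξ₀ ∈ ball (0 : V) r := by simpa [mem_ball, dist_eq_norm] using hξ
  have h1 := fderiv_comp_sub (𝕜 := ℝ) (f := fun η => (g η : F →L[ℝ] F)) (x := ξ) ξ₀
  rw [h1, hgd _ hη, (heq _ hη).self_of_nhds]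
  simp

end ParallelFrames

/-! ### Parallel frames of a flat connection on the bundle. -/

section FlatFrames

set_option maxSynthPendingDepth 3

open ContinuousLinearMap Metric

variable {EB : Type*} [NormedAddCommGroup EB] [NormedSpace ℝ EB] [FiniteDimensional ℝ EB]
  {B : Type*} [TopologicalSpace B] [ChartedSpace EB B] [IsManifold 𝓘(ℝ, EB) ∞ B]
  {F : Type*} [NormedAddCommGroup F] [NormedSpace ℝ F] [FiniteDimensional ℝ F]
  {E : B → Type*} [∀ b, AddCommGroup (E b)] [∀ b, Module ℝ (E b)]
  [∀ b, TopologicalSpace (E b)] [∀ b, IsTopologicalAddGroup (E b)]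
  [∀ b, ContinuousSMul ℝ (E b)] [TopologicalSpace (TotalSpace F E)]
  [FiberBundle F E] [VectorBundle ℝ F E] [ContMDiffVectorBundle ∞ F E 𝓘(ℝ, EB)]

namespace BundleFrame

/-- The connection form in a changed frame. -/
theorem connForm_twist (φ : BundleFrame EB F E) {U : Set EB} (hU : IsOpen U) (hUφ : U ⊆ φ.dom)
    (g : EB → F ≃L[ℝ] F) (hg : ContDiffOn ℝ ∞ (fun ξ => (g ξ : F →L[ℝ] F)) U)
    [CompleteSpace F] (D : CovariantDerivative 𝓘(ℝ, EB) F E) {ξ : EB} (hξ : ξ ∈ U) (u : EB) (x : F) :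
    g ξ ((φ.twist hU hUφ g hg).connForm D ξ u x) =
      fderiv ℝ (fun ξ => (g ξ : F →L[ℝ] F)) ξ u x + φ.connForm D ξ u (g ξ x) := by
  set φ' := φ.twist hU hUφ g hg with hφ'
  have hgd : HasFDerivAt (fun η => g η x)
      ((fderiv ℝ (fun ξ => (g ξ : F →L[ℝ] F)) ξ).flip x) ξ := by
    have := ((hg.contDiffAt (hU.mem_nhds hξ)).differentiableAt (by simp)).hasFDerivAt.clm_apply
      (hasFDerivAt_const x ξ)
    simpa using! this
  have h1 := covariantDerivative_sec (φ := φ') D (c := fun _ => x) hξ (differentiableAt_const x) u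
  have h2 := covariantDerivative_sec (φ := φ) D (c := fun η => g η x) (hUφ hξ)
    hgd.differentiableAt u
  have h3 := h1.symm.trans h2
  have h4 : ∀ y, φ'.fib (φ.base ξ) y = φ.fib (φ.base ξ) (g ξ y) := by
    intro y
    change φ.fib (φ.base ξ) (g (φ.chart (φ.base ξ)) y) = _
    rw [φ.chart_base ξ (hUφ hξ)]
  have h5 := congrArg (φ.coord (φ.base ξ)) ((h4 _).symm.trans h3)
  rw [φ.coord_fib _ (φ.base_mem ξ (hUφ hξ)), φ.coord_fib _ (φ.base_mem ξ (hUφ hξ)), hgd.fderiv] at h5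
  simpa using h5

end BundleFrame

/-- A flat connection has parallel frames. -/
theorem exists_flat_frame [T2Space B] (D : CovariantDerivative 𝓘(ℝ, EB) F E)
    [CovariantDerivative.ContMDiffCovariantDerivative D ∞] (hD : IsFlatConnection D) (b : B) :
    ∃ φ : BundleFrame EB F E, b ∈ φ.img ∧ Convex ℝ φ.dom ∧ ∀ ξ ∈ φ.dom, φ.connForm D ξ = 0 := by
  have := FiniteDimensional.complete ℝ F
  set φ := BundleFrame.standard EB F E b with hφ
  have hb : b ∈ φ.img := BundleFrame.mem_img_standard b
  obtain ⟨r, hr, hrO, g, hg, hgd⟩ := exists_parallel_frame φ.isOpen_dom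
    (BundleFrame.contDiffOn_connForm (φ := φ) D)
    (fun ξ hξ u v => BundleFrame.connForm_of_isFlatConnection D hD hξ u v) (φ.chart_mem b hb)
  refine ⟨φ.twist isOpen_ball hrO g hg.contDiffOn, ⟨hb, mem_ball_self hr⟩, convex_ball _ _,
    fun ξ hξ => ?_⟩
  ext u x
  have h := φ.connForm_twist isOpen_ball hrO g hg.contDiffOn D hξ u x
  rw [hgd ξ hξ] at h
  simpa using! h

end FlatFrames

/-! ### Poisson tensors on a manifold read through a local diffeomorphism. -/

section LocalExpression

set_option maxSynthPendingDepth 3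

open ContinuousLinearMap

/-- A map into the continuous endomorphisms is smooth if its matrix entries are. -/
theorem contDiffAt_of_dual {X W : Type*} [NormedAddCommGroup X] [NormedSpace ℝ X]
    [NormedAddCommGroup W] [NormedSpace ℝ W] [FiniteDimensional ℝ W] {w : X → W} {x : X}
    (h : ∀ β : W →L[ℝ] ℝ, ContDiffAt ℝ ∞ (fun y => β (w y)) x) : ContDiffAt ℝ ∞ w x := by
  have h1 : w = fun y => ∑ i, ((Module.finBasis ℝ W).coord i).toContinuousLinearMap (w y) •
      Module.finBasis ℝ W i := funext fun y => ((Module.finBasis ℝ W).sum_repr (w y)).symm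
  rw [h1]
  exact ContDiffAt.sum fun i _ => (h _).smul contDiffAt_const

theorem contDiffAt_clm_of_apply {X V W : Type*} [NormedAddCommGroup X] [NormedSpace ℝ X]
    [NormedAddCommGroup V] [NormedSpace ℝ V] [FiniteDimensional ℝ V]
    [NormedAddCommGroup W] [NormedSpace ℝ W] {w : X → V →L[ℝ] W} {x : X}
    (h : ∀ v : V, ContDiffAt ℝ ∞ (fun y => w y v) x) : ContDiffAt ℝ ∞ w x := by
  have h1 : w = fun y => ∑ i, smulRightL ℝ V W
      ((Module.finBasis ℝ V).coord i).toContinuousLinearMap (w y (Module.finBasis ℝ V i)) := by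
    ext y v
    rw [FunLike.coe_sum, Finset.sum_apply]
    conv_lhs => rw [← (Module.finBasis ℝ V).sum_repr v, map_sum]
    refine Finset.sum_congr rfl fun i _ => ?_
    rw [map_smul]
    rfl
  rw [h1]
  exact ContDiffAt.sum fun i _ => (ContinuousLinearMap.contDiff _).contDiffAt.comp x (h _)

variable {EM : Type*} [NormedAddCommGroup EM] [NormedSpace ℝ EM] [FiniteDimensional ℝ EM]
  {M : Type*} [TopologicalSpace M] [ChartedSpace EM M] [IsManifold 𝓘(ℝ, EM) ∞ M] [T2Space M]
  {W : Type*} [NormedAddCommGroup W] [NormedSpace ℝ W] [FiniteDimensional ℝ W]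
  {Ψ : TensorField₂ 𝓘(ℝ, EM) M} {k : W → M} {q : W}

/-- The pull-back of a tensor field by a map from a normed space. -/
def localExpression (Ψ : TensorField₂ 𝓘(ℝ, EM) M) (k : W → M) (q : W) : (W →L[ℝ] ℝ) →L[ℝ] W :=
  pullback (I := 𝓘(ℝ, W)) k Ψ q

omit [FiniteDimensional ℝ EM] [IsManifold 𝓘(ℝ, EM) ∞ M] [T2Space M] [FiniteDimensional ℝ W] in
theorem isInvertible_mfderiv_of_isLocalDiffeomorphAt
    (hk : IsLocalDiffeomorphAt 𝓘(ℝ, W) 𝓘(ℝ, EM) ∞ k q) :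
    (mfderiv 𝓘(ℝ, W) 𝓘(ℝ, EM) k q : W →L[ℝ] EM).IsInvertible :=
  ⟨hk.mfderivToContinuousLinearEquiv (by simp), hk.mfderivToContinuousLinearEquiv_coe (by simp)⟩

omit [FiniteDimensional ℝ EM] [IsManifold 𝓘(ℝ, EM) ∞ M] [T2Space M] [FiniteDimensional ℝ W] in
theorem localExpression_antisymm (hanti : ∀ (p : M) (α β : TangentSpace 𝓘(ℝ, EM) p →L[ℝ] ℝ),
    β (Ψ p α) = -α (Ψ p β)) (q : W) (α β : W →L[ℝ] ℝ) :
    β (localExpression Ψ k q α) = -α (localExpression Ψ k q β) :=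
  hanti (k q) (α ∘L (mfderiv 𝓘(ℝ, W) 𝓘(ℝ, EM) k q).inverse)
    (β ∘L (mfderiv 𝓘(ℝ, W) 𝓘(ℝ, EM) k q).inverse)

/-- A linear coordinate of a local diffeomorphism extends to a smooth function. -/
theorem exists_extension_of_linear (hk : IsLocalDiffeomorphAt 𝓘(ℝ, W) 𝓘(ℝ, EM) ∞ k q)
    (α : W →L[ℝ] ℝ) :
    ∃ h : M → ℝ, ContMDiff 𝓘(ℝ, EM) 𝓘(ℝ, ℝ) ∞ h ∧ ∀ᶠ y in 𝓝 q, h (k y) = α y := by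
  obtain ⟨Φ, hq, hΦ⟩ := hk
  obtain ⟨ρ, hρ, hρs, hρ1⟩ := exists_contMDiff_cutoff (EB := EM) Φ.open_target (Φ.map_source hq)
  refine ⟨fun m => ρ m • α (Φ.symm m), ?_, ?_⟩
  · have h1 : ContMDiffOn 𝓘(ℝ, EM) 𝓘(ℝ, ℝ) ∞ (fun m => α (Φ.symm m)) Φ.target :=
      α.contDiff.contMDiff.comp_contMDiffOn Φ.contMDiffOn_invFun
    refine contMDiff_of_tsupport fun m hm => ?_
    have hm' : m ∈ tsupport ρ := closure_mono (Function.support_smul_subset_left _ _) hm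
    exact (hρ m).smul (h1.contMDiffAt (Φ.open_target.mem_nhds (hρs hm')))
  · have hc : Filter.Tendsto k (𝓝 q) (𝓝 (Φ q)) := by
      have h1 := (Φ.contMDiffOn_toFun.contMDiffAt (Φ.open_source.mem_nhds hq)).continuousAt
      refine h1.tendsto.congr' ?_
      filter_upwards [Φ.open_source.mem_nhds hq] with y hy using (hΦ hy).symm
    filter_upwards [hc.eventually hρ1, Φ.open_source.mem_nhds hq] with y hy hys
    rw [hy, hΦ hys]
    have : Φ.symm (Φ y) = y := Φ.left_inv hys
    rw [Pi.one_apply, one_smul]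
    exact congrArg α this

omit [FiniteDimensional ℝ EM] [IsManifold 𝓘(ℝ, EM) ∞ M] [T2Space M] [FiniteDimensional ℝ W] in
theorem mvfderiv_comp_localDiffeo (hk : IsLocalDiffeomorphAt 𝓘(ℝ, W) 𝓘(ℝ, EM) ∞ k q)
    {h : M → ℝ} (hh : ContMDiff 𝓘(ℝ, EM) 𝓘(ℝ, ℝ) ∞ h) :
    HasFDerivAt (fun y => h (k y)) (mvfderiv 𝓘(ℝ, EM) h (k q) ∘L mfderiv 𝓘(ℝ, W) 𝓘(ℝ, EM) k q :
      W →L[ℝ] ℝ) q := by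
  have h1 := ((hh.mdifferentiable (by simp)) (k q)).hasMFDerivAt
  have h2 := (hk.mdifferentiableAt (by simp)).hasMFDerivAt
  exact hasMFDerivAt_iff_hasFDerivAt.1 (h1.comp q h2)

omit [FiniteDimensional ℝ EM] [IsManifold 𝓘(ℝ, EM) ∞ M] [T2Space M] [FiniteDimensional ℝ W] in
/-- The bracket in terms of the local expression of a tensor. -/
theorem bracket_localDiffeo (hk : IsLocalDiffeomorphAt 𝓘(ℝ, W) 𝓘(ℝ, EM) ∞ k q)
    {g h : M → ℝ} (hg : ContMDiff 𝓘(ℝ, EM) 𝓘(ℝ, ℝ) ∞ g) (hh : ContMDiff 𝓘(ℝ, EM) 𝓘(ℝ, ℝ) ∞ h) :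
    bracket Ψ g h (k q) = fderiv ℝ (fun y => h (k y)) q
      (localExpression Ψ k q (fderiv ℝ (fun y => g (k y)) q)) := by
  have hi := isInvertible_mfderiv_of_isLocalDiffeomorphAt hk
  rw [(mvfderiv_comp_localDiffeo hk hg).fderiv, (mvfderiv_comp_localDiffeo hk hh).fderiv]
  have h1 : ((mvfderiv 𝓘(ℝ, EM) g (k q) ∘L mfderiv 𝓘(ℝ, W) 𝓘(ℝ, EM) k q : W →L[ℝ] ℝ)) ∘L
      (mfderiv 𝓘(ℝ, W) 𝓘(ℝ, EM) k q : W →L[ℝ] EM).inverse = mvfderiv 𝓘(ℝ, EM) g (k q) := by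
    refine ContinuousLinearMap.ext fun v => ?_
    exact congrArg (mvfderiv 𝓘(ℝ, EM) g (k q)) (hi.self_apply_inverse v)
  refine Eq.trans ?_ (congrArg (mvfderiv 𝓘(ℝ, EM) h (k q)) (hi.self_apply_inverse _)).symm
  exact congrArg (fun α => mvfderiv 𝓘(ℝ, EM) h (k q) (Ψ (k q) α)) h1.symm

/-- The matrix entries of the local expression are brackets of linear coordinates. Smoothness of a
Poisson tensor is tested on global functions, so the coordinates are first extended by cutoffs. -/
theorem contDiffAt_localExpression (hΨ : IsPoissonTensor Ψ)
    (hk : ∀ᶠ y in 𝓝 q, IsLocalDiffeomorphAt 𝓘(ℝ, W) 𝓘(ℝ, EM) ∞ k y) :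
    ContDiffAt ℝ ∞ (localExpression Ψ k) q := by
  refine contDiffAt_clm_of_apply fun α => contDiffAt_of_dual fun β => ?_
  obtain ⟨g, hg, hgα⟩ := exists_extension_of_linear hk.self_of_nhds α
  obtain ⟨h, hh, hhβ⟩ := exists_extension_of_linear hk.self_of_nhds β
  have h1 : ContDiffAt ℝ ∞ (fun y => bracket Ψ g h (k y)) q :=
    contMDiffAt_iff_contDiffAt.1
      ((hΨ.smooth g h hg hh).contMDiffAt.comp q hk.self_of_nhds.contMDiffAt)
  refine h1.congr_of_eventuallyEq ?_
  filter_upwards [hk, hgα.eventually_nhds, hhβ.eventually_nhds] with y hy hgy hhy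
  rw [bracket_localDiffeo hy hg hh, Filter.EventuallyEq.fderiv_eq hgy,
    Filter.EventuallyEq.fderiv_eq hhy, α.fderiv, β.fderiv]

/-- The Jacobi identity for global functions extending three linear coordinates: near the point
these have constant differentials, so only derivatives of the tensor itself remain in the iterated
brackets. -/
theorem jacobiAt_localExpression (hΨ : IsPoissonTensor Ψ)
    (hk : ∀ᶠ y in 𝓝 q, IsLocalDiffeomorphAt 𝓘(ℝ, W) 𝓘(ℝ, EM) ∞ k y) :
    JacobiAt (localExpression Ψ k) q := by
  set Q := localExpression Ψ k with hQ
  have hQd : DifferentiableAt ℝ Q q := (contDiffAt_localExpression hΨ hk).differentiableAt (by simp)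
  have key : ∀ (α β γ : W →L[ℝ] ℝ) (f g h : M → ℝ), ContMDiff 𝓘(ℝ, EM) 𝓘(ℝ, ℝ) ∞ f →
      ContMDiff 𝓘(ℝ, EM) 𝓘(ℝ, ℝ) ∞ g → ContMDiff 𝓘(ℝ, EM) 𝓘(ℝ, ℝ) ∞ h →
      (∀ᶠ y in 𝓝 q, f (k y) = α y) → (∀ᶠ y in 𝓝 q, g (k y) = β y) →
      (∀ᶠ y in 𝓝 q, h (k y) = γ y) →
      bracket Ψ f (bracket Ψ g h) (k q) = γ (fderiv ℝ Q q (Q q α) β) := by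
    intro α β γ f g h hf hg hh hfα hgβ hhγ
    rw [bracket_localDiffeo hk.self_of_nhds hf (hΨ.smooth g h hg hh),
      Filter.EventuallyEq.fderiv_eq hfα, α.fderiv]
    have h1 : (fun y => bracket Ψ g h (k y)) =ᶠ[𝓝 q] fun y => γ (Q y β) := by
      filter_upwards [hk, hgβ.eventually_nhds, hhγ.eventually_nhds] with y hy hgy hhy
      rw [bracket_localDiffeo hy hg hh, Filter.EventuallyEq.fderiv_eq hgy,
        Filter.EventuallyEq.fderiv_eq hhy, β.fderiv, γ.fderiv]
    have h2 := (γ.hasFDerivAt.comp q (hQd.hasFDerivAt.clm_apply (hasFDerivAt_const β q))).fderiv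
    rw [h1.fderiv_eq]
    refine (congrArg (fun L => L (Q q α)) h2).trans ?_
    simp
  intro α β γ
  obtain ⟨f, hf, hfα⟩ := exists_extension_of_linear hk.self_of_nhds α
  obtain ⟨g, hg, hgβ⟩ := exists_extension_of_linear hk.self_of_nhds β
  obtain ⟨h, hh, hhγ⟩ := exists_extension_of_linear hk.self_of_nhds γ
  have h1 := hΨ.jacobi f g h hf hg hh (k q)
  rw [key α β γ f g h hf hg hh hfα hgβ hhγ, key β γ α g h f hg hh hf hgβ hhγ hfα,
    key γ α β h f g hh hf hg hhγ hfα hgβ] at h1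
  exact h1

end LocalExpression

/-! ### Coupling form, coupling lift and vertical part as blocks in a frame. -/

section FrameExpressions

set_option maxSynthPendingDepth 3

open ContinuousLinearMap

variable {EB : Type*} [NormedAddCommGroup EB] [NormedSpace ℝ EB]
  {B : Type*} [TopologicalSpace B] [ChartedSpace EB B]
  {F : Type*} [NormedAddCommGroup F] [NormedSpace ℝ F]
  {E : B → Type*} [∀ b, AddCommGroup (E b)] [∀ b, Module ℝ (E b)]
  [∀ b, TopologicalSpace (E b)] [∀ b, IsTopologicalAddGroup (E b)]
  [∀ b, ContinuousSMul ℝ (E b)] [TopologicalSpace (TotalSpace F E)]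
  [FiberBundle F E] [VectorBundle ℝ F E]

/-- The block `T^*B → TB` of a tensor on a product. -/
def block₁₁ (T : (EB × F →L[ℝ] ℝ) →L[ℝ] EB × F) : (EB →L[ℝ] ℝ) →L[ℝ] EB :=
  fst ℝ EB F ∘L T ∘L precomp ℝ (fst ℝ EB F)

/-- The block `T^*B → V` of a tensor on a product. -/
def block₂₁ (T : (EB × F →L[ℝ] ℝ) →L[ℝ] EB × F) : (EB →L[ℝ] ℝ) →L[ℝ] F :=
  snd ℝ EB F ∘L T ∘L precomp ℝ (fst ℝ EB F)

/-- The block `V^* → V` of a tensor on a product. -/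
def block₂₂ (T : (EB × F →L[ℝ] ℝ) →L[ℝ] EB × F) : (F →L[ℝ] ℝ) →L[ℝ] F :=
  snd ℝ EB F ∘L T ∘L precomp ℝ (snd ℝ EB F)

theorem block₂₂_apply (T : (EB × F →L[ℝ] ℝ) →L[ℝ] EB × F) (a : F →L[ℝ] ℝ) :
    block₂₂ T a = (T (a ∘L snd ℝ EB F)).2 := rfl

/-- The decomposition of an antisymmetric tensor into its horizontal and vertical parts. -/
theorem sub_horizontal_part {T : (EB × F →L[ℝ] ℝ) →L[ℝ] EB × F}
    (hT : ∀ α β : EB × F →L[ℝ] ℝ, β (T α) = -α (T β)) (hS : (block₁₁ T).IsInvertible)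
    (c : EB × F →L[ℝ] ℝ) :
    T c - ((block₁₁ T) (c ∘L (ContinuousLinearMap.id ℝ EB).prod (block₂₁ T ∘L (block₁₁ T).inverse)),
      block₂₁ T (c ∘L (ContinuousLinearMap.id ℝ EB).prod (block₂₁ T ∘L (block₁₁ T).inverse))) =
    (0, block₂₂ T (c ∘L inr ℝ EB F) -
      block₂₁ T ((c ∘L inr ℝ EB F) ∘L block₂₁ T ∘L (block₁₁ T).inverse)) := by
  set S := block₁₁ T with hSdef
  set N := block₂₁ T with hNdef
  set a := c ∘L inl ℝ EB F with ha
  set γ := c ∘L inr ℝ EB F with hγ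
  have hc : c = a ∘L fst ℝ EB F + γ ∘L snd ℝ EB F := by
    ext x
    · simp only [ha, hγ, ContinuousLinearMap.comp_apply, add_apply, coe_fst', coe_snd', inl_apply,
        map_zero, add_zero]
    · simp only [ha, hγ, ContinuousLinearMap.comp_apply, add_apply, coe_fst', coe_snd', inr_apply,
        map_zero, zero_add]
  have hcp : c ∘L (ContinuousLinearMap.id ℝ EB).prod (N ∘L S.inverse) = a + γ ∘L N ∘L S.inverse := by
    rw [hc]
    ext u
    simp
  -- Antisymmetry determines the remaining mixed block from `S` and `N`; this makes the base
  -- component of the difference vanish.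
  have hM : (T (γ ∘L snd ℝ EB F)).1 = S (γ ∘L N ∘L S.inverse) := by
    refine (SeparatingDual.eq_iff_forall_dual_eq (R := ℝ)).2 fun d => ?_
    have h1 := hT (γ ∘L snd ℝ EB F) (d ∘L fst ℝ EB F)
    have h2 := hT ((γ ∘L N ∘L S.inverse) ∘L fst ℝ EB F) (d ∘L fst ℝ EB F)
    refine h1.trans (Eq.trans ?_ h2.symm)
    have h3 : S.inverse (T (d ∘L fst ℝ EB F)).1 = d := hS.inverse_apply_self d
    simp only [ContinuousLinearMap.comp_apply, coe_fst', coe_snd', h3]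
    rfl
  rw [hcp]
  nth_rewrite 1 [hc]
  rw [map_add, map_add, map_add]
  refine Prod.ext ?_ ?_
  · simp only [Prod.fst_sub, Prod.fst_add]
    rw [hM]
    exact sub_self _
  · simp only [Prod.snd_sub, Prod.snd_add]
    change (T (a ∘L fst ℝ EB F)).2 + (T (γ ∘L snd ℝ EB F)).2 -
      ((T (a ∘L fst ℝ EB F)).2 + N (γ ∘L N ∘L S.inverse)) = block₂₂ T γ - N (γ ∘L N ∘L S.inverse)
    rw [block₂₂_apply]
    abel

theorem inverse_neg_inverse {X Y : Type*} [AddCommGroup X] [Module ℝ X] [TopologicalSpace X]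
    [IsTopologicalAddGroup X] [AddCommGroup Y] [Module ℝ Y] [TopologicalSpace Y]
    [IsTopologicalAddGroup Y] {L : X →L[ℝ] Y} (hL : L.IsInvertible) :
    (-L.inverse).inverse = -L :=
  ContinuousLinearMap.inverse_eq (by ext x; simp [hL.inverse_apply_self])
    (by ext x; simp [hL.self_apply_inverse])

namespace BundleFrame

variable {φ : BundleFrame EB F E}

omit [∀ b, IsTopologicalAddGroup (E b)] [∀ b, ContinuousSMul ℝ (E b)] in
theorem isLocalDiffeomorphAt_tot {q : EB × F} (hq : q ∈ φ.source) :
    IsLocalDiffeomorphAt 𝓘(ℝ, EB × F) (𝓘(ℝ, EB).prod 𝓘(ℝ, F)) ∞ φ.tot q :=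
  ⟨{ toFun := φ.tot
     invFun := φ.inv
     source := φ.source
     target := φ.target
     map_source' := fun _ h => tot_mem h
     map_target' := fun _ h => inv_mem h
     left_inv' := fun _ h => inv_tot h
     right_inv' := fun _ h => tot_inv h
     open_source := isOpen_source
     open_target := isOpen_target
     contMDiffOn_toFun := φ.contMDiffOn_tot
     contMDiffOn_invFun := φ.contMDiffOn_inv }, hq, fun _ _ => rfl⟩

variable {P : TensorField₂ (𝓘(ℝ, EB).prod 𝓘(ℝ, F)) (TotalSpace F E)} {q : EB × F}
  {T : (EB × F →L[ℝ] ℝ) →L[ℝ] EB × F}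

omit [∀ b, IsTopologicalAddGroup (E b)] [∀ b, ContinuousSMul ℝ (E b)] in
theorem baseBlock_eq (hq : q ∈ φ.source) (hT : φ.IsLocal P q T) :
    baseBlock P (φ.tot q) = φ.dbase q.1 ∘L block₁₁ T ∘L
      (precomp ℝ (φ.dbase q.1) : (EB →L[ℝ] ℝ) →L[ℝ] (EB →L[ℝ] ℝ)) := by
  refine ContinuousLinearMap.ext fun a => ?_
  refine (congrArg (dproj (φ.tot q)) (hT _)).trans ?_
  rw [dproj_dtot hq]
  have h1 : (a ∘L dproj (φ.tot q)) ∘L φ.dtot q = (a ∘L φ.dbase q.1) ∘L fst ℝ EB F :=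
    ContinuousLinearMap.ext fun v => congrArg a (dproj_dtot hq v)
  exact congrArg (fun z => φ.dbase q.1 (T z).1) h1

omit [∀ b, IsTopologicalAddGroup (E b)] [∀ b, ContinuousSMul ℝ (E b)] in
theorem inverse_baseBlock (hq : q ∈ φ.source) (hT : φ.IsLocal P q T)
    (hS : (block₁₁ T).IsInvertible) (u : EB) :
    (baseBlock P (φ.tot q)).IsInvertible ∧
    (baseBlock P (φ.tot q)).inverse (φ.dbase q.1 u) =
      ((block₁₁ T).inverse u ∘L (φ.dbase q.1).inverse : EB →L[ℝ] ℝ) := by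
  have hd : (φ.dbase q.1 : EB →L[ℝ] EB).IsInvertible := isInvertible_dbase (mem_source.1 hq)
  have hp : (precomp ℝ (φ.dbase q.1) : (EB →L[ℝ] ℝ) →L[ℝ] (EB →L[ℝ] ℝ)).IsInvertible :=
    isInvertible_precomp (X := EB) (Y := EB) hd
  have h1 : (baseBlock P (φ.tot q)).IsInvertible := by
    rw [baseBlock_eq hq hT]
    obtain ⟨e, he⟩ := hp
    obtain ⟨s, hs⟩ := hS
    obtain ⟨d, hd⟩ : ∃ d : EB ≃L[ℝ] EB, (d : EB →L[ℝ] EB) = φ.dbase q.1 := hd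
    have h3 : (d : EB →L[ℝ] EB) ∘L (s : (EB →L[ℝ] ℝ) →L[ℝ] EB) ∘L
      (e : (EB →L[ℝ] ℝ) →L[ℝ] (EB →L[ℝ] ℝ)) = φ.dbase q.1 ∘L block₁₁ T ∘L
      (precomp ℝ (φ.dbase q.1) : (EB →L[ℝ] ℝ) →L[ℝ] (EB →L[ℝ] ℝ)) := by
      rw [he, hs, hd]
      rfl
    exact ⟨(e.trans s).trans d, h3⟩
  refine ⟨h1, ?_⟩
  have h2 : baseBlock P (φ.tot q) ((block₁₁ T).inverse u ∘L (φ.dbase q.1).inverse : EB →L[ℝ] ℝ) =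
      φ.dbase q.1 u := by
    rw [baseBlock_eq hq hT]
    have h3 : ((block₁₁ T).inverse u ∘L (φ.dbase q.1).inverse : EB →L[ℝ] ℝ) ∘L
        (φ.dbase q.1 : EB →L[ℝ] EB) = (block₁₁ T).inverse u := by
      ext v
      exact congrArg ((block₁₁ T).inverse u) (hd.inverse_apply_self v)
    refine (congrArg (fun z => φ.dbase q.1 (block₁₁ T z)) h3).trans ?_
    rw [hS.self_apply_inverse]
  rw [← h2]
  exact h1.inverse_apply_self _

omit [∀ b, IsTopologicalAddGroup (E b)] [∀ b, ContinuousSMul ℝ (E b)] in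
theorem couplingLift_dbase (hq : q ∈ φ.source) (hT : φ.IsLocal P q T)
    (hS : (block₁₁ T).IsInvertible) (u : EB) :
    couplingLift P (φ.tot q) (φ.dbase q.1 u) =
      φ.dtot q (u, block₂₁ T ((block₁₁ T).inverse u)) := by
  have hd : (φ.dbase q.1 : EB →L[ℝ] EB).IsInvertible := isInvertible_dbase (mem_source.1 hq)
  have h1 := (inverse_baseBlock hq hT hS u).2
  refine (congrArg (fun a => P (φ.tot q) (a ∘L dproj (φ.tot q))) h1).trans ?_
  refine (hT _).trans (congrArg (φ.dtot q) ?_)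
  have h2 : ((((block₁₁ T).inverse u ∘L (φ.dbase q.1).inverse : EB →L[ℝ] ℝ) :
      TangentSpace 𝓘(ℝ, EB) (φ.tot q).proj →L[ℝ] ℝ) ∘L dproj (φ.tot q)) ∘L φ.dtot q =
      (block₁₁ T).inverse u ∘L fst ℝ EB F := by
    refine ContinuousLinearMap.ext fun v => ?_
    refine (congrArg (fun z : EB => (block₁₁ T).inverse u ((φ.dbase q.1).inverse z))
      (dproj_dtot hq v)).trans ?_
    exact congrArg ((block₁₁ T).inverse u) (hd.inverse_apply_self v.1)
  refine (congrArg T h2).trans (Prod.ext ?_ rfl)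
  exact hS.self_apply_inverse u

omit [∀ b, IsTopologicalAddGroup (E b)] [∀ b, ContinuousSMul ℝ (E b)] in
theorem couplingForm_dbase (hq : q ∈ φ.source) (hT : φ.IsLocal P q T)
    (hS : (block₁₁ T).IsInvertible) (u v : EB) :
    couplingForm P (φ.tot q) (φ.dbase q.1 u) (φ.dbase q.1 v) = -(block₁₁ T).inverse u v := by
  have hd : (φ.dbase q.1 : EB →L[ℝ] EB).IsInvertible := isInvertible_dbase (mem_source.1 hq)
  have h1 := (inverse_baseBlock hq hT hS u).2
  refine (congrArg (fun a : EB →L[ℝ] ℝ => -(a (φ.dbase q.1 v))) h1).trans ?_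
  exact congrArg (fun z => -((block₁₁ T).inverse u z)) (hd.inverse_apply_self v)

omit [∀ b, IsTopologicalAddGroup (E b)] [∀ b, ContinuousSMul ℝ (E b)] in
-- Subtracting the horizontal part leaves the Schur complement of the base block, embedded
-- vertically.
theorem vertPart_eq (hq : q ∈ φ.source) (hT : φ.IsLocal P q T)
    (hanti : ∀ α β : EB × F →L[ℝ] ℝ, β (T α) = -α (T β)) (hS : (block₁₁ T).IsInvertible)
    (γ : TangentSpace (𝓘(ℝ, EB).prod 𝓘(ℝ, F)) (φ.tot q) →L[ℝ] ℝ) :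
    vertPart P (φ.tot q) γ = vertLift EB (φ.tot q) (φ.fib (φ.base q.1)
      (block₂₂ T ((γ ∘L φ.dtot q) ∘L inr ℝ EB F) -
        block₂₁ T (((γ ∘L φ.dtot q) ∘L inr ℝ EB F) ∘L block₂₁ T ∘L (block₁₁ T).inverse))) := by
  have hi := (inverse_baseBlock hq hT hS 0).1
  rw [← dtot_inr hq, ← sub_horizontal_part hanti hS]
  have h1 : (couplingForm P (φ.tot q)).inverse = -baseBlock P (φ.tot q) := by
    exact inverse_neg_inverse hi
  have h3 : horTensor (φ.tot q) (couplingLift P (φ.tot q)) (couplingForm P (φ.tot q)) γ =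
      couplingLift P (φ.tot q) (baseBlock P (φ.tot q) (γ ∘L couplingLift P (φ.tot q))) := by
    have h4 : horTensor (φ.tot q) (couplingLift P (φ.tot q)) (couplingForm P (φ.tot q)) γ =
      -couplingLift P (φ.tot q) ((couplingForm P (φ.tot q)).inverse
        (γ ∘L couplingLift P (φ.tot q))) := rfl
    rw [h4, h1, neg_apply, map_neg, neg_neg]
  have h5 : baseBlock P (φ.tot q) (γ ∘L couplingLift P (φ.tot q)) = φ.dbase q.1 (block₁₁ T
      ((γ ∘L φ.dtot q) ∘L (ContinuousLinearMap.id ℝ EB).prod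
        (block₂₁ T ∘L (block₁₁ T).inverse))) := by
    rw [baseBlock_eq hq hT]
    refine congrArg (fun z => φ.dbase q.1 (block₁₁ T z)) ?_
    exact ContinuousLinearMap.ext fun u => congrArg γ (couplingLift_dbase hq hT hS u)
  have h6 : vertPart P (φ.tot q) γ = P (φ.tot q) γ -
      horTensor (φ.tot q) (couplingLift P (φ.tot q)) (couplingForm P (φ.tot q)) γ := rfl
  rw [h6, h3, h5, couplingLift_dbase hq hT hS, hT, ← map_sub, hS.inverse_apply_self]

end BundleFrame

end FrameExpressions

/-! ### The pulled back tensor in a frame and its values on the zero section. -/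

section JetExtraction

set_option maxSynthPendingDepth 3

open ContinuousLinearMap

section Blocks

variable {EB : Type*} [NormedAddCommGroup EB] [NormedSpace ℝ EB]
  {F : Type*} [NormedAddCommGroup F] [NormedSpace ℝ F]
  {Q : ℝ → (EB × F →L[ℝ] ℝ) →L[ℝ] EB × F} {Q' : (EB × F →L[ℝ] ℝ) →L[ℝ] EB × F} {t : ℝ}

theorem hasDerivAt_block₁₁ (h : HasDerivAt Q Q' t) :
    HasDerivAt (fun s => block₁₁ (Q s)) (block₁₁ Q') t := by
  have h1 := ((compL ℝ (EB →L[ℝ] ℝ) (EB × F) EB (fst ℝ EB F)) ∘L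
    ((compL ℝ (EB →L[ℝ] ℝ) (EB × F →L[ℝ] ℝ) (EB × F)).flip
      (precomp ℝ (fst ℝ EB F)))).hasFDerivAt.comp_hasDerivAt t h
  exact h1

theorem hasDerivAt_block₂₁ (h : HasDerivAt Q Q' t) :
    HasDerivAt (fun s => block₂₁ (Q s)) (block₂₁ Q') t := by
  have h1 := ((compL ℝ (EB →L[ℝ] ℝ) (EB × F) F (snd ℝ EB F)) ∘L
    ((compL ℝ (EB →L[ℝ] ℝ) (EB × F →L[ℝ] ℝ) (EB × F)).flip
      (precomp ℝ (fst ℝ EB F)))).hasFDerivAt.comp_hasDerivAt t h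
  exact h1

theorem hasDerivAt_block₂₂ (h : HasDerivAt Q Q' t) :
    HasDerivAt (fun s => block₂₂ (Q s)) (block₂₂ Q') t := by
  have h1 := ((compL ℝ (F →L[ℝ] ℝ) (EB × F) F (snd ℝ EB F)) ∘L
    ((compL ℝ (F →L[ℝ] ℝ) (EB × F →L[ℝ] ℝ) (EB × F)).flip
      (precomp ℝ (snd ℝ EB F)))).hasFDerivAt.comp_hasDerivAt t h
  exact h1

end Blocks

variable {EM : Type*} [NormedAddCommGroup EM] [NormedSpace ℝ EM]
  {M : Type*} [TopologicalSpace M] [ChartedSpace EM M]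
  {EB : Type*} [NormedAddCommGroup EB] [NormedSpace ℝ EB]
  {B : Type*} [TopologicalSpace B] [ChartedSpace EB B]
  {F : Type*} [NormedAddCommGroup F] [NormedSpace ℝ F]
  {E : B → Type*} [∀ b, AddCommGroup (E b)] [∀ b, Module ℝ (E b)]
  [∀ b, TopologicalSpace (E b)]
  [TopologicalSpace (TotalSpace F E)]
  [FiberBundle F E] [VectorBundle ℝ F E]
  {Ψ : TensorField₂ 𝓘(ℝ, EM) M} {f : TotalSpace F E → M} {φ : BundleFrame EB F E}

namespace BundleFrame

theorem isLocalDiffeomorphAt_comp_tot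
    (hf : IsLocalDiffeomorph (𝓘(ℝ, EB).prod 𝓘(ℝ, F)) 𝓘(ℝ, EM) ∞ f) {q : EB × F}
    (hq : q ∈ φ.source) : IsLocalDiffeomorphAt 𝓘(ℝ, EB × F) 𝓘(ℝ, EM) ∞ (f ∘ φ.tot) q :=
  (isLocalDiffeomorphAt_tot hq).comp 𝓘(ℝ, EM) M (hf _)

theorem isLocal_localExpression
    (hf : IsLocalDiffeomorph (𝓘(ℝ, EB).prod 𝓘(ℝ, F)) 𝓘(ℝ, EM) ∞ f) {q : EB × F}
    (hq : q ∈ φ.source) : φ.IsLocal (pullback f Ψ) q (localExpression Ψ (f ∘ φ.tot) q) := by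
  intro α
  have h1 := hasMFDerivAt_tot hq
  have h2 := ((hf (φ.tot q)).mdifferentiableAt (by simp)).hasMFDerivAt
  have h3 := (h2.comp q h1).mfderiv
  have hd : (φ.dtot q : EB × F →L[ℝ] EB × F).IsInvertible := isInvertible_dtot hq
  have hdf : (mfderiv (𝓘(ℝ, EB).prod 𝓘(ℝ, F)) 𝓘(ℝ, EM) f (φ.tot q) : EB × F →L[ℝ] EM).IsInvertible :=
    ⟨(hf (φ.tot q)).mfderivToContinuousLinearEquiv (by simp),
      (hf (φ.tot q)).mfderivToContinuousLinearEquiv_coe (by simp)⟩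
  set L : EB × F →L[ℝ] EM := mfderiv (𝓘(ℝ, EB).prod 𝓘(ℝ, F)) 𝓘(ℝ, EM) f (φ.tot q) with hL
  have h4 : ∀ w : EM, φ.dtot q ((mfderiv 𝓘(ℝ, EB × F) 𝓘(ℝ, EM) (f ∘ φ.tot) q :
      EB × F →L[ℝ] EM).inverse w) = L.inverse w := by
    intro w
    refine hdf.injective ?_
    refine Eq.trans ?_ (hdf.self_apply_inverse w).symm
    refine (congrArg (fun K : EB × F →L[ℝ] EM => K ((mfderiv 𝓘(ℝ, EB × F) 𝓘(ℝ, EM) (f ∘ φ.tot) q :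
      EB × F →L[ℝ] EM).inverse w)) h3).symm.trans ?_
    exact (isInvertible_mfderiv_of_isLocalDiffeomorphAt
      (isLocalDiffeomorphAt_comp_tot hf hq)).self_apply_inverse w
  have h6 : (α ∘L φ.dtot q) ∘L (mfderiv 𝓘(ℝ, EB × F) 𝓘(ℝ, EM) (f ∘ φ.tot) q :
      EB × F →L[ℝ] EM).inverse = (α ∘L L.inverse : EM →L[ℝ] ℝ) :=
    ContinuousLinearMap.ext fun w => congrArg α (h4 w)
  refine Eq.trans ?_ (congrArg (fun c : EM →L[ℝ] ℝ => φ.dtot q ((mfderiv 𝓘(ℝ, EB × F) 𝓘(ℝ, EM)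
    (f ∘ φ.tot) q : EB × F →L[ℝ] EM).inverse (Ψ (f (φ.tot q)) c))) h6).symm
  exact (h4 _).symm

end BundleFrame

section Zero

variable [IsManifold 𝓘(ℝ, EB) ∞ B] [ContMDiffVectorBundle ∞ F E 𝓘(ℝ, EB)] {ι : B → M}
  {ξ : EB}

theorem mfderiv_zero_section_frame
    (hf : IsLocalDiffeomorph (𝓘(ℝ, EB).prod 𝓘(ℝ, F)) 𝓘(ℝ, EM) ∞ f)
    (hz : ∀ b, f ⟨b, 0⟩ = ι b) (hξ : ξ ∈ φ.dom) (u : EB) :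
    (mfderiv 𝓘(ℝ, EB × F) 𝓘(ℝ, EM) (f ∘ φ.tot) (ξ, 0) : EB × F →L[ℝ] EM) (u, 0) =
      mfderiv 𝓘(ℝ, EB) 𝓘(ℝ, EM) ι (φ.base ξ) (φ.dbase ξ u) := by
  have hι : ContMDiff 𝓘(ℝ, EB) 𝓘(ℝ, EM) ∞ ι := by
    have h1 : ι = f ∘ zeroSection F E := funext fun b => (hz b).symm
    rw [h1]
    exact hf.contMDiff.comp (contMDiff_zeroSection ℝ E)
  have h1 := (hι.mdifferentiable (by simp) (φ.base ξ)).hasMFDerivAt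
  have h2 := (h1.comp ξ (BundleFrame.hasMFDerivAt_base hξ)).mfderiv
  have h3 : HasMFDerivAt 𝓘(ℝ, EB) 𝓘(ℝ, EB × F) (fun η : EB => ((η, 0) : EB × F)) ξ (inl ℝ EB F) :=
    ((hasFDerivAt_id ξ).prodMk (hasFDerivAt_const (0 : F) ξ)).hasMFDerivAt
  have h4 := ((BundleFrame.isLocalDiffeomorphAt_comp_tot (φ := φ) hf (q := (ξ, 0))
    (BundleFrame.mem_source.2 hξ)).mdifferentiableAt (by simp)).hasMFDerivAt
  have h5 := (h4.comp ξ h3).mfderiv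
  have h6 : (f ∘ φ.tot) ∘ (fun η : EB => ((η, 0) : EB × F)) = ι ∘ φ.base := by
    ext1 η
    simp only [Function.comp_apply, BundleFrame.tot_zero, hz]
  rw [h6] at h5
  exact congrArg (fun L => L u) (h5.symm.trans h2)

variable [FiniteDimensional ℝ EB] {Ω : FormField₂ 𝓘(ℝ, EB) B}

/-- The local expression along the zero section. -/
theorem localExpression_zero
    (hanti : ∀ (p : M) (α β : TangentSpace 𝓘(ℝ, EM) p →L[ℝ] ℝ), β (Ψ p α) = -α (Ψ p β))
    (hleaf : IsEmbeddedSymplecticLeaf Ψ ι Ω)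
    (hf : IsLocalDiffeomorph (𝓘(ℝ, EB).prod 𝓘(ℝ, F)) 𝓘(ℝ, EM) ∞ f)
    (hz : ∀ b, f ⟨b, 0⟩ = ι b) (hξ : ξ ∈ φ.dom) :
    (∀ c, localExpression Ψ (f ∘ φ.tot) (ξ, 0) c =
      (block₁₁ (localExpression Ψ (f ∘ φ.tot) (ξ, 0)) (c ∘L inl ℝ EB F), 0)) ∧
    (block₁₁ (localExpression Ψ (f ∘ φ.tot) (ξ, 0))).IsInvertible ∧
    block₁₁ (localExpression Ψ (f ∘ φ.tot) (ξ, 0)) = -(φ.locForm ξ (Ω (φ.base ξ))).inverse ∧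
    (φ.locForm ξ (Ω (φ.base ξ))).IsInvertible := by
  have hk := BundleFrame.isLocalDiffeomorphAt_comp_tot (φ := φ) hf (q := (ξ, 0))
    (BundleFrame.mem_source.2 hξ)
  have hi := isInvertible_mfderiv_of_isLocalDiffeomorphAt hk
  set Q := localExpression Ψ (f ∘ φ.tot) (ξ, 0) with hQ
  set L : EB × F →L[ℝ] EM := mfderiv 𝓘(ℝ, EB × F) 𝓘(ℝ, EM) (f ∘ φ.tot) (ξ, 0) with hL
  replace hi : ContinuousLinearMap.IsInvertible (M := EB × F) (M₂ := EM) L := hi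
  have hQa : ∀ α β : EB × F →L[ℝ] ℝ, β (Q α) = -α (Q β) :=
    localExpression_antisymm (k := f ∘ φ.tot) hanti (ξ, 0)
  have hpt : (f ∘ φ.tot) (ξ, 0) = ι (φ.base ξ) := by
    simp only [Function.comp_apply, BundleFrame.tot_zero, hz]
  have hLd : ∀ u : EB, L (u, 0) = (mfderiv 𝓘(ℝ, EB) 𝓘(ℝ, EM) ι (φ.base ξ) (φ.dbase ξ u) : EM) :=
    mfderiv_zero_section_frame hf hz hξ (ι := ι)
  have hQL : ∀ c : EB × F →L[ℝ] ℝ, L (Q c) = Ψ (ι (φ.base ξ)) (c ∘L L.inverse : EM →L[ℝ] ℝ) := by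
    intro c
    have h1 : L (Q c) = Ψ ((f ∘ φ.tot) (ξ, 0)) (c ∘L L.inverse : EM →L[ℝ] ℝ) :=
      hi.self_apply_inverse _
    rw [h1]
    have h2 : ∀ m m' : M, m = m' → ∀ c : EM →L[ℝ] ℝ, (Ψ m c : EM) = Ψ m' c := by
      rintro m _ rfl c; rfl
    exact h2 _ _ hpt _
  have hdb : (φ.dbase ξ : EB →L[ℝ] EB).IsInvertible := BundleFrame.isInvertible_dbase hξ
  have htan := hleaf.tangent (φ.base ξ)
  -- Hamiltonian vectors at points of the leaf are tangent to the leaf, that is, to the zero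
  -- section.
  have hsnd : ∀ c, (Q c).2 = 0 := by
    intro c
    obtain ⟨w, hw⟩ : Ψ (ι (φ.base ξ)) (c ∘L L.inverse : EM →L[ℝ] ℝ) ∈
        range (mfderiv 𝓘(ℝ, EB) 𝓘(ℝ, EM) ι (φ.base ξ)) := by
      rw [htan]; exact mem_range_self _
    have h1 : L (Q c) = L ((φ.dbase ξ).inverse w, 0) := by
      rw [hQL, hLd, ← hw]
      exact congrArg _ (hdb.self_apply_inverse w).symm
    rw [hi.injective h1]
  have hzero : ∀ c, Q c = (block₁₁ Q (c ∘L inl ℝ EB F), 0) := by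
    intro c
    refine Prod.ext ?_ (hsnd c)
    refine (SeparatingDual.eq_iff_forall_dual_eq (R := ℝ)).2 fun d => ?_
    have h1 := hQa c (d ∘L fst ℝ EB F)
    have h2 := hQa ((c ∘L inl ℝ EB F) ∘L fst ℝ EB F) (d ∘L fst ℝ EB F)
    refine h1.trans (Eq.trans ?_ h2.symm)
    have h3 : Q (d ∘L fst ℝ EB F) = ((Q (d ∘L fst ℝ EB F)).1, 0) := Prod.ext rfl (hsnd _)
    refine congrArg Neg.neg ?_
    exact congrArg c h3
  have hsurj : ∀ u : EB, ∃ c : EB × F →L[ℝ] ℝ, Q c = (u, 0) := by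
    intro u
    obtain ⟨α, hα⟩ : mfderiv 𝓘(ℝ, EB) 𝓘(ℝ, EM) ι (φ.base ξ) (φ.dbase ξ u) ∈
        range (Ψ (ι (φ.base ξ))) := by
      rw [← htan]; exact mem_range_self _
    refine ⟨(α ∘L L : EB × F →L[ℝ] ℝ), hi.injective ((hQL _).trans ?_)⟩
    refine Eq.trans ?_ (hα.trans (hLd u).symm)
    refine congrArg (Ψ (ι (φ.base ξ))) ?_
    exact ContinuousLinearMap.ext fun v => congrArg α (hi.self_apply_inverse v)
  have hSs : Function.Surjective (block₁₁ Q) := by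
    intro u
    obtain ⟨c, hc⟩ := hsurj u
    refine ⟨c ∘L inl ℝ EB F, ?_⟩
    rw [hzero] at hc
    exact congrArg Prod.fst hc
  -- Hamiltonian vectors fill the tangent space of the leaf, so the base block is surjective; a
  -- space and its dual have equal dimension.
  have hSi : (block₁₁ Q).IsInvertible := by
    have hdim : Module.finrank ℝ (EB →L[ℝ] ℝ) = Module.finrank ℝ EB := by
      rw [← LinearEquiv.finrank_eq (LinearMap.toContinuousLinearMap (𝕜 := ℝ) (E := EB) (F' := ℝ))]
      exact Subspace.dual_finrank_eq
    have hinj := (LinearMap.injective_iff_surjective_of_finrank_eq_finrank hdim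
      (f := (block₁₁ Q : (EB →L[ℝ] ℝ) →ₗ[ℝ] EB))).2 hSs
    exact ⟨(LinearEquiv.ofBijective (block₁₁ Q : (EB →L[ℝ] ℝ) →ₗ[ℝ] EB)
      ⟨hinj, hSs⟩).toContinuousLinearEquiv, by ext; rfl⟩
  -- The compatibility of the form with the tensor, together with antisymmetry, fixes the sign: the
  -- base block is minus the inverse of `ω`.
  have hform : ∀ a, φ.locForm ξ (Ω (φ.base ξ)) (block₁₁ Q a) = -a := by
    intro a
    ext v
    obtain ⟨c, hc⟩ := hsurj v
    have hQa' : Q (a ∘L fst ℝ EB F) = (block₁₁ Q a, 0) := Prod.ext rfl (hsnd _)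
    have h1 := hleaf.form (φ.base ξ) ((a ∘L fst ℝ EB F) ∘L L.inverse : EM →L[ℝ] ℝ)
      (c ∘L L.inverse : EM →L[ℝ] ℝ) (φ.dbase ξ (block₁₁ Q a)) (φ.dbase ξ v)
      ((hLd _).symm.trans ((congrArg L hQa').symm.trans (hQL _)))
      ((hLd _).symm.trans ((congrArg L hc).symm.trans (hQL _)))
    refine h1.trans ?_
    refine (congrArg (fun w : EM => c (L.inverse w)) (hQL (a ∘L fst ℝ EB F))).symm.trans ?_
    rw [hi.inverse_apply_self, hQa, hc]
    rfl
  have hF : φ.locForm ξ (Ω (φ.base ξ)) = -(block₁₁ Q).inverse := by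
    ext1 u
    obtain ⟨a, rfl⟩ := hSs u
    rw [hform, neg_apply, hSi.inverse_apply_self]
  have hFi : (φ.locForm ξ (Ω (φ.base ξ))).IsInvertible := by
    obtain ⟨e, he⟩ := hSi
    exact ⟨e.symm.trans (ContinuousLinearEquiv.neg ℝ), by rw [hF, ← he, inverse_equiv]; rfl⟩
  refine ⟨hzero, hSi, ?_, hFi⟩
  rw [hF, inverse_neg_inverse hSi, neg_neg]

end Zero

end JetExtraction

/-! ### First derivatives along the zero section from the linearized data. -/

section JetExtraction

set_option maxSynthPendingDepth 3

open ContinuousLinearMap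

variable {EB : Type*} [NormedAddCommGroup EB] [NormedSpace ℝ EB] [FiniteDimensional ℝ EB]
  {B : Type*} [TopologicalSpace B] [ChartedSpace EB B] [IsManifold 𝓘(ℝ, EB) ∞ B]
  {F : Type*} [NormedAddCommGroup F] [NormedSpace ℝ F] [FiniteDimensional ℝ F]
  {E : B → Type*} [∀ b, AddCommGroup (E b)] [∀ b, Module ℝ (E b)]
  [∀ b, TopologicalSpace (E b)] [∀ b, IsTopologicalAddGroup (E b)]
  [∀ b, ContinuousSMul ℝ (E b)] [TopologicalSpace (TotalSpace F E)]
  [FiberBundle F E] [VectorBundle ℝ F E] [ContMDiffVectorBundle ∞ F E 𝓘(ℝ, EB)]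
  {φ : BundleFrame EB F E}
  {P : TensorField₂ (𝓘(ℝ, EB).prod 𝓘(ℝ, F)) (TotalSpace F E)}
  {Λ : LinearVertTensor E} {D : CovariantDerivative 𝓘(ℝ, EB) F E} {R : DualValuedForm EB E}
  {Q : EB × F → (EB × F →L[ℝ] ℝ) →L[ℝ] EB × F} {ξ : EB}

namespace BundleFrame

section Line

variable {y : F}

omit [FiniteDimensional ℝ EB] [FiniteDimensional ℝ F] in
theorem hasDerivAt_line (hd : DifferentiableAt ℝ Q (ξ, 0)) :
    HasDerivAt (fun t : ℝ => Q (ξ, t • y)) (fderiv ℝ Q (ξ, 0) (0, y)) 0 := by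
  have h1 : HasDerivAt (fun t : ℝ => ((ξ, t • y) : EB × F)) (0, y) 0 := by
    have h2 : HasDerivAt (fun t : ℝ => t • y) y 0 := by
      simpa using (hasDerivAt_id' (0 : ℝ)).smul_const y
    exact (hasDerivAt_const _ _).prodMk h2
  have h3 : HasFDerivAt Q (fderiv ℝ Q (ξ, 0)) (ξ, (0 : ℝ) • y) := by
    rw [zero_smul]; exact hd.hasFDerivAt
  exact h3.comp_hasDerivAt 0 h1

theorem hasDerivAt_inverse_line {S : ℝ → (EB →L[ℝ] ℝ) →L[ℝ] EB} {S' : (EB →L[ℝ] ℝ) →L[ℝ] EB}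
    (hS : HasDerivAt S S' 0) (hi : (S 0).IsInvertible) :
    HasDerivAt (fun t => (S t).inverse) (-((S 0).inverse ∘L S' ∘L (S 0).inverse)) 0 := by
  have := FiniteDimensional.complete ℝ (EB →L[ℝ] ℝ)
  have hev : ∀ᶠ t in 𝓝 (0 : ℝ), (S t).IsInvertible :=
    hS.continuousAt.eventually (isOpen_setOf_isInvertible.mem_nhds hi)
  have hd : DifferentiableAt ℝ (fun t => (S t).inverse) 0 := by
    have h1 : ContDiffAt ℝ ∞ (fun L : (EB →L[ℝ] ℝ) →L[ℝ] EB => L.inverse) (S 0) :=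
      contDiffAt_inverse contDiffAt_id hi
    exact (h1.differentiableAt (by simp)).comp 0 hS.differentiableAt
  have h2 : HasDerivAt (fun t => S t ∘L (S t).inverse)
      (S' ∘L (S 0).inverse + S 0 ∘L deriv (fun t => (S t).inverse) 0) 0 := by
    have := hS.clm_comp hd.hasDerivAt
    exact this
  have h3 : HasDerivAt (fun t => S t ∘L (S t).inverse) 0 0 := by
    refine (hasDerivAt_const (0 : ℝ) (ContinuousLinearMap.id ℝ EB)).congr_of_eventuallyEq ?_
    filter_upwards [hev] with t ht
    ext u
    exact ht.self_apply_inverse u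
  have h4 := h2.unique h3
  have h5 : deriv (fun t => (S t).inverse) 0 = -((S 0).inverse ∘L S' ∘L (S 0).inverse) := by
    ext1 u
    have h6 := congrArg (fun L => (S 0).inverse (L u)) h4
    simp only [add_apply, ContinuousLinearMap.comp_apply, map_add, zero_apply, map_zero,
      hi.inverse_apply_self] at h6
    rw [neg_apply]
    exact eq_neg_of_add_eq_zero_right h6
  rw [← h5]
  exact hd.hasDerivAt

variable (hξ : ξ ∈ φ.dom) (hd : DifferentiableAt ℝ Q (ξ, 0))
  (hQ : ∀ q ∈ φ.source, φ.IsLocal P q (Q q))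
  (hanti : ∀ q ∈ φ.source, ∀ α β : EB × F →L[ℝ] ℝ, β (Q q α) = -α (Q q β))
  (hS : (block₁₁ (Q (ξ, 0))).IsInvertible) (hN : block₂₁ (Q (ξ, 0)) = 0)
  (hlin : IsLinearization P Λ D R)
include hξ hd hQ hS

theorem eventually_isInvertible_line :
    ∀ᶠ t in 𝓝 (0 : ℝ), (block₁₁ (Q (ξ, t • y))).IsInvertible := by
  have := FiniteDimensional.complete ℝ (EB →L[ℝ] ℝ)
  have h1 := (hasDerivAt_block₁₁ (hasDerivAt_line (y := y) hd)).continuousAt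
  refine h1.eventually (isOpen_setOf_isInvertible.mem_nhds ?_)
  simpa using hS

include hlin in
-- The coupling form along a fibre line is minus the inverse of the base block, so its derivative
-- comes from the derivative of the inverse.
theorem form_line (u v : EB) :
    (block₁₁ (Q (ξ, 0))).inverse (block₁₁ (fderiv ℝ Q (ξ, 0) (0, y)) ((block₁₁ (Q (ξ, 0))).inverse u))
      v = -φ.locDual R ξ y u v := by
  have h1 := hlin.form (φ.base ξ) (φ.fib (φ.base ξ) y) (φ.dbase ξ u) (φ.dbase ξ v)
  have h2 := hasDerivAt_inverse_line (hasDerivAt_block₁₁ (hasDerivAt_line (y := y) hd))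
    (by simpa using hS)
  have h3 : HasDerivAt (fun t : ℝ => -(block₁₁ (Q (ξ, t • y))).inverse u v) _ 0 :=
    ((h2.clm_apply (hasDerivAt_const (0 : ℝ) u)).clm_apply (hasDerivAt_const (0 : ℝ) v)).neg
  have h4 : (fun t : ℝ => couplingForm P (⟨φ.base ξ, t • φ.fib (φ.base ξ) y⟩ : TotalSpace F E)
      (φ.dbase ξ u) (φ.dbase ξ v)) =ᶠ[𝓝 0] fun t => -(block₁₁ (Q (ξ, t • y))).inverse u v := by
    filter_upwards [eventually_isInvertible_line (y := y) hξ hd hQ hS] with t ht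
    have hq : ((ξ, t • y) : EB × F) ∈ φ.source := mem_source.2 hξ
    rw [← couplingForm_dbase hq (hQ _ hq) ht]
    have h5 : ∀ z z' : E (φ.base ξ), z = z' →
        couplingForm P (⟨φ.base ξ, z⟩ : TotalSpace F E) (φ.dbase ξ u) (φ.dbase ξ v) =
        couplingForm P (⟨φ.base ξ, z'⟩ : TotalSpace F E) (φ.dbase ξ u) (φ.dbase ξ v) := by
      rintro z _ rfl; rfl
    exact h5 _ _ (map_smul _ _ _).symm
  have h6 := h1.unique (h3.congr_of_eventuallyEq h4)
  rw [locDual_apply, h6]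
  simp

include hlin hN in
-- The fibre component of the difference between coupling lift and linear lift along a fibre line is
-- `N S⁻¹ u + A(u)(t y)`. Since `N` vanishes at `t = 0`, the derivative of `S⁻¹` does not
-- contribute.
theorem conn_line (u : EB) :
    block₂₁ (fderiv ℝ Q (ξ, 0) (0, y)) ((block₁₁ (Q (ξ, 0))).inverse u) =
      -φ.connForm D ξ u y := by
  refine (SeparatingDual.eq_iff_forall_dual_eq (R := ℝ)).2 fun α => ?_
  have h1 := hlin.conn (φ.base ξ) (φ.fib (φ.base ξ) y) (α ∘L φ.coord (φ.base ξ)) (φ.dbase ξ u)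
  have h2 := hasDerivAt_inverse_line (hasDerivAt_block₁₁ (hasDerivAt_line (y := y) hd))
    (by simpa using hS)
  have h3 : HasDerivAt (fun t : ℝ => block₂₁ (Q (ξ, t • y)) ((block₁₁ (Q (ξ, t • y))).inverse u))
      (block₂₁ (fderiv ℝ Q (ξ, 0) (0, y)) ((block₁₁ (Q (ξ, 0))).inverse u)) 0 := by
    have := (hasDerivAt_block₂₁ (hasDerivAt_line (y := y) hd)).clm_apply
      (h2.clm_apply (hasDerivAt_const (0 : ℝ) u))
    simpa [hN] using! this
  have h3' : HasDerivAt (fun t : ℝ => φ.connForm D ξ u (t • y)) (φ.connForm D ξ u y) 0 := by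
    have h7 : HasDerivAt (fun t : ℝ => t • y) y 0 := by
      simpa using (hasDerivAt_id' (0 : ℝ)).smul_const y
    exact (φ.connForm D ξ u).hasFDerivAt.comp_hasDerivAt 0 h7
  have h4 : (fun t : ℝ => (α ∘L φ.coord (φ.base ξ)) (vertCoord EB
      (⟨φ.base ξ, t • φ.fib (φ.base ξ) y⟩ : TotalSpace F E)
      (couplingLift P ⟨φ.base ξ, t • φ.fib (φ.base ξ) y⟩ (φ.dbase ξ u) -
        horLift D ⟨φ.base ξ, t • φ.fib (φ.base ξ) y⟩ (φ.dbase ξ u)))) =ᶠ[𝓝 0]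
      fun t => α (block₂₁ (Q (ξ, t • y)) ((block₁₁ (Q (ξ, t • y))).inverse u) +
        φ.connForm D ξ u (t • y)) := by
    filter_upwards [eventually_isInvertible_line (y := y) hξ hd hQ hS] with t ht
    have hq : ((ξ, t • y) : EB × F) ∈ φ.source := mem_source.2 hξ
    have h5 : ∀ z z' : E (φ.base ξ), z = z' →
        (α ∘L φ.coord (φ.base ξ)) (vertCoord EB (⟨φ.base ξ, z⟩ : TotalSpace F E)
          (couplingLift P ⟨φ.base ξ, z⟩ (φ.dbase ξ u) - horLift D ⟨φ.base ξ, z⟩ (φ.dbase ξ u))) =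
        (α ∘L φ.coord (φ.base ξ)) (vertCoord EB (⟨φ.base ξ, z'⟩ : TotalSpace F E)
          (couplingLift P ⟨φ.base ξ, z'⟩ (φ.dbase ξ u) - horLift D ⟨φ.base ξ, z'⟩ (φ.dbase ξ u))) := by
      rintro z _ rfl; rfl
    refine (h5 _ _ (map_smul _ _ _).symm).trans ?_
    have h6 : couplingLift P (φ.tot (ξ, t • y)) (φ.dbase ξ u) -
        horLift D (φ.tot (ξ, t • y)) (φ.dbase ξ u) = vertLift EB (φ.tot (ξ, t • y))
          (φ.fib (φ.base ξ) (block₂₁ (Q (ξ, t • y)) ((block₁₁ (Q (ξ, t • y))).inverse u) +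
            φ.connForm D ξ u (t • y))) := by
      rw [couplingLift_dbase hq (hQ _ hq) ht, isConnForm_connForm D hξ, ← map_sub, ← dtot_inr hq]
      congr 1
      simp
    refine (congrArg (fun w => α (φ.coord (φ.base ξ) (vertCoord EB (φ.tot (ξ, t • y)) w))) h6).trans ?_
    refine congrArg α ?_
    refine (congrArg (φ.coord (φ.base ξ)) (vertCoord_vertLift _ _)).trans ?_
    exact φ.coord_fib _ (φ.base_mem ξ hξ) _
  have h8 := α.hasFDerivAt.comp_hasDerivAt 0 (h3.fun_add h3')
  have h9 := h1.unique (h8.congr_of_eventuallyEq h4)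
  rw [map_add] at h9
  rw [map_neg]
  exact eq_neg_of_add_eq_zero_left h9.symm

include hlin hN hanti in
-- The correction in the Schur complement is quadratic in the mixed block, which vanishes on the
-- zero section; to first order the vertical part is just the fibre block.
theorem vert_line (β : F →L[ℝ] ℝ) :
    block₂₂ (fderiv ℝ Q (ξ, 0) (0, y)) β = φ.locVert Λ ξ y β := by
  refine (SeparatingDual.eq_iff_forall_dual_eq (R := ℝ)).2 fun α => ?_
  have h1 := hlin.vert (φ.base ξ) (φ.fib (φ.base ξ) y) (β ∘L φ.coord (φ.base ξ))
    (α ∘L φ.coord (φ.base ξ))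
  have h2 := hasDerivAt_inverse_line (hasDerivAt_block₁₁ (hasDerivAt_line (y := y) hd))
    (by simpa using hS)
  have hNd := hasDerivAt_block₂₁ (hasDerivAt_line (y := y) hd)
  have h3 : HasDerivAt (fun t : ℝ => block₂₁ (Q (ξ, t • y))
      (β ∘L block₂₁ (Q (ξ, t • y)) ∘L (block₁₁ (Q (ξ, t • y))).inverse)) 0 0 := by
    have h5 : HasDerivAt (fun t : ℝ => β ∘L block₂₁ (Q (ξ, t • y)) ∘L
        (block₁₁ (Q (ξ, t • y))).inverse) _ 0 :=
      (hasDerivAt_const (0 : ℝ) β).clm_comp (hNd.clm_comp h2)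
    have h6 := hNd.clm_apply h5
    simpa [hN] using! h6
  have h7 := (hasDerivAt_block₂₂ (hasDerivAt_line (y := y) hd)).clm_apply (hasDerivAt_const (0 : ℝ) β)
  have h8 := α.hasFDerivAt.comp_hasDerivAt 0 (h7.fun_sub h3)
  have h4 : (fun t : ℝ => (α ∘L φ.coord (φ.base ξ)) (vertCoord EB
      (⟨φ.base ξ, t • φ.fib (φ.base ξ) y⟩ : TotalSpace F E)
      (vertPart P ⟨φ.base ξ, t • φ.fib (φ.base ξ) y⟩ ((β ∘L φ.coord (φ.base ξ)) ∘L
        vertCoord EB (⟨φ.base ξ, t • φ.fib (φ.base ξ) y⟩ : TotalSpace F E))))) =ᶠ[𝓝 0]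
      fun t => α (block₂₂ (Q (ξ, t • y)) β - block₂₁ (Q (ξ, t • y))
        (β ∘L block₂₁ (Q (ξ, t • y)) ∘L (block₁₁ (Q (ξ, t • y))).inverse)) := by
    filter_upwards [eventually_isInvertible_line (y := y) hξ hd hQ hS] with t ht
    have hq : ((ξ, t • y) : EB × F) ∈ φ.source := mem_source.2 hξ
    have h5 : ∀ z z' : E (φ.base ξ), z = z' →
        (α ∘L φ.coord (φ.base ξ)) (vertCoord EB (⟨φ.base ξ, z⟩ : TotalSpace F E)
          (vertPart P ⟨φ.base ξ, z⟩ ((β ∘L φ.coord (φ.base ξ)) ∘L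
            vertCoord EB (⟨φ.base ξ, z⟩ : TotalSpace F E)))) =
        (α ∘L φ.coord (φ.base ξ)) (vertCoord EB (⟨φ.base ξ, z'⟩ : TotalSpace F E)
          (vertPart P ⟨φ.base ξ, z'⟩ ((β ∘L φ.coord (φ.base ξ)) ∘L
            vertCoord EB (⟨φ.base ξ, z'⟩ : TotalSpace F E)))) := by
      rintro z _ rfl; rfl
    refine (h5 _ _ (map_smul _ _ _).symm).trans ?_
    have h6 := vertPart_eq hq (hQ _ hq) (hanti _ hq) ht
      ((β ∘L φ.coord (φ.base ξ)) ∘L vertCoord EB (φ.tot (ξ, t • y)))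
    have h9 : (((β ∘L φ.coord (φ.base ξ)) ∘L vertCoord EB (φ.tot (ξ, t • y))) ∘L
        φ.dtot (ξ, t • y)) ∘L inr ℝ EB F = β := by
      refine ContinuousLinearMap.ext fun z => ?_
      have e1 : vertCoord EB (φ.tot (ξ, t • y)) (φ.dtot (ξ, t • y) (0, z)) =
        φ.fib (φ.base ξ) z := by
        rw [dtot_inr hq]
        exact vertCoord_vertLift _ _
      refine (congrArg (fun w => β (φ.coord (φ.base ξ) w)) e1).trans ?_
      exact congrArg β (φ.coord_fib _ (φ.base_mem ξ hξ) _)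
    rw [h9] at h6
    refine (congrArg (fun w => α (φ.coord (φ.base ξ) (vertCoord EB (φ.tot (ξ, t • y)) w))) h6).trans ?_
    refine congrArg α ?_
    refine (congrArg (φ.coord (φ.base ξ)) (vertCoord_vertLift _ _)).trans ?_
    exact φ.coord_fib _ (φ.base_mem ξ hξ) _
  have h9 := h1.unique (h8.congr_of_eventuallyEq h4)
  rw [map_zero, add_zero, sub_zero] at h9
  exact h9.symm

end Line

end BundleFrame

variable {EM : Type*} [NormedAddCommGroup EM] [NormedSpace ℝ EM] [FiniteDimensional ℝ EM]
  {M : Type*} [TopologicalSpace M] [ChartedSpace EM M] [IsManifold 𝓘(ℝ, EM) ∞ M] [T2Space M]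
  {Ψ : TensorField₂ 𝓘(ℝ, EM) M} {f : TotalSpace F E → M} {ι : B → M} {Ω : FormField₂ 𝓘(ℝ, EB) B}

/-- The jet of the pulled back Poisson tensor in a frame. -/
theorem jetData_of_isLinearization (hΨ : IsPoissonTensor Ψ) (hleaf : IsEmbeddedSymplecticLeaf Ψ ι Ω)
    (hf : IsLocalDiffeomorph (𝓘(ℝ, EB).prod 𝓘(ℝ, F)) 𝓘(ℝ, EM) ∞ f)
    (hz : ∀ b, f ⟨b, 0⟩ = ι b) (hlin : IsLinearization (pullback f Ψ) Λ D R)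
    (φ : BundleFrame EB F E) :
    JetData φ.dom φ.source (localExpression Ψ (f ∘ φ.tot))
      (fun ξ => -(φ.locForm ξ (Ω (φ.base ξ))).inverse) (φ.locVert Λ) (φ.connForm D)
      (φ.locDual R) ∧ ∀ ξ ∈ φ.dom, (φ.locForm ξ (Ω (φ.base ξ))).IsInvertible := by
  have hk : ∀ q ∈ φ.source, ∀ᶠ y in 𝓝 q, IsLocalDiffeomorphAt 𝓘(ℝ, EB × F) 𝓘(ℝ, EM) ∞ (f ∘ φ.tot) y := by
    intro q hq
    filter_upwards [BundleFrame.isOpen_source.mem_nhds hq] with y hy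
    exact BundleFrame.isLocalDiffeomorphAt_comp_tot hf hy
  have hz' := fun ξ (hξ : ξ ∈ φ.dom) => localExpression_zero hΨ.antisymm hleaf hf hz hξ
  set Q := localExpression Ψ (f ∘ φ.tot) with hQ
  have hmem : ∀ ξ ∈ φ.dom, ((ξ, 0) : EB × F) ∈ φ.source := fun ξ hξ => BundleFrame.mem_source.2 hξ
  have hd : ∀ ξ ∈ φ.dom, DifferentiableAt ℝ Q (ξ, 0) := fun ξ hξ =>
    (contDiffAt_localExpression hΨ (hk _ (hmem ξ hξ))).differentiableAt (by simp)
  have hanti : ∀ q ∈ φ.source, ∀ α β : EB × F →L[ℝ] ℝ, β (Q q α) = -α (Q q β) :=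
    fun q _ => localExpression_antisymm (k := f ∘ φ.tot) hΨ.antisymm q
  have hloc : ∀ q ∈ φ.source, φ.IsLocal (pullback f Ψ) q (Q q) := fun q hq =>
    BundleFrame.isLocal_localExpression hf hq
  have hN : ∀ ξ ∈ φ.dom, block₂₁ (Q (ξ, 0)) = 0 := by
    intro ξ hξ
    ext1 a
    exact congrArg Prod.snd ((hz' ξ hξ).1 (a ∘L fst ℝ EB F))
  have hSa : ∀ ξ ∈ φ.dom, ∀ a c : EB →L[ℝ] ℝ, c (block₁₁ (Q (ξ, 0)) a) = -a (block₁₁ (Q (ξ, 0)) c) :=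
    fun ξ hξ a c => hanti _ (hmem ξ hξ) (a ∘L fst ℝ EB F) (c ∘L fst ℝ EB F)
  refine ⟨?_, fun ξ hξ => (hz' ξ hξ).2.2.2⟩
  exact
  { isOpen := φ.isOpen_dom
    isOpen_dom := BundleFrame.isOpen_source
    mem := hmem
    smooth := fun q hq => (contDiffAt_localExpression hΨ (hk q hq)).contDiffWithinAt
    antisymm := hanti
    jacobi := fun q hq => jacobiAt_localExpression hΨ (hk q hq)
    zero := fun ξ hξ c => by rw [← (hz' ξ hξ).2.2.1]; exact (hz' ξ hξ).1 c
    inv := fun ξ hξ => by rw [← (hz' ξ hξ).2.2.1]; exact (hz' ξ hξ).2.1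
    vert := fun ξ hξ y β => BundleFrame.vert_line hξ (hd ξ hξ) hloc hanti (hz' ξ hξ).2.1
      (hN ξ hξ) hlin β
    conn := fun ξ hξ y a => by
      rw [← (hz' ξ hξ).2.2.1]
      have h1 := BundleFrame.conn_line (y := y) hξ (hd ξ hξ) hloc (hz' ξ hξ).2.1 (hN ξ hξ) hlin
        (block₁₁ (Q (ξ, 0)) a)
      rw [(hz' ξ hξ).2.1.inverse_apply_self] at h1
      exact h1
    form := fun ξ hξ y a c => by
      rw [← (hz' ξ hξ).2.2.1]
      have h1 := BundleFrame.form_line (y := y) hξ (hd ξ hξ) hloc (hz' ξ hξ).2.1 hlin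
        (block₁₁ (Q (ξ, 0)) a) (block₁₁ (Q (ξ, 0)) c)
      rw [(hz' ξ hξ).2.1.inverse_apply_self] at h1
      have h2 := hSa ξ hξ ((block₁₁ (Q (ξ, 0))).inverse (block₁₁ (fderiv ℝ Q (ξ, 0) (0, y)) a)) c
      rw [(hz' ξ hξ).2.1.self_apply_inverse, h1, neg_neg] at h2
      exact h2.symm }

end JetExtraction

/-! ### Parallel tensors are constant in parallel frames. -/

section ParallelTensors

set_option maxSynthPendingDepth 3

open ContinuousLinearMap

variable {EB : Type*} [NormedAddCommGroup EB] [NormedSpace ℝ EB] [FiniteDimensional ℝ EB]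
  {B : Type*} [TopologicalSpace B] [ChartedSpace EB B] [IsManifold 𝓘(ℝ, EB) ∞ B]
  {F : Type*} [NormedAddCommGroup F] [NormedSpace ℝ F] [FiniteDimensional ℝ F]
  {E : B → Type*} [∀ b, AddCommGroup (E b)] [∀ b, Module ℝ (E b)]
  [∀ b, TopologicalSpace (E b)] [∀ b, IsTopologicalAddGroup (E b)]
  [∀ b, ContinuousSMul ℝ (E b)] [TopologicalSpace (TotalSpace F E)]
  [FiberBundle F E] [VectorBundle ℝ F E] [ContMDiffVectorBundle ∞ F E 𝓘(ℝ, EB)]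
  {Λ : LinearVertTensor E} {D : CovariantDerivative 𝓘(ℝ, EB) F E}

namespace BundleFrame

variable {φ : BundleFrame EB F E}

omit [IsManifold 𝓘(ℝ, EB) ∞ B] in
theorem mvfderiv_of_eventuallyEq_comp_chart {V : Type*} [NormedAddCommGroup V] [NormedSpace ℝ V]
    {h : B → V} {c : EB → V} {ξ : EB} (hξ : ξ ∈ φ.dom)
    (hh : h =ᶠ[𝓝 (φ.base ξ)] fun b => c (φ.chart b)) (hc : DifferentiableAt ℝ c ξ) (u : EB) :
    mvfderiv 𝓘(ℝ, EB) h (φ.base ξ) (φ.dbase ξ u) = fderiv ℝ c ξ u := by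
  have h1 := hasMFDerivAt_comp_chart (φ := φ) hξ hc
  rw [mvfderiv_congr_of_eventuallyEq hh]
  refine (congrArg (fun L => L (φ.dbase ξ u)) h1.mfderiv).trans ?_
  exact congrArg (fderiv ℝ c ξ) ((isInvertible_dbase hξ).inverse_apply_self u)

/-- The section of the dual bundle which is constant in a frame. -/
def dualSec (φ : BundleFrame EB F E) (a : F →L[ℝ] ℝ) (b : B) : E b →L[ℝ] ℝ := a ∘L φ.coord b

theorem contMDiffOn_dualSec (a : F →L[ℝ] ℝ) :
    ContMDiffOn 𝓘(ℝ, EB) (𝓘(ℝ, EB).prod 𝓘(ℝ, F →L[ℝ] ℝ)) ∞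
      (fun b => TotalSpace.mk' (F →L[ℝ] ℝ) b (φ.dualSec a b)) φ.img := by
  intro b₀ hb₀
  refine ContMDiffAt.contMDiffWithinAt ?_
  refine contMDiffAt_totalSpace.2 ⟨contMDiffAt_id, ?_⟩
  set ψ := standard EB F E b₀ with hψ
  obtain ⟨ξ, hξ, rfl⟩ : ∃ ξ ∈ φ.dom, φ.base ξ = b₀ :=
    ⟨φ.chart b₀, φ.chart_mem b₀ hb₀, φ.base_chart b₀ hb₀⟩
  have hb := mem_img_standard (EB := EB) (F := F) (E := E) (φ.base ξ)
  have h1 : ∀ v : F, ContDiffAt ℝ ∞ (fun η => a (φ.coord (φ.base η) (ψ.fib (φ.base η) v))) ξ := by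
    intro v
    have h2 := ((contMDiffOn_sec (φ := ψ) (c := fun _ => v) contDiffOn_const).contMDiffAt
      (ψ.isOpen_img.mem_nhds hb)).comp ξ (contMDiffAt_base hξ)
    have h4 := (contMDiffAt_inv (φ := φ) (p := ⟨φ.base ξ, _⟩) (φ.base_mem ξ hξ)).comp ξ h2
    exact a.contDiff.contDiffAt.comp ξ (contMDiffAt_iff_contDiffAt.1 h4).snd
  have h2 : ContDiffAt ℝ ∞ (fun η => a ∘L φ.coord (φ.base η) ∘L ψ.fib (φ.base η)) ξ :=
    contDiffAt_clm_of_apply h1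
  have h3 : ContMDiffAt 𝓘(ℝ, EB) 𝓘(ℝ, F →L[ℝ] ℝ) ∞
      (fun η => a ∘L φ.coord (φ.base η) ∘L ψ.fib (φ.base η)) (φ.chart (φ.base ξ)) := by
    rw [φ.chart_base ξ hξ]
    exact h2.contMDiffAt
  have h4 := h3.comp (φ.base ξ) (contMDiffAt_chart (φ.base_mem ξ hξ))
  refine h4.congr_of_eventuallyEq ?_
  filter_upwards [φ.isOpen_img.mem_nhds hb₀, ψ.isOpen_img.mem_nhds hb] with b hb1 hb2
  obtain ⟨η, hη, rfl⟩ : ∃ η ∈ φ.dom, φ.base η = b :=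
    ⟨φ.chart b, φ.chart_mem b hb1, φ.base_chart b hb1⟩
  simp only [Function.comp_apply]
  rw [φ.chart_base η hη]
  ext v
  change (trivializationAt ℝ (Trivial B ℝ) (φ.base ξ)).continuousLinearMapAt ℝ (φ.base η)
    (a (φ.coord (φ.base η) (ψ.fib (φ.base η) v))) = a (φ.coord (φ.base η) (ψ.fib (φ.base η) v))
  rw [Trivialization.continuousLinearMapAt_apply, Trivialization.coe_linearMapAt_of_mem _ (mem_univ _)]
  rfl

theorem contMDiff_cutoff_dualSec (a : F →L[ℝ] ℝ) {ρ : B → ℝ}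
    (hρ : ContMDiff 𝓘(ℝ, EB) 𝓘(ℝ, ℝ) ∞ ρ) (hs : tsupport ρ ⊆ φ.img) :
    ContMDiff 𝓘(ℝ, EB) (𝓘(ℝ, EB).prod 𝓘(ℝ, F →L[ℝ] ℝ)) ∞
      (fun b => TotalSpace.mk' (F →L[ℝ] ℝ) b ((ρ • φ.dualSec a) b)) :=
  ContMDiffOn.smul_section_of_tsupport hρ.contMDiffOn φ.isOpen_img hs (contMDiffOn_dualSec a)

/-- Dual sections that are constant in a parallel frame are parallel. -/
theorem hasDualDerivAt_zero (hD : ∀ ξ ∈ φ.dom, φ.connForm D ξ = 0) {α : ∀ b, E b →L[ℝ] ℝ}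
    {a : F →L[ℝ] ℝ} {ξ : EB} (hξ : ξ ∈ φ.dom)
    (hα : ∀ᶠ b in 𝓝 (φ.base ξ), α b = φ.dualSec a b) (u : EB) :
    HasDualDerivAt D α (φ.base ξ) (φ.dbase ξ u) 0 := by
  intro s hs
  have hsd : DifferentiableAt ℝ (fun η => φ.coord (φ.base η) (s (φ.base η))) ξ := by
    have h2 := (hs (φ.base ξ)).comp ξ (contMDiffAt_base hξ)
    have h4 := (contMDiffAt_inv (φ := φ) (p := ⟨φ.base ξ, _⟩) (φ.base_mem ξ hξ)).comp ξ h2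
    exact (contMDiffAt_iff_contDiffAt.1 h4).snd.differentiableAt (by simp)
  have hss : ∀ᶠ b in 𝓝 (φ.base ξ), s b = φ.sec (fun η => φ.coord (φ.base η) (s (φ.base η))) b := by
    filter_upwards [φ.isOpen_img.mem_nhds (φ.base_mem ξ hξ)] with b hb
    obtain ⟨η, hη, rfl⟩ : ∃ η ∈ φ.dom, φ.base η = b :=
      ⟨φ.chart b, φ.chart_mem b hb, φ.base_chart b hb⟩
    rw [sec_base hη, φ.fib_coord _ (φ.base_mem η hη)]
  have h1 := covariantDerivative_of_eventuallyEq D hξ hss hsd u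
  have h2 := mvfderiv_of_eventuallyEq_comp_chart (φ := φ) (h := fun b => α b (s b))
    (c := fun η => a (φ.coord (φ.base η) (s (φ.base η)))) hξ ?_
    (a.differentiableAt.comp ξ hsd) u
  · rw [h1, h2, hα.self_of_nhds, hD ξ hξ, dualSec, ContinuousLinearMap.comp_apply,
      φ.coord_fib _ (φ.base_mem ξ hξ)]
    have h3 := (a.hasFDerivAt.comp ξ hsd.hasFDerivAt).fderiv
    have h4 := congrArg (fun L => L u) h3
    simp only [ContinuousLinearMap.comp_apply] at h4
    rw [zero_apply, zero_apply, zero_apply, add_zero, eq_comm, sub_eq_zero]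
    exact h4
  · filter_upwards [φ.isOpen_img.mem_nhds (φ.base_mem ξ hξ), hα] with b hb hbα
    obtain ⟨η, hη, rfl⟩ : ∃ η ∈ φ.dom, φ.base η = b :=
      ⟨φ.chart b, φ.chart_mem b hb, φ.base_chart b hb⟩
    rw [hbα, φ.chart_base η hη]
    rfl

variable [T2Space B]

/-- A parallel linear vertical tensor is constant in parallel frames. -/
theorem locVert_eq (hLP : IsLiePoissonConnection D Λ) (hD : ∀ ξ ∈ φ.dom, φ.connForm D ξ = 0)
    (hconv : Convex ℝ φ.dom) (hΛ : ∀ ξ ∈ φ.dom, DifferentiableAt ℝ (φ.locVert Λ) ξ)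
    {ξ ξ' : EB} (hξ : ξ ∈ φ.dom) (hξ' : ξ' ∈ φ.dom) : φ.locVert Λ ξ = φ.locVert Λ ξ' := by
  ext y a
  refine (SeparatingDual.eq_iff_forall_dual_eq (R := ℝ)).2 fun c => ?_
  have hdc : ∀ η ∈ φ.dom, DifferentiableAt ℝ (fun η => c (φ.locVert Λ η y a)) η := fun η hη =>
    c.differentiableAt.comp η
      (((hΛ η hη).clm_apply (differentiableAt_const y)).clm_apply (differentiableAt_const a))
  refine φ.isOpen_dom.is_const_of_fderiv_eq_zero (𝕜 := ℝ) hconv.isPreconnected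
    (fun η hη => (hdc η hη).differentiableWithinAt) (fun η hη => ?_) hξ hξ'
  ext u
  obtain ⟨ρ, hρ, hρs, hρ1⟩ := exists_contMDiff_cutoff (EB := EB) φ.isOpen_img (φ.base_mem η hη)
  have hev : ∀ a : F →L[ℝ] ℝ, ∀ᶠ b in 𝓝 (φ.base η), (ρ • φ.dualSec a) b = φ.dualSec a b := by
    intro a
    filter_upwards [hρ1] with b hb
    rw [Pi.smul_apply', hb]
    exact one_smul _ _
  have hevs := cutoff_sec_eventuallyEq (φ := φ) hρ1 (fun _ => y)
  -- Near the point all three arguments are parallel, so every term on the right of the Lie–Poisson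
  -- condition vanishes. The cutoffs turn them into global sections.
  have h1 := hLP (ρ • φ.dualSec a) (ρ • φ.dualSec c) (ρ • φ.sec fun _ => y)
    (contMDiff_cutoff_dualSec a hρ hρs) (contMDiff_cutoff_dualSec c hρ hρs)
    (contMDiff_cutoff_sec contDiffOn_const hρ hρs) (φ.base η) (φ.dbase η u) 0 0
    (hasDualDerivAt_zero hD hη (hev a) u) (hasDualDerivAt_zero hD hη (hev c) u)
  have h2 := covariantDerivative_of_eventuallyEq D hη hevs (differentiableAt_const y) u
  rw [hD η hη] at h2
  have h0 : fderiv ℝ (fun _ : EB => y) η u + (0 : EB →L[ℝ] F →L[ℝ] F) u y = 0 := by simp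
  rw [h0, map_zero] at h2
  rw [h2, map_zero, map_zero, zero_apply, zero_apply, map_zero, add_zero, add_zero] at h1
  rw [← mvfderiv_of_eventuallyEq_comp_chart (φ := φ) (h := fun b' => (ρ • φ.dualSec c) b'
    (Λ b' ((ρ • φ.sec fun _ => y) b') ((ρ • φ.dualSec a) b'))) hη ?_ (hdc η hη) u, h1]
  · rfl
  filter_upwards [φ.isOpen_img.mem_nhds (φ.base_mem η hη), hev a, hev c, hevs] with b hb hba hbc hbs
  rw [hba, hbc, hbs]
  obtain ⟨θ, hθ, rfl⟩ : ∃ θ ∈ φ.dom, φ.base θ = b :=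
    ⟨φ.chart b, φ.chart_mem b hb, φ.base_chart b hb⟩
  rw [φ.chart_base θ hθ, sec_base hθ]
  rfl

end BundleFrame

end ParallelTensors

/-! ### Propagation of the fibre Lie algebra, and gauge frames at every point. -/

section GaugeFrames

set_option maxSynthPendingDepth 3

open ContinuousLinearMap

variable {EB : Type*} [NormedAddCommGroup EB] [NormedSpace ℝ EB]
  {B : Type*} [TopologicalSpace B] [ChartedSpace EB B]
  {F : Type*} [NormedAddCommGroup F] [NormedSpace ℝ F] [FiniteDimensional ℝ F]
  {E : B → Type*} [∀ b, AddCommGroup (E b)] [∀ b, Module ℝ (E b)]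
  [∀ b, TopologicalSpace (E b)] [∀ b, IsTopologicalAddGroup (E b)]
  [∀ b, ContinuousSMul ℝ (E b)] [TopologicalSpace (TotalSpace F E)]
  [FiberBundle F E] [VectorBundle ℝ F E]
  {Ω : FormField₂ 𝓘(ℝ, EB) B} {Λ : LinearVertTensor E}
  {D Dflat : CovariantDerivative 𝓘(ℝ, EB) F E} {R : DualValuedForm EB E}

/-- The frame `φ` is parallel for `Dflat` and the linearized data are there a gauge transformation,
by `μ`, of the flat model with linear vertical tensor `Λ₀`. -/
structure BundleFrame.IsGaugeFrame (φ : BundleFrame EB F E) (Ω : FormField₂ 𝓘(ℝ, EB) B)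
    (Λ : LinearVertTensor E) (D : CovariantDerivative 𝓘(ℝ, EB) F E) (R : DualValuedForm EB E)
    (Dflat : CovariantDerivative 𝓘(ℝ, EB) F E) (Λ₀ : F →L[ℝ] (F →L[ℝ] ℝ) →L[ℝ] F)
    (μ : EB → EB →L[ℝ] F →L[ℝ] ℝ) : Prop where
  model : LocalModelData φ.dom (fun ξ => -(φ.locForm ξ (Ω (φ.base ξ))).inverse) Λ₀ μ
  form_inv : ∀ ξ ∈ φ.dom, (φ.locForm ξ (Ω (φ.base ξ))).IsInvertible
  vert : ∀ ξ ∈ φ.dom, φ.locVert Λ ξ = Λ₀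
  flat : ∀ ξ ∈ φ.dom, φ.connForm Dflat ξ = 0
  conn : ∀ ξ ∈ φ.dom, ∀ u y, φ.connForm D ξ u y = Λ₀ y (μ ξ u)
  dual : ∀ ξ ∈ φ.dom, ∀ x, φ.locDual R ξ x = -muDiff μ (ξ, x) + muBracket Λ₀ (μ ξ) x
  nondeg : ∀ β : F →L[ℝ] ℝ, (∀ y, Λ₀ y β = 0) → β = 0

variable (E) in
/-- The identification of the dual of a fibre given by a frame. -/
def BundleFrame.dualEquiv (φ : BundleFrame EB F E) {b : B} (hb : b ∈ φ.img) :
    (E b →L[ℝ] ℝ) ≃ₗ[ℝ] (F →L[ℝ] ℝ) where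
  toFun a := a ∘L φ.fib b
  invFun a := a ∘L φ.coord b
  map_add' _ _ := rfl
  map_smul' _ _ := rfl
  left_inv a := by ext y; simp [φ.fib_coord b hb]
  right_inv a := by ext y; simp [φ.coord_fib b hb]

variable {𝔤 : Type*} [LieRing 𝔤] [LieAlgebra ℝ 𝔤]

theorem BundleFrame.isLieIso_trans_dualEquiv (φ : BundleFrame EB F E) {ξ : EB} (hξ : ξ ∈ φ.dom)
    {e : 𝔤 ≃ₗ[ℝ] (E (φ.base ξ) →L[ℝ] ℝ)}
    (he : ∀ (x y : 𝔤) (v : E (φ.base ξ)), e ⁅x, y⁆ v = e y (Λ (φ.base ξ) v (e x))) :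
    IsLieIso (e.trans (φ.dualEquiv E (φ.base_mem ξ hξ))) (φ.locVert Λ ξ) := by
  intro x y v
  change e ⁅x, y⁆ (φ.fib (φ.base ξ) v) = e y (φ.fib (φ.base ξ) (φ.locVert Λ ξ v (e x ∘L φ.fib (φ.base ξ))))
  rw [he, fib_locVert hξ]

theorem BundleFrame.exists_of_isLieIso (φ : BundleFrame EB F E) {ξ : EB} (hξ : ξ ∈ φ.dom)
    {e : 𝔤 ≃ₗ[ℝ] (F →L[ℝ] ℝ)} (he : IsLieIso e (φ.locVert Λ ξ)) :
    ∃ e : 𝔤 ≃ₗ[ℝ] (E (φ.base ξ) →L[ℝ] ℝ),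
      ∀ (x y : 𝔤) (v : E (φ.base ξ)), e ⁅x, y⁆ v = e y (Λ (φ.base ξ) v (e x)) := by
  refine ⟨e.trans (φ.dualEquiv E (φ.base_mem ξ hξ)).symm, fun x y v => ?_⟩
  change e ⁅x, y⁆ (φ.coord (φ.base ξ) v) =
    e y (φ.coord (φ.base ξ) (Λ (φ.base ξ) v (e x ∘L φ.coord (φ.base ξ))))
  rw [he, locVert_apply, φ.fib_coord _ (φ.base_mem ξ hξ)]

variable [FiniteDimensional ℝ EB] [IsManifold 𝓘(ℝ, EB) ∞ B] [ContMDiffVectorBundle ∞ F E 𝓘(ℝ, EB)]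
  [T2Space B]
  {EM : Type*} [NormedAddCommGroup EM] [NormedSpace ℝ EM] [FiniteDimensional ℝ EM]
  {M : Type*} [TopologicalSpace M] [ChartedSpace EM M] [IsManifold 𝓘(ℝ, EM) ∞ M] [T2Space M]
  {Ψ : TensorField₂ 𝓘(ℝ, EM) M} {f : TotalSpace F E → M} {ι : B → M}
  [CovariantDerivative.ContMDiffCovariantDerivative D ∞]
  [CovariantDerivative.ContMDiffCovariantDerivative Dflat ∞]

/-- The linearization has a parallel fibre Lie algebra, for a flat Lie–Poisson connection. -/
theorem exists_lieIso [ConnectedSpace B]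
    (hΛ : ∀ φ : BundleFrame EB F E, ∀ ξ ∈ φ.dom, DifferentiableAt ℝ (φ.locVert Λ) ξ)
    (hflat : IsFlatConnection Dflat) (hLP : IsLiePoissonConnection Dflat Λ)
    {b₀ : B} (e : 𝔤 ≃ₗ[ℝ] (E b₀ →L[ℝ] ℝ))
    (he : ∀ (x y : 𝔤) (v : E b₀), e ⁅x, y⁆ v = e y (Λ b₀ v (e x))) (b : B) :
    ∃ e : 𝔤 ≃ₗ[ℝ] (E b →L[ℝ] ℝ), ∀ (x y : 𝔤) (v : E b), e ⁅x, y⁆ v = e y (Λ b v (e x)) := by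
  set A : Set B := {b | ∃ e : 𝔤 ≃ₗ[ℝ] (E b →L[ℝ] ℝ),
    ∀ (x y : 𝔤) (v : E b), e ⁅x, y⁆ v = e y (Λ b v (e x))} with hA
  -- In a flat frame with convex domain the vertical tensor is constant, so an isomorphism at one
  -- point gives one at every other point of the frame. Hence `A` is open and closed in the
  -- connected base.
  have key : ∀ b, ∃ V ∈ 𝓝 b, ∀ b₁ ∈ V, ∀ b₂ ∈ V, b₁ ∈ A → b₂ ∈ A := by
    intro b
    obtain ⟨φ, hb, hconv, hD⟩ := exists_flat_frame Dflat hflat b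
    refine ⟨φ.img, φ.isOpen_img.mem_nhds hb, fun b₁ h₁ b₂ h₂ => ?_⟩
    obtain ⟨ξ₁, hξ₁, rfl⟩ : ∃ η ∈ φ.dom, φ.base η = b₁ :=
      ⟨φ.chart b₁, φ.chart_mem b₁ h₁, φ.base_chart b₁ h₁⟩
    obtain ⟨ξ₂, hξ₂, rfl⟩ : ∃ η ∈ φ.dom, φ.base η = b₂ :=
      ⟨φ.chart b₂, φ.chart_mem b₂ h₂, φ.base_chart b₂ h₂⟩
    rintro ⟨e, he⟩
    have h3 := φ.isLieIso_trans_dualEquiv hξ₁ he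
    rw [BundleFrame.locVert_eq hLP hD hconv (hΛ φ) hξ₁ hξ₂] at h3
    exact φ.exists_of_isLieIso hξ₂ h3
  have hcl : IsClopen A := by
    constructor
    · rw [← isOpen_compl_iff, isOpen_iff_mem_nhds]
      intro b hb
      obtain ⟨V, hV, h⟩ := key b
      exact Filter.mem_of_superset hV fun b' hb' hA' => hb (h b' hb' b (mem_of_mem_nhds hV) hA')
    · rw [isOpen_iff_mem_nhds]
      intro b hb
      obtain ⟨V, hV, h⟩ := key b
      exact Filter.mem_of_superset hV fun b' hb' => h b (mem_of_mem_nhds hV) b' hb' hb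
  have h : b ∈ A := by rw [hcl.eq_univ ⟨b₀, e, he⟩]; exact mem_univ b
  exact h

/-- There are gauge frames at every point of the leaf. -/
theorem exists_gaugeFrame [ConnectedSpace B] (hΨ : IsPoissonTensor Ψ)
    (hleaf : IsEmbeddedSymplecticLeaf Ψ ι Ω)
    (hf : IsLocalDiffeomorph (𝓘(ℝ, EB).prod 𝓘(ℝ, F)) 𝓘(ℝ, EM) ∞ f)
    (hz : ∀ b, f ⟨b, 0⟩ = ι b) (hlin : IsLinearization (pullback f Ψ) Λ D R)
    (hcenter : LieAlgebra.center ℝ 𝔤 = ⊥) (hH1 : Subsingleton (FirstCohomology 𝔤))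
    (hflat : IsFlatConnection Dflat) (hLP : IsLiePoissonConnection Dflat Λ)
    {b₀ : B} (e : 𝔤 ≃ₗ[ℝ] (E b₀ →L[ℝ] ℝ))
    (he : ∀ (x y : 𝔤) (v : E b₀), e ⁅x, y⁆ v = e y (Λ b₀ v (e x))) (b : B) :
    ∃ (φ : BundleFrame EB F E) (Λ₀ : F →L[ℝ] (F →L[ℝ] ℝ) →L[ℝ] F) (μ : EB → EB →L[ℝ] F →L[ℝ] ℝ),
      b ∈ φ.img ∧ Convex ℝ φ.dom ∧ φ.IsGaugeFrame Ω Λ D R Dflat Λ₀ μ := by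
  have hjet := fun φ => jetData_of_isLinearization hΨ hleaf hf hz hlin φ
  have hΛ : ∀ φ : BundleFrame EB F E, ∀ ξ ∈ φ.dom, DifferentiableAt ℝ (φ.locVert Λ) ξ :=
    fun φ ξ hξ => ((hjet φ).1.contDiffAt_vert hξ).differentiableAt (by simp)
  obtain ⟨φ, hb, hconv, hD⟩ := exists_flat_frame Dflat hflat b
  obtain ⟨ξ₀, hξ₀, rfl⟩ : ∃ η ∈ φ.dom, φ.base η = b :=
    ⟨φ.chart b, φ.chart_mem b hb, φ.base_chart b hb⟩
  obtain ⟨e', he'⟩ := exists_lieIso hΛ hflat hLP e he (φ.base ξ₀)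
  have hiso := φ.isLieIso_trans_dualEquiv hξ₀ he'
  have hvert : ∀ ξ ∈ φ.dom, φ.locVert Λ ξ = φ.locVert Λ ξ₀ := fun ξ hξ =>
    BundleFrame.locVert_eq hLP hD hconv (hΛ φ) hξ hξ₀
  -- The same jet, with the vertical tensor replaced by its constant value in the flat frame.
  have hj : JetData φ.dom φ.source (localExpression Ψ (f ∘ φ.tot))
      (fun ξ => -(φ.locForm ξ (Ω (φ.base ξ))).inverse) (fun _ => φ.locVert Λ ξ₀) (φ.connForm D)
      (φ.locDual R) :=
    { (hjet φ).1 with vert := fun ξ hξ y β => by rw [(hjet φ).1.vert ξ hξ, hvert ξ hξ] }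
  obtain ⟨μ, hμ, hconn, hdual⟩ := hiso.exists_gauge hcenter hH1 hj
    (BundleFrame.contDiffOn_connForm (φ := φ) D)
  exact ⟨φ, φ.locVert Λ ξ₀, μ, hb, hconv, hμ, (hjet φ).2, hvert, hD, hconn, hdual,
    fun β hβ => hiso.eq_zero_of_forall hcenter fun y γ => by rw [hβ, map_zero]⟩

end GaugeFrames

/-! ### Moser's field on the whole bundle. -/

section MoserField

set_option maxSynthPendingDepth 3

open ContinuousLinearMap

variable {EB : Type*} [NormedAddCommGroup EB] [NormedSpace ℝ EB]
  {B : Type*} [TopologicalSpace B] [ChartedSpace EB B]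
  {F : Type*} [NormedAddCommGroup F] [NormedSpace ℝ F] [FiniteDimensional ℝ F]
  {E : B → Type*} [∀ b, AddCommGroup (E b)] [∀ b, Module ℝ (E b)]
  [∀ b, TopologicalSpace (E b)] [∀ b, IsTopologicalAddGroup (E b)]
  [∀ b, ContinuousSMul ℝ (E b)] [TopologicalSpace (TotalSpace F E)]
  [FiberBundle F E] [VectorBundle ℝ F E]

/-- The evaluation of covectors on tangent vectors. -/
def evalTangent (b : B) :
    TangentSpace 𝓘(ℝ, EB) b →L[ℝ] (TangentSpace 𝓘(ℝ, EB) b →L[ℝ] ℝ) →L[ℝ] ℝ :=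
  (apply ℝ ℝ : EB →L[ℝ] (EB →L[ℝ] ℝ) →L[ℝ] ℝ)

/-- The flip of a covector valued linear form on a fibre. -/
def flipForm {b : B} (m : E b →L[ℝ] TangentSpace 𝓘(ℝ, EB) b →L[ℝ] ℝ) :
    TangentSpace 𝓘(ℝ, EB) b →L[ℝ] E b →L[ℝ] ℝ :=
  (precomp ℝ m : ((TangentSpace 𝓘(ℝ, EB) b →L[ℝ] ℝ) →L[ℝ] ℝ) →L[ℝ] (E b →L[ℝ] ℝ)) ∘L evalTangent b

@[simp] theorem flipForm_apply {b : B} (m : E b →L[ℝ] TangentSpace 𝓘(ℝ, EB) b →L[ℝ] ℝ)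
    (u : TangentSpace 𝓘(ℝ, EB) b) (y : E b) : flipForm m u y = m y u := rfl

/-- The difference of the connections `Dflat` and `D` at `b` is the family of Hamiltonian fields of
the linear functions `m(·, u)`. -/
def IsGaugeForm (Λ : LinearVertTensor E) (D Dflat : CovariantDerivative 𝓘(ℝ, EB) F E) (b : B)
    (m : E b →L[ℝ] TangentSpace 𝓘(ℝ, EB) b →L[ℝ] ℝ) : Prop :=
  ∀ (u : TangentSpace 𝓘(ℝ, EB) b) (y : E b),
    horLift Dflat (⟨b, y⟩ : TotalSpace F E) u - horLift D (⟨b, y⟩ : TotalSpace F E) u =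
      vertLift EB (⟨b, y⟩ : TotalSpace F E) (Λ b y (flipForm m u))

open Classical in
/-- The form which realizes the difference of two connections. -/
def globalGauge (Λ : LinearVertTensor E) (D Dflat : CovariantDerivative 𝓘(ℝ, EB) F E) (b : B) :
    E b →L[ℝ] TangentSpace 𝓘(ℝ, EB) b →L[ℝ] ℝ :=
  if h : ∃ m, IsGaugeForm Λ D Dflat b m then h.choose else 0

/-- The coupling forms of Moser's path. -/
def moserForm (Ω : FormField₂ 𝓘(ℝ, EB) B) (Λ : LinearVertTensor E)
    (D : CovariantDerivative 𝓘(ℝ, EB) F E) (R : DualValuedForm EB E)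
    (Dflat : CovariantDerivative 𝓘(ℝ, EB) F E) (t : ℝ) (p : TotalSpace F E) :
    TangentSpace 𝓘(ℝ, EB) p.proj →L[ℝ] TangentSpace 𝓘(ℝ, EB) p.proj →L[ℝ] ℝ :=
  Ω p.proj - t • R p.proj p.2 + (t - t ^ 2) • (globalGauge Λ D Dflat p.proj ∘L Λ p.proj p.2 ∘L
    flipForm (globalGauge Λ D Dflat p.proj))

/-- The time-dependent field of Moser's path. -/
def moserField (Ω : FormField₂ 𝓘(ℝ, EB) B) (Λ : LinearVertTensor E)
    (D : CovariantDerivative 𝓘(ℝ, EB) F E) (R : DualValuedForm EB E)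
    (Dflat : CovariantDerivative 𝓘(ℝ, EB) F E) (s : ℝ) (p : TotalSpace F E) :
    TangentSpace (𝓘(ℝ, EB).prod 𝓘(ℝ, F)) p :=
  (s • horLift Dflat p + (1 - s) • horLift D p)
    ((moserForm Ω Λ D R Dflat (1 - s) p).inverse (globalGauge Λ D Dflat p.proj p.2))

/-- The domain of Moser's field. -/
def moserDomain (Ω : FormField₂ 𝓘(ℝ, EB) B) (Λ : LinearVertTensor E)
    (D : CovariantDerivative 𝓘(ℝ, EB) F E) (R : DualValuedForm EB E)
    (Dflat : CovariantDerivative 𝓘(ℝ, EB) F E) : Set (TotalSpace F E) :=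
  {p | ∀ s ∈ Icc (0 : ℝ) 1, (moserForm Ω Λ D R Dflat (1 - s) p).IsInvertible}

variable {Ω : FormField₂ 𝓘(ℝ, EB) B} {Λ : LinearVertTensor E}
  {D Dflat : CovariantDerivative 𝓘(ℝ, EB) F E} {R : DualValuedForm EB E}
  {φ : BundleFrame EB F E} {Λ₀ : F →L[ℝ] (F →L[ℝ] ℝ) →L[ℝ] F}
  {μ : EB → EB →L[ℝ] F →L[ℝ] ℝ}

namespace BundleFrame.IsGaugeFrame

variable [IsManifold 𝓘(ℝ, EB) ∞ B] [ContMDiffVectorBundle ∞ F E 𝓘(ℝ, EB)]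
  (hG : φ.IsGaugeFrame Ω Λ D R Dflat Λ₀ μ) {ξ : EB} (hξ : ξ ∈ φ.dom)
include hG hξ

theorem horLift_flat (x : F) (u : EB) :
    horLift Dflat (φ.tot (ξ, x)) (φ.dbase ξ u) = φ.dtot (ξ, x) (u, 0) := by
  have : IsManifold 𝓘(ℝ, EB) 1 B := IsManifold.of_le (n := ∞) (by exact_mod_cast le_top)
  have : ContMDiffVectorBundle 1 F E 𝓘(ℝ, EB) :=
    ContMDiffVectorBundle.of_le (n := ∞) (by exact_mod_cast le_top)
  have h := isConnForm_connForm Dflat hξ x u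
  rw [hG.flat ξ hξ] at h
  simpa using! h

theorem horLift_lin (x : F) (u : EB) :
    horLift D (φ.tot (ξ, x)) (φ.dbase ξ u) = φ.dtot (ξ, x) (u, -Λ₀ x (μ ξ u)) := by
  have : IsManifold 𝓘(ℝ, EB) 1 B := IsManifold.of_le (n := ∞) (by exact_mod_cast le_top)
  have : ContMDiffVectorBundle 1 F E 𝓘(ℝ, EB) :=
    ContMDiffVectorBundle.of_le (n := ∞) (by exact_mod_cast le_top)
  have h := isConnForm_connForm D hξ x u
  rw [hG.conn ξ hξ] at h
  exact h

theorem horLift_sub (x : F) (u : EB) :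
    horLift Dflat (φ.tot (ξ, x)) (φ.dbase ξ u) - horLift D (φ.tot (ξ, x)) (φ.dbase ξ u) =
      vertLift EB (φ.tot (ξ, x)) (φ.fib (φ.base ξ) (Λ₀ x (μ ξ u))) := by
  rw [hG.horLift_flat hξ, hG.horLift_lin hξ, ← map_sub, ← dtot_inr (mem_source.2 hξ)]
  simp

theorem vert_fib (x : F) (γ : E (φ.base ξ) →L[ℝ] ℝ) :
    Λ (φ.base ξ) (φ.fib (φ.base ξ) x) γ =
      φ.fib (φ.base ξ) (Λ₀ x (γ ∘L φ.fib (φ.base ξ))) := by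
  rw [fib_locVert hξ, hG.vert ξ hξ]

/-- By the nondegeneracy of `Λ₀`, coming from the trivial centre, a linear function is determined by
its Hamiltonian field. So the gauge form is unique, and `μ` is the local expression of an object
that does not depend on the frame. -/
theorem isGaugeForm_iff (m : E (φ.base ξ) →L[ℝ] TangentSpace 𝓘(ℝ, EB) (φ.base ξ) →L[ℝ] ℝ) :
    IsGaugeForm Λ D Dflat (φ.base ξ) m ↔
      ∀ x u, m (φ.fib (φ.base ξ) x) (φ.dbase ξ u) = μ ξ u x := by
  constructor
  · intro h x u
    have h1 : μ ξ u - flipForm m (φ.dbase ξ u) ∘L φ.fib (φ.base ξ) = 0 := by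
      refine hG.nondeg _ fun y => ?_
      have h2 := (hG.horLift_sub hξ y u).symm.trans (h (φ.dbase ξ u) (φ.fib (φ.base ξ) y))
      have h3 := congrArg (fun w => φ.coord (φ.base ξ) (vertCoord EB (φ.tot (ξ, y)) w)) h2
      have h4 : ∀ z : E (φ.base ξ), φ.coord (φ.base ξ) (vertCoord EB (φ.tot (ξ, y))
          (vertLift EB (φ.tot (ξ, y)) z)) = φ.coord (φ.base ξ) z := fun z =>
        congrArg (φ.coord (φ.base ξ)) (vertCoord_vertLift _ _)
      have h5 := (h4 _).symm.trans (h3.trans (h4 _))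
      rw [hG.vert_fib hξ, φ.coord_fib _ (φ.base_mem ξ hξ), φ.coord_fib _ (φ.base_mem ξ hξ)] at h5
      rw [map_sub, h5, sub_self]
    have h2 := congrArg (fun L => L x) (sub_eq_zero.1 h1)
    exact h2.symm
  · intro h u y
    obtain ⟨u, rfl⟩ : ∃ u', φ.dbase ξ u' = u :=
      ⟨(φ.dbase ξ).inverse u, (isInvertible_dbase hξ).self_apply_inverse u⟩
    obtain ⟨y, rfl⟩ : ∃ y', φ.fib (φ.base ξ) y' = y :=
      ⟨φ.coord (φ.base ξ) y, φ.fib_coord _ (φ.base_mem ξ hξ) y⟩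
    refine (hG.horLift_sub hξ y u).trans ?_
    rw [hG.vert_fib hξ]
    have h1 : flipForm m (φ.dbase ξ u) ∘L φ.fib (φ.base ξ) = μ ξ u := by
      ext x; exact h x u
    rw [h1]
    rfl

theorem globalGauge_apply (x : F) (u : EB) :
    globalGauge Λ D Dflat (φ.base ξ) (φ.fib (φ.base ξ) x) (φ.dbase ξ u) = μ ξ u x := by
  have h : ∃ m, IsGaugeForm Λ D Dflat (φ.base ξ) m := by
    refine ⟨(precomp ℝ (φ.dbase ξ).inverse : (EB →L[ℝ] ℝ) →L[ℝ]
      (TangentSpace 𝓘(ℝ, EB) (φ.base ξ) →L[ℝ] ℝ)) ∘L (μ ξ).flip ∘L φ.coord (φ.base ξ), ?_⟩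
    rw [hG.isGaugeForm_iff hξ]
    intro x u
    change μ ξ ((φ.dbase ξ).inverse (φ.dbase ξ u)) (φ.coord (φ.base ξ) (φ.fib (φ.base ξ) x)) = _
    rw [φ.coord_fib _ (φ.base_mem ξ hξ), (isInvertible_dbase hξ).inverse_apply_self]
  rw [globalGauge, dif_pos h]
  exact (hG.isGaugeForm_iff hξ _).1 h.choose_spec x u

/-- The expression of the coupling form without `dμ` matches the frame-independent definition term
by term. -/
theorem locForm_moserForm (t : ℝ) (x : F) :
    φ.locForm ξ (moserForm Ω Λ D R Dflat t (φ.tot (ξ, x))) =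
      localCoupling (fun ξ => -(φ.locForm ξ (Ω (φ.base ξ))).inverse) Λ₀ μ t (ξ, x) := by
  rw [localCoupling_eq (hG.dual ξ hξ x), inverse_neg_inverse (hG.form_inv ξ hξ), neg_neg]
  ext u v
  have h1 : globalGauge Λ D Dflat (φ.base ξ) (Λ (φ.base ξ) (φ.fib (φ.base ξ) x)
      (flipForm (globalGauge Λ D Dflat (φ.base ξ)) (φ.dbase ξ u))) (φ.dbase ξ v) =
      muBracket Λ₀ (μ ξ) x u v := by
    rw [hG.vert_fib hξ, hG.globalGauge_apply hξ, muBracket_apply]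
    congr 2
    ext y
    exact hG.globalGauge_apply hξ y u
  exact congrArg (fun r => Ω (φ.base ξ) (φ.dbase ξ u) (φ.dbase ξ v) -
    t • R (φ.base ξ) (φ.fib (φ.base ξ) x) (φ.dbase ξ u) (φ.dbase ξ v) + (t - t ^ 2) • r) h1

theorem isInvertible_moserForm (t : ℝ) (x : F) :
    (moserForm Ω Λ D R Dflat t (φ.tot (ξ, x))).IsInvertible ↔
      (localCoupling (fun ξ => -(φ.locForm ξ (Ω (φ.base ξ))).inverse) Λ₀ μ t (ξ, x)).IsInvertible := by
  rw [← hG.locForm_moserForm hξ]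
  exact (isInvertible_locForm hξ _).symm

/-- In a parallel frame the combination of the two horizontal lifts with weights `s` and `1 - s` is
the lift `localHor` with parameter `1 - s`. -/
theorem moserField_tot (s : ℝ) (x : F) :
    moserField Ω Λ D R Dflat s (φ.tot (ξ, x)) = φ.dtot (ξ, x)
      (localField (fun ξ => -(φ.locForm ξ (Ω (φ.base ξ))).inverse) Λ₀ μ (s, ξ, x)) := by
  have h1 := inverse_locForm hξ (moserForm Ω Λ D R Dflat (1 - s) (φ.tot (ξ, x)))
    (globalGauge Λ D Dflat (φ.base ξ) (φ.fib (φ.base ξ) x))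
  rw [hG.locForm_moserForm hξ] at h1
  have h2 : globalGauge Λ D Dflat (φ.base ξ) (φ.fib (φ.base ξ) x) ∘L φ.dbase ξ = (μ ξ).flip x := by
    ext u
    exact hG.globalGauge_apply hξ x u
  rw [h2] at h1
  set u := (localCoupling (fun ξ => -(φ.locForm ξ (Ω (φ.base ξ))).inverse) Λ₀ μ (1 - s)
    (ξ, x)).inverse ((μ ξ).flip x) with hu
  refine (congrArg (s • horLift Dflat (φ.tot (ξ, x)) + (1 - s) • horLift D (φ.tot (ξ, x))) h1).trans ?_
  change s • horLift Dflat (φ.tot (ξ, x)) (φ.dbase ξ u) +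
    (1 - s) • horLift D (φ.tot (ξ, x)) (φ.dbase ξ u) = φ.dtot (ξ, x) (localHor Λ₀ μ (1 - s) (ξ, x) u)
  rw [hG.horLift_flat hξ, hG.horLift_lin hξ, ← map_smul, ← map_smul, ← map_add, localHor_apply]
  congr 1
  ext
  · simp [← add_smul]
  · simp

theorem isLocal_flatModel (x : F) : φ.IsLocal (flatModel Ω Λ Dflat) (ξ, x)
    (localFlat (fun ξ => -(φ.locForm ξ (Ω (φ.base ξ))).inverse) Λ₀ (ξ, x)) := by
  intro α
  refine (isLocal_coupling (mem_source.2 hξ) (hor' := inl ℝ EB F)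
    (fun u => hG.horLift_flat hξ x u) (Ω (φ.base ξ)) Λ α).trans ?_
  congr 2
  rw [hG.vert ξ hξ, localFlat]
  simp [ContinuousLinearMap.neg_comp, ContinuousLinearMap.comp_neg]

theorem isLocal_linearizedTensor (x : F) : φ.IsLocal (linearizedTensor Ω Λ D R) (ξ, x)
    (localLin (fun ξ => -(φ.locForm ξ (Ω (φ.base ξ))).inverse) Λ₀ μ 1 (ξ, x)) := by
  intro α
  have h0 := hG.locForm_moserForm hξ 1 x
  have h1 : moserForm Ω Λ D R Dflat 1 (φ.tot (ξ, x)) =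
      Ω (φ.base ξ) - R (φ.base ξ) (φ.fib (φ.base ξ) x) := by
    rw [moserForm]
    simp only [one_pow, sub_self, zero_smul, add_zero, one_smul]
    rfl
  rw [h1] at h0
  refine (isLocal_coupling (mem_source.2 hξ) (hor' := localHor Λ₀ μ 1 (ξ, x))
    (fun u => ?_) (Ω (φ.base ξ) - R (φ.base ξ) (φ.fib (φ.base ξ) x)) Λ α).trans ?_
  · refine (hG.horLift_lin hξ x u).trans ?_
    rw [localHor_apply, one_smul]
  · congr 2
    rw [hG.vert ξ hξ, h0, localLin]

end BundleFrame.IsGaugeFrame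

end MoserField

/-! ### Domain, smoothness and uniqueness of integral curves of Moser's field. -/

section MoserCurves

set_option maxSynthPendingDepth 3

open ContinuousLinearMap

/-- Local uniqueness of the solutions of an ordinary differential equation on `[0, 1]`. -/
theorem eventually_eq_of_hasDerivWithinAt {V : Type*} [NormedAddCommGroup V] [NormedSpace ℝ V]
    {v : ℝ × V → V} {f g : ℝ → V} {t₀ : ℝ} (ht₀ : t₀ ∈ Icc (0 : ℝ) 1)
    (hv : ContDiffAt ℝ 1 v (t₀, f t₀))
    (hf : ∀ᶠ t in 𝓝[Icc 0 1] t₀, HasDerivWithinAt f (v (t, f t)) (Icc 0 1) t)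
    (hg : ∀ᶠ t in 𝓝[Icc 0 1] t₀, HasDerivWithinAt g (v (t, g t)) (Icc 0 1) t)
    (h : f t₀ = g t₀) : ∀ᶠ t in 𝓝[Icc 0 1] t₀, f t = g t := by
  obtain ⟨K, s, hs, hK⟩ := hv.exists_lipschitzOnWith
  have hfc : ∀ᶠ t in 𝓝[Icc 0 1] t₀, (t, f t) ∈ s :=
    (continuousWithinAt_id.prodMk (hf.self_of_nhdsWithin ht₀).continuousWithinAt) hs
  have hgc : ∀ᶠ t in 𝓝[Icc 0 1] t₀, (t, g t) ∈ s := by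
    refine (continuousWithinAt_id.prodMk (hg.self_of_nhdsWithin ht₀).continuousWithinAt) ?_
    change s ∈ 𝓝 (t₀, g t₀)
    rw [← h]
    exact hs
  obtain ⟨ε, hε, hsub⟩ := Metric.mem_nhdsWithin_iff.1 (((hf.and hg).and hfc).and hgc)
  have hord : ∀ a b t : ℝ, a ∈ Metric.ball t₀ ε ∩ Icc 0 1 → b ∈ Metric.ball t₀ ε ∩ Icc 0 1 →
      t ∈ Icc a b → t ∈ Metric.ball t₀ ε ∩ Icc 0 1 := by
    intro a b t ha hb ht
    rw [Real.ball_eq_Ioo] at *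
    exact ⟨⟨ha.1.1.trans_le ht.1, ht.2.trans_lt hb.1.2⟩, ha.2.1.trans ht.1, ht.2.trans hb.2.2⟩
  have hlip : ∀ t, LipschitzOnWith K (fun x => v (t, x)) {x | (t, x) ∈ s} := by
    intro t x hx y hy
    refine (hK hx hy).trans_eq ?_
    rw [Prod.edist_eq, edist_self]
    simp
  have ht₀m : t₀ ∈ Metric.ball t₀ ε ∩ Icc 0 1 := ⟨Metric.mem_ball_self hε, ht₀⟩
  filter_upwards [inter_mem_nhdsWithin (Icc (0 : ℝ) 1) (Metric.ball_mem_nhds t₀ hε)] with t ht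
  have htm : t ∈ Metric.ball t₀ ε ∩ Icc 0 1 := ⟨ht.2, ht.1⟩
  rcases le_total t₀ t with hle | hle
  · have hm := fun r hr => hsub (hord t₀ t r ht₀m htm hr)
    have hI : ∀ r ∈ Ico t₀ t, Icc (0 : ℝ) 1 ∈ 𝓝[≥] r := fun r hr =>
      Icc_mem_nhdsGE_of_mem ⟨ht₀.1.trans hr.1, hr.2.trans_le ht.1.2⟩
    refine ODE_solution_unique_of_mem_Icc_right (v := fun t x => v (t, x))
      (s := fun t => {x | (t, x) ∈ s}) (fun r _ => hlip r)
      (fun r hr => ((hm r hr).1.1.1.continuousWithinAt).mono_of_mem_nhdsWithin ?_)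
      (fun r hr => ((hm r (Ico_subset_Icc_self hr)).1.1.1).mono_of_mem_nhdsWithin (hI r hr))
      (fun r hr => (hm r (Ico_subset_Icc_self hr)).1.2)
      (fun r hr => ((hm r hr).1.1.2.continuousWithinAt).mono_of_mem_nhdsWithin ?_)
      (fun r hr => ((hm r (Ico_subset_Icc_self hr)).1.1.2).mono_of_mem_nhdsWithin (hI r hr))
      (fun r hr => (hm r (Ico_subset_Icc_self hr)).2) h (right_mem_Icc.2 hle)
    all_goals
      exact Filter.mem_of_superset self_mem_nhdsWithin (Icc_subset_Icc ht₀.1 ht.1.2)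
  · have hm := fun r hr => hsub (hord t t₀ r htm ht₀m hr)
    have hI : ∀ r ∈ Ioc t t₀, Icc (0 : ℝ) 1 ∈ 𝓝[≤] r := fun r hr =>
      Icc_mem_nhdsLE_of_mem ⟨ht.1.1.trans_lt hr.1, hr.2.trans ht₀.2⟩
    refine ODE_solution_unique_of_mem_Icc_left (v := fun t x => v (t, x))
      (s := fun t => {x | (t, x) ∈ s}) (fun r _ => hlip r)
      (fun r hr => ((hm r hr).1.1.1.continuousWithinAt).mono_of_mem_nhdsWithin ?_)
      (fun r hr => ((hm r (Ioc_subset_Icc_self hr)).1.1.1).mono_of_mem_nhdsWithin (hI r hr))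
      (fun r hr => (hm r (Ioc_subset_Icc_self hr)).1.2)
      (fun r hr => ((hm r hr).1.1.2.continuousWithinAt).mono_of_mem_nhdsWithin ?_)
      (fun r hr => ((hm r (Ioc_subset_Icc_self hr)).1.1.2).mono_of_mem_nhdsWithin (hI r hr))
      (fun r hr => (hm r (Ioc_subset_Icc_self hr)).2) h (left_mem_Icc.2 hle)
    all_goals
      exact Filter.mem_of_superset self_mem_nhdsWithin (Icc_subset_Icc ht.1.1 ht₀.2)

/-- Two curves in a Hausdorff space that agree locally wherever they meet are equal, if they meet. -/
theorem eqOn_Icc_of_eventually_eq {X : Type*} [TopologicalSpace X] [T2Space X] {c c' : ℝ → X}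
    (hc : ContinuousOn c (Icc 0 1)) (hc' : ContinuousOn c' (Icc 0 1))
    (h : ∀ t ∈ Icc (0 : ℝ) 1, c t = c' t → ∀ᶠ s in 𝓝[Icc 0 1] t, c s = c' s)
    {t₀ : ℝ} (ht₀ : t₀ ∈ Icc (0 : ℝ) 1) (h0 : c t₀ = c' t₀) : EqOn c c' (Icc 0 1) := by
  have := Subtype.preconnectedSpace (isPreconnected_Icc (a := (0 : ℝ)) (b := 1))
  have hcl : IsClopen {t : Icc (0 : ℝ) 1 | c t = c' t} := by
    refine ⟨isClosed_eq hc.domRestrict hc'.domRestrict, ?_⟩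
    rw [isOpen_iff_mem_nhds]
    intro t ht
    have h1 := h t t.2 ht
    rw [← map_nhds_subtype_val, Filter.eventually_map] at h1
    exact h1
  have huniv := hcl.eq_univ ⟨⟨t₀, ht₀⟩, h0⟩
  intro t ht
  have : (⟨t, ht⟩ : Icc (0 : ℝ) 1) ∈ {t : Icc (0 : ℝ) 1 | c t = c' t} := by
    rw [huniv]; trivial
  exact this

variable {EB : Type*} [NormedAddCommGroup EB] [NormedSpace ℝ EB] [FiniteDimensional ℝ EB]
  {B : Type*} [TopologicalSpace B] [ChartedSpace EB B] [IsManifold 𝓘(ℝ, EB) ∞ B]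
  {F : Type*} [NormedAddCommGroup F] [NormedSpace ℝ F] [FiniteDimensional ℝ F]
  {E : B → Type*} [∀ b, AddCommGroup (E b)] [∀ b, Module ℝ (E b)]
  [∀ b, TopologicalSpace (E b)] [∀ b, IsTopologicalAddGroup (E b)]
  [∀ b, ContinuousSMul ℝ (E b)] [TopologicalSpace (TotalSpace F E)]
  [FiberBundle F E] [VectorBundle ℝ F E] [ContMDiffVectorBundle ∞ F E 𝓘(ℝ, EB)]
  {Ω : FormField₂ 𝓘(ℝ, EB) B} {Λ : LinearVertTensor E}
  {D Dflat : CovariantDerivative 𝓘(ℝ, EB) F E} {R : DualValuedForm EB E}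
  {φ : BundleFrame EB F E} {Λ₀ : F →L[ℝ] (F →L[ℝ] ℝ) →L[ℝ] F}
  {μ : EB → EB →L[ℝ] F →L[ℝ] ℝ}

theorem BundleFrame.hasMFDerivAt_inv {q : EB × F} (hq : q ∈ φ.source) :
    HasMFDerivAt (𝓘(ℝ, EB).prod 𝓘(ℝ, F)) 𝓘(ℝ, EB × F) φ.inv (φ.tot q) (φ.dtot q).inverse := by
  have h2 : HasMFDerivAt (𝓘(ℝ, EB).prod 𝓘(ℝ, F)) 𝓘(ℝ, EB × F) φ.inv (φ.tot q) _ :=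
    ((contMDiffAt_inv (tot_mem hq)).mdifferentiableAt (by simp)).hasMFDerivAt
  have h12 := (h2.comp q (hasMFDerivAt_tot hq)).mfderiv
  have h3 : φ.inv ∘ φ.tot =ᶠ[𝓝 q] id := by
    filter_upwards [isOpen_source.mem_nhds hq] with x hx using inv_tot hx
  rw [h3.mfderiv_eq, mfderiv_id] at h12
  suffices h : (φ.dtot q).inverse = mfderiv (𝓘(ℝ, EB).prod 𝓘(ℝ, F)) 𝓘(ℝ, EB × F) φ.inv (φ.tot q) by
    rw [h]; exact h2
  refine ContinuousLinearMap.ext fun w => ?_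
  obtain ⟨u, rfl⟩ : ∃ u, φ.dtot q u = w :=
    ⟨(φ.dtot q).inverse w, (isInvertible_dtot hq).self_apply_inverse w⟩
  rw [(isInvertible_dtot hq).inverse_apply_self]
  exact congrArg (fun L => L u) h12

namespace BundleFrame.IsGaugeFrame

variable (hG : φ.IsGaugeFrame Ω Λ D R Dflat Λ₀ μ)
include hG

theorem mfderiv_inv_moserField (s : ℝ) {p : TotalSpace F E} (hp : p ∈ φ.target) :
    mfderiv (𝓘(ℝ, EB).prod 𝓘(ℝ, F)) 𝓘(ℝ, EB × F) φ.inv p (moserField Ω Λ D R Dflat s p) =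
      localField (fun ξ => -(φ.locForm ξ (Ω (φ.base ξ))).inverse) Λ₀ μ (s, φ.inv p) := by
  obtain ⟨⟨ξ, x⟩, hq, rfl⟩ : ∃ q ∈ φ.source, φ.tot q = p := ⟨φ.inv p, inv_mem hp, tot_inv hp⟩
  rw [hG.moserField_tot (mem_source.1 hq), (hasMFDerivAt_inv hq).mfderiv, inv_tot hq]
  exact (isInvertible_dtot hq).inverse_apply_self _

theorem hasDerivWithinAt_inv_comp {c : ℝ → TotalSpace F E} {I : Set ℝ} {t : ℝ}
    (hc : HasMFDerivWithinAt 𝓘(ℝ, ℝ) (𝓘(ℝ, EB).prod 𝓘(ℝ, F)) c I t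
      ((1 : ℝ →L[ℝ] ℝ).smulRight (moserField Ω Λ D R Dflat t (c t)))) (ht : c t ∈ φ.target) :
    HasDerivWithinAt (fun s => φ.inv (c s))
      (localField (fun ξ => -(φ.locForm ξ (Ω (φ.base ξ))).inverse) Λ₀ μ (t, φ.inv (c t))) I t := by
  have h1 := ((contMDiffAt_inv ht).mdifferentiableAt (by simp)).hasMFDerivAt
  set L : ℝ →L[ℝ] EB × F := (mfderiv (𝓘(ℝ, EB).prod 𝓘(ℝ, F)) 𝓘(ℝ, EB × F) φ.inv (c t)) ∘L
    ((1 : ℝ →L[ℝ] ℝ).smulRight (moserField Ω Λ D R Dflat t (c t))) with hL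
  have h2 : HasFDerivWithinAt (fun s => φ.inv (c s)) L I t :=
    (h1.comp_hasMFDerivWithinAt t hc).hasFDerivWithinAt
  have h3 : HasDerivWithinAt (fun s => φ.inv (c s)) (L 1) I t := h2.hasDerivWithinAt
  refine h3.congr_deriv ?_
  refine Eq.trans ?_ (hG.mfderiv_inv_moserField t ht)
  change mfderiv (𝓘(ℝ, EB).prod 𝓘(ℝ, F)) 𝓘(ℝ, EB × F) φ.inv (c t)
    ((1 : ℝ) • moserField Ω Λ D R Dflat t (c t)) = _
  rw [one_smul]

theorem moserDomain_iff {p : TotalSpace F E} (hp : p ∈ φ.target) :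
    p ∈ moserDomain Ω Λ D R Dflat ↔ ∀ s ∈ Icc (0 : ℝ) 1,
      (s, φ.inv p) ∈ localDomain φ.dom (fun ξ => -(φ.locForm ξ (Ω (φ.base ξ))).inverse) Λ₀ μ := by
  obtain ⟨⟨ξ, x⟩, hq, rfl⟩ : ∃ q ∈ φ.source, φ.tot q = p := ⟨φ.inv p, inv_mem hp, tot_inv hp⟩
  refine forall₂_congr fun s _ => ?_
  rw [hG.isInvertible_moserForm (mem_source.1 hq), inv_tot hq]
  exact ⟨fun h => ⟨mem_source.1 hq, h⟩, fun h => h.2⟩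

/-- Nondegeneracy is open in time and point together; compactness of `[0, 1]` makes it open in the
point for all times simultaneously. -/
theorem moserDomain_mem_nhds {p : TotalSpace F E} (hp : p ∈ φ.target)
    (h : p ∈ moserDomain Ω Λ D R Dflat) : moserDomain Ω Λ D R Dflat ∈ 𝓝 p := by
  have h1 : ∀ᶠ p' in 𝓝 p, ∀ s ∈ Icc (0 : ℝ) 1, (s, φ.inv p') ∈
      localDomain φ.dom (fun ξ => -(φ.locForm ξ (Ω (φ.base ξ))).inverse) Λ₀ μ := by
    refine isCompact_Icc.eventually_forall_of_forall_eventually fun s hs => ?_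
    have h2 : ContinuousAt (fun z : TotalSpace F E × ℝ => (z.2, φ.inv z.1)) (p, s) :=
      continuousAt_snd.prodMk
        (ContinuousAt.comp (g := φ.inv) (f := Prod.fst) (x := (p, s))
          (contMDiffAt_inv hp).continuousAt continuousAt_fst)
    have := FiniteDimensional.complete ℝ EB
    exact h2.eventually (hG.model.isOpen_localDomain.mem_nhds ((hG.moserDomain_iff hp).1 h s hs))
  filter_upwards [h1, isOpen_target.mem_nhds hp] with p' hp' ht
  exact (hG.moserDomain_iff ht).2 hp'

theorem zero_mem_moserDomain {b : B} (hb : b ∈ φ.img) :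
    (⟨b, 0⟩ : TotalSpace F E) ∈ moserDomain Ω Λ D R Dflat := by
  refine (hG.moserDomain_iff (p := ⟨b, 0⟩) hb).2 fun s _ => ?_
  have h : φ.inv (⟨b, 0⟩ : TotalSpace F E) = (φ.chart b, 0) := by simp [inv]
  rw [h]
  exact hG.model.mem_localDomain_zero s (φ.chart_mem b hb)

theorem contMDiffAt_moserField {p : TotalSpace F E} (hp : p ∈ φ.target)
    (h : p ∈ moserDomain Ω Λ D R Dflat) {t : ℝ} (ht : t ∈ Icc (0 : ℝ) 1) :
    ContMDiffAt (𝓘(ℝ, ℝ).prod (𝓘(ℝ, EB).prod 𝓘(ℝ, F))) (𝓘(ℝ, EB).prod 𝓘(ℝ, F)).tangent ∞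
      (fun q : ℝ × TotalSpace F E => (⟨q.2, moserField Ω Λ D R Dflat q.1 q.2⟩ :
        TangentBundle (𝓘(ℝ, EB).prod 𝓘(ℝ, F)) (TotalSpace F E))) (t, p) := by
  have := FiniteDimensional.complete ℝ EB
  set S := fun ξ => -(φ.locForm ξ (Ω (φ.base ξ))).inverse with hS
  have hdom := (hG.moserDomain_iff hp).1 h t ht
  have h1 : ContMDiffAt (𝓘(ℝ, ℝ).prod (𝓘(ℝ, EB).prod 𝓘(ℝ, F))) 𝓘(ℝ, ℝ × EB × F) ∞
      (fun q : ℝ × TotalSpace F E => (q.1, φ.inv q.2)) (t, p) :=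
    contMDiffAt_fst.prodMk_space ((contMDiffAt_inv hp).comp (t, p) contMDiffAt_snd)
  have h2 : ContMDiffAt 𝓘(ℝ, ℝ × EB × F) 𝓘(ℝ, EB × F).tangent ∞
      (fun z : ℝ × EB × F => (⟨z.2, localField S Λ₀ μ z⟩ : TangentBundle 𝓘(ℝ, EB × F) (EB × F)))
      (t, φ.inv p) := by
    have h3 := (hG.model.contDiffOn_localField.contDiffAt
      (hG.model.isOpen_localDomain.mem_nhds hdom)).contMDiffAt
    refine (contMDiffAt_totalSpace).2 ⟨contDiffAt_snd.contMDiffAt, ?_⟩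
    refine h3.congr_of_eventuallyEq (Filter.Eventually.of_forall fun z => ?_)
    simp [hS]
  have h3 := (φ.contMDiffOn_tot.contMDiffOn_tangentMapWithin (m := ∞) (by simp)
    isOpen_source.uniqueMDiffOn)
  have h4 : ContMDiffAt 𝓘(ℝ, EB × F).tangent (𝓘(ℝ, EB).prod 𝓘(ℝ, F)).tangent ∞
      (tangentMapWithin 𝓘(ℝ, EB × F) (𝓘(ℝ, EB).prod 𝓘(ℝ, F)) φ.tot φ.source)
      (⟨φ.inv p, localField S Λ₀ μ (t, φ.inv p)⟩ : TangentBundle 𝓘(ℝ, EB × F) (EB × F)) := by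
    refine h3.contMDiffAt (IsOpen.mem_nhds ?_ (inv_mem hp))
    exact isOpen_source.preimage (FiberBundle.continuous_proj (EB × F) _)
  have h5 := (h4.comp (t, φ.inv p) h2).comp (t, p) h1
  refine h5.congr_of_eventuallyEq ?_
  filter_upwards [continuousAt_snd.eventually (isOpen_target.mem_nhds hp)] with z hz
  obtain ⟨s, p'⟩ := z
  obtain ⟨⟨ξ, x⟩, hq, rfl⟩ : ∃ q ∈ φ.source, φ.tot q = p' := ⟨φ.inv p', inv_mem hz, tot_inv hz⟩
  simp only [Function.comp_apply]
  rw [inv_tot hq, tangentMapWithin, mfderivWithin_of_isOpen isOpen_source hq,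
    hG.moserField_tot (mem_source.1 hq)]
  rfl

end BundleFrame.IsGaugeFrame

/-- The integral curves of Moser's field. -/
def IsMoserCurve (Ω : FormField₂ 𝓘(ℝ, EB) B) (Λ : LinearVertTensor E)
    (D : CovariantDerivative 𝓘(ℝ, EB) F E) (R : DualValuedForm EB E)
    (Dflat : CovariantDerivative 𝓘(ℝ, EB) F E) (c : ℝ → TotalSpace F E) : Prop :=
  ∀ t ∈ Icc (0 : ℝ) 1, c t ∈ moserDomain Ω Λ D R Dflat ∧
    HasMFDerivWithinAt 𝓘(ℝ, ℝ) (𝓘(ℝ, EB).prod 𝓘(ℝ, F)) c (Icc 0 1) t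
      ((1 : ℝ →L[ℝ] ℝ).smulRight (moserField Ω Λ D R Dflat t (c t)))

/-- In a gauge frame the curves solve a smooth equation, hence agree near any time at which they
meet. The set of such times is open and closed in `[0, 1]`; the meeting time need not be 0, which
later gives injectivity of the time-one map. -/
theorem IsMoserCurve.eqOn [T2Space (TotalSpace F E)]
    (hG : ∀ b, ∃ (φ : BundleFrame EB F E) (Λ₀ : F →L[ℝ] (F →L[ℝ] ℝ) →L[ℝ] F)
      (μ : EB → EB →L[ℝ] F →L[ℝ] ℝ), b ∈ φ.img ∧ φ.IsGaugeFrame Ω Λ D R Dflat Λ₀ μ)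
    {c c' : ℝ → TotalSpace F E} (hc : IsMoserCurve Ω Λ D R Dflat c)
    (hc' : IsMoserCurve Ω Λ D R Dflat c') {t₀ : ℝ} (ht₀ : t₀ ∈ Icc (0 : ℝ) 1)
    (h0 : c t₀ = c' t₀) : EqOn c c' (Icc 0 1) := by
  have := FiniteDimensional.complete ℝ EB
  refine eqOn_Icc_of_eventually_eq (fun t ht => (hc t ht).2.continuousWithinAt)
    (fun t ht => (hc' t ht).2.continuousWithinAt) (fun t ht h => ?_) ht₀ h0
  obtain ⟨φ, Λ₀, μ, hb, hφ⟩ := hG (c t).proj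
  have e1 : ∀ᶠ s in 𝓝[Icc 0 1] t, c s ∈ φ.target :=
    (hc t ht).2.continuousWithinAt (BundleFrame.isOpen_target.mem_nhds hb)
  have e2 : ∀ᶠ s in 𝓝[Icc 0 1] t, c' s ∈ φ.target := by
    refine (hc' t ht).2.continuousWithinAt (BundleFrame.isOpen_target.mem_nhds ?_)
    rw [← h]; exact hb
  have hdom := (hφ.moserDomain_iff hb).1 (hc t ht).1 t ht
  have hv := (hφ.model.contDiffOn_localField.contDiffAt
    (hφ.model.isOpen_localDomain.mem_nhds hdom)).of_le (m := 1) (by exact_mod_cast le_top)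
  have h3 := eventually_eq_of_hasDerivWithinAt (f := fun s => φ.inv (c s))
    (g := fun s => φ.inv (c' s)) ht hv ?_ ?_ (congrArg φ.inv h)
  · filter_upwards [e1, e2, h3] with s h1 h2 h3
    rw [← BundleFrame.tot_inv h1, ← BundleFrame.tot_inv h2, h3]
  · filter_upwards [e1, self_mem_nhdsWithin] with s h1 hs
    exact hφ.hasDerivWithinAt_inv_comp (hc s hs).2 h1
  · filter_upwards [e2, self_mem_nhdsWithin] with s h1 hs
    exact hφ.hasDerivWithinAt_inv_comp (hc' s hs).2 h1

end MoserCurves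

/-! ### Moser's flow near a point of the leaf. -/

section MoserFlow

set_option maxSynthPendingDepth 3

open ContinuousLinearMap

variable {EB : Type*} [NormedAddCommGroup EB] [NormedSpace ℝ EB] [FiniteDimensional ℝ EB]
  {B : Type*} [TopologicalSpace B] [ChartedSpace EB B] [IsManifold 𝓘(ℝ, EB) ∞ B]
  {F : Type*} [NormedAddCommGroup F] [NormedSpace ℝ F] [FiniteDimensional ℝ F]
  {E : B → Type*} [∀ b, AddCommGroup (E b)] [∀ b, Module ℝ (E b)]
  [∀ b, TopologicalSpace (E b)] [∀ b, IsTopologicalAddGroup (E b)]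
  [∀ b, ContinuousSMul ℝ (E b)] [TopologicalSpace (TotalSpace F E)]
  [FiberBundle F E] [VectorBundle ℝ F E] [ContMDiffVectorBundle ∞ F E 𝓘(ℝ, EB)]
  {Ω : FormField₂ 𝓘(ℝ, EB) B} {Λ : LinearVertTensor E}
  {D Dflat : CovariantDerivative 𝓘(ℝ, EB) F E} {R : DualValuedForm EB E}
  {φ : BundleFrame EB F E} {Λ₀ : F →L[ℝ] (F →L[ℝ] ℝ) →L[ℝ] F}
  {μ : EB → EB →L[ℝ] F →L[ℝ] ℝ}

theorem inverse_conj_apply {V : Type*} [NormedAddCommGroup V] [NormedSpace ℝ V] {A A' L : V →L[ℝ] V}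
    {T T' : (V →L[ℝ] ℝ) →L[ℝ] V} (hA : A.IsInvertible) (hA' : A'.IsInvertible)
    (hL : L.IsInvertible) (h : ∀ α, T' α = L (T (α ∘L L))) (α : V →L[ℝ] ℝ) :
    (A' ∘L L ∘L A.inverse).inverse (A' (T' ((α ∘L (A' ∘L L ∘L A.inverse).inverse) ∘L A'))) =
      A (T (α ∘L A)) := by
  set m := A' ∘L L ∘L A.inverse with hm
  have im : m.IsInvertible := by
    obtain ⟨a, ha⟩ := hA
    obtain ⟨a', ha'⟩ := hA'
    obtain ⟨l, hl⟩ := hL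
    refine ⟨(a.symm.trans l).trans a', ?_⟩
    rw [hm, ← ha, ← ha', ← hl, inverse_equiv]
    rfl
  have hmA : ∀ v, m (A v) = A' (L v) := fun v => by
    rw [hm, ContinuousLinearMap.comp_apply, ContinuousLinearMap.comp_apply, hA.inverse_apply_self]
  have h1 : (((α ∘L m.inverse) ∘L A') ∘L L) = α ∘L A := by
    ext v
    change α (m.inverse (A' (L _))) = α (A _)
    rw [← hmA, im.inverse_apply_self]
  rw [h, h1, ← hmA, im.inverse_apply_self]

namespace BundleFrame

theorem isLocalDiffeomorphAt_inv {p : TotalSpace F E} (hp : p ∈ φ.target) :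
    IsLocalDiffeomorphAt (𝓘(ℝ, EB).prod 𝓘(ℝ, F)) 𝓘(ℝ, EB × F) ∞ φ.inv p :=
  ⟨{ toFun := φ.inv
     invFun := φ.tot
     source := φ.target
     target := φ.source
     map_source' := fun _ h => inv_mem h
     map_target' := fun _ h => tot_mem h
     left_inv' := fun _ h => tot_inv h
     right_inv' := fun _ h => inv_tot h
     open_source := isOpen_target
     open_target := isOpen_source
     contMDiffOn_toFun := φ.contMDiffOn_inv
     contMDiffOn_invFun := φ.contMDiffOn_tot }, hp, fun _ _ => rfl⟩

/-- A map of the total space pulls back a tensor to another one, if its expression in a frame does. -/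
theorem pullback_of_isLocal {P Q : TensorField₂ (𝓘(ℝ, EB).prod 𝓘(ℝ, F)) (TotalSpace F E)}
    {g : TotalSpace F E → TotalSpace F E} {k : EB × F → EB × F} {q : EB × F}
    (hq : q ∈ φ.source) (hk : k q ∈ φ.source) (hg : g =ᶠ[𝓝 (φ.tot q)] fun p => φ.tot (k (φ.inv p)))
    (hkd : DifferentiableAt ℝ k q) (hki : (fderiv ℝ k q).IsInvertible)
    {T T' : (EB × F →L[ℝ] ℝ) →L[ℝ] EB × F} (hT : φ.IsLocal P q T) (hT' : φ.IsLocal Q (k q) T')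
    (h : ∀ α, T' α = fderiv ℝ k q (T (α ∘L fderiv ℝ k q))) :
    pullback g Q (φ.tot q) = P (φ.tot q) := by
  have hk' : HasMFDerivAt 𝓘(ℝ, EB × F) 𝓘(ℝ, EB × F) k (φ.inv (φ.tot q)) (fderiv ℝ k q) := by
    rw [inv_tot hq]; exact hkd.hasFDerivAt.hasMFDerivAt
  have ht' : HasMFDerivAt 𝓘(ℝ, EB × F) (𝓘(ℝ, EB).prod 𝓘(ℝ, F)) φ.tot (k (φ.inv (φ.tot q)))
      (φ.dtot (k q)) := by
    rw [inv_tot hq]; exact hasMFDerivAt_tot hk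
  have h0 := hk'.comp (φ.tot q) (hasMFDerivAt_inv hq)
  have h1 := ((HasMFDerivAt.comp (f := k ∘ φ.inv) (g := φ.tot) (φ.tot q) ht' h0).congr_of_eventuallyEq
    hg).mfderiv
  have hgq : g (φ.tot q) = φ.tot (k q) := 
    hg.self_of_nhds.trans (congrArg (fun z => φ.tot (k z)) (inv_tot hq))
  have i1 : (φ.dtot q : EB × F →L[ℝ] EB × F).IsInvertible := isInvertible_dtot hq
  have i2 : (φ.dtot (k q) : EB × F →L[ℝ] EB × F).IsInvertible := isInvertible_dtot hk
  set A : EB × F →L[ℝ] EB × F := φ.dtot q with hA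
  set A' : EB × F →L[ℝ] EB × F := φ.dtot (k q) with hA'
  set L := fderiv ℝ k q with hL
  set m : EB × F →L[ℝ] EB × F := A' ∘L L ∘L A.inverse with hm
  -- Tensors at `g (φ.tot q)` and at `φ.tot (k q)` have different types; after generalizing the
  -- point, both are read in the common model space.
  have key : ∀ p', g (φ.tot q) = p' → ∀ α : EB × F →L[ℝ] ℝ,
      (show EB × F from pullback (I := 𝓘(ℝ, EB).prod 𝓘(ℝ, F)) g Q (φ.tot q) α) =
      m.inverse (show EB × F from Q p' (show EB × F →L[ℝ] ℝ from α ∘L m.inverse)) := by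
    rintro _ rfl α
    have h2 : mfderiv (𝓘(ℝ, EB).prod 𝓘(ℝ, F)) (𝓘(ℝ, EB).prod 𝓘(ℝ, F)) g (φ.tot q) = m := h1
    unfold pullback
    rw [h2]
    rfl
  refine ContinuousLinearMap.ext fun α => ?_
  refine (key _ hgq α).trans ?_
  have h3 := hT' (show EB × F →L[ℝ] ℝ from (show EB × F →L[ℝ] ℝ from α) ∘L m.inverse)
  refine (congrArg m.inverse h3).trans ?_
  refine Eq.trans ?_ (hT α).symm
  exact inverse_conj_apply (V := EB × F) i1 i2 hki h α

end BundleFrame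

/-- Moser's flow near a point of the leaf. -/
theorem BundleFrame.IsGaugeFrame.exists_moserFlow (hG : φ.IsGaugeFrame Ω Λ D R Dflat Λ₀ μ) {b : B}
    (hb : b ∈ φ.img) :
    ∃ (Fl : ℝ → TotalSpace F E → TotalSpace F E) (N : Set (TotalSpace F E)),
      IsOpen N ∧ (⟨b, 0⟩ : TotalSpace F E) ∈ N ∧
      ContMDiffOn (𝓘(ℝ, ℝ).prod (𝓘(ℝ, EB).prod 𝓘(ℝ, F))) (𝓘(ℝ, EB).prod 𝓘(ℝ, F)) ∞
        (fun q : ℝ × TotalSpace F E => Fl q.1 q.2) (Icc 0 1 ×ˢ N) ∧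
      (∀ p ∈ N, IsMoserCurve Ω Λ D R Dflat (fun t => Fl t p)) ∧ (∀ p ∈ N, Fl 0 p = p) ∧
      (∀ p ∈ N, IsLocalDiffeomorphAt (𝓘(ℝ, EB).prod 𝓘(ℝ, F)) (𝓘(ℝ, EB).prod 𝓘(ℝ, F)) ∞ (Fl 1) p) ∧
      ∀ p ∈ N, pullback (Fl 1) (flatModel Ω Λ Dflat) p = linearizedTensor Ω Λ D R p := by
  set S := fun ξ => -(φ.locForm ξ (Ω (φ.base ξ))).inverse with hS
  have hO : IsOpen (φ.target ∩ moserDomain Ω Λ D R Dflat) := isOpen_iff_mem_nhds.2 fun p hp =>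
    Filter.inter_mem (isOpen_target.mem_nhds hp.1) (hG.moserDomain_mem_nhds hp.1 hp.2)
  -- Confining the local flow to this set ensures that its image stays in the frame and in the
  -- domain where the coupling forms are nondegenerate for all times.
  have hW : IsOpen (φ.source ∩ φ.tot ⁻¹' (φ.target ∩ moserDomain Ω Λ D R Dflat)) :=
    φ.contMDiffOn_tot.continuousOn.isOpen_inter_preimage isOpen_source hO
  have hinv0 : φ.inv (⟨b, 0⟩ : TotalSpace F E) = (φ.chart b, 0) := by simp [inv]
  have hb' : (⟨b, 0⟩ : TotalSpace F E) ∈ φ.target := hb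
  have hW1 : ((φ.chart b, 0) : EB × F) ∈
      φ.source ∩ φ.tot ⁻¹' (φ.target ∩ moserDomain Ω Λ D R Dflat) := by
    rw [← hinv0]
    refine ⟨inv_mem hb', ?_⟩
    rw [mem_preimage, tot_inv hb']
    exact ⟨hb', hG.zero_mem_moserDomain hb⟩
  obtain ⟨Φ, Θ, N₀, hΦ, hΘ, hΘΦ, hΦΘ, hΦ0, hN₀, hN₀b, hflow, hpull⟩ :=
    hG.model.exists_flow (φ.chart_mem b hb) hW hW1
  have hN : IsOpen (φ.target ∩ φ.inv ⁻¹' N₀) :=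
    φ.contMDiffOn_inv.continuousOn.isOpen_inter_preimage isOpen_target hN₀
  have hΦ1 : ContDiff ℝ ∞ (Φ 1) := hΦ.comp (contDiff_const.prodMk contDiff_id)
  refine ⟨fun t p => φ.tot (Φ t (φ.inv p)), φ.target ∩ φ.inv ⁻¹' N₀, hN, ⟨hb', ?_⟩, ?_, ?_, ?_, ?_, ?_⟩
  · rw [mem_preimage, hinv0]; exact hN₀b
  · have h1 : ContMDiffOn (𝓘(ℝ, ℝ).prod (𝓘(ℝ, EB).prod 𝓘(ℝ, F))) 𝓘(ℝ, ℝ × EB × F) ∞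
        (fun q : ℝ × TotalSpace F E => (q.1, φ.inv q.2)) (Icc 0 1 ×ˢ (φ.target ∩ φ.inv ⁻¹' N₀)) :=
      contMDiffOn_fst.prodMk_space (φ.contMDiffOn_inv.comp contMDiffOn_snd fun q hq => hq.2.1)
    exact φ.contMDiffOn_tot.comp (hΦ.contMDiff.comp_contMDiffOn h1)
      fun q hq => (hflow _ hq.2.2 _ hq.1).2.1.1
  · intro p hp t ht
    obtain ⟨-, hw, hd⟩ := hflow _ hp.2 t ht
    refine ⟨hw.2.2, ?_⟩
    have h1 : HasMFDerivAt 𝓘(ℝ, ℝ) 𝓘(ℝ, EB × F) (fun s => Φ s (φ.inv p)) t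
        ((1 : ℝ →L[ℝ] ℝ).smulRight (localField S Λ₀ μ (t, Φ t (φ.inv p)))) :=
      hd.hasFDerivAt.hasMFDerivAt
    have h2 := ((hasMFDerivAt_tot hw.1).comp t h1).hasMFDerivWithinAt (s := Icc 0 1)
    have h3 : φ.dtot (Φ t (φ.inv p)) ∘L
        ((1 : ℝ →L[ℝ] ℝ).smulRight (localField S Λ₀ μ (t, Φ t (φ.inv p)))) =
        (1 : ℝ →L[ℝ] ℝ).smulRight (moserField Ω Λ D R Dflat t (φ.tot (Φ t (φ.inv p)))) := by
      refine ContinuousLinearMap.ext fun r => ?_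
      have h4 := hG.moserField_tot (mem_source.1 hw.1) t (Φ t (φ.inv p)).2
      refine Eq.trans ?_ (congrArg (fun w => r • w) h4).symm
      exact map_smul (φ.dtot (Φ t (φ.inv p))) r _
    rw [← h3]
    exact h2
  · intro p hp
    change φ.tot (Φ 0 (φ.inv p)) = p
    rw [hΦ0, tot_inv hp.1]
  · intro p hp
    have hw := (hflow _ hp.2 1 (by simp)).2.1.1
    have h1 : IsLocalDiffeomorphAt 𝓘(ℝ, EB × F) 𝓘(ℝ, EB × F) ∞ (Φ 1) (φ.inv p) :=
      ⟨{ toFun := Φ 1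
         invFun := Θ
         source := univ
         target := univ
         map_source' := fun _ _ => trivial
         map_target' := fun _ _ => trivial
         left_inv' := fun q _ => hΘΦ q
         right_inv' := fun q _ => hΦΘ q
         open_source := isOpen_univ
         open_target := isOpen_univ
         contMDiffOn_toFun := hΦ1.contMDiff.contMDiffOn
         contMDiffOn_invFun := hΘ.contMDiff.contMDiffOn }, trivial, fun _ _ => rfl⟩
    have h2 := (isLocalDiffeomorphAt_inv hp.1).comp 𝓘(ℝ, EB × F) (EB × F) h1
    exact h2.comp (𝓘(ℝ, EB).prod 𝓘(ℝ, F)) (TotalSpace F E) (isLocalDiffeomorphAt_tot hw)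
  · intro p hp
    obtain ⟨⟨ξ, x⟩, hq, rfl⟩ : ∃ q ∈ φ.source, φ.tot q = p :=
      ⟨φ.inv p, inv_mem hp.1, tot_inv hp.1⟩
    have hqN : (ξ, x) ∈ N₀ := by have := hp.2; rwa [mem_preimage, inv_tot hq] at this
    have hw := (hflow _ hqN 1 (by simp)).2.1.1
    have hi : (fderiv ℝ (Φ 1) (ξ, x)).IsInvertible := by
      have e1 := ((hΦ1.differentiable (by simp)) (ξ, x)).hasFDerivAt
      have e2 := ((hΘ.differentiable (by simp)) (Φ 1 (ξ, x))).hasFDerivAt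
      have e3 := (e2.comp (ξ, x) e1).unique
        ((hasFDerivAt_id (ξ, x)).congr_of_eventuallyEq (Filter.Eventually.of_forall hΘΦ))
      have e2' : HasFDerivAt (Φ 1) (fderiv ℝ (Φ 1) (ξ, x)) (Θ (Φ 1 (ξ, x))) := by
        rw [hΘΦ]; exact e1
      have e4 := (e2'.comp (Φ 1 (ξ, x)) e2).unique
        ((hasFDerivAt_id (Φ 1 (ξ, x))).congr_of_eventuallyEq (Filter.Eventually.of_forall hΦΘ))
      exact IsInvertible.of_inverse e4 e3
    exact pullback_of_isLocal (k := Φ 1) hq hw (Filter.Eventually.of_forall fun p => rfl)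
      ((hΦ1.differentiable (by simp)) _) hi (hG.isLocal_linearizedTensor (mem_source.1 hq) x)
      (hG.isLocal_flatModel (mem_source.1 hw) (Φ 1 (ξ, x)).2) (hpull _ hqN)

end MoserFlow

/-! ### Gluing the local flows along the leaf. -/

section GlobalFlow

set_option maxSynthPendingDepth 3

open ContinuousLinearMap

variable {EB : Type*} [NormedAddCommGroup EB] [NormedSpace ℝ EB] [FiniteDimensional ℝ EB]
  {B : Type*} [TopologicalSpace B] [ChartedSpace EB B] [IsManifold 𝓘(ℝ, EB) ∞ B]
  {F : Type*} [NormedAddCommGroup F] [NormedSpace ℝ F] [FiniteDimensional ℝ F]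
  {E : B → Type*} [∀ b, AddCommGroup (E b)] [∀ b, Module ℝ (E b)]
  [∀ b, TopologicalSpace (E b)] [∀ b, IsTopologicalAddGroup (E b)]
  [∀ b, ContinuousSMul ℝ (E b)] [TopologicalSpace (TotalSpace F E)]
  [FiberBundle F E] [VectorBundle ℝ F E] [ContMDiffVectorBundle ∞ F E 𝓘(ℝ, EB)]
  {Ω : FormField₂ 𝓘(ℝ, EB) B} {Λ : LinearVertTensor E}
  {D Dflat : CovariantDerivative 𝓘(ℝ, EB) F E} {R : DualValuedForm EB E}

theorem isLocalDiffeomorphAt_congr {f g : TotalSpace F E → TotalSpace F E} {p : TotalSpace F E}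
    (hf : IsLocalDiffeomorphAt (𝓘(ℝ, EB).prod 𝓘(ℝ, F)) (𝓘(ℝ, EB).prod 𝓘(ℝ, F)) ∞ f p)
    (h : g =ᶠ[𝓝 p] f) :
    IsLocalDiffeomorphAt (𝓘(ℝ, EB).prod 𝓘(ℝ, F)) (𝓘(ℝ, EB).prod 𝓘(ℝ, F)) ∞ g p := by
  obtain ⟨Φ, hp, hΦ⟩ := hf
  obtain ⟨U, hUh, hU, hpU⟩ := eventually_nhds_iff.1 h
  exact ⟨{ toPartialEquiv := Φ.toPartialEquiv.restr U
           open_source := Φ.open_source.inter hU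
           open_target := Φ.contMDiffOn_invFun.continuousOn.isOpen_inter_preimage Φ.open_target hU
           contMDiffOn_toFun := Φ.contMDiffOn_toFun.mono inter_subset_left
           contMDiffOn_invFun := Φ.contMDiffOn_invFun.mono inter_subset_left },
    ⟨hp, hpU⟩, fun x hx => (hUh x hx.2).trans (hΦ hx.1)⟩

/-- If there are gauge frames at every point of the base, then the linearized tensor is isomorphic to
the flat model near the zero section. -/
theorem germIsomorphic_of_gaugeFrames [T2Space (TotalSpace F E)]
    (hG : ∀ b, ∃ (φ : BundleFrame EB F E) (Λ₀ : F →L[ℝ] (F →L[ℝ] ℝ) →L[ℝ] F)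
      (μ : EB → EB →L[ℝ] F →L[ℝ] ℝ), b ∈ φ.img ∧ φ.IsGaugeFrame Ω Λ D R Dflat Λ₀ μ) :
    GermIsomorphic (linearizedTensor Ω Λ D R) (flatModel Ω Λ Dflat) := by
  have hloc : ∀ b : B, ∃ (Fl : ℝ → TotalSpace F E → TotalSpace F E) (N : Set (TotalSpace F E)),
      IsOpen N ∧ (⟨b, 0⟩ : TotalSpace F E) ∈ N ∧
      ContMDiffOn (𝓘(ℝ, ℝ).prod (𝓘(ℝ, EB).prod 𝓘(ℝ, F))) (𝓘(ℝ, EB).prod 𝓘(ℝ, F)) ∞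
        (fun q : ℝ × TotalSpace F E => Fl q.1 q.2) (Icc 0 1 ×ˢ N) ∧
      (∀ p ∈ N, IsMoserCurve Ω Λ D R Dflat (fun t => Fl t p)) ∧ (∀ p ∈ N, Fl 0 p = p) ∧
      (∀ p ∈ N, IsLocalDiffeomorphAt (𝓘(ℝ, EB).prod 𝓘(ℝ, F)) (𝓘(ℝ, EB).prod 𝓘(ℝ, F)) ∞ (Fl 1) p) ∧
      ∀ p ∈ N, pullback (Fl 1) (flatModel Ω Λ Dflat) p = linearizedTensor Ω Λ D R p := by
    intro b
    obtain ⟨φ, Λ₀, μ, hb, hφ⟩ := hG b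
    exact hφ.exists_moserFlow hb
  choose Fl N hN hN0 hsm hcurve h0 hdiff hpull using hloc
  classical
  -- An arbitrary choice of a local flow at each point. Uniqueness of Moser curves makes the glued
  -- flow agree with every local flow on its domain, so the choice is immaterial on the union of the
  -- `N b`.
  set c : TotalSpace F E → B := fun p => if h : ∃ b, p ∈ N b then h.choose else p.proj with hc
  have hcN : ∀ b, ∀ p ∈ N b, p ∈ N (c p) := fun b p hp => by
    have h : ∃ b, p ∈ N b := ⟨b, hp⟩
    rw [hc]
    simp only [dif_pos h]
    exact h.choose_spec
  set G : ℝ → TotalSpace F E → TotalSpace F E := fun t p => Fl (c p) t p with hGdef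
  have hGeq : ∀ b, ∀ p ∈ N b, ∀ t ∈ Icc (0 : ℝ) 1, G t p = Fl b t p := fun b p hp t ht =>
    (hcurve (c p) p (hcN b p hp)).eqOn hG (hcurve b p hp) (t₀ := 0) (by simp)
      ((h0 _ p (hcN b p hp)).trans (h0 b p hp).symm) ht
  have hG1 : ∀ b, ∀ p ∈ N b, G 1 =ᶠ[𝓝 p] Fl b 1 := fun b p hp => by
    filter_upwards [(hN b).mem_nhds hp] with p' hp' using hGeq b p' hp' 1 (by simp)
  have hGc : ∀ p ∈ ⋃ b, N b, IsMoserCurve Ω Λ D R Dflat (fun t => G t p) := fun p hp => by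
    obtain ⟨b, hb⟩ := mem_iUnion.1 hp
    exact hcurve (c p) p (hcN b p hb)
  have hG0 : ∀ p ∈ ⋃ b, N b, G 0 p = p := fun p hp => by
    obtain ⟨b, hb⟩ := mem_iUnion.1 hp
    exact h0 (c p) p (hcN b p hb)
  refine ⟨⋃ b, N b, G 1, ⟨isOpen_iUnion hN, fun b => mem_iUnion.2 ⟨b, hN0 b⟩, ?_, ?_,
    moserDomain Ω Λ D R Dflat, moserField Ω Λ D R Dflat, G, ?_, ?_, ?_, ?_, ?_, ?_, ?_, hG0,
    fun _ _ => rfl⟩, ?_⟩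
  -- Injectivity: two integral curves that meet at time 1 coincide, and hence have the same initial
  -- point.
  · intro p hp p' hp' h
    have h1 := (hGc p hp).eqOn hG (hGc p' hp') (t₀ := 1) (by simp) h (show (0 : ℝ) ∈ Icc 0 1 by simp)
    exact (hG0 p hp).symm.trans (h1.trans (hG0 p' hp'))
  · rintro ⟨p, hp⟩
    obtain ⟨b, hb⟩ := mem_iUnion.1 hp
    exact isLocalDiffeomorphAt_congr (hdiff b p hb) (hG1 b p hb)
  · refine isOpen_iff_mem_nhds.2 fun p hp => ?_
    obtain ⟨φ, Λ₀, μ, hb, hφ⟩ := hG p.proj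
    exact hφ.moserDomain_mem_nhds hb hp
  · intro b
    obtain ⟨φ, Λ₀, μ, hb, hφ⟩ := hG b
    exact hφ.zero_mem_moserDomain hb
  · rintro ⟨t, p⟩ ⟨ht, hp⟩
    obtain ⟨φ, Λ₀, μ, hb, hφ⟩ := hG p.proj
    exact (hφ.contMDiffAt_moserField hb hp ht).contMDiffWithinAt
  · intro t _ b
    rw [moserField]
    simp
  · rintro ⟨t, p⟩ ⟨ht, hp⟩
    obtain ⟨b, hb⟩ := mem_iUnion.1 hp
    have h1 := hsm b (t, p) ⟨ht, hb⟩
    have h2 : Icc (0 : ℝ) 1 ×ˢ N b ∈ 𝓝[Icc (0 : ℝ) 1 ×ˢ ⋃ b, N b] (t, p) := by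
      rw [mem_nhdsWithin]
      exact ⟨univ ×ˢ N b, isOpen_univ.prod (hN b), ⟨trivial, hb⟩, fun z hz => ⟨hz.2.1, hz.1.2⟩⟩
    refine (h1.mono_of_mem_nhdsWithin h2).congr_of_eventuallyEq ?_ (hGeq b p hb t ht)
    filter_upwards [h2] with z hz using hGeq b z.2 hz.2 z.1 hz.1
  · exact fun t ht p hp => (hGc p hp t ht).1
  · exact fun p hp t ht => (hGc p hp t ht).2
  · intro p hp
    obtain ⟨b, hb⟩ := mem_iUnion.1 hp
    rw [← hpull b p hb]
    have h1 := (hG1 b p hb).self_of_nhds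
    have h2 : mfderiv (𝓘(ℝ, EB).prod 𝓘(ℝ, F)) (𝓘(ℝ, EB).prod 𝓘(ℝ, F)) (G 1) p =
      mfderiv (𝓘(ℝ, EB).prod 𝓘(ℝ, F)) (𝓘(ℝ, EB).prod 𝓘(ℝ, F)) (Fl b 1) p := (hG1 b p hb).mfderiv_eq
    unfold pullback
    rw [h2]
    have h3 : ∀ p', p' = Fl b 1 p → ∀ α : EB × F →L[ℝ] ℝ,
        (show EB × F from flatModel Ω Λ Dflat p' (show EB × F →L[ℝ] ℝ from α)) =
        (show EB × F from flatModel Ω Λ Dflat (Fl b 1 p) (show EB × F →L[ℝ] ℝ from α)) := by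
      rintro _ rfl α; rfl
    refine ContinuousLinearMap.ext fun α => ?_
    exact congrArg (mfderiv (𝓘(ℝ, EB).prod 𝓘(ℝ, F)) (𝓘(ℝ, EB).prod 𝓘(ℝ, F)) (Fl b 1) p).inverse
      (h3 _ h1 _)

end GlobalFlow

/-! ### Parallel curves of a flat connection. -/

section Holonomy

set_option maxSynthPendingDepth 3

open ContinuousLinearMap

variable {EB : Type*} [NormedAddCommGroup EB] [NormedSpace ℝ EB]
  {B : Type*} [TopologicalSpace B] [ChartedSpace EB B] [IsManifold 𝓘(ℝ, EB) ∞ B]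
  {F : Type*} [NormedAddCommGroup F] [NormedSpace ℝ F] [FiniteDimensional ℝ F]
  {E : B → Type*} [∀ b, AddCommGroup (E b)] [∀ b, Module ℝ (E b)]
  [∀ b, TopologicalSpace (E b)] [∀ b, IsTopologicalAddGroup (E b)]
  [∀ b, ContinuousSMul ℝ (E b)] [TopologicalSpace (TotalSpace F E)]
  [FiberBundle F E] [VectorBundle ℝ F E] [ContMDiffVectorBundle ∞ F E 𝓘(ℝ, EB)]
  {D : CovariantDerivative 𝓘(ℝ, EB) F E}

/-- The curve `c` is near `t` a curve with constant components in a parallel frame. -/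
def IsFlatAt (D : CovariantDerivative 𝓘(ℝ, EB) F E) (c : ℝ → TotalSpace F E) (t : ℝ) : Prop :=
  ∃ (φ : BundleFrame EB F E) (γ : ℝ → EB) (x : F), (∀ ξ ∈ φ.dom, φ.connForm D ξ = 0) ∧
    ContDiffAt ℝ ∞ γ t ∧ γ t ∈ φ.dom ∧ c =ᶠ[𝓝 t] fun s => φ.tot (γ s, x)

theorem IsFlatAt.congr {c c' : ℝ → TotalSpace F E} {t : ℝ} (h : IsFlatAt D c t)
    (hc : c' =ᶠ[𝓝 t] c) : IsFlatAt D c' t := by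
  obtain ⟨φ, γ, x, hφ, hγ, ht, hcγ⟩ := h
  exact ⟨φ, γ, x, hφ, hγ, ht, hc.trans hcγ⟩

theorem IsFlatAt.comp {c : ℝ → TotalSpace F E} {g : ℝ → ℝ} {t : ℝ} (h : IsFlatAt D c (g t))
    (hg : ContDiffAt ℝ ∞ g t) : IsFlatAt D (fun s => c (g s)) t := by
  obtain ⟨φ, γ, x, hφ, hγ, ht, hcγ⟩ := h
  exact ⟨φ, γ ∘ g, x, hφ, hγ.comp t hg, ht, hg.continuousAt.eventually hcγ⟩

theorem horLift_of_connForm_eq_zero {φ : BundleFrame EB F E} {ξ : EB} (hξ : ξ ∈ φ.dom)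
    (h : φ.connForm D ξ = 0) (x : F) (u : EB) :
    horLift D (φ.tot (ξ, x)) (φ.dbase ξ u) = φ.dtot (ξ, x) (u, 0) := by
  have : IsManifold 𝓘(ℝ, EB) 1 B := IsManifold.of_le (n := ∞) (by exact_mod_cast le_top)
  have : ContMDiffVectorBundle 1 F E 𝓘(ℝ, EB) :=
    ContMDiffVectorBundle.of_le (n := ∞) (by exact_mod_cast le_top)
  have h1 := BundleFrame.isConnForm_connForm D hξ x u
  rw [h] at h1
  simpa using! h1

theorem isHorizontalCurve_of_isFlatAt {c : ℝ → TotalSpace F E}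
    (h : ∀ t ∈ Icc (0 : ℝ) 1, IsFlatAt D c t) : IsHorizontalCurve D c := by
  constructor
  · intro t ht
    obtain ⟨φ, γ, x, hφ, hγ, hγt, hcγ⟩ := h t ht
    have h1 : ContMDiffAt 𝓘(ℝ, ℝ) 𝓘(ℝ, EB × F) ∞ (fun s => (γ s, x)) t :=
      (hγ.prodMk contDiffAt_const).contMDiffAt
    have h2 := (BundleFrame.contMDiffAt_tot (φ := φ) (q := (γ t, x))
      (BundleFrame.mem_source.2 hγt)).comp t h1
    exact (h2.congr_of_eventuallyEq hcγ).contMDiffWithinAt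
  · intro t ht
    obtain ⟨φ, γ, x, hφ, hγ, hγt, hcγ⟩ := h t ht
    have h1 : HasMFDerivAt 𝓘(ℝ, ℝ) 𝓘(ℝ, EB × F) (fun s => (γ s, x)) t
        ((fderiv ℝ γ t).prod (0 : ℝ →L[ℝ] F)) :=
      ((hγ.differentiableAt (by simp)).hasFDerivAt.prodMk (hasFDerivAt_const x t)).hasMFDerivAt
    have h2 : HasMFDerivAt 𝓘(ℝ, EB × F) (𝓘(ℝ, EB).prod 𝓘(ℝ, F)) φ.tot (γ t, x) (φ.dtot (γ t, x)) :=
      BundleFrame.hasMFDerivAt_tot (BundleFrame.mem_source.2 hγt)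
    have h3 := ((h2.comp t h1).congr_of_eventuallyEq hcγ).hasMFDerivWithinAt (s := Icc 0 1)
    have h4 := h3.mfderivWithin ((uniqueDiffOn_Icc zero_lt_one).uniqueMDiffOn t ht)
    set v : EB × F := mfderivWithin 𝓘(ℝ, ℝ) (𝓘(ℝ, EB).prod 𝓘(ℝ, F)) c (Icc 0 1) t (1 : ℝ) with hv
    have h5 : v = φ.dtot (γ t, x) (fderiv ℝ γ t 1, 0) := congrArg (fun L => L (1 : ℝ)) h4
    have h6 : ∀ p, p = φ.tot (γ t, x) →
        v = (show EB × F from horLift D p (dproj p (show TangentSpace _ p from v))) := by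
      rintro _ rfl
      rw [h5]
      have h7 := BundleFrame.dproj_dtot (φ := φ) (q := (γ t, x)) (BundleFrame.mem_source.2 hγt)
        (fderiv ℝ γ t 1, 0)
      exact (((congrArg (horLift D (φ.tot (γ t, x))) h7).trans
        (horLift_of_connForm_eq_zero hγt (hφ _ hγt) x _))).symm
    exact h6 _ hcγ.self_of_nhds

/-- The points `p` and `p'` are joined by a smooth parallel curve, constant near its ends. -/
def ParallelJoined (D : CovariantDerivative 𝓘(ℝ, EB) F E) (p p' : TotalSpace F E) : Prop :=
  ∃ (c : ℝ → TotalSpace F E) (ε : ℝ), 0 < ε ∧ (∀ t ≤ ε, c t = p) ∧ (∀ t, 1 - ε ≤ t → c t = p') ∧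
    ∀ t, IsFlatAt D c t

/-- Closing up the curve in the base, trivial holonomy identifies its two end points in the fibre.
-/
theorem ParallelJoined.eq (hD : HasTrivialHolonomy D) {p p' : TotalSpace F E}
    (h : ParallelJoined D p p') (hp : p.proj = p'.proj) : p = p' := by
  obtain ⟨c, ε, hε, h0, h1, hc⟩ := h
  have h2 := hD c (isHorizontalCurve_of_isFlatAt fun t _ => hc t)
  rw [h0 0 hε.le, h1 1 (by linarith)] at h2
  exact h2 hp

theorem ParallelJoined.symm {p p' : TotalSpace F E} (h : ParallelJoined D p p') :
    ParallelJoined D p' p := by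
  obtain ⟨c, ε, hε, h0, h1, hc⟩ := h
  refine ⟨fun t => c (1 - t), ε, hε, fun t ht => h1 _ (by linarith), fun t ht => h0 _ (by linarith),
    fun t => (hc (1 - t)).comp (g := fun s => 1 - s) (by fun_prop)⟩

/-- The curves are constant near their ends, so the concatenation at half time agrees with one of
the two rescaled curves near every time and remains smooth. -/
theorem ParallelJoined.trans {p p' p'' : TotalSpace F E} (h : ParallelJoined D p p')
    (h' : ParallelJoined D p' p'') : ParallelJoined D p p'' := by
  obtain ⟨c, ε, hε, h0, h1, hc⟩ := h
  obtain ⟨c', ε', hε', h0', h1', hc'⟩ := h'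
  set d : ℝ → TotalSpace F E := fun t => if t ≤ 1 / 2 then c (2 * t) else c' (2 * t - 1) with hd
  have hd1 : ∀ t, t < 1 / 2 + ε' / 2 → d t = c (2 * t) := fun t ht => by
    rw [hd]
    dsimp only
    split_ifs with h
    · rfl
    · rw [h0' _ (by linarith), h1 _ (by linarith)]
  have hd2 : ∀ t, 1 / 2 - ε / 2 < t → d t = c' (2 * t - 1) := fun t ht => by
    rw [hd]
    dsimp only
    split_ifs with h
    · rw [h0' _ (by linarith), h1 _ (by linarith)]
    · rfl
  refine ⟨d, min (ε / 2) (ε' / 2), by positivity, fun t ht => ?_, fun t ht => ?_, fun t => ?_⟩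
  · by_cases h : t < 1 / 2 + ε' / 2
    · rw [hd1 t h, h0 _ (by linarith [min_le_left (ε / 2) (ε' / 2)])]
    · exfalso; linarith [min_le_right (ε / 2) (ε' / 2)]
  · by_cases h : 1 / 2 - ε / 2 < t
    · rw [hd2 t h, h1' _ (by linarith [min_le_right (ε / 2) (ε' / 2)])]
    · exfalso; linarith [min_le_left (ε / 2) (ε' / 2)]
  · by_cases h : t < 1 / 2 + ε' / 2
    · refine ((hc (2 * t)).comp (g := fun s => 2 * s) (by fun_prop)).congr ?_
      filter_upwards [Iio_mem_nhds h] with s hs using hd1 s hs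
    · have h' : 1 / 2 - ε / 2 < t := by linarith
      refine ((hc' (2 * t - 1)).comp (g := fun s => 2 * s - 1) (by fun_prop)).congr ?_
      filter_upwards [Ioi_mem_nhds h'] with s hs using hd2 s hs

/-- Constant components over a segment in the convex domain. The parameter is a smooth transition
that is constant up to 1/4 and from 3/4 on. -/
theorem parallelJoined_tot {φ : BundleFrame EB F E} (hconv : Convex ℝ φ.dom)
    (hφ : ∀ ξ ∈ φ.dom, φ.connForm D ξ = 0) {ξ ξ' : EB} (hξ : ξ ∈ φ.dom) (hξ' : ξ' ∈ φ.dom) (x : F) :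
    ParallelJoined D (φ.tot (ξ, x)) (φ.tot (ξ', x)) := by
  set s : ℝ → ℝ := fun t => Real.smoothTransition (2 * t - 1 / 2) with hs
  have hs0 : ∀ t ≤ 1 / 4, s t = 0 := fun t ht =>
    Real.smoothTransition.zero_of_nonpos (by linarith)
  have hs1 : ∀ t, 1 - 1 / 4 ≤ t → s t = 1 := fun t ht =>
    Real.smoothTransition.one_of_one_le (by linarith)
  have hsd : ContDiff ℝ ∞ s := (Real.smoothTransition.contDiff (n := ⊤)).comp (by fun_prop)
  set γ : ℝ → EB := fun t => ξ + s t • (ξ' - ξ) with hγ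
  refine ⟨fun t => φ.tot (γ t, x), 1 / 4, by norm_num, fun t ht => ?_, fun t ht => ?_, fun t => ?_⟩
  · simp [hγ, hs0 t ht]
  · simp [hγ, hs1 t ht]
  · refine ⟨φ, γ, x, hφ, ?_, hconv.add_smul_sub_mem hξ hξ' ⟨Real.smoothTransition.nonneg _,
      Real.smoothTransition.le_one _⟩, Filter.EventuallyEq.rfl⟩
    exact (contDiff_const.add (hsd.smul contDiff_const)).contDiffAt

end Holonomy

/-! ### The global parallel frame when the holonomy is trivial. -/

section ParallelTrivialization

set_option maxSynthPendingDepth 3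

open ContinuousLinearMap

variable {EB : Type*} [NormedAddCommGroup EB] [NormedSpace ℝ EB]
  {B : Type*} [TopologicalSpace B] [ChartedSpace EB B] [IsManifold 𝓘(ℝ, EB) ∞ B]
  {F : Type*} [NormedAddCommGroup F] [NormedSpace ℝ F] [FiniteDimensional ℝ F]
  {E : B → Type*} [∀ b, AddCommGroup (E b)] [∀ b, Module ℝ (E b)]
  [∀ b, TopologicalSpace (E b)] [∀ b, IsTopologicalAddGroup (E b)]
  [∀ b, ContinuousSMul ℝ (E b)] [TopologicalSpace (TotalSpace F E)]
  [FiberBundle F E] [VectorBundle ℝ F E] [ContMDiffVectorBundle ∞ F E 𝓘(ℝ, EB)]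
  {Ω : FormField₂ 𝓘(ℝ, EB) B} {Λ : LinearVertTensor E}
  {D Dflat : CovariantDerivative 𝓘(ℝ, EB) F E} {R : DualValuedForm EB E}

/-- The identification of a fibre with the model given by a frame. -/
def BundleFrame.fibEquiv (φ : BundleFrame EB F E) {b : B} (hb : b ∈ φ.img) : F ≃L[ℝ] E b :=
  ContinuousLinearEquiv.equivOfInverse (φ.fib b) (φ.coord b) (φ.coord_fib b hb) (φ.fib_coord b hb)

/-- If the holonomy of a flat Lie–Poisson connection is trivial, then the bundle has a parallel
trivialization, which has constant components in the gauge frames. -/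
theorem exists_parallel_trivialization [ConnectedSpace B]
    (hG : ∀ b, ∃ (φ : BundleFrame EB F E) (Λ₀ : F →L[ℝ] (F →L[ℝ] ℝ) →L[ℝ] F)
      (μ : EB → EB →L[ℝ] F →L[ℝ] ℝ),
      b ∈ φ.img ∧ Convex ℝ φ.dom ∧ φ.IsGaugeFrame Ω Λ D R Dflat Λ₀ μ)
    (hD : HasTrivialHolonomy Dflat) (b₀ : B) :
    ∃ (S : ∀ b, F ≃L[ℝ] E b) (Λ₁ : F →L[ℝ] (F →L[ℝ] ℝ) →L[ℝ] F),
      (∀ b x γ, Λ b (S b x) γ = S b (Λ₁ x (γ ∘L (S b : F →L[ℝ] E b)))) ∧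
      ∀ b, ∃ (φ : BundleFrame EB F E) (Λ₀ : F →L[ℝ] (F →L[ℝ] ℝ) →L[ℝ] F)
        (μ : EB → EB →L[ℝ] F →L[ℝ] ℝ) (K : F ≃L[ℝ] F), b ∈ φ.img ∧
        φ.IsGaugeFrame Ω Λ D R Dflat Λ₀ μ ∧
        ∀ ξ ∈ φ.dom, ∀ x, S (φ.base ξ) x = φ.fib (φ.base ξ) (K x) := by
  obtain ⟨φ₀, Λ₁, μ₀, hb₀, -, hφ₀⟩ := hG b₀
  set S₀ := φ₀.fibEquiv hb₀ with hS₀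
  -- The points to which the chosen frame at `b₀` can be transported in parallel, carrying `Λ₁` to
  -- `Λ`. Convex parallel frames show that this set is open and closed.
  set A : Set B := {b | ∃ S : F ≃L[ℝ] E b,
    (∀ x, ParallelJoined Dflat ⟨b₀, S₀ x⟩ ⟨b, S x⟩) ∧
    ∀ x γ, Λ b (S x) γ = S (Λ₁ x (γ ∘L (S : F →L[ℝ] E b)))} with hA
  have key : ∀ b, ∃ V ∈ 𝓝 b, ∀ b₁ ∈ V, ∀ b₂ ∈ V, b₁ ∈ A → b₂ ∈ A := by
    intro b
    obtain ⟨φ, Λ₀, μ, hb, hconv, hφ⟩ := hG b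
    refine ⟨φ.img, φ.isOpen_img.mem_nhds hb, fun b₁ h₁ b₂ h₂ => ?_⟩
    obtain ⟨ξ₁, hξ₁, rfl⟩ : ∃ η ∈ φ.dom, φ.base η = b₁ :=
      ⟨φ.chart b₁, φ.chart_mem b₁ h₁, φ.base_chart b₁ h₁⟩
    obtain ⟨ξ₂, hξ₂, rfl⟩ : ∃ η ∈ φ.dom, φ.base η = b₂ :=
      ⟨φ.chart b₂, φ.chart_mem b₂ h₂, φ.base_chart b₂ h₂⟩
    rintro ⟨S, hS, hSΛ⟩
    refine ⟨(S.trans (φ.fibEquiv h₁).symm).trans (φ.fibEquiv h₂), fun x => ?_, fun x γ => ?_⟩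
    · have h := parallelJoined_tot hconv hφ.flat hξ₁ hξ₂ (φ.coord (φ.base ξ₁) (S x))
      have h1 : φ.tot (ξ₁, φ.coord (φ.base ξ₁) (S x)) = ⟨φ.base ξ₁, S x⟩ := by
        rw [BundleFrame.tot]
        simp only [φ.fib_coord _ h₁]
      rw [h1] at h
      exact (hS x).trans h
    · change Λ (φ.base ξ₂) (φ.fib (φ.base ξ₂) (φ.coord (φ.base ξ₁) (S x))) γ =
        φ.fib (φ.base ξ₂) (φ.coord (φ.base ξ₁) (S (Λ₁ x _)))
      rw [hφ.vert_fib hξ₂]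
      have h1 := hφ.vert_fib hξ₁ (φ.coord (φ.base ξ₁) (S x))
        ((γ ∘L φ.fib (φ.base ξ₂)) ∘L φ.coord (φ.base ξ₁))
      rw [φ.fib_coord _ h₁, hSΛ] at h1
      have h2 := congrArg (φ.coord (φ.base ξ₁)) h1
      rw [φ.coord_fib _ h₁] at h2
      have h3 : ((γ ∘L φ.fib (φ.base ξ₂)) ∘L φ.coord (φ.base ξ₁)) ∘L φ.fib (φ.base ξ₁) =
          γ ∘L φ.fib (φ.base ξ₂) := by
        ext y
        simp [φ.coord_fib _ h₁]
      rw [h3] at h2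
      rw [← h2]
      rfl
  have hb₀A : b₀ ∈ A := by
    obtain ⟨ξ, hξ, rfl⟩ : ∃ η ∈ φ₀.dom, φ₀.base η = b₀ :=
      ⟨φ₀.chart b₀, φ₀.chart_mem b₀ hb₀, φ₀.base_chart b₀ hb₀⟩
    refine ⟨S₀, fun x => ?_, fun x γ => hφ₀.vert_fib hξ x γ⟩
    exact ⟨fun _ => φ₀.tot (ξ, x), 1, one_pos, fun _ _ => rfl, fun _ _ => rfl,
      fun t => ⟨φ₀, fun _ => ξ, x, hφ₀.flat, contDiffAt_const, hξ, Filter.EventuallyEq.rfl⟩⟩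
  have hcl : IsClopen A := by
    constructor
    · rw [← isOpen_compl_iff, isOpen_iff_mem_nhds]
      intro b hb
      obtain ⟨V, hV, h⟩ := key b
      exact Filter.mem_of_superset hV fun b' hb' hA' => hb (h b' hb' b (mem_of_mem_nhds hV) hA')
    · rw [isOpen_iff_mem_nhds]
      intro b hb
      obtain ⟨V, hV, h⟩ := key b
      exact Filter.mem_of_superset hV fun b' hb' => h b (mem_of_mem_nhds hV) b' hb' hb
  have hall : ∀ b, b ∈ A := fun b => by rw [hcl.eq_univ ⟨b₀, hb₀A⟩]; exact mem_univ b
  choose S hS hSΛ using hall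
  refine ⟨S, Λ₁, hSΛ, fun b => ?_⟩
  obtain ⟨φ, Λ₀, μ, hb, hconv, hφ⟩ := hG b
  refine ⟨φ, Λ₀, μ, (S b).trans (φ.fibEquiv hb).symm, hb, hφ, fun ξ hξ x => ?_⟩
  obtain ⟨ξ₁, hξ₁, rfl⟩ : ∃ η ∈ φ.dom, φ.base η = b := ⟨φ.chart b, φ.chart_mem b hb, φ.base_chart b hb⟩
  have h := parallelJoined_tot hconv hφ.flat hξ₁ hξ (φ.coord (φ.base ξ₁) (S (φ.base ξ₁) x))
  have h1 : φ.tot (ξ₁, φ.coord (φ.base ξ₁) (S (φ.base ξ₁) x)) = ⟨φ.base ξ₁, S (φ.base ξ₁) x⟩ := by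
    rw [BundleFrame.tot]
    simp only [φ.fib_coord _ hb]
  rw [h1] at h
  -- Two parallel transports from `b₀` to the same fibre agree, so in a gauge frame the chosen
  -- isomorphisms have the constant component `K`. Smoothness of the global frame will follow from
  -- this.
  have h2 := (((hS (φ.base ξ) x).symm.trans (hS (φ.base ξ₁) x)).trans h).eq hD rfl
  have h3 : ∀ y y' : E (φ.base ξ), (⟨φ.base ξ, y⟩ : TotalSpace F E) = ⟨φ.base ξ, y'⟩ → y = y' := by
    intro y y' h
    simpa using h
  exact h3 _ _ h2

end ParallelTrivialization

/-! ### Identification of the model fibre with the dual of the Lie algebra. -/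

section LiePoissonTrivialization

set_option maxSynthPendingDepth 3

open ContinuousLinearMap

variable {F : Type*} [NormedAddCommGroup F] [NormedSpace ℝ F] [FiniteDimensional ℝ F]
  {𝔤 : Type*} [LieRing 𝔤] [LieAlgebra ℝ 𝔤] [FiniteDimensional ℝ 𝔤]
  {G : Type*} [NormedAddCommGroup G] [NormedSpace ℝ G] [FiniteDimensional ℝ G]

/-- The transpose of a linear isomorphism. -/
def transposeEquiv {W : Type*} [AddCommGroup W] [Module ℝ W] [TopologicalSpace W]
    [IsTopologicalAddGroup W] [ContinuousSMul ℝ W] (S : F ≃L[ℝ] W) :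
    (W →L[ℝ] ℝ) ≃ₗ[ℝ] (F →L[ℝ] ℝ) where
  toFun a := a ∘L (S : F →L[ℝ] W)
  invFun a := a ∘L (S.symm : W →L[ℝ] F)
  map_add' _ _ := rfl
  map_smul' _ _ := rfl
  left_inv a := by ext y; simp
  right_inv a := by ext y; simp

/-- Replaces the biduality isomorphism in the definition by any element `a` that represents the
covector. -/
theorem liePoissonMap_apply (κ : G ≃ₗ[ℝ] Module.Dual ℝ 𝔤) (g : G) (β : G →L[ℝ] ℝ) {a : 𝔤}
    (ha : ∀ g', β g' = κ g' a) (y : 𝔤) : κ (liePoissonMap κ g β) y = κ g ⁅a, y⁆ := by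
  have h1 : (Module.evalEquiv ℝ 𝔤).symm ((κ.symm : Module.Dual ℝ 𝔤 →ₗ[ℝ] G).dualMap
      (ContinuousLinearMap.coeLM ℝ β)) = a := by
    rw [LinearEquiv.symm_apply_eq]
    ext f
    simp [ha]
  change κ (κ.symm (LinearMap.llcomp ℝ 𝔤 𝔤 ℝ (κ g) (LieAlgebra.ad ℝ 𝔤 ((Module.evalEquiv ℝ 𝔤).symm
    ((κ.symm : Module.Dual ℝ 𝔤 →ₗ[ℝ] G).dualMap (ContinuousLinearMap.coeLM ℝ β)))))) y = _
  rw [h1, LinearEquiv.apply_symm_apply]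
  rfl

/-- A linear isomorphism of a space with the dual of a Lie algebra, from one of the Lie algebra with
the dual of the space. -/
theorem exists_dual_equiv (e : 𝔤 ≃ₗ[ℝ] (F →L[ℝ] ℝ)) (κ : G ≃ₗ[ℝ] Module.Dual ℝ 𝔤) :
    ∃ J : F ≃L[ℝ] G, ∀ x a, κ (J x) a = e a x := by
  set j : F →ₗ[ℝ] Module.Dual ℝ 𝔤 := ((ContinuousLinearMap.coeLM ℝ).comp (e : 𝔤 →ₗ[ℝ] F →L[ℝ] ℝ)).flip
    with hj
  have hinj : Function.Injective j := by
    rw [injective_iff_map_eq_zero]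
    intro x hx
    by_contra hne
    obtain ⟨f, -, hf⟩ := exists_dual_vector ℝ x (norm_ne_zero_iff.2 hne)
    have h1 := congrArg (fun l => l (e.symm f)) hx
    have h2 : f x = 0 := by simpa [hj] using h1
    rw [h2] at hf
    exact hne (norm_eq_zero.1 (by simpa using hf.symm))
  have hdim : Module.finrank ℝ F = Module.finrank ℝ (Module.Dual ℝ 𝔤) := by
    rw [Subspace.dual_finrank_eq, e.finrank_eq,
      ← (LinearMap.toContinuousLinearMap (𝕜 := ℝ) (E := F) (F' := ℝ)).finrank_eq]
    exact (Subspace.dual_finrank_eq (K := ℝ) (V := F)).symm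
  refine ⟨((LinearEquiv.ofInjectiveOfFinrankEq j hinj hdim).trans κ.symm).toContinuousLinearEquiv,
    fun x a => ?_⟩
  change κ (κ.symm (j x)) a = _
  rw [LinearEquiv.apply_symm_apply]
  rfl

/-- An isomorphism of linear Poisson structures. -/
theorem liePoissonMap_eq {Λ₁ : F →L[ℝ] (F →L[ℝ] ℝ) →L[ℝ] F} {e : 𝔤 ≃ₗ[ℝ] (F →L[ℝ] ℝ)}
    (he : IsLieIso e Λ₁) (κ : G ≃ₗ[ℝ] Module.Dual ℝ 𝔤) {J : F ≃L[ℝ] G}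
    (hJ : ∀ x a, κ (J x) a = e a x) (x : F) (β : G →L[ℝ] ℝ) :
    liePoissonMap κ (J x) β = J (Λ₁ x (β ∘L (J : F →L[ℝ] G))) := by
  apply κ.injective
  ext y
  set a := e.symm (β ∘L (J : F →L[ℝ] G)) with ha
  have h1 : e a = β ∘L (J : F →L[ℝ] G) := e.apply_symm_apply _
  rw [liePoissonMap_apply κ (J x) β (a := a), hJ, hJ, he, h1]
  intro g
  obtain ⟨x', rfl⟩ := J.surjective g
  rw [hJ, h1]
  rfl

end LiePoissonTrivialization

/-! ### The flat model as a product of Poisson structures. -/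

section GlobalTrivialization

set_option maxSynthPendingDepth 3

open ContinuousLinearMap

variable {EB : Type*} [NormedAddCommGroup EB] [NormedSpace ℝ EB]
  {B : Type*} [TopologicalSpace B] [ChartedSpace EB B] [IsManifold 𝓘(ℝ, EB) ∞ B]
  {F : Type*} [NormedAddCommGroup F] [NormedSpace ℝ F] [FiniteDimensional ℝ F]
  {E : B → Type*} [∀ b, AddCommGroup (E b)] [∀ b, Module ℝ (E b)]
  [∀ b, TopologicalSpace (E b)] [∀ b, IsTopologicalAddGroup (E b)]
  [∀ b, ContinuousSMul ℝ (E b)] [TopologicalSpace (TotalSpace F E)]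
  [FiberBundle F E] [VectorBundle ℝ F E] [ContMDiffVectorBundle ∞ F E 𝓘(ℝ, EB)]
  {G : Type*} [NormedAddCommGroup G] [NormedSpace ℝ G]

/-- A global frame which has constant components in local frames trivializes the bundle. -/
theorem exists_diffeomorph_of_global_frame (S : ∀ b, F ≃L[ℝ] E b) (J : F ≃L[ℝ] G)
    (h : ∀ b, ∃ (φ : BundleFrame EB F E) (K : F ≃L[ℝ] F), b ∈ φ.img ∧
      ∀ ξ ∈ φ.dom, ∀ x, S (φ.base ξ) x = φ.fib (φ.base ξ) (K x)) :
    ∃ τ : Diffeomorph (𝓘(ℝ, EB).prod 𝓘(ℝ, F)) (𝓘(ℝ, EB).prod 𝓘(ℝ, G))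
        (TotalSpace F E) (B × G) ∞,
      ∀ p, τ p = (p.proj, J ((S p.proj).symm p.2)) := by
  have h' : ∀ b, ∃ (φ : BundleFrame EB F E) (K : F ≃L[ℝ] F), b ∈ φ.img ∧
      ∀ b ∈ φ.img, ∀ x, S b x = φ.fib b (K x) := by
    intro b
    obtain ⟨φ, K, hb, hK⟩ := h b
    refine ⟨φ, K, hb, fun b' hb' x => ?_⟩
    obtain ⟨ξ, hξ, rfl⟩ : ∃ η ∈ φ.dom, φ.base η = b' :=
      ⟨φ.chart b', φ.chart_mem b' hb', φ.base_chart b' hb'⟩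
    exact hK ξ hξ x
  refine ⟨{ toFun := fun p => (p.proj, J ((S p.proj).symm p.2))
            invFun := fun q => ⟨q.1, S q.1 (J.symm q.2)⟩
            left_inv := fun p => by simp
            right_inv := fun q => by simp
            contMDiff_toFun := fun p => ?_
            contMDiff_invFun := fun q => ?_ }, fun p => rfl⟩
  · obtain ⟨φ, K, hb, hK⟩ := h' p.proj
    have h1 : ContMDiffAt (𝓘(ℝ, EB).prod 𝓘(ℝ, F)) 𝓘(ℝ, G) ∞
        (fun p : TotalSpace F E => J (K.symm (φ.inv p).2)) p := by
      have h2 : ContMDiff 𝓘(ℝ, EB × F) 𝓘(ℝ, G) ∞ (fun z : EB × F => J (K.symm z.2)) :=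
        (J.contDiff.comp (K.symm.contDiff.comp contDiff_snd)).contMDiff
      exact h2.contMDiffAt.comp p (BundleFrame.contMDiffAt_inv hb)
    refine ((Bundle.contMDiff_proj E).contMDiffAt.prodMk h1).congr_of_eventuallyEq ?_
    filter_upwards [φ.isOpen_target.mem_nhds hb] with p' hp'
    refine Prod.ext rfl (congrArg J ?_)
    rw [ContinuousLinearEquiv.symm_apply_eq, hK _ hp', K.apply_symm_apply]
    exact (φ.fib_coord _ hp' _).symm
  · obtain ⟨φ, K, hb, hK⟩ := h' q.1
    have h1 : ContMDiffAt (𝓘(ℝ, EB).prod 𝓘(ℝ, G)) 𝓘(ℝ, EB) ∞ (fun q : B × G => φ.chart q.1) q :=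
      (BundleFrame.contMDiffAt_chart hb).comp q contMDiffAt_fst
    have h2 : ContMDiffAt (𝓘(ℝ, EB).prod 𝓘(ℝ, G)) 𝓘(ℝ, F) ∞
        (fun q : B × G => K (J.symm q.2)) q := by
      have h3 : ContMDiff 𝓘(ℝ, G) 𝓘(ℝ, F) ∞ (fun g : G => K (J.symm g)) :=
        (K.contDiff.comp J.symm.contDiff).contMDiff
      exact h3.contMDiffAt.comp q contMDiffAt_snd
    have h4 := (BundleFrame.contMDiffAt_tot (φ := φ) (q := (φ.chart q.1, K (J.symm q.2)))
      (BundleFrame.mem_source.2 (φ.chart_mem _ hb))).comp q (h1.prodMk_space h2)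
    refine h4.congr_of_eventuallyEq ?_
    filter_upwards [(φ.isOpen_img.preimage continuous_fst).mem_nhds (show q ∈ Prod.fst ⁻¹' φ.img from hb)]
      with q' hq'
    change (⟨q'.1, S q'.1 (J.symm q'.2)⟩ : TotalSpace F E) = φ.tot (φ.chart q'.1, K (J.symm q'.2))
    rw [hK _ hq']
    have h5 : ∀ b', b' = q'.1 → (⟨q'.1, φ.fib q'.1 (K (J.symm q'.2))⟩ : TotalSpace F E) =
        ⟨b', φ.fib b' (K (J.symm q'.2))⟩ := by
      rintro _ rfl; rfl
    exact h5 _ (φ.base_chart _ hq')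

theorem prodTensor_apply (P : TensorField₂ 𝓘(ℝ, EB) B) (Q : TensorField₂ 𝓘(ℝ, G) G) (b : B) (g : G)
    (β : EB × G →L[ℝ] ℝ) :
    (show EB × G from prodTensor P Q (b, g) β) =
      ((show EB from P b (show EB →L[ℝ] ℝ from β ∘L inl ℝ EB G)),
        (show G from Q g (show G →L[ℝ] ℝ from β ∘L inr ℝ EB G))) := by
  have h1 : (mfderiv 𝓘(ℝ, EB) (𝓘(ℝ, EB).prod 𝓘(ℝ, G)) (fun x : B => (x, g)) b : EB →L[ℝ] EB × G) =
    inl ℝ EB G := mfderiv_prod_left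
  have h2 : (mfderiv 𝓘(ℝ, G) (𝓘(ℝ, EB).prod 𝓘(ℝ, G)) (fun y : G => (b, y)) g : G →L[ℝ] EB × G) =
    inr ℝ EB G := mfderiv_prod_right
  set m₁ : EB →L[ℝ] EB × G :=
    mfderiv 𝓘(ℝ, EB) (𝓘(ℝ, EB).prod 𝓘(ℝ, G)) (fun x : B => (x, g)) b with hm₁
  set m₂ : G →L[ℝ] EB × G :=
    mfderiv 𝓘(ℝ, G) (𝓘(ℝ, EB).prod 𝓘(ℝ, G)) (fun y : G => (b, y)) g with hm₂
  have h3 : (show EB × G from prodTensor P Q (b, g) β) =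
      m₁ (show EB from P b (show EB →L[ℝ] ℝ from β ∘L m₁)) +
      m₂ (show G from Q g (show G →L[ℝ] ℝ from β ∘L m₂)) := rfl
  rw [h3, h1, h2]
  exact Prod.ext (add_zero (M := EB) _) (zero_add (M := G) _)

variable {𝔤 : Type*} [LieRing 𝔤] [LieAlgebra ℝ 𝔤] [FiniteDimensional ℝ 𝔤] [FiniteDimensional ℝ G]
  {Ω : FormField₂ 𝓘(ℝ, EB) B} {Λ : LinearVertTensor E}
  {D Dflat : CovariantDerivative 𝓘(ℝ, EB) F E} {R : DualValuedForm EB E}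

/-- In a trivialization by a parallel global frame, the flat model is the product of the
Poisson structure of the leaf and a Lie–Poisson structure. -/
theorem pullback_prodTensor {κ : G ≃ₗ[ℝ] Module.Dual ℝ 𝔤} {S : ∀ b, F ≃L[ℝ] E b} {J : F ≃L[ℝ] G}
    {τ : Diffeomorph (𝓘(ℝ, EB).prod 𝓘(ℝ, F)) (𝓘(ℝ, EB).prod 𝓘(ℝ, G)) (TotalSpace F E) (B × G) ∞}
    (hτ : ∀ p, τ p = (p.proj, J ((S p.proj).symm p.2)))
    {Λ₁ : F →L[ℝ] (F →L[ℝ] ℝ) →L[ℝ] F}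
    (hΛ : ∀ b x γ, Λ b (S b x) γ = S b (Λ₁ x (γ ∘L (S b : F →L[ℝ] E b))))
    (hJ : ∀ x (β : G →L[ℝ] ℝ), liePoissonMap κ (J x) β = J (Λ₁ x (β ∘L (J : F →L[ℝ] G))))
    {φ : BundleFrame EB F E} {Λ₀ : F →L[ℝ] (F →L[ℝ] ℝ) →L[ℝ] F} {μ : EB → EB →L[ℝ] F →L[ℝ] ℝ}
    {K : F ≃L[ℝ] F} (hG : φ.IsGaugeFrame Ω Λ D R Dflat Λ₀ μ)
    (hK : ∀ ξ ∈ φ.dom, ∀ x, S (φ.base ξ) x = φ.fib (φ.base ξ) (K x)) {ξ : EB} (hξ : ξ ∈ φ.dom) (x : F) :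
    pullback τ (prodTensor (symplecticTensor Ω) (liePoissonTensor κ)) (φ.tot (ξ, x)) =
      flatModel Ω Λ Dflat (φ.tot (ξ, x)) := by
  have hτt : ∀ η ∈ φ.dom, ∀ y, τ (φ.tot (η, y)) = (φ.base η, J (K.symm y)) := by
    intro η hη y
    rw [hτ]
    refine Prod.ext rfl (congrArg J ?_)
    rw [ContinuousLinearEquiv.symm_apply_eq]
    change φ.fib (φ.base η) y = S (φ.base η) (K.symm y)
    rw [hK η hη, K.apply_symm_apply]
  -- The constant tensors of the gauge frame and of the global frame are related by the constant
  -- change of frame `K`.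
  have hΛK : ∀ γ, Λ₀ x γ = K (Λ₁ (K.symm x) (γ ∘L (K : F →L[ℝ] F))) := by
    intro γ
    have h1 := hΛ (φ.base ξ) (K.symm x) (γ ∘L φ.coord (φ.base ξ))
    rw [hK ξ hξ, hK ξ hξ, K.apply_symm_apply, hG.vert_fib hξ] at h1
    have h2 := congrArg (φ.coord (φ.base ξ)) h1
    rw [φ.coord_fib _ (φ.base_mem ξ hξ), φ.coord_fib _ (φ.base_mem ξ hξ)] at h2
    have h3 : (γ ∘L φ.coord (φ.base ξ)) ∘L φ.fib (φ.base ξ) = γ := by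
      ext y; simp [φ.coord_fib _ (φ.base_mem ξ hξ)]
    have h4 : (γ ∘L φ.coord (φ.base ξ)) ∘L (S (φ.base ξ) : F →L[ℝ] E (φ.base ξ)) =
        γ ∘L (K : F →L[ℝ] F) := by
      ext y
      change γ (φ.coord (φ.base ξ) (S (φ.base ξ) y)) = γ (K y)
      rw [hK ξ hξ, φ.coord_fib _ (φ.base_mem ξ hξ)]
    rw [h3, h4] at h2
    exact h2
  set m : EB × F →L[ℝ] EB × G :=
    mfderiv (𝓘(ℝ, EB).prod 𝓘(ℝ, F)) (𝓘(ℝ, EB).prod 𝓘(ℝ, G)) τ (φ.tot (ξ, x)) with hm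
  have him : m.IsInvertible :=
    ⟨τ.mfderivToContinuousLinearEquiv (by simp) (φ.tot (ξ, x)), rfl⟩
  set A : EB × F →L[ℝ] EB × F := φ.dtot (ξ, x) with hA
  set C : F →L[ℝ] G := (J : F →L[ℝ] G) ∘L (K.symm : F →L[ℝ] F) with hC
  set N : EB →L[ℝ] EB := φ.dbase ξ with hN
  -- In the frame, the trivialization is the product of the base parametrization and a constant
  -- linear map, so its derivative is block diagonal and the two factors can be compared separately.
  have hmA : m ∘L A = (N ∘L fst ℝ EB F).prod (C ∘L snd ℝ EB F) := by
    have h1 : HasMFDerivAt (𝓘(ℝ, EB).prod 𝓘(ℝ, F)) (𝓘(ℝ, EB).prod 𝓘(ℝ, G)) τ (φ.tot (ξ, x)) m :=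
      ((τ.contMDiff.contMDiffAt).mdifferentiableAt (by simp)).hasMFDerivAt
    have h2 := (h1.comp (ξ, x) (BundleFrame.hasMFDerivAt_tot (φ := φ)
      (BundleFrame.mem_source.2 hξ))).mfderiv
    have h3 : HasMFDerivAt 𝓘(ℝ, EB × F) 𝓘(ℝ, EB) (Prod.fst : EB × F → EB) (ξ, x) (fst ℝ EB F) :=
      hasFDerivAt_fst.hasMFDerivAt
    have h4 : HasMFDerivAt 𝓘(ℝ, EB × F) 𝓘(ℝ, G) (fun z : EB × F => J (K.symm z.2)) (ξ, x)
        (C ∘L snd ℝ EB F) := (C ∘L snd ℝ EB F).hasFDerivAt.hasMFDerivAt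
    have h5 := ((BundleFrame.hasMFDerivAt_base (φ := φ) hξ).comp (ξ, x) h3).prodMk h4
    have h6 : τ ∘ φ.tot =ᶠ[𝓝 (ξ, x)] fun z : EB × F => (φ.base z.1, J (K.symm z.2)) := by
      filter_upwards [φ.isOpen_source.mem_nhds (BundleFrame.mem_source.2 hξ)] with z hz
        using hτt z.1 hz.1 z.2
    exact h2.symm.trans (h5.congr_of_eventuallyEq h6).mfderiv
  set T := localFlat (fun ξ => -(φ.locForm ξ (Ω (φ.base ξ))).inverse) Λ₀ (ξ, x) with hT
  have hprod : ∀ q, q = (φ.base ξ, J (K.symm x)) → ∀ β : EB × G →L[ℝ] ℝ,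
      (show EB × G from prodTensor (symplecticTensor Ω) (liePoissonTensor κ) q
        (show EB × G →L[ℝ] ℝ from β)) = m (A (T (β ∘L m ∘L A))) := by
    rintro _ rfl β
    refine (prodTensor_apply _ _ _ _ β).trans ?_
    change _ = (m ∘L A) (T (β ∘L (m ∘L A)))
    rw [hmA, hT, localFlat_apply]
    refine Prod.ext ?_ ?_
    · have h1 := BundleFrame.inverse_locForm hξ (Ω (φ.base ξ)) (show EB →L[ℝ] ℝ from β ∘L inl ℝ EB G)
      have h2 : (β ∘L (N ∘L fst ℝ EB F).prod (C ∘L snd ℝ EB F)) ∘L inl ℝ EB F =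
          (β ∘L inl ℝ EB G) ∘L N := by
        ext v; simp
      change -(show EB from (Ω (φ.base ξ)).inverse (show EB →L[ℝ] ℝ from β ∘L inl ℝ EB G)) =
        N (-((φ.locForm ξ (Ω (φ.base ξ))).inverse _))
      rw [h2, map_neg]
      exact congrArg Neg.neg h1
    · have h2 : (β ∘L (N ∘L fst ℝ EB F).prod (C ∘L snd ℝ EB F)) ∘L inr ℝ EB F =
          (β ∘L inr ℝ EB G) ∘L C := by
        ext v; simp
      change liePoissonMap κ (J (K.symm x)) (β ∘L inr ℝ EB G) = C (Λ₀ x _)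
      rw [h2, hJ, hΛK]
      change _ = J (K.symm (K _))
      rw [K.symm_apply_apply]
      congr 2
      ext v
      simp [hC]
  have hτp := hτt ξ hξ x
  refine ContinuousLinearMap.ext fun α => ?_
  have h1 := hprod _ hτp ((show EB × F →L[ℝ] ℝ from α) ∘L m.inverse)
  have h2 : ((show EB × F →L[ℝ] ℝ from α) ∘L m.inverse) ∘L m ∘L A = (show EB × F →L[ℝ] ℝ from α) ∘L A := by
    refine ContinuousLinearMap.ext fun v => ?_
    change (show EB × F →L[ℝ] ℝ from α) (m.inverse (m (A v))) = _
    rw [him.inverse_apply_self]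
    rfl
  rw [h2] at h1
  have h3 := congrArg m.inverse h1
  rw [him.inverse_apply_self] at h3
  exact h3.trans (hG.isLocal_flatModel hξ x α).symm

end GlobalTrivialization

end PoissonLin

end

/-! ### The theorem. -/

open PoissonLin in
theorem proposition4p9
    {EM : Type*} [NormedAddCommGroup EM] [NormedSpace ℝ EM] [FiniteDimensional ℝ EM]
    {M : Type*} [TopologicalSpace M] [ChartedSpace EM M] [IsManifold 𝓘(ℝ, EM) ∞ M]
    [T2Space M] [SecondCountableTopology M]
    {EB : Type*} [NormedAddCommGroup EB] [NormedSpace ℝ EB] [FiniteDimensional ℝ EB]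
    {B : Type*} [TopologicalSpace B] [ChartedSpace EB B] [IsManifold 𝓘(ℝ, EB) ∞ B]
    [ConnectedSpace B]
    {F : Type*} [NormedAddCommGroup F] [NormedSpace ℝ F] [FiniteDimensional ℝ F]
    {E : B → Type*} [∀ b, AddCommGroup (E b)] [∀ b, Module ℝ (E b)]
    [∀ b, TopologicalSpace (E b)] [∀ b, IsTopologicalAddGroup (E b)]
    [∀ b, ContinuousSMul ℝ (E b)] [TopologicalSpace (TotalSpace F E)]
    [FiberBundle F E] [VectorBundle ℝ F E] [ContMDiffVectorBundle ∞ F E 𝓘(ℝ, EB)]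
    -- the Poisson manifold, the symplectic leaf, its normal bundle and an exponential map
    (Ψ : TensorField₂ 𝓘(ℝ, EM) M) (hΨ : IsPoissonTensor Ψ)
    (ι : B → M) (Ω : FormField₂ 𝓘(ℝ, EB) B) (hleaf : IsEmbeddedSymplecticLeaf Ψ ι Ω)
    (ν : ∀ b : B, TangentSpace 𝓘(ℝ, EM) (ι b) →L[ℝ] E b)
    (hν : IsNormalBundle (EB := EB) (F := F) ι ν)
    (f : TotalSpace F E → M) (hf : IsExponentialMap (EB := EB) ι ν f)
    -- the linearized data of the pull-back of `Ψ`
    (Λ : LinearVertTensor E) (D : CovariantDerivative 𝓘(ℝ, EB) F E)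
    [CovariantDerivative.ContMDiffCovariantDerivative D ∞] (R : DualValuedForm EB E)
    (hlin : IsLinearization (pullback f Ψ) Λ D R)
    -- the transverse Lie algebra and a normed model of its dual
    {𝔤 : Type*} [LieRing 𝔤] [LieAlgebra ℝ 𝔤] [FiniteDimensional ℝ 𝔤]
    (b₀ : B) (e : 𝔤 ≃ₗ[ℝ] (E b₀ →L[ℝ] ℝ))
    (he : ∀ (x y : 𝔤) (v : E b₀), e ⁅x, y⁆ v = e y (Λ b₀ v (e x)))
    {G : Type*} [NormedAddCommGroup G] [NormedSpace ℝ G] [FiniteDimensional ℝ G]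
    (κ : G ≃ₗ[ℝ] Module.Dual ℝ 𝔤)
    (hcenter : LieAlgebra.center ℝ 𝔤 = ⊥) (hH1 : Subsingleton (FirstCohomology 𝔤))
    -- a flat Lie–Poisson connection
    (Dflat : CovariantDerivative 𝓘(ℝ, EB) F E) [CovariantDerivative.ContMDiffCovariantDerivative Dflat ∞]
    (hflat : IsFlatConnection Dflat) (hLP : IsLiePoissonConnection Dflat Λ) :
    GermIsomorphic (linearizedTensor Ω Λ D R) (flatModel Ω Λ Dflat) ∧
    (HasTrivialHolonomy Dflat →
      ∃ τ : Diffeomorph (𝓘(ℝ, EB).prod 𝓘(ℝ, F)) (𝓘(ℝ, EB).prod 𝓘(ℝ, G))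
          (TotalSpace F E) (B × G) ∞,
        (∀ p, (τ p).1 = p.proj) ∧
        (∀ b : B, IsLinearMap ℝ (fun y : E b => (τ ⟨b, y⟩).2)) ∧
        GermIsomorphic (linearizedTensor Ω Λ D R)
          (pullback τ (prodTensor (symplecticTensor Ω) (liePoissonTensor κ)))) := by
  -- The Hausdorff property passes from `M` to the bundle through the injective map `f`, and from
  -- there to `B` through the zero section.
  have hT2 : T2Space (TotalSpace F E) :=
    T2Space.of_injective_continuous hf.injective hf.localDiffeo.contMDiff.continuous
  have hB2 : T2Space B := by
    refine T2Space.of_injective_continuous (f := fun b : B => (⟨b, 0⟩ : TotalSpace F E)) ?_ ?_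
    · intro b b' h
      exact congrArg TotalSpace.proj h
    · exact (contMDiff_zeroSection (n := ∞) (IB := 𝓘(ℝ, EB)) (F := F) ℝ E).continuous
  have hG := exists_gaugeFrame hΨ hleaf hf.localDiffeo hf.zero hlin hcenter hH1 hflat hLP e he
  have hiso : GermIsomorphic (linearizedTensor Ω Λ D R) (flatModel Ω Λ Dflat) :=
    germIsomorphic_of_gaugeFrames fun b => by
      obtain ⟨φ, Λ₀, μ, hb, -, hφ⟩ := hG b
      exact ⟨φ, Λ₀, μ, hb, hφ⟩
  refine ⟨hiso, fun hhol => ?_⟩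
  obtain ⟨S, Λ₁, hΛ, hS⟩ := exists_parallel_trivialization hG hhol b₀
  set e₁ : 𝔤 ≃ₗ[ℝ] (F →L[ℝ] ℝ) := e.trans (transposeEquiv (S b₀)) with he₁
  have hiso₁ : IsLieIso e₁ Λ₁ := by
    intro x y v
    change e ⁅x, y⁆ (S b₀ v) = e y (S b₀ (Λ₁ v (e x ∘L (S b₀ : F →L[ℝ] E b₀))))
    rw [he, hΛ]
  obtain ⟨J, hJ⟩ := exists_dual_equiv e₁ κ
  have hS' : ∀ b, ∃ (φ : BundleFrame EB F E) (K : F ≃L[ℝ] F), b ∈ φ.img ∧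
      ∀ ξ ∈ φ.dom, ∀ x, S (φ.base ξ) x = φ.fib (φ.base ξ) (K x) := fun b => by
    obtain ⟨φ, Λ₀, μ, K, hb, hφ, hK⟩ := hS b
    exact ⟨φ, K, hb, hK⟩
  obtain ⟨τ, hτ⟩ := exists_diffeomorph_of_global_frame S J hS'
  refine ⟨τ, fun p => by rw [hτ], fun b => ⟨fun y y' => ?_, fun c y => ?_⟩, ?_⟩
  · simp [hτ]
  · simp [hτ]
  -- The trivialization carries the product structure to the flat model exactly, on the whole
  -- bundle; only the passage from the linearized tensor to the flat model is a statement about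
  -- germs.
  · have h : pullback τ (prodTensor (symplecticTensor Ω) (liePoissonTensor κ)) =
        flatModel Ω Λ Dflat := by
      funext p
      obtain ⟨φ, Λ₀, μ, K, hb, hφ, hK⟩ := hS p.proj
      obtain ⟨⟨ξ, x⟩, hq, rfl⟩ : ∃ q ∈ φ.source, φ.tot q = p :=
        ⟨φ.inv p, BundleFrame.inv_mem hb, BundleFrame.tot_inv hb⟩
      exact pullback_prodTensor hτ hΛ (liePoissonMap_eq hiso₁ κ hJ) hφ hK hq.1 x
    rw [h]
    exact hiso
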